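/- **Data.** Let $\mathfrak g$ be a simple Lie algebra over $\mathbb C$ of rank $N$, $I=\{0,\dots,N\}$, and $A=(a_{ij})_{i,j\in I}$, $a_{ij}=\langle\alpha_j,h_i\rangle$, the untwisted affine Cartan matrix of $\widehat{\mathfrak g}$. Let $d_i$ be positive integers such that $b_{ij}=d_ia_{ij}$ is symmetric, and let $a_i$ $(i\in I)$ be the coprime positive integers with $\sum_i a_ib_{ij}=0$. Put $m_{ij}=\delta_{i,j+1}-\delta_{i+1,j}$ (indices mod $N+1$) for $\mathfrak g=A_N$ and $m_{ij}=0$ otherwise. Let $q,\kappa,p\in\mathbb C^\times$, $k\in\mathbb C^\times$, $l\in\mathbb C$, $p^*=pq^{-2k}$, $s=q^{2k}$ (complex powers of $q$ are taken with a fixed logarithm of $q$), with $|p|,|p^*|,|q^{2k}|<1$ and with $q,\kappa$ generic in the following sense: $q$ is not a root of unity and $\det\big([b_{ij}n]\kappa^{-nm_{ij}}\big)_{i,j\in I}\neq0$ for all $n\ge1$, where $[n]=\frac{q^n-q^{-n}}{q-q^{-1}}$. (For $\mathfrak g=\mathfrak{sl}_2$ this determinant is always $0$, so $\mathfrak g\ne\mathfrak{sl}_2$.)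 Put $q_i=q^{d_i}$, $[n]_i=\frac{q_i^n-q_i^{-n}}{q_i-q_i^{-1}}$, $[kn]=\frac{q^{kn}-q^{-kn}}{q-q^{-1}}$, $\delta(z)=\sum_{n\in\mathbb Z}z^n$, $(x;t)_\infty=\prod_{n\ge0}(1-xt^n)$, and $$g_{ij}(u;t)=\exp\Big(-\sum_{m>0}\tfrac1m\tfrac{q^{b_{ij}m}-q^{-b_{ij}m}}{1-t^m}(tu)^m\Big).$$ Let $H^*=\mathfrak h^*\oplus H_P^*$, where $\mathfrak h$ is spanned by $h_i$ $(i\in I)$ and $d$, $H_P$ by $P_i$ $(i\in I)$, $\alpha_j\in\mathfrak h^*$ with $\langle\alpha_j,h_i\rangle=a_{ij}$, $\langle\alpha_j,d\rangle=\delta_{j0}$, and $Q_j\in H_P^*$ with $\langle Q_j,P_i\rangle=a_{ij}$. Let $\mathbb F$ be the field of meromorphic functions on $H^*$ and $(T_\chi g)(\mu)=g(\mu+\chi)$. On an $\mathbb F$-vector space $V$ with an $H$-grading $V=\bigoplus_{\nu\in H^*}V_\nu$ by $\mathbb F$-subspaces, a $\mathbb C$-linear operator $f$ has weight $\chi$ if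 $g\,f=f\,T_\chi(g)$ for all $g\in\mathbb F$ and $f(V_\nu)\subset V_{\nu+\chi}$ for all $\nu$. All relations between currents $Y(z)=\sum_nY_nz^{-n}$ are imposed coefficientwise, functions of $w/z$ being expanded in powers of $w/z$ and functions of $z/w$ in powers of $z/w$. **Common conditions on $Y^\pm_i(z)$, $K^\pm_i$, $q^d$.** $Y^+_{j,n}$, $Y^-_{j,n}$, $K^\pm_j$, $q^d$ have weights $\alpha_j-Q_j$, $-\alpha_j$, $-Q_j$, $0$; $K^\pm_i$, $q^d$ are invertible and commute with one another; $K^\pm_iY^+_j(z)(K_i^\pm)^{-1}=q^{\pm b_{ij}}Y^+_j(z)$, $K^\pm_iY^-_j(z)(K_i^\pm)^{-1}=q^{\mp b_{ij}}Y^-_j(z)$; $q^dY^\pm_{j,n}q^{-d}=q^nY^\pm_{j,n}$; $\prod_i(K^\pm_i)^{a_i}$ are central and $\prod_i(K^+_i)^{a_i}=q^{-l}$; with $V_\omega=\{v: q^dv=q^\omega v\}$, $V$ is the sum of the $V_\omega$ $(\omega\in\mathbb C)$, and for every $\omega$ one has $V_{\omega+n}=0$ for all large $n\in\mathbb N$.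 **$\mathfrak C_{k,l}$** is the category of $H$-graded $\mathbb F$-vector spaces $V$ with operators $\alpha^\vee_{i,m}$ $(m\in\mathbb Z\setminus\{0\})$, $x^\pm_{i,n}$ $(n\in\mathbb Z)$, $K^\pm_i$, $q^d$ satisfying the common conditions (with $Y^\pm=x^\pm$) and the level-$(k,l)$ relations of $U_{q,\kappa,p}(\mathfrak g_{tor})$: $\alpha^\vee_{i,m}$ has weight $0$, commutes with $K^\pm_j$, $q^d\alpha^\vee_{i,m}q^{-d}=q^m\alpha^\vee_{i,m}$, $$[\alpha^\vee_{i,n},\alpha^\vee_{j,m}]=\delta_{n+m,0}\tfrac{[a_{ij}n]_i}{n}\tfrac{q^{kn}-q^{-kn}}{q_j-q_j^{-1}}\tfrac{1-p^n}{1-p^{*n}}\kappa^{-nm_{ij}}q^{-kn},$$ $$[\alpha^\vee_{i,n},x^+_j(z)]=\tfrac{[a_{ij}n]_i}{n}\tfrac{1-p^n}{1-p^{*n}}q^{-kn}\kappa^{-nm_{ij}}z^nx^+_j(z),\qquad[\alpha^\vee_{i,n},x^-_j(z)]=-\tfrac{[a_{ij}n]_i}{n}\kappa^{-nm_{ij}}z^nx^-_j(z),$$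 $$(\kappa^{m_{ij}}z-q^{\pm b_{ij}}w)G^\pm_{ij}(w/z)x^\pm_i(z)x^\pm_j(w)=(\kappa^{m_{ij}}q^{\pm b_{ij}}z-w)G^\pm_{ji}(z/w)x^\pm_j(w)x^\pm_i(z),$$ where $G^+_{ij}(u)=g_{ij}(\kappa^{-m_{ij}}u;p^*)$, $G^-_{ij}(u)=g_{ij}(\kappa^{-m_{ij}}u;p)^{-1}$; $$[x^+_i(z),x^-_j(w)]=\tfrac{\delta_{ij}}{q_i-q_i^{-1}}\big(\delta(q^k\tfrac wz)\phi^+_i(q^{k/2}w)-\delta(q^{-k}\tfrac wz)\phi^-_i(q^{k/2}z)\big),$$ $$\phi^+_i(q^{k/2}z)=K^+_i\exp\Big(-(q_i-q_i^{-1})\sum_{n>0}\tfrac{p^n\alpha^\vee_{i,-n}}{1-p^n}z^n\Big)\exp\Big((q_i-q_i^{-1})\sum_{n>0}\tfrac{\alpha^\vee_{i,n}}{1-p^n}z^{-n}\Big),$$ $$\phi^-_i(q^{-k/2}z)=K^-_i\exp\Big(-(q_i-q_i^{-1})\sum_{n>0}\tfrac{\alpha^\vee_{i,-n}}{1-p^n}z^n\Big)\exp\Big((q_i-q_i^{-1})\sum_{n>0}\tfrac{p^n\alpha^\vee_{i,n}}{1-p^n}z^{-n}\Big);$$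 and, for $i\ne j$ and $a=1-a_{ij}$, the Serre relations $\mathrm{Serre}_{ij}(G^\pm,x^\pm)$, where $\mathrm{Serre}_{ij}(G,Y)$ is $$\sum_{\sigma\in\mathfrak S_a}\prod_{1\le t<m\le a}G_{ii}\big(\tfrac{z_{\sigma(m)}}{z_{\sigma(t)}}\big)\sum_{r=0}^a(-1)^r{a\brack r}_i\prod_{t\le r}G_{ij}\big(\tfrac w{z_{\sigma(t)}}\big)\prod_{t>r}G_{ji}\big(\tfrac{z_{\sigma(t)}}w\big)\,Y_i(z_{\sigma(1)})\cdots Y_i(z_{\sigma(r)})Y_j(w)Y_i(z_{\sigma(r+1)})\cdots Y_i(z_{\sigma(a)})=0.$$ **$\mathfrak D_{k,l}$** is the category of $H$-graded $\mathbb F$-vector spaces $\mathcal W$ with operators $\mathcal Z^\pm_{i,n}$ $(n\in\mathbb Z)$, $K^\pm_i$, $q^d$ satisfying the common conditions (with $Y^\pm=\mathcal Z^\pm$) and the relations of the universal dynamical $Z$-algebra $\mathcal Z_{k,l}$: $$z\tfrac{(q^{-b_{ij}}\kappa^{-m_{ij}}w/z;s)_\infty}{(s\,q^{b_{ij}}\kappa^{-m_{ij}}w/z;s)_\infty}\mathcal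 Z^\pm_i(z)\mathcal Z^\pm_j(w)=-w\kappa^{-m_{ij}}\tfrac{(q^{-b_{ij}}\kappa^{m_{ij}}z/w;s)_\infty}{(s\,q^{b_{ij}}\kappa^{m_{ij}}z/w;s)_\infty}\mathcal Z^\pm_j(w)\mathcal Z^\pm_i(z),$$ $$\tfrac{(q^{b_{ij}+k}\kappa^{-m_{ij}}w/z;s)_\infty}{(q^{-b_{ij}+k}\kappa^{-m_{ij}}w/z;s)_\infty}\mathcal Z^+_i(z)\mathcal Z^-_j(w)-\tfrac{(q^{b_{ij}+k}\kappa^{m_{ij}}z/w;s)_\infty}{(q^{-b_{ij}+k}\kappa^{m_{ij}}z/w;s)_\infty}\mathcal Z^-_j(w)\mathcal Z^+_i(z)=\tfrac{\delta_{ij}}{q_i-q_i^{-1}}\big\{\delta(q^k\tfrac wz)K^+_i-\delta(q^{-k}\tfrac wz)K^-_i\big\},$$ and $\mathrm{Serre}_{ij}(F^\pm,\mathcal Z^\pm)$ for $i\neq j$, where $F^+_{ij}(u)=\frac{(q^{-b_{ij}}\kappa^{-m_{ij}}u;s)_\infty}{(q^{b_{ij}}\kappa^{-m_{ij}}u;s)_\infty}$,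 $F^-_{ij}(u)=\frac{(s\,q^{-b_{ij}}\kappa^{-m_{ij}}u;s)_\infty}{(s\,q^{b_{ij}}\kappa^{-m_{ij}}u;s)_\infty}$. In both categories morphisms are the $\mathbb F$-linear maps that preserve the $H$-grading and commute with all the operators; an object is irreducible if it is nonzero and has no proper nonzero $H$-graded $\mathbb F$-subspace stable under all the operators and under the inverses of $K^\pm_i$, $q^d$. **The functors.** Put $\alpha_{i,m}=[d_i]\alpha^\vee_{i,m}$, $\alpha'_{i,m}=\frac{1-p^{*m}}{1-p^m}q^{km}\alpha_{i,m}$, $E^\pm(\alpha_i,z)=\exp\{\pm\sum_{m>0}\frac{\alpha_{i,\pm m}}{[km]}z^{\mp m}\}$, $E^\pm(\alpha'_i,z)=\exp\{\mp\sum_{m>0}\frac{\alpha'_{i,\pm m}}{[km]}z^{\mp m}\}$. $\Omega(V)$ is the vacuum space $\Omega_V=\{v\in V:\alpha_{i,m}v=0\ \forall i\in I,\,m>0\}$ with the restrictions of the $H$-grading, of $K^\pm_i$, $q^d$, and of the coefficients of $\mathcal Z^+_i(z)=E^-(\alpha_i,z)x^+_i(z)E^+(\alpha_i,z)$ and $\mathcal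 Z^-_i(z)=E^-(\alpha'_i,z)x^-_i(z)E^+(\alpha'_i,z)$; $\Omega(\varphi)=\varphi|_{\Omega_V}$. $\Lambda(\mathcal W)=\mathrm{Ind}\,\mathcal W=\mathcal F^\alpha_{k,l}\otimes_{\mathbb C}\mathcal W$, where $\mathcal F^\alpha_{k,l}=\mathbb C[\alpha_{i,-n}\,(i\in I,n>0)]$ is the Fock module of the Heisenberg algebra ($\alpha_{i,-n}$ acts by multiplication and $\alpha_{i,n}$ by $\sum_j\frac{[b_{ij}n][kn]}n\frac{1-p^n}{1-p^{*n}}\kappa^{-nm_{ij}}q^{-kn}\frac{\partial}{\partial\alpha_{j,-n}}$, and $\alpha_{i,-n}$ has $q^d$-eigenvalue $q^{-n}$), with $\alpha_{i,m}=\alpha_{i,m}\otimes1$, $K^\pm_i=1\otimes K^\pm_i$, $q^d=q^d\otimes q^d$, the $H$-grading and $\mathbb F$-action of $\mathcal W$, and $x^+_i(z)=E^-(\alpha_i,z)^{-1}E^+(\alpha_i,z)^{-1}\otimes\mathcal Z^+_i(z)$, $x^-_i(z)=E^-(\alpha'_i,z)^{-1}E^+(\alpha'_i,z)^{-1}\otimes\mathcal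 Z^-_i(z)$; $\Lambda(\varphi)=1\otimes\varphi$. **Theorem.** These prescriptions define functors $\Omega:\mathfrak C_{k,l}\to\mathfrak D_{k,l}$ and $\Lambda:\mathfrak D_{k,l}\to\mathfrak C_{k,l}$ (that is, $\Omega_V$ is stable under the operators and lies in $\mathfrak D_{k,l}$, $\mathrm{Ind}\,\mathcal W$ lies in $\mathfrak C_{k,l}$, and the maps between them are morphisms), and $\Omega$, $\Lambda$ are mutually quasi-inverse equivalences of categories. In particular, for $\mathcal W\in\mathfrak D_{k,l}$, the module $\mathrm{Ind}\,\mathcal W$ is irreducible in $\mathfrak C_{k,l}$ if and only if $\mathcal W$ is an irreducible $\mathcal Z_{k,l}$-module. -/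

import Mathlib

universe u

open CategoryTheory TensorProduct

noncomputable section

namespace EllToroidal

/-! ## Untwisted affine Cartan matrices -/

/-- The isomorphism classes of simple Lie algebras over `ℂ`. -/
inductive SimpleType
  | A (n : ℕ) (hn : 1 ≤ n)
  | B (n : ℕ) (hn : 3 ≤ n)
  | C (n : ℕ) (hn : 2 ≤ n)
  | D (n : ℕ) (hn : 4 ≤ n)
  | E6 | E7 | E8 | F4 | G2

namespace SimpleType

/-- The rank `N` of the simple Lie algebra. -/
def rank : SimpleType → ℕ
  | A n _ | B n _ | C n _ | D n _ => n
  | E6 => 6 | E7 => 7 | E8 => 8 | F4 => 4 | G2 => 2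

/-- The Cartan matrix `⟨α_j, h_i⟩` of the simple Lie algebra. (Mathlib's matrices are written in the
convention `⟨α_i, h_j⟩`, with the long node of `G₂` first; hence the transposes.) -/
def finCartan : (X : SimpleType) → Matrix (Fin X.rank) (Fin X.rank) ℤ
  | A n _ => (CartanMatrix.A n).transpose
  | B n _ => (CartanMatrix.B n).transpose
  | C n _ => (CartanMatrix.C n).transpose
  | D n _ => (CartanMatrix.D n).transpose
  | E6 => CartanMatrix.E₆.transpose
  | E7 => CartanMatrix.E₇.transpose
  | E8 => CartanMatrix.E₈.transpose
  | F4 => CartanMatrix.F₄.transpose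
  | G2 => CartanMatrix.G₂.transpose

/-- `⟨θ, h_i⟩`, `1 ≤ i ≤ N`, for the highest root `θ` (indices shifted to start at `0`). -/
def thetaOnCoroot : (X : SimpleType) → Fin X.rank → ℤ
  | A n _ => fun i => (if i.val = 0 then 1 else 0) + (if i.val + 1 = n then 1 else 0)
  | B _ _ => fun i => if i.val = 1 then 1 else 0
  | C _ _ => fun i => if i.val = 0 then 2 else 0
  | D _ _ => fun i => if i.val = 1 then 1 else 0
  | E6 => fun i => if i.val = 1 then 1 else 0
  | E7 => fun i => if i.val = 0 then 1 else 0
  | E8 => fun i => if i.val = 7 then 1 else 0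
  | F4 => fun i => if i.val = 0 then 1 else 0
  | G2 => fun i => if i.val = 0 then 1 else 0

/-- `⟨α_j, θ^∨⟩`, `1 ≤ j ≤ N`, for the highest root `θ`. -/
def rootOnThetaCheck : (X : SimpleType) → Fin X.rank → ℤ
  | C _ _ => fun j => if j.val = 0 then 1 else 0
  | X => X.thetaOnCoroot

/-- The index set `I = {0, 1, …, N}`. -/
abbrev Idx (X : SimpleType) : Type := Fin (X.rank + 1)

/-- The generalized Cartan matrix `a_{ij} = ⟨α_j, h_i⟩` of the untwisted affine Lie algebra; the
affine node is `0`, with `α_0 = δ - θ`. -/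
def cartan (X : SimpleType) (i j : X.Idx) : ℤ :=
  Fin.cases (motive := fun _ => ℤ)
    (Fin.cases (motive := fun _ => ℤ) 2 (fun j' => - X.rootOnThetaCheck j') j)
    (fun i' => Fin.cases (motive := fun _ => ℤ) (- X.thetaOnCoroot i') (fun j' => X.finCartan i' j') j)
    i

/-- The matrix `m_{ij} = δ_{i,j+1} - δ_{i+1,j}` for type `A_N` (indices modulo `N + 1`), and `0` for
the other types. -/
def mMat : (X : SimpleType) → X.Idx → X.Idx → ℤ
  | A n _ => fun (i j : Fin (n + 1)) =>
      (if i = j + 1 then 1 else 0) - (if i + 1 = j then 1 else 0)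
  | _ => fun _ _ => 0

end SimpleType

/-- The numerical data: a symmetrizer `d`, the exponents `a` of the central product of the `K_i`,
the parameters `q, κ, p` and the level `(k, l)`. -/
structure Params (X : SimpleType) where
  d : X.Idx → ℕ
  a : X.Idx → ℕ
  q : ℂ
  κ : ℂ
  p : ℂ
  k : ℂ
  l : ℂ

variable {X : SimpleType}

namespace Params

variable (T : Params X)

/-- `b_{ij} = d_i a_{ij}`. -/
def b (i j : X.Idx) : ℤ := T.d i * X.cartan i j

/-- `q_i = q^{d_i}`. -/
def qi (i : X.Idx) : ℂ := T.q ^ T.d i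

/-- `q^k`, the value of `q^c`. -/
def qk : ℂ := T.q ^ T.k

/-- `q^{2k}`. -/
def s : ℂ := T.qk ^ 2

/-- `p^* = p q^{-2k}`. -/
def pStar : ℂ := T.p / T.qk ^ 2

/-- `κ^{-m_{ij}}`. -/
def κm (i j : X.Idx) : ℂ := T.κ ^ (- X.mMat i j)

/-- `[n] = (q^n - q^{-n})/(q - q^{-1})`. -/
def br (n : ℤ) : ℂ := (T.q ^ n - T.q ^ (-n)) / (T.q - T.q⁻¹)

/-- `[n]_i = (q_i^n - q_i^{-n})/(q_i - q_i^{-1})`. -/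
def bri (i : X.Idx) (n : ℤ) : ℂ := (T.qi i ^ n - T.qi i ^ (-n)) / (T.qi i - (T.qi i)⁻¹)

/-- `[kn] = (q^{kn} - q^{-kn})/(q - q^{-1})`. -/
def brk (n : ℤ) : ℂ := (T.qk ^ n - T.qk ^ (-n)) / (T.q - T.q⁻¹)

/-- `[n]_i!`. -/
def brFact (i : X.Idx) (n : ℕ) : ℂ := ∏ r ∈ Finset.range n, T.bri i (r + 1)

/-- The `q_i`-binomial coefficient. -/
def brBinom (i : X.Idx) (n r : ℕ) : ℂ := T.brFact i n / (T.brFact i (n - r) * T.brFact i r)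

/-- `(1 - p^n)/(1 - p^{*n})`. -/
def pRatio (n : ℤ) : ℂ := (1 - T.p ^ n) / (1 - T.pStar ^ n)

end Params

/-! ## The field of meromorphic functions on `H^*` -/

/-- The dual space `H^* = 𝔥^* ⊕ H_P^*`. A point `μ` is given by its coordinates
`(⟨μ, h_i⟩)_{i ∈ I}`, `⟨μ, d⟩` and `(⟨μ, P_i⟩)_{i ∈ I}`. -/
abbrev HStar (X : SimpleType) : Type := (X.Idx → ℂ) × ℂ × (X.Idx → ℂ)

/-- The simple root `α_j ∈ 𝔥^*`. -/
def rootVec (X : SimpleType) (j : X.Idx) : HStar X :=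
  (fun i => (X.cartan i j : ℂ), if j = 0 then 1 else 0, 0)

/-- `Q_j ∈ H_P^*`, with `⟨Q_j, P_i⟩ = ⟨α_j, h_i⟩`. -/
def qVec (X : SimpleType) (j : X.Idx) : HStar X :=
  (0, 0, fun i => (X.cartan i j : ℂ))

/-- The ring of entire functions on `H^*`. -/
def Entire (X : SimpleType) : Subalgebra ℂ (HStar X → ℂ) where
  carrier := {f | Differentiable ℂ f}
  mul_mem' hf hg := Differentiable.mul hf hg
  add_mem' hf hg := Differentiable.add hf hg
  algebraMap_mem' c := differentiable_const c

instance (X : SimpleType) : IsDomain (Entire X) := by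
  have : NoZeroDivisors (Entire X) := by
    refine ⟨fun {f g} h => ?_⟩
    by_contra hne
    rw [not_or] at hne
    obtain ⟨hf, hg⟩ := hne
    have hfg : ∀ x, f.1 x * g.1 x = 0 := fun x => congrFun (congrArg Subtype.val h) x
    obtain ⟨x, hx⟩ : ∃ x, f.1 x ≠ 0 := by
      by_contra h'
      push Not at h'
      exact hf (Subtype.ext (funext h'))
    obtain ⟨y, hy⟩ : ∃ y, g.1 y ≠ 0 := by
      by_contra h'
      push Not at h'
      exact hg (Subtype.ext (funext h'))
    let L : ℂ → HStar X := fun t => x + t • (y - x)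
    have hL : Differentiable ℂ L :=
      (differentiable_const x).add
        ((differentiable_id (𝕜 := ℂ) (E := ℂ)).smul (differentiable_const (y - x)))
    have hF : AnalyticOnNhd ℂ (f.1 ∘ L) Set.univ :=
      ((f.2 : Differentiable ℂ f.1).comp hL).differentiableOn.analyticOnNhd isOpen_univ
    have hG : AnalyticOnNhd ℂ (g.1 ∘ L) Set.univ :=
      ((g.2 : Differentiable ℂ g.1).comp hL).differentiableOn.analyticOnNhd isOpen_univ
    have hprod : ∀ t ∈ Set.univ, (f.1 ∘ L) t * (g.1 ∘ L) t = 0 := fun t _ => hfg (L t)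
    rcases hF.eq_zero_or_eq_zero_of_mul_eq_zero hG hprod isPreconnected_univ with h1 | h1
    · exact hx (by simpa [L] using h1 0 (Set.mem_univ _))
    · exact hy (by simpa [L] using h1 1 (Set.mem_univ _))
  exact NoZeroDivisors.to_isDomain _

/-- The field `𝔽 = ℳ_{H^*}` of meromorphic functions on `H^*`: on a finite-dimensional complex
vector space every meromorphic function is a quotient of two entire functions. -/
abbrev Mero (X : SimpleType) : Type := FractionRing (Entire X)

/-- Translation `(T_χ g)(μ) = g(μ + χ)` of entire functions. -/
def transEntire (χ : HStar X) : Entire X ≃+* Entire X where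
  toFun f := ⟨fun μ => f.1 (μ + χ), (f.2 : Differentiable ℂ f.1).comp
    (differentiable_id.add (differentiable_const χ))⟩
  invFun f := ⟨fun μ => f.1 (μ - χ), (f.2 : Differentiable ℂ f.1).comp
    (differentiable_id.sub (differentiable_const χ))⟩
  left_inv f := by ext μ; simp
  right_inv f := by ext μ; simp
  map_mul' _ _ := rfl
  map_add' _ _ := rfl

/-- Translation `(T_χ g)(μ) = g(μ + χ)` of meromorphic functions. -/
def trans (χ : HStar X) : Mero X ≃+* Mero X :=
  IsFractionRing.ringEquivOfRingEquiv (transEntire χ)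

/-! ## Formal series -/

/-- The coefficients of the formal series `exp(∑_{n ≥ 1} c_n u^n)`. -/
def expCoeff {A : Type*} [Ring A] [Algebra ℂ A] (c : ℕ → A) (n : ℕ) : A :=
  PowerSeries.coeff n (∑ r ∈ Finset.range (n + 1),
    ((r.factorial : ℂ)⁻¹) • (PowerSeries.mk fun m => if m = 0 then 0 else c m) ^ r)

/-- `exp(∑_{n ≥ 1} c_n u^n)`. -/
def expSeries (c : ℕ → ℂ) : PowerSeries ℂ := PowerSeries.mk (expCoeff c)

/-- `(x u; s)_∞ = ∏_{n ≥ 0} (1 - x s^n u) = exp(-∑_{m ≥ 1} x^m u^m / (m (1 - s^m)))`, `|s| < 1`. -/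
def qPoch (x s : ℂ) : PowerSeries ℂ := expSeries fun m => - (x ^ m / (m * (1 - s ^ m)))

namespace Params

variable (T : Params X)

/-- `g_{ij}(u; t) = exp(-∑_{m ≥ 1} (1/m) (q^{b_{ij} m} - q^{-b_{ij} m})/(1 - t^m) (t u)^m)`. -/
def gSeries (i j : X.Idx) (t : ℂ) : PowerSeries ℂ := expSeries fun m =>
  - (1 / m * ((T.q ^ (T.b i j * m) - T.q ^ (- (T.b i j * m))) / (1 - t ^ m)) * t ^ m)

end Params

/-- The signs `±`. -/
inductive Sgn
  | pos
  | neg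

/-- `±1`. -/
def Sgn.val : Sgn → ℤ
  | .pos => 1
  | .neg => -1

namespace Params

variable (T : Params X)

/-- `g_{ij}(κ^{-m_{ij}} u; p^*)` for `+`, and `g_{ij}(κ^{-m_{ij}} u; p)⁻¹` for `-`. -/
def strU (ε : Sgn) (i j : X.Idx) : PowerSeries ℂ :=
  PowerSeries.rescale (T.κm i j) <| match ε with
    | .pos => T.gSeries i j T.pStar
    | .neg => (T.gSeries i j T.p)⁻¹

/-- `(q^{-b_{ij}} x u; q^{2k})_∞ / (q^{b_{ij}} y u; q^{2k})_∞` at `κ^{-m_{ij}} u` in place of `u`. -/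
def strRatio (i j : X.Idx) (x y : ℂ) : PowerSeries ℂ :=
  PowerSeries.rescale (T.κm i j)
    (qPoch (T.q ^ (- T.b i j) * x) T.s * (qPoch (T.q ^ T.b i j * y) T.s)⁻¹)

/-- The structure function of the quadratic relations of the `Z`-algebra. -/
def strZ (i j : X.Idx) : PowerSeries ℂ := T.strRatio i j 1 T.s

/-- The structure function of the mixed relations of the `Z`-algebra:
`(q^{b_{ij}} q^k u; q^{2k})_∞ / (q^{-b_{ij}} q^k u; q^{2k})_∞` at `κ^{-m_{ij}} u`. -/
def strMix (i j : X.Idx) : PowerSeries ℂ :=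
  PowerSeries.rescale (T.κm i j)
    (qPoch (T.q ^ T.b i j * T.qk) T.s * (qPoch (T.q ^ (- T.b i j) * T.qk) T.s)⁻¹)

/-- The structure functions of the Serre relations of the `Z`-algebra. -/
def strSerreZ (ε : Sgn) (i j : X.Idx) : PowerSeries ℂ :=
  match ε with
    | .pos => T.strRatio i j 1 1
    | .neg => T.strRatio i j T.s T.s

end Params

section Currents

variable {V : Type u} [AddCommGroup V] [Module ℂ V]

/-- For currents `Y(z) = ∑ Y_n z^{-n}` and `Y'(w) = ∑ Y'_n w^{-n}`: the coefficient of
`z^{-a} w^{-b}` in `G(w/z) Y(z) Y'(w) v`. -/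
def twoCoeff (G : PowerSeries ℂ) (Y Y' : ℤ → V → V) (a b : ℤ) (v : V) : V :=
  ∑ᶠ n : ℕ, PowerSeries.coeff n G • Y (a - n) (Y' (b + n) v)

/-- For currents `Y_0(z_0), …, Y_{r-1}(z_{r-1})`: the coefficient of `∏_t z_t^{-N_t}` in
`∏_{s < t} G_{st}(z_t/z_s) Y_0(z_0) ⋯ Y_{r-1}(z_{r-1}) v`. -/
def multiCoeff {r : ℕ} (G : Fin r → Fin r → PowerSeries ℂ) (Y : Fin r → ℤ → V → V)
    (N : Fin r → ℤ) (v : V) : V :=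
  ∑ᶠ e : {st : Fin r × Fin r // st.1 < st.2} → ℕ,
    (∏ st, PowerSeries.coeff (e st) (G st.1.1 st.1.2)) •
      (List.ofFn fun t => Y t (N t + (∑ st, if st.1.2 = t then (e st : ℤ) else 0)
        - ∑ st, if st.1.1 = t then (e st : ℤ) else 0)).foldr (fun f w => f w) v

/-- The Serre relation between the currents `Y_i` and `Y_j` with structure functions `G`, `a = 1 - a_{ij}`:
`∑_σ ∏_{s < t} G_{ii}(z_{σ(t)}/z_{σ(s)}) ∑_r (-1)^r [a over r]_i ∏_{s ≤ r} G_{ij}(w/z_{σ(s)})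
∏_{s > r} G_{ji}(z_{σ(s)}/w) Y_i(z_{σ(1)}) ⋯ Y_i(z_{σ(r)}) Y_j(w) Y_i(z_{σ(r+1)}) ⋯ Y_i(z_{σ(a)}) = 0`,
coefficient by coefficient. -/
def SerreRel (T : Params X) (G : X.Idx → X.Idx → PowerSeries ℂ) (Y : X.Idx → ℤ → V → V)
    (i j : X.Idx) (a : ℕ) : Prop :=
  ∀ (N : Fin a → ℤ) (M : ℤ) (v : V),
    ∑ σ : Equiv.Perm (Fin a), ∑ r : Fin (a + 1),
      ((-1) ^ r.val * T.brBinom i a r.val) •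
        multiCoeff
          (fun s t => G (Fin.insertNth (α := fun _ => X.Idx) r j (fun _ => i) s)
            (Fin.insertNth (α := fun _ => X.Idx) r j (fun _ => i) t))
          (fun t => Y (Fin.insertNth (α := fun _ => X.Idx) r j (fun _ => i) t))
          (Fin.insertNth (α := fun _ => ℤ) r M (fun t => N (σ t))) v = 0

end Currents

/-! ## Modules over the elliptic quantum toroidal algebra -/

/-- An `𝔽`-vector space with operators named after the generators of `U_{q,κ,p}(𝔤_tor)` and an
`H^*`-indexed family of subspaces (no relations imposed yet). `x`, `K` need not be `𝔽`-linear. -/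
structure URep (X : SimpleType) where
  carrier : Type u
  [grp : AddCommGroup carrier]
  [modC : Module ℂ carrier]
  [modF : Module (Mero X) carrier]
  [tower : IsScalarTower ℂ (Mero X) carrier]
  /-- the weight spaces -/
  wt : HStar X → Submodule (Mero X) carrier
  /-- the operators `α^∨_{i,m}`, `m ≠ 0` (with `0` at `m = 0`) -/
  avee : X.Idx → ℤ → Module.End (Mero X) carrier
  /-- the operators `x^±_{i,n}` -/
  x : Sgn → X.Idx → ℤ → carrier → carrier
  /-- the operators `K^±_i` -/
  K : Sgn → X.Idx → Module.End ℂ carrier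
  /-- the operator `q^d` -/
  qd : Module.End (Mero X) carrier

attribute [instance] URep.grp URep.modC URep.modF URep.tower

instance : CoeSort (URep.{u} X) (Type u) := ⟨URep.carrier⟩

/-- The weight of `x^+_j` is `(α_j, -Q_j)`, that of `x^-_j` is `(-α_j, 0)`. -/
def wtX (X : SimpleType) : Sgn → X.Idx → HStar X
  | .pos, j => rootVec X j - qVec X j
  | .neg, j => - rootVec X j

/-- A family of operators `f` has weight `χ`: it is `ℂ`-linear, `g f = f T_χ(g)` for all
`g ∈ ℳ_{H^*}`, and it maps the weight space at `ν` into that at `ν + χ`. -/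
structure HasWeight {V : Type u} [AddCommGroup V] [Module ℂ V] [Module (Mero X) V]
    (wt : HStar X → Submodule (Mero X) V) (χ : HStar X) (f : V → V) : Prop where
  linear : IsLinearMap ℂ f
  shift : ∀ (g : Mero X) (v : V), g • f v = f (trans χ g • v)
  maps : ∀ (ν : HStar X), ∀ v ∈ wt ν, f v ∈ wt (ν + χ)

/-- `∏_{i ∈ I} K_i^{a_i}`. -/
def centralProd {V : Type u} [AddCommGroup V] [Module ℂ V] (T : Params X)
    (K : X.Idx → Module.End ℂ V) : Module.End ℂ V :=
  ((List.finRange (X.rank + 1)).map fun i => K i ^ T.a i).prod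

/-- The conditions on the `H`-grading and the operators `K^±_i`, `q^d` that are common to level
`(k,l)` modules over `U_{q,κ,p}(𝔤_tor)` and over the `Z`-algebra, `Y^±_i(z)` being the currents. -/
structure IsCommon {V : Type u} [AddCommGroup V] [Module ℂ V] [Module (Mero X) V]
    (T : Params X) (wt : HStar X → Submodule (Mero X) V) (Y : Sgn → X.Idx → ℤ → V → V)
    (K : Sgn → X.Idx → Module.End ℂ V) (qd : Module.End (Mero X) V) : Prop where
  /-- `V` is `H`-diagonalizable -/
  internal : DirectSum.IsInternal wt
  Y_weight : ∀ ε j n, HasWeight wt (wtX X ε j) (Y ε j n)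
  K_weight : ∀ ε j, HasWeight wt (- qVec X j) (K ε j)
  qd_maps : ∀ ν, ∀ v ∈ wt ν, qd v ∈ wt ν
  /-- `K^±_i` and `q^d` are invertible -/
  K_bij : ∀ ε j, Function.Bijective (K ε j)
  qd_bij : Function.Bijective qd
  K_comm : ∀ ε ε' i j, Commute (K ε i) (K ε' j)
  K_qd : ∀ ε i v, K ε i (qd v) = qd (K ε i v)
  /-- `K^±_i Y^+_j (K^±_i)⁻¹ = q^{± b_{ij}} Y^+_j`, `K^±_i Y^-_j (K^±_i)⁻¹ = q^{∓ b_{ij}} Y^-_j` -/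
  K_Y : ∀ ε i ε' j n v,
    K ε i (Y ε' j n v) = T.q ^ (ε.val * ε'.val * T.b i j) • Y ε' j n (K ε i v)
  /-- `q^d Y_n q^{-d} = q^n Y_n` -/
  qd_Y : ∀ ε j n v, qd (Y ε j n v) = T.q ^ n • Y ε j n (qd v)
  /-- `∏_i (K^±_i)^{a_i}` is central -/
  central_Y : ∀ ε ε' j n v,
    centralProd T (K ε) (Y ε' j n v) = Y ε' j n (centralProd T (K ε) v)
  central_F : ∀ ε (g : Mero X) v, centralProd T (K ε) (g • v) = g • centralProd T (K ε) v
  /-- the level is `(k,l)` -/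
  level : ∀ v, centralProd T (K .pos) v = T.q ^ (- T.l) • v

/-- `V_ω = {v | q^d v = q^ω v}`. -/
def degSpace {V : Type u} [AddCommGroup V] [Module (Mero X) V] (T : Params X)
    (qd : Module.End (Mero X) V) (ω : ℂ) : Submodule (Mero X) V :=
  Module.End.eigenspace qd (algebraMap ℂ (Mero X) (T.q ^ ω))

/-- `V` is the sum of the `V_ω`, and for each `ω` one has `V_{ω+n} = 0` for all large `n ∈ ℕ`. -/
structure IsTruncated {V : Type u} [AddCommGroup V] [Module (Mero X) V] (T : Params X)
    (qd : Module.End (Mero X) V) : Prop where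
  diag : ⨆ ω : ℂ, degSpace T qd ω = ⊤
  trunc : ∀ ω : ℂ, ∃ n₀ : ℕ, ∀ n : ℕ, n₀ < n → degSpace T qd (ω + n) = ⊥

namespace URep

variable (T : Params X) (V : URep.{u} X)

/-- The coefficients of `y^{-M}` in `φ^+_i(q^{k/2} y)` and in `φ^-_i(q^{-k/2} y)`, where
`φ^+_i(q^{k/2} y) = K^+_i exp(-(q_i - q_i⁻¹) ∑ p^n α^∨_{i,-n} y^n / (1 - p^n))
  exp((q_i - q_i⁻¹) ∑ α^∨_{i,n} y^{-n} / (1 - p^n))`,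
`φ^-_i(q^{-k/2} y) = K^-_i exp(-(q_i - q_i⁻¹) ∑ α^∨_{i,-n} y^n / (1 - p^n))
  exp((q_i - q_i⁻¹) ∑ p^n α^∨_{i,n} y^{-n} / (1 - p^n))`. -/
def phi (ε : Sgn) (i : X.Idx) (M : ℤ) (v : V) : V :=
  let c := T.qi i - (T.qi i)⁻¹
  let u : ℕ → ℂ := fun n => match ε with | .pos => T.p ^ n | .neg => 1
  let u' : ℕ → ℂ := fun n => match ε with | .pos => 1 | .neg => T.p ^ n
  let L : ℕ → Module.End (Mero X) V :=
    expCoeff fun n => (- (c * u n / (1 - T.p ^ n))) • V.avee i (-n)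
  let R : ℕ → Module.End (Mero X) V :=
    expCoeff fun n => (c * u' n / (1 - T.p ^ n)) • V.avee i n
  V.K ε i (∑ᶠ n : ℕ × ℕ, if (n.2 : ℤ) - n.1 = M then L n.1 (R n.2 v) else 0)

/-- `V` is a dynamical representation of `U_{q,κ,p}(𝔤_tor)` of level `(k,l)` in the category
`ℭ_{k,l}`. The relations between currents are imposed coefficient by coefficient; all the sums which
occur in them are finite because of the truncation condition. -/
structure IsUModule : Prop where
  common : IsCommon T V.wt V.x V.K V.qd
  truncated : IsTruncated T V.qd
  avee_zero : ∀ i, V.avee i 0 = 0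
  avee_maps : ∀ i m ν, ∀ v ∈ V.wt ν, V.avee i m v ∈ V.wt ν
  avee_K : ∀ i m ε j v, V.K ε j (V.avee i m v) = V.avee i m (V.K ε j v)
  avee_qd : ∀ i m v, V.qd (V.avee i m v) = T.q ^ m • V.avee i m (V.qd v)
  avee_avee : ∀ i j (l m : ℤ), l ≠ 0 → m ≠ 0 → ∀ v,
    V.avee i l (V.avee j m v) - V.avee j m (V.avee i l v) =
      (if l + m = 0 then
        T.bri i (X.cartan i j * l) / l * ((T.qk ^ l - T.qk ^ (-l)) / (T.qi j - (T.qi j)⁻¹)) *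
          T.pRatio l * T.κm i j ^ l * T.qk ^ (-l) else 0) • v
  avee_xpos : ∀ i j (l n : ℤ), l ≠ 0 → ∀ v,
    V.avee i l (V.x .pos j n v) - V.x .pos j n (V.avee i l v) =
      (T.bri i (X.cartan i j * l) / l * T.pRatio l * T.qk ^ (-l) * T.κm i j ^ l) •
        V.x .pos j (n + l) v
  avee_xneg : ∀ i j (l n : ℤ), l ≠ 0 → ∀ v,
    V.avee i l (V.x .neg j n v) - V.x .neg j n (V.avee i l v) =
      - (T.bri i (X.cartan i j * l) / l * T.κm i j ^ l) • V.x .neg j (n + l) v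
  /-- `(κ^{m_{ij}} z - q^{±b_{ij}} w) G(w/z) x^±_i(z) x^±_j(w)
    = (κ^{m_{ij}} q^{±b_{ij}} z - w) G'(z/w) x^±_j(w) x^±_i(z)` -/
  x_x : ∀ ε i j (a b : ℤ) v,
    T.κ ^ X.mMat i j • twoCoeff (T.strU ε i j) (V.x ε i) (V.x ε j) (a + 1) b v
      - T.q ^ (ε.val * T.b i j) • twoCoeff (T.strU ε i j) (V.x ε i) (V.x ε j) a (b + 1) v =
    (T.κ ^ X.mMat i j * T.q ^ (ε.val * T.b i j)) •
        twoCoeff (T.strU ε j i) (V.x ε j) (V.x ε i) b (a + 1) v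
      - twoCoeff (T.strU ε j i) (V.x ε j) (V.x ε i) (b + 1) a v
  /-- `[x^+_i(z), x^-_j(w)] = δ_{ij}/(q_i - q_i⁻¹)
    (δ(q^k w/z) φ^+_i(q^{k/2} w) - δ(q^{-k} w/z) φ^-_i(q^{k/2} z))` -/
  xpos_xneg : ∀ i j (a b : ℤ) v,
    V.x .pos i a (V.x .neg j b v) - V.x .neg j b (V.x .pos i a v) =
      if i = j then (T.qi i - (T.qi i)⁻¹)⁻¹ •
        (T.qk ^ a • V.phi T .pos i (a + b) v - T.qk ^ (-a) • V.phi T .neg i (a + b) v) else 0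
  serre : ∀ ε i j, i ≠ j →
    SerreRel T (T.strU ε) (V.x ε) i j (1 - X.cartan i j).toNat

end URep

/-- The category `ℭ_{k,l}`. -/
structure CatC (T : Params X) where
  rep : URep.{u} X
  isModule : rep.IsUModule T

namespace CatC

variable {T : Params X}

/-- Module maps. -/
structure IsHom (V V' : URep.{u} X) (φ : V →ₗ[Mero X] V') : Prop where
  wt : ∀ ν, ∀ v ∈ V.wt ν, φ v ∈ V'.wt ν
  avee : ∀ i m v, φ (V.avee i m v) = V'.avee i m (φ v)
  x : ∀ ε i n v, φ (V.x ε i n v) = V'.x ε i n (φ v)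
  K : ∀ ε i v, φ (V.K ε i v) = V'.K ε i (φ v)
  qd : ∀ v, φ (V.qd v) = V'.qd (φ v)

/-- Morphisms of `ℭ_{k,l}`. -/
@[ext]
structure Hom (V V' : CatC.{u} T) where
  map : V.rep →ₗ[Mero X] V'.rep
  isHom : IsHom V.rep V'.rep map

instance : Category (CatC.{u} T) where
  Hom := Hom
  id V := ⟨LinearMap.id, ⟨fun _ _ h => h, fun _ _ _ => rfl, fun _ _ _ _ => rfl,
    fun _ _ _ => rfl, fun _ => rfl⟩⟩
  comp f g := ⟨g.map ∘ₗ f.map,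
    ⟨fun ν v h => g.isHom.wt ν _ (f.isHom.wt ν v h),
     fun i m v => by simp [f.isHom.avee, g.isHom.avee],
     fun ε i n v => by simp [f.isHom.x, g.isHom.x],
     fun ε i v => by simp [f.isHom.K, g.isHom.K],
     fun v => by simp [f.isHom.qd, g.isHom.qd]⟩⟩

/-- `V` is irreducible: it is nonzero and has no proper nonzero `H`-graded `𝔽`-subspace which is
stable under all the generators and the inverses of `K^±_i` and `q^d`. -/
def IsIrreducible (V : CatC.{u} T) : Prop :=
  Nontrivial V.rep ∧ ∀ S : Submodule (Mero X) V.rep,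
    (S ≤ ⨆ ν, S ⊓ V.rep.wt ν) → (∀ i m, ∀ v ∈ S, V.rep.avee i m v ∈ S) →
    (∀ ε i n, ∀ v ∈ S, V.rep.x ε i n v ∈ S) → (∀ ε i v, V.rep.K ε i v ∈ S ↔ v ∈ S) →
    (∀ v, V.rep.qd v ∈ S ↔ v ∈ S) → S = ⊥ ∨ S = ⊤

end CatC

/-! ## Modules over the universal dynamical `Z`-algebra -/

/-- An `𝔽`-vector space with operators named after the generators of `𝒵_{k,l}` and an
`H^*`-indexed family of subspaces (no relations imposed yet). -/
structure ZRep (X : SimpleType) where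
  carrier : Type u
  [grp : AddCommGroup carrier]
  [modC : Module ℂ carrier]
  [modF : Module (Mero X) carrier]
  [tower : IsScalarTower ℂ (Mero X) carrier]
  /-- the weight spaces -/
  wt : HStar X → Submodule (Mero X) carrier
  /-- the operators `𝒵^±_{i,n}` -/
  Z : Sgn → X.Idx → ℤ → carrier → carrier
  /-- the operators `K^±_i` -/
  K : Sgn → X.Idx → Module.End ℂ carrier
  /-- the operator `q^d` -/
  qd : Module.End (Mero X) carrier

attribute [instance] ZRep.grp ZRep.modC ZRep.modF ZRep.tower

instance : CoeSort (ZRep.{u} X) (Type u) := ⟨ZRep.carrier⟩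

/-- `W` is a module of level `(k,l)` over the universal dynamical quantum `Z`-algebra `𝒵_{k,l}` in
the category `𝔇_{k,l}`. -/
structure ZRep.IsZModule (T : Params X) (W : ZRep.{u} X) : Prop where
  common : IsCommon T W.wt W.Z W.K W.qd
  truncated : IsTruncated T W.qd
  /-- `z G_{ij}(w/z) Z^±_i(z) Z^±_j(w) = - w κ^{-m_{ij}} G_{ji}(z/w) Z^±_j(w) Z^±_i(z)`, where
  `G_{ij}(u) = (q^{-b_{ij}} κ^{-m_{ij}} u; q^{2k})_∞ / (q^{2k} q^{b_{ij}} κ^{-m_{ij}} u; q^{2k})_∞` -/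
  Z_Z : ∀ ε i j (a b : ℤ) v,
    twoCoeff (T.strZ i j) (W.Z ε i) (W.Z ε j) (a + 1) b v =
      - T.κm i j • twoCoeff (T.strZ j i) (W.Z ε j) (W.Z ε i) (b + 1) a v
  /-- `F_{ij}(w/z) Z^+_i(z) Z^-_j(w) - F_{ji}(z/w) Z^-_j(w) Z^+_i(z)
    = δ_{ij}/(q_i - q_i⁻¹) (δ(q^k w/z) K^+_i - δ(q^{-k} w/z) K^-_i)` -/
  Zpos_Zneg : ∀ i j (a b : ℤ) v,
    twoCoeff (T.strMix i j) (W.Z .pos i) (W.Z .neg j) a b v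
      - twoCoeff (T.strMix j i) (W.Z .neg j) (W.Z .pos i) b a v =
      if i = j ∧ a + b = 0 then (T.qi i - (T.qi i)⁻¹)⁻¹ •
        (T.qk ^ a • W.K .pos i v - T.qk ^ (-a) • W.K .neg i v) else 0
  serre : ∀ ε i j, i ≠ j →
    SerreRel T (T.strSerreZ ε) (W.Z ε) i j (1 - X.cartan i j).toNat

/-- The category `𝔇_{k,l}`. -/
structure CatD (T : Params X) where
  rep : ZRep.{u} X
  isModule : rep.IsZModule T

namespace CatD

variable {T : Params X}

/-- Module maps. -/
structure IsHom (W W' : ZRep.{u} X) (φ : W →ₗ[Mero X] W') : Prop where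
  wt : ∀ ν, ∀ v ∈ W.wt ν, φ v ∈ W'.wt ν
  Z : ∀ ε i n v, φ (W.Z ε i n v) = W'.Z ε i n (φ v)
  K : ∀ ε i v, φ (W.K ε i v) = W'.K ε i (φ v)
  qd : ∀ v, φ (W.qd v) = W'.qd (φ v)

/-- Morphisms of `𝔇_{k,l}`. -/
@[ext]
structure Hom (W W' : CatD.{u} T) where
  map : W.rep →ₗ[Mero X] W'.rep
  isHom : IsHom W.rep W'.rep map

instance : Category (CatD.{u} T) where
  Hom := Hom
  id V := ⟨LinearMap.id, ⟨fun _ _ h => h, fun _ _ _ _ => rfl, fun _ _ _ => rfl, fun _ => rfl⟩⟩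
  comp f g := ⟨g.map ∘ₗ f.map,
    ⟨fun ν v h => g.isHom.wt ν _ (f.isHom.wt ν v h),
     fun ε i n v => by simp [f.isHom.Z, g.isHom.Z],
     fun ε i v => by simp [f.isHom.K, g.isHom.K],
     fun v => by simp [f.isHom.qd, g.isHom.qd]⟩⟩

/-- `W` is irreducible: it is nonzero and has no proper nonzero `H`-graded `𝔽`-subspace which is
stable under all the generators and the inverses of `K^±_i` and `q^d`. -/
def IsIrreducible (W : CatD.{u} T) : Prop :=
  Nontrivial W.rep ∧ ∀ S : Submodule (Mero X) W.rep,
    (S ≤ ⨆ ν, S ⊓ W.rep.wt ν) →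
    (∀ ε i n, ∀ v ∈ S, W.rep.Z ε i n v ∈ S) → (∀ ε i v, W.rep.K ε i v ∈ S ↔ v ∈ S) →
    (∀ v, W.rep.qd v ∈ S ↔ v ∈ S) → S = ⊥ ∨ S = ⊤

end CatD

/-! ## The operators `E^±` -/

section Heisenberg

variable {A : Type*} [Ring A] [Algebra ℂ A] (T : Params X)

/-- `al ↦ α_{i,m}` for `+`; for `-`, `α'_{i,m} = (1 - p^{*m})/(1 - p^m) q^{km} α_{i,m}`. -/
def heis (ε : Sgn) (al : X.Idx → ℤ → A) (i : X.Idx) (m : ℤ) : A :=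
  match ε with
    | .pos => al i m
    | .neg => ((1 - T.pStar ^ m) / (1 - T.p ^ m) * T.qk ^ m) • al i m

/-- The coefficient of `z^{-m}` in `exp(θ ∑_{m ≥ 1} (q - q⁻¹)/(q^{km} - q^{-km}) β_{i,m} z^{-m})`,
resp. (for `η = -`) of `z^m` in `exp(θ ∑_{m ≥ 1} (q - q⁻¹)/(q^{km} - q^{-km}) β_{i,-m} z^m)`, where
`β = α` for `ε = +` and `β = α'` for `ε = -`. With `θ = ε η 1` this is `E^η(α_i, z)` for `ε = +` and
`E^η(α'_i, z)` for `ε = -`; with `θ = -(ε η 1)` it is the inverse of that series. -/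
def eOp (ε η : Sgn) (θ : ℤ) (al : X.Idx → ℤ → A) (i : X.Idx) : ℕ → A :=
  expCoeff fun m =>
    (θ * ((T.q - T.q⁻¹) / (T.qk ^ (m : ℤ) - T.qk ^ (-(m : ℤ)))) : ℂ) • heis T ε al i (η.val * m)

end Heisenberg

/-! ## The functor `Ω` -/

namespace URep

variable (T : Params X) (V : URep.{u} X)

/-- `α_{i,m} = [d_i] α^∨_{i,m}`. -/
def al (i : X.Idx) (m : ℤ) : Module.End (Mero X) V := T.br (T.d i) • V.avee i m

/-- The coefficient of `z^{-n}` in `𝒵^+_i(z; V) = E^-(α_i, z) x^+_i(z) E^+(α_i, z)`, resp.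
`𝒵^-_i(z; V) = E^-(α'_i, z) x^-_i(z) E^+(α'_i, z)`. -/
def zOp (ε : Sgn) (i : X.Idx) (n : ℤ) (v : V) : V :=
  ∑ᶠ ab : ℕ × ℕ, eOp T ε .neg (-ε.val) (V.al T) i ab.1
    (V.x ε i (n + ab.1 - ab.2) (eOp T ε .pos ε.val (V.al T) i ab.2 v))

/-- The vacuum space `Ω_V = {v | α_{i,m} v = 0 for all i ∈ I, m > 0}`. -/
def vacuum : Submodule (Mero X) V where
  carrier := {v | ∀ i, ∀ m : ℤ, 0 < m → V.al T i m v = 0}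
  zero_mem' := by intro i m _; simp
  add_mem' := by intro v w hv hw i m hm; simp [hv i m hm, hw i m hm]
  smul_mem' := by intro g v hv i m hm; simp [hv i m hm]

/-- `Ω_V` is stable under `𝒵^±_{i,n}(V)`, `K^±_i` and `q^d`. -/
structure VacuumStable : Prop where
  Z : ∀ ε i n, ∀ v ∈ V.vacuum T, V.zOp T ε i n v ∈ V.vacuum T
  K : ∀ ε i, ∀ v ∈ V.vacuum T, V.K ε i v ∈ V.vacuum T
  qd : ∀ v ∈ V.vacuum T, V.qd v ∈ V.vacuum T

/-- `Ω_V` with the operators `𝒵^±_{i,n}(V)`, `K^±_i`, `q^d`. -/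
def vacuumRep (h : V.VacuumStable T) : ZRep.{u} X where
  carrier := V.vacuum T
  wt ν := (V.wt ν).comap (V.vacuum T).subtype
  Z ε i n v := ⟨V.zOp T ε i n v, h.Z ε i n v v.2⟩
  K ε i := ((V.K ε i).comp ((V.vacuum T).subtype.restrictScalars ℂ)).codRestrict
    ((V.vacuum T).restrictScalars ℂ) (fun v => h.K ε i v v.2)
  qd := V.qd.restrict h.qd

end URep

/-- The restriction of a module map to the vacuum spaces. -/
def vacuumMap {T : Params X} {V V' : CatC.{u} T} (φ : V ⟶ V') :
    V.rep.vacuum T →ₗ[Mero X] V'.rep.vacuum T :=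
  φ.map.restrict fun v hv i m hm => by
    have h := hv i m hm
    simp only [URep.al, LinearMap.smul_apply] at h ⊢
    rw [← φ.isHom.avee, ← LinearMap.map_smul_of_tower, h, map_zero]

/-- The vacuum spaces are `𝒵_{k,l}`-modules in `𝔇_{k,l}`, and the restrictions of module maps to them
are module maps. -/
structure OmegaWellDefined (T : Params X) : Prop where
  stable : ∀ V : CatC.{u} T, V.rep.VacuumStable T
  isModule : ∀ V : CatC.{u} T, (V.rep.vacuumRep T (stable V)).IsZModule T
  isHom : ∀ {V V' : CatC.{u} T} (φ : V ⟶ V'),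
    CatD.IsHom (V.rep.vacuumRep T (stable V)) (V'.rep.vacuumRep T (stable V')) (vacuumMap φ)

/-- The functor `Ω : ℭ_{k,l} ⥤ 𝔇_{k,l}`. -/
def Omega {T : Params X} (h : OmegaWellDefined.{u} T) : CatC.{u} T ⥤ CatD.{u} T where
  obj V := ⟨V.rep.vacuumRep T (h.stable V), h.isModule V⟩
  map φ := ⟨vacuumMap φ, h.isHom φ⟩
  map_id _ := rfl
  map_comp _ _ := rfl

/-! ## The functor `Λ` -/

/-- The Fock space `ℂ[α_{i,-n} (i ∈ I, n > 0)]`. -/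
abbrev Fock (X : SimpleType) : Type := MvPolynomial (X.Idx × ℕ+) ℂ

/-- The action of `α_{i,m}` on the level-`(k,l)` Fock module: `α_{i,-n}` acts by multiplication, and
`α_{i,n}` by
`∑_j ([b_{ij} n][kn]/n) (1 - p^n)/(1 - p^{*n}) κ^{-n m_{ij}} q^{-kn} ∂/∂α_{j,-n}` (`n > 0`). -/
def fockAl (T : Params X) (i : X.Idx) : ℤ → Module.End ℂ (Fock X)
  | .ofNat 0 => 0
  | .ofNat (n + 1) => ∑ j : X.Idx,
      (T.br (T.b i j * (n + 1)) * T.brk (n + 1) / (n + 1) * T.pRatio (n + 1) *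
        T.κm i j ^ (n + 1) * T.qk ^ (-((n : ℤ) + 1))) •
      (MvPolynomial.pderiv (j, n.succPNat)).toLinearMap
  | .negSucc n => LinearMap.mulLeft ℂ (MvPolynomial.X (i, n.succPNat))

/-- The action of `q^d` on the Fock space: `α_{i,-n}` has degree `-n`. -/
def fockQd (T : Params X) : Module.End ℂ (Fock X) :=
  (MvPolynomial.aeval fun in' : X.Idx × ℕ+ =>
    MvPolynomial.C (T.q ^ (-(in'.2 : ℤ))) * MvPolynomial.X in' : Fock X →ₐ[ℂ] Fock X).toLinearMap

namespace CatD

variable {T : Params X} (W : CatD.{u} T)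

/-- The operator `𝒵^±_{i,n}` on `W` as a `ℂ`-linear map. -/
def zLin (ε : Sgn) (i : X.Idx) (n : ℤ) : Module.End ℂ W.rep :=
  (W.isModule.common.Y_weight ε i n).linear.mk'

/-- `Ind W`, i.e. the tensor product over `ℂ` of `W` and the Fock module, with
`x^+_i(z) = E^-(α_i, z)⁻¹ E^+(α_i, z)⁻¹ ⊗ 𝒵^+_i(z)`,
`x^-_i(z) = E^-(α'_i, z)⁻¹ E^+(α'_i, z)⁻¹ ⊗ 𝒵^-_i(z)`. (The factor `W` is written first because
`𝔽` acts on it.) -/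
def indRep : URep.{u} X where
  carrier := W.rep ⊗[ℂ] Fock X
  tower := TensorProduct.isScalarTower_left
  wt ν := Submodule.span (Mero X) {t | ∃ w ∈ W.rep.wt ν, ∃ f : Fock X, t = w ⊗ₜ[ℂ] f}
  avee i m := (T.br (T.d i))⁻¹ •
    TensorProduct.AlgebraTensorModule.map LinearMap.id (fockAl T i m)
  x ε i n t := ∑ᶠ ab : ℕ × ℕ, TensorProduct.map (W.zLin ε i (n + ab.1 - ab.2))
    (eOp T ε .neg ε.val (fockAl T) i ab.1 * eOp T ε .pos (-ε.val) (fockAl T) i ab.2) t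
  K ε i := TensorProduct.map (W.rep.K ε i) LinearMap.id
  qd := TensorProduct.AlgebraTensorModule.map W.rep.qd (fockQd T)

/-- The map `φ ⊗ id` between induced modules. -/
def indMap {W W' : CatD.{u} T} (φ : W ⟶ W') : W.indRep →ₗ[Mero X] W'.indRep :=
  TensorProduct.AlgebraTensorModule.map φ.map LinearMap.id

end CatD

/-- The induced spaces are `U_{q,κ,p}(𝔤_tor)`-modules in `ℭ_{k,l}`, and the induced maps are module
maps. -/
structure LambdaWellDefined (T : Params X) : Prop where
  isModule : ∀ W : CatD.{u} T, W.indRep.IsUModule T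
  isHom : ∀ {W W' : CatD.{u} T} (φ : W ⟶ W'),
    CatC.IsHom W.indRep W'.indRep (CatD.indMap φ)

/-- The functor `Λ : 𝔇_{k,l} ⥤ ℭ_{k,l}`. -/
def Lambda {T : Params X} (h : LambdaWellDefined.{u} T) : CatD.{u} T ⥤ CatC.{u} T where
  obj W := ⟨W.indRep, h.isModule W⟩
  map φ := ⟨CatD.indMap φ, h.isHom φ⟩
  map_id W := CatC.Hom.ext (TensorProduct.AlgebraTensorModule.map_id)
  map_comp φ ψ := CatC.Hom.ext (by
    refine TensorProduct.AlgebraTensorModule.ext fun w f => ?_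
    rfl)

end EllToroidal

end

/-!
The idea is that a module of level `(k,l)` factors into a Fock space of the Heisenberg algebra and
its vacuum space. By genericity the pairing `[α_{i,n}, α_{j,-n}]` is nondegenerate for every
`n ≥ 1`, and the conditions on `q^d` make every vector vanish under all operators of high degree.
For such representations of the Heisenberg algebra the complete reducibility into Fock spaces takes
the following form: a subspace stable under the `α_{i,m}` is generated by its vacuum vectors
(`HeisBase.Nondeg.le_of_vac_le`), and no nonzero vacuum vector lies in the image `J` of the creation
operators (`HeisBase.Nondeg.eq_zero_of_mem_J`). Both follow by projecting onto kernels of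
annihilation operators by means of the series `∑_r (-1)^r x^r p^r / r!` for `[p, x] = 1`.

The currents `x^±_i(z)` are eigenvectors for the adjoint action of the `α_{j,m}`. Multiplication by
the vertex operators `E^±` cancels the eigenvalues, so that the dressed currents `Z^±_i(z)` commute
with the Heisenberg algebra and preserve the vacuum space; multiplication by the inverse vertex
operators recovers `x^±_i(z)` (`dress_dress`). Moving the vertex operators apart in a product of
currents shows that modulo `J`, and on the vacuum space, the product of currents equals the
product of dressed currents times scalar series, the contractions of all pairs
(`HeisSystem.mkQ_word`). A family of operators which is covariant under the Heisenberg algebra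
vanishes as soon as its matrix elements from the vacuum space to the quotient by `J` do
(`HeisBase.Nondeg.eq_zero_of_matrix`). Hence a relation between products of the `x^±_i(z)` holds on
`V` if and only if the relation between the `Z^±_i(z)`, with the structure functions multiplied by
the contractions, holds on the vacuum space (`HeisSystem.relation_iff`).

It remains to compute the contractions. The elliptic structure functions `G^±_{ij}` times the
contractions are the functions `F^±_{ij}`, which do not depend on `p`
(`Params.Generic.strU_mul_contr`); the contractions of `x^+_i` and `x^-_j` are the structure
functions of the mixed relations (`Params.Generic.contr_mixed`); and `φ^±_i` is `K^±_i` times a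
vertex operator, so that its vacuum matrix elements are those of `K^±_i`. Therefore the quadratic,
mixed and Serre relations of `U_{q,κ,p}` on `V` are equivalent to the relations of the `Z`-algebra
on the vacuum space of `V` (`URep.IsPreModule.isUModule_iff`). Read from left to right this shows
that `Ω` is well defined. Read from right to left it shows the same for `Λ`, because the vacuum
space of `Ind W` is `W ⊗ 1` and the dressed currents act there as the operators of `W`
(`CatD.indVac_indEval`, `CatD.indRep_z`).

A map from `W` to the vacuum space of `V` which commutes with all operators extends uniquely to
`Ind W → V` by `w ⊗ f ↦ f φ(w)`. The kernel and the image of the extension are governed by their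
vacuum vectors, so that it is an isomorphism if `φ` is (`indLift_injective`,
`indLift_surjective`). Applied to the inclusion of `Ω_V` this gives `Ind Ω_V ≅ V`, and `w ↦ w ⊗ 1`
gives `W ≅ Ω_{Ind W}`. The same principle identifies the graded stable subspaces of `Ind W` with
those of `W`, whence the statement on irreducibility.
-/

noncomputable section

set_option linter.unusedSectionVars false

namespace EllToroidal

/-! ### Exponentials of formal series with commuting coefficients -/

section ExpCalculus

variable {A : Type*} [Ring A] [Algebra ℂ A]

/-- The exponent `∑_{m ≥ 1} c_m u^m` of the series with coefficients `expCoeff c`. -/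
def genSer (c : ℕ → A) : PowerSeries A := PowerSeries.mk fun m => if m = 0 then 0 else c m

/-- The series `exp(∑_{m ≥ 1} c_m u^m)` with coefficients in a noncommutative algebra. -/
def expSer (c : ℕ → A) : PowerSeries A := PowerSeries.mk (expCoeff c)

/-- The Euler derivation `u d/du` of formal power series. -/
def euler (f : PowerSeries A) : PowerSeries A :=
  PowerSeries.mk fun n => (n : ℂ) • PowerSeries.coeff n f

@[simp] lemma coeff_euler (f : PowerSeries A) (n : ℕ) :
    PowerSeries.coeff n (euler f) = (n : ℂ) • PowerSeries.coeff n f := by simp [euler]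

@[simp] lemma coeff_expSer (c : ℕ → A) (n : ℕ) :
    PowerSeries.coeff n (expSer c) = expCoeff c n := by simp [expSer]

lemma coeff_genSer (c : ℕ → A) (n : ℕ) :
    PowerSeries.coeff n (genSer c) = if n = 0 then 0 else c n := by simp [genSer]

lemma euler_mul (f g : PowerSeries A) : euler (f * g) = euler f * g + f * euler g := by
  ext n
  simp only [coeff_euler, PowerSeries.coeff_mul, map_add, Finset.smul_sum,
    ← Finset.sum_add_distrib]
  refine Finset.sum_congr rfl fun x hx => ?_
  rw [← Finset.HasAntidiagonal.mem_antidiagonal.mp hx]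
  push_cast
  rw [add_smul, smul_mul_assoc, mul_smul_comm]

lemma euler_add (f g : PowerSeries A) : euler (f + g) = euler f + euler g := by
  ext n; simp

lemma euler_smul (a : ℂ) (f : PowerSeries A) : euler (a • f) = a • euler f := by
  ext n
  rw [coeff_euler, PowerSeries.coeff_smul, PowerSeries.coeff_smul, coeff_euler, smul_comm]

lemma euler_one : euler (1 : PowerSeries A) = 0 := by
  ext n
  rcases Nat.eq_zero_or_pos n with rfl | h
  · simp
  · simp [PowerSeries.coeff_one, h.ne']

lemma commute_of_coeff {f g : PowerSeries A}
    (h : ∀ m n, Commute (PowerSeries.coeff m f) (PowerSeries.coeff n g)) : Commute f g := by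
  show f * g = g * f
  ext n
  rw [PowerSeries.coeff_mul, PowerSeries.coeff_mul, ← Finset.Nat.sum_antidiagonal_swap]
  exact Finset.sum_congr rfl fun x _ => h _ _

lemma euler_pow {f : PowerSeries A} (h : Commute f (euler f)) (r : ℕ) :
    euler (f ^ (r + 1)) = ((r + 1 : ℕ) : ℂ) • (euler f * f ^ r) := by
  induction r with
  | zero => simp
  | succ r ih =>
    rw [pow_succ', euler_mul, ih, mul_smul_comm, ← mul_assoc, h.eq, mul_assoc, ← pow_succ',
      Nat.cast_succ (r + 1), add_smul, one_smul, add_comm]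

lemma coeff_genSer_pow_eq_zero (c : ℕ → A) {n r : ℕ} (h : n < r) :
    PowerSeries.coeff n (genSer c ^ r) = 0 := by
  induction r generalizing n with
  | zero => omega
  | succ r ih =>
    rw [pow_succ', PowerSeries.coeff_mul]
    refine Finset.sum_eq_zero fun x hx => ?_
    have hx' := Finset.HasAntidiagonal.mem_antidiagonal.mp hx
    rcases Nat.eq_zero_or_pos x.1 with h0 | h0
    · simp [coeff_genSer, h0]
    · rw [ih (by omega), mul_zero]

/-- The powers `C^r` with `r > n` do not contribute to the coefficient of `u^n` in `exp C`. -/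
lemma expCoeff_eq_coeff (c : ℕ → A) {n M : ℕ} (h : n < M) :
    expCoeff c n = PowerSeries.coeff n (∑ r ∈ Finset.range M,
      ((r.factorial : ℂ)⁻¹) • genSer c ^ r) := by
  have h1 : expCoeff c n = PowerSeries.coeff n (∑ r ∈ Finset.range (n + 1),
      ((r.factorial : ℂ)⁻¹) • genSer c ^ r) := rfl
  rw [h1, map_sum, map_sum]
  refine Finset.sum_subset (by intro x; simp; omega) fun r _ hr => ?_
  rw [PowerSeries.coeff_smul, coeff_genSer_pow_eq_zero c (by simpa using hr), smul_zero]

@[simp] lemma expCoeff_zero (c : ℕ → A) : expCoeff c 0 = 1 := by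
  rw [expCoeff_eq_coeff c (M := 1) one_pos]; simp

lemma expCoeff_congr {c c' : ℕ → A} (h : ∀ m, 0 < m → c m = c' m) : expCoeff c = expCoeff c' := by
  have : genSer c = genSer c' := by
    ext n
    rcases Nat.eq_zero_or_pos n with rfl | h0
    · simp [coeff_genSer]
    · simp [coeff_genSer, h0.ne', h n h0]
  funext n
  rw [expCoeff_eq_coeff c n.lt_succ_self, expCoeff_eq_coeff c' n.lt_succ_self, this]

lemma coeff_pow_mem (B : Subalgebra ℂ A) {f : PowerSeries A}
    (h : ∀ n, PowerSeries.coeff n f ∈ B) (r n : ℕ) : PowerSeries.coeff n (f ^ r) ∈ B := by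
  induction r generalizing n with
  | zero =>
    rw [pow_zero, PowerSeries.coeff_one]; split_ifs
    exacts [B.one_mem, B.zero_mem]
  | succ r ih =>
    rw [pow_succ', PowerSeries.coeff_mul]
    exact B.sum_mem fun x _ => B.mul_mem (h _) (ih _)

lemma expCoeff_mem (B : Subalgebra ℂ A) {c : ℕ → A} (h : ∀ m, 0 < m → c m ∈ B) (n : ℕ) :
    expCoeff c n ∈ B := by
  rw [expCoeff_eq_coeff c n.lt_succ_self, map_sum]
  refine B.sum_mem fun r _ => ?_
  rw [PowerSeries.coeff_smul]
  refine B.smul_mem (coeff_pow_mem B (fun n => ?_) r n) _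
  rw [coeff_genSer]
  split_ifs with h0
  · exact B.zero_mem
  · exact h n (Nat.pos_of_ne_zero h0)

lemma map_expCoeff {B : Type*} [Ring B] [Algebra ℂ B] (f : A →ₐ[ℂ] B) (c : ℕ → A) (n : ℕ) :
    f (expCoeff c n) = expCoeff (fun m => f (c m)) n := by
  have hg : genSer (fun m => f (c m)) = PowerSeries.map (f : A →+* B) (genSer c) := by
    ext n
    simp only [coeff_genSer, PowerSeries.coeff_map]
    split_ifs <;> simp
  have h : ∀ r, PowerSeries.coeff n (genSer (fun m => f (c m)) ^ r)
      = f (PowerSeries.coeff n (genSer c ^ r)) := fun r => by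
    rw [hg, ← map_pow, PowerSeries.coeff_map]; rfl
  rw [expCoeff_eq_coeff _ n.lt_succ_self, expCoeff_eq_coeff _ n.lt_succ_self, map_sum, map_sum,
    map_sum]
  refine Finset.sum_congr rfl fun r _ => ?_
  rw [PowerSeries.coeff_smul, PowerSeries.coeff_smul, h, map_smul]

lemma expCoeff_scale (a : ℂ) (c : ℕ → A) (n : ℕ) :
    expCoeff (fun m => a ^ m • c m) n = a ^ n • expCoeff c n := by
  have h : ∀ r n, PowerSeries.coeff n (genSer (fun m => a ^ m • c m) ^ r)
      = a ^ n • PowerSeries.coeff n (genSer c ^ r) := by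
    intro r
    induction r with
    | zero =>
      intro n
      rw [pow_zero, pow_zero, PowerSeries.coeff_one]
      split_ifs with h <;> simp [h]
    | succ r ih =>
      intro n
      rw [pow_succ', pow_succ', PowerSeries.coeff_mul, PowerSeries.coeff_mul, Finset.smul_sum]
      refine Finset.sum_congr rfl fun x hx => ?_
      rw [ih, coeff_genSer, coeff_genSer, ← Finset.HasAntidiagonal.mem_antidiagonal.mp hx, pow_add,
        mul_smul]
      split_ifs
      · simp
      · rw [smul_mul_assoc, mul_smul_comm]
  rw [expCoeff_eq_coeff _ n.lt_succ_self, expCoeff_eq_coeff _ n.lt_succ_self, map_sum, map_sum,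
    Finset.smul_sum]
  refine Finset.sum_congr rfl fun r _ => ?_
  rw [PowerSeries.coeff_smul, PowerSeries.coeff_smul, h, smul_comm]

/-- The coefficients `c_m`, `m ≥ 1`, commute with one another. -/
def PairComm (c : ℕ → A) : Prop := ∀ m n, 0 < m → 0 < n → Commute (c m) (c n)

/-- The differential equation `u E'(u) = (u C'(u)) E(u)` of the exponential `E = exp C`. -/
lemma euler_expSer {c : ℕ → A} (h : PairComm c) :
    euler (expSer c) = euler (genSer c) * expSer c := by
  have hc : Commute (genSer c) (euler (genSer c)) := by
    refine commute_of_coeff fun m n => ?_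
    rw [coeff_euler, coeff_genSer, coeff_genSer]
    refine Commute.smul_right ?_ _
    split_ifs with h1 h2 h2
    · exact Commute.zero_left _
    · exact Commute.zero_left _
    · exact Commute.zero_right _
    · exact h m n (Nat.pos_of_ne_zero h1) (Nat.pos_of_ne_zero h2)
  have hS : ∀ n, euler (∑ r ∈ Finset.range (n + 1), ((r.factorial : ℂ)⁻¹) • genSer c ^ r)
      = euler (genSer c) * ∑ r ∈ Finset.range n, ((r.factorial : ℂ)⁻¹) • genSer c ^ r := by
    intro n
    induction n with
    | zero => simp [euler_one]
    | succ n ih =>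
      rw [Finset.sum_range_succ, euler_add, ih, Finset.sum_range_succ _ n, mul_add, euler_smul,
        euler_pow hc, smul_smul, mul_smul_comm]
      congr 2
      rw [Nat.factorial_succ]
      have h1 : ((n + 1 : ℕ) : ℂ) ≠ 0 := Nat.cast_ne_zero.mpr n.succ_ne_zero
      push_cast at h1 ⊢
      rw [mul_inv, mul_comm _ ((n.factorial : ℂ)⁻¹), mul_assoc, inv_mul_cancel₀ h1, mul_one]
  -- Only finitely many powers of `C` matter for the coefficient of `u^n`, so the exponential may be
  -- replaced by its partial sums.
  ext n
  rw [coeff_euler, coeff_expSer, expCoeff_eq_coeff c (M := n + 2) (by omega), ← coeff_euler, hS,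
    PowerSeries.coeff_mul, PowerSeries.coeff_mul]
  refine Finset.sum_congr rfl fun x hx => ?_
  have := Finset.HasAntidiagonal.mem_antidiagonal.mp hx
  rw [coeff_expSer, expCoeff_eq_coeff c (M := n + 1) (by omega)]

/-- A solution of `u F'(u) = G(u) F(u)`, where `G(0) = 0`, is determined by `F(0)`. -/
lemma eq_of_euler_eq {F F' G : PowerSeries A} (hG : PowerSeries.coeff 0 G = 0)
    (hF : euler F = G * F) (hF' : euler F' = G * F')
    (h0 : PowerSeries.coeff 0 F = PowerSeries.coeff 0 F') : F = F' := by
  ext n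
  induction n using Nat.strong_induction_on with
  | _ n ih =>
    rcases Nat.eq_zero_or_pos n with rfl | hn
    · exact h0
    · have key : (n : ℂ) • PowerSeries.coeff n F = (n : ℂ) • PowerSeries.coeff n F' := by
        rw [← coeff_euler, ← coeff_euler, hF, hF', PowerSeries.coeff_mul, PowerSeries.coeff_mul]
        refine Finset.sum_congr rfl fun x hx => ?_
        have hx' := Finset.HasAntidiagonal.mem_antidiagonal.mp hx
        rcases Nat.eq_zero_or_pos x.1 with h | h
        · rw [h, hG, zero_mul, zero_mul]
        · rw [ih x.2 (by omega)]
      have hn' : (n : ℂ) ≠ 0 := Nat.cast_ne_zero.mpr hn.ne'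
      simpa [smul_smul, hn'] using congrArg (fun y => (n : ℂ)⁻¹ • y) key

lemma coeff_zero_euler (f : PowerSeries A) : PowerSeries.coeff 0 (euler f) = 0 := by simp

/-- If `[u C'(u), Φ(u)] = u Φ'(u)`, then `exp(C(u)) Φ(0) exp(-C(u)) = Φ(u)`. -/
lemma expSer_mul_C {c : ℕ → A} (h : PairComm c) (Φ : PowerSeries A)
    (hΦ : euler (genSer c) * Φ = Φ * euler (genSer c) + euler Φ) :
    expSer c * PowerSeries.C (PowerSeries.coeff 0 Φ) = Φ * expSer c := by
  -- Both sides solve `u F' = (u C') F` and have the same constant term.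
  refine eq_of_euler_eq (coeff_zero_euler (genSer c)) ?_ ?_ ?_
  · have : euler (PowerSeries.C (PowerSeries.coeff 0 Φ)) = 0 := by
      ext n
      rcases Nat.eq_zero_or_pos n with rfl | hn
      · simp
      · simp [PowerSeries.coeff_C, hn.ne']
    rw [euler_mul, euler_expSer h, this, mul_zero, add_zero, mul_assoc]
  · rw [euler_mul, euler_expSer h, ← mul_assoc, ← mul_assoc, hΦ, add_mul, add_comm]
  · simp [PowerSeries.coeff_mul]

lemma commute_expCoeff {c : ℕ → A} {a : A} (h : ∀ m, 0 < m → Commute (c m) a) (n : ℕ) :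
    Commute (expCoeff c n) a := by
  have := expCoeff_mem (Subalgebra.centralizer ℂ {a}) (c := c) (fun m hm => by
    rw [Subalgebra.mem_centralizer_iff]; simpa using (h m hm).eq.symm) n
  rw [Subalgebra.mem_centralizer_iff] at this
  exact (this a rfl).symm

lemma expSer_add {c c' : ℕ → A} (h : PairComm c) (h' : PairComm c')
    (hcc : ∀ m n, 0 < m → 0 < n → Commute (c m) (c' n)) :
    expSer c * expSer c' = expSer (fun m => c m + c' m) := by
  have hg : genSer (fun m => c m + c' m) = genSer c + genSer c' := by
    ext n; simp only [coeff_genSer, map_add]; split_ifs <;> simp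
  refine eq_of_euler_eq (coeff_zero_euler (genSer fun m => c m + c' m)) ?_ ?_ ?_
  · have hcm : Commute (expSer c) (euler (genSer c')) := by
      refine commute_of_coeff fun m n => ?_
      rw [coeff_euler, coeff_expSer, coeff_genSer]
      refine Commute.smul_right ?_ _
      split_ifs with h0
      · exact Commute.zero_right _
      · exact commute_expCoeff (fun m hm => hcc m n hm (Nat.pos_of_ne_zero h0)) m
    rw [euler_mul, euler_expSer h, euler_expSer h', hg, euler_add, add_mul, ← mul_assoc, hcm.eq,
      mul_assoc, mul_assoc]
  · refine euler_expSer fun m n hm hn => ?_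
    exact ((h m n hm hn).add_right (hcc m n hm hn)).add_left
      ((hcc n m hn hm).symm.add_right (h' m n hm hn))
  · simp [PowerSeries.coeff_mul]

lemma expSer_zero : expSer (fun _ => (0 : A)) = 1 := by
  refine eq_of_euler_eq (coeff_zero_euler (genSer fun _ => (0 : A)))
    (euler_expSer fun _ _ _ _ => Commute.zero_left _) ?_ (by simp)
  have : genSer (fun _ => (0 : A)) = 0 := by ext; simp [coeff_genSer]
  rw [euler_one, this]
  ext; simp

lemma PairComm.neg {c : ℕ → A} (h : PairComm c) : PairComm fun m => - c m :=
  fun m n hm hn => ((h m n hm hn).neg_left).neg_right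

lemma expSer_mul_neg {c : ℕ → A} (h : PairComm c) : expSer c * expSer (fun m => - c m) = 1 := by
  rw [expSer_add h h.neg fun m n hm hn => (h m n hm hn).neg_right, ← expSer_zero]
  congr 1; funext m; simp

lemma expSer_neg_mul {c : ℕ → A} (h : PairComm c) : expSer (fun m => - c m) * expSer c = 1 := by
  simpa using expSer_mul_neg h.neg

/-- The recursion `n E_n = ∑_m m c_m E_{n-m}` for the coefficients of an exponential. -/
lemma nsmul_expCoeff {c : ℕ → A} (h : PairComm c) (n : ℕ) :
    (n : ℂ) • expCoeff c n = ∑ x ∈ Finset.HasAntidiagonal.antidiagonal n,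
      ((x.1 : ℂ) • (if x.1 = 0 then 0 else c x.1)) * expCoeff c x.2 := by
  have := congrArg (PowerSeries.coeff n) (euler_expSer h)
  rw [coeff_euler, PowerSeries.coeff_mul, coeff_expSer] at this
  rw [this]
  refine Finset.sum_congr rfl fun x _ => ?_
  rw [coeff_euler, coeff_genSer, coeff_expSer]

/-- The higher coefficients of an exponential lie in every subspace containing all `c_m a`: by the
recursion they are combinations of such elements. -/
lemma expCoeff_mem_of_left {c : ℕ → A} (h : PairComm c) (S : Submodule ℂ A)
    (hS : ∀ m a, 0 < m → c m * a ∈ S) {n : ℕ} (hn : 0 < n) : expCoeff c n ∈ S := by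
  have hn' : (n : ℂ) ≠ 0 := Nat.cast_ne_zero.mpr hn.ne'
  have key : (n : ℂ) • expCoeff c n ∈ S := by
    rw [nsmul_expCoeff h]
    refine S.sum_mem fun x _ => ?_
    rw [smul_mul_assoc]
    refine S.smul_mem _ ?_
    split_ifs with h0
    · simp
    · exact hS _ _ (Nat.pos_of_ne_zero h0)
  simpa [smul_smul, hn'] using S.smul_mem (n : ℂ)⁻¹ key

lemma expCoeff_mem_of_right {c : ℕ → A} (h : PairComm c) (S : Submodule ℂ A)
    (hS : ∀ m a, 0 < m → a * c m ∈ S) {n : ℕ} (hn : 0 < n) : expCoeff c n ∈ S := by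
  have hn' : (n : ℂ) ≠ 0 := Nat.cast_ne_zero.mpr hn.ne'
  have key : (n : ℂ) • expCoeff c n ∈ S := by
    rw [nsmul_expCoeff h]
    refine S.sum_mem fun x _ => ?_
    rw [smul_mul_assoc]
    refine S.smul_mem _ ?_
    split_ifs with h0
    · simp
    · rw [← (commute_expCoeff (fun m hm => h m x.1 hm (Nat.pos_of_ne_zero h0)) x.2).eq]
      exact hS _ _ (Nat.pos_of_ne_zero h0)
  simpa [smul_smul, hn'] using S.smul_mem (n : ℂ)⁻¹ key

/-- If `[c_m, y] = λ_m` is central, then `E_b y = y E_b + ∑ λ_m E_{b-m}`. -/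
lemma expCoeff_mul_of_comm {c : ℕ → A} (h : PairComm c) (y : A) (l : ℕ → ℂ)
    (hl : ∀ m, 0 < m → c m * y - y * c m = algebraMap ℂ A (l m)) (b : ℕ) :
    expCoeff c b * y = y * expCoeff c b + ∑ x ∈ Finset.HasAntidiagonal.antidiagonal b,
      (if x.1 = 0 then 0 else l x.1) • expCoeff c x.2 := by
  let Φ : PowerSeries A := PowerSeries.mk fun m => if m = 0 then y else algebraMap ℂ A (l m)
  have hΦ : euler (genSer c) * Φ = Φ * euler (genSer c) + euler Φ := by
    let Λ : PowerSeries A := PowerSeries.mk fun m => if m = 0 then 0 else algebraMap ℂ A (l m)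
    have hsplit : Φ = PowerSeries.C y + Λ := by
      ext m
      simp only [Φ, Λ, PowerSeries.coeff_mk, map_add, PowerSeries.coeff_C]
      split_ifs <;> simp
    have hcomm : Commute (euler (genSer c)) Λ := by
      refine commute_of_coeff fun m n => ?_
      simp only [Λ, PowerSeries.coeff_mk]
      split_ifs
      · exact Commute.zero_right _
      · exact (Algebra.commutes _ _).symm
    have h2 : euler (genSer c) * PowerSeries.C y
        = PowerSeries.C y * euler (genSer c) + euler Φ := by
      ext m
      rw [map_add, PowerSeries.coeff_mul_C, PowerSeries.coeff_C_mul, coeff_euler, coeff_euler,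
        coeff_genSer]
      simp only [Φ, PowerSeries.coeff_mk]
      split_ifs with h0
      · simp [h0]
      · rw [← hl m (Nat.pos_of_ne_zero h0), smul_sub, smul_mul_assoc, mul_smul_comm]
        abel
    rw [hsplit, mul_add, add_mul, h2, hcomm.eq, ← hsplit]
    abel
  have := congrArg (PowerSeries.coeff b) (expSer_mul_C h Φ hΦ)
  rw [show PowerSeries.coeff 0 Φ = y by simp [Φ], PowerSeries.coeff_mul_C, coeff_expSer,
    PowerSeries.coeff_mul] at this
  rw [this]
  have h0 : ((0, b) : ℕ × ℕ) ∈ Finset.HasAntidiagonal.antidiagonal b := by simp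
  rw [← Finset.add_sum_erase _ _ h0, ← Finset.add_sum_erase _ _ h0]
  simp only [Φ, PowerSeries.coeff_mk, coeff_expSer, if_true, zero_smul, zero_add]
  congr 1
  refine Finset.sum_congr rfl fun x hx => ?_
  have hx1 : x.1 ≠ 0 := by
    rintro h0
    obtain ⟨h1, h2⟩ := Finset.mem_erase.mp hx
    have := Finset.HasAntidiagonal.mem_antidiagonal.mp h2
    exact h1 (Prod.ext h0 (by simp; omega))
  rw [if_neg hx1, if_neg hx1, Algebra.smul_def]

/-- If `[c_m, x_N] = κ_m x_{N+m}`, then `E(u) x_N = ∑_e k_e u^e x_{N+e} E(u)`, where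
`∑ k_e u^e = exp(∑ κ_m u^m)`. -/
lemma expCoeff_mul_current {c : ℕ → A} (h : PairComm c) (x : ℤ → A) (κ : ℕ → ℂ)
    (hκ : ∀ m N, 0 < m → c m * x N - x N * c m = κ m • x (N + m)) (b : ℕ) (N : ℤ) :
    expCoeff c b * x N = ∑ e ∈ Finset.HasAntidiagonal.antidiagonal b,
      expCoeff κ e.1 • (x (N + e.1) * expCoeff c e.2) := by
  let Φ : PowerSeries A := PowerSeries.mk fun e => expCoeff κ e • x (N + e)
  have hκc : PairComm κ := fun _ _ _ _ => Commute.all _ _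
  have hΦ : euler (genSer c) * Φ = Φ * euler (genSer c) + euler Φ := by
    ext n
    rw [map_add, PowerSeries.coeff_mul, PowerSeries.coeff_mul, ← Finset.Nat.sum_antidiagonal_swap,
      coeff_euler]
    simp only [Φ, PowerSeries.coeff_mk, coeff_euler, coeff_genSer, Prod.fst_swap, Prod.snd_swap]
    rw [smul_smul, show (n : ℂ) * expCoeff κ n = (n : ℂ) • expCoeff κ n from rfl,
      nsmul_expCoeff hκc, Finset.sum_smul]
    conv_rhs => rw [← Finset.Nat.sum_antidiagonal_swap (n := n)
      (f := fun e : ℕ × ℕ => (((e.1 : ℂ) • if e.1 = 0 then 0 else κ e.1) * expCoeff κ e.2) • x (N +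
        n))]
    rw [← Finset.sum_add_distrib]
    refine Finset.sum_congr rfl fun e he => ?_
    have he' := Finset.HasAntidiagonal.mem_antidiagonal.mp he
    simp only [Prod.fst_swap, Prod.snd_swap]
    split_ifs with h0
    · simp
    · have := hκ e.2 (N + e.1) (Nat.pos_of_ne_zero h0)
      rw [sub_eq_iff_eq_add] at this
      rw [smul_mul_assoc, mul_smul_comm, this, smul_mul_assoc, mul_smul_comm,
        show N + (e.1 : ℤ) + e.2 = N + n by rw [← he']; push_cast; ring]
      module
  have := congrArg (PowerSeries.coeff b) (expSer_mul_C h Φ hΦ)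
  rw [show PowerSeries.coeff 0 Φ = x N by simp [Φ], PowerSeries.coeff_mul_C, coeff_expSer,
    PowerSeries.coeff_mul] at this
  rw [this]
  refine Finset.sum_congr rfl fun e _ => ?_
  simp [Φ]

end ExpCalculus

section ExpEnd

variable {V V' : Type*} [AddCommGroup V] [Module ℂ V] [AddCommGroup V'] [Module ℂ V']

/-- A linear map which intertwines the exponents intertwines the exponentials. -/
lemma expCoeff_intertwine (φ : V →ₗ[ℂ] V') {c : ℕ → Module.End ℂ V} {c' : ℕ → Module.End ℂ V'}
    (h : ∀ m, 0 < m → ∀ v, φ (c m v) = c' m (φ v)) (n : ℕ) (v : V) :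
    φ (expCoeff c n v) = expCoeff c' n (φ v) := by
  -- The pairs of operators intertwined by `φ` form a subalgebra, which contains the coefficients of
  -- the exponential of a series as soon as it contains those of the series.
  let B : Subalgebra ℂ (Module.End ℂ V × Module.End ℂ V') :=
    { carrier := {p | ∀ v, φ (p.1 v) = p.2 (φ v)}
      mul_mem' := fun {p p'} hp hp' v => by
        simp only [Set.mem_ofPred_eq] at hp hp'
        simp [hp, hp']
      add_mem' := fun {p p'} hp hp' v => by
        simp only [Set.mem_ofPred_eq] at hp hp'
        simp [hp, hp']
      algebraMap_mem' := fun a v => by simp [Module.algebraMap_end_apply] }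
  have hB := expCoeff_mem B (c := fun m => (c m, c' m)) h n
  have h1 := map_expCoeff (AlgHom.fst ℂ (Module.End ℂ V) (Module.End ℂ V')) (fun m => (c m, c' m)) n
  have h2 := map_expCoeff (AlgHom.snd ℂ (Module.End ℂ V) (Module.End ℂ V')) (fun m => (c m, c' m)) n
  simp only [AlgHom.fst_apply, AlgHom.snd_apply] at h1 h2
  rw [← h1, ← h2]
  exact hB v

end ExpEnd

section ScalarSeries

lemma expSeries_eq_expSer (c : ℕ → ℂ) : expSeries c = expSer c := rfl

lemma pairComm_scalar (c : ℕ → ℂ) : PairComm c := fun _ _ _ _ => Commute.all _ _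

lemma expSeries_mul (c c' : ℕ → ℂ) :
    expSeries c * expSeries c' = expSeries fun m => c m + c' m :=
  expSer_add (pairComm_scalar c) (pairComm_scalar c') fun _ _ _ _ => Commute.all _ _

lemma expSeries_inv (c : ℕ → ℂ) : (expSeries c)⁻¹ = expSeries fun m => - c m := by
  have h0 : PowerSeries.constantCoeff (expSeries c) ≠ 0 := by
    rw [← PowerSeries.coeff_zero_eq_constantCoeff_apply, expSeries_eq_expSer, coeff_expSer]; simp
  rw [PowerSeries.inv_eq_iff_mul_eq_one h0]
  exact expSer_neg_mul (pairComm_scalar c)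

lemma rescale_expSeries (a : ℂ) (c : ℕ → ℂ) :
    PowerSeries.rescale a (expSeries c) = expSeries fun m => a ^ m * c m := by
  ext n
  rw [PowerSeries.coeff_rescale, expSeries_eq_expSer, expSeries_eq_expSer, coeff_expSer,
    coeff_expSer]
  exact (expCoeff_scale a c n).symm

lemma expSeries_congr {c c' : ℕ → ℂ} (h : ∀ m, 0 < m → c m = c' m) :
    expSeries c = expSeries c' := by
  rw [expSeries_eq_expSer, expSeries_eq_expSer, expSer, expSer, expCoeff_congr h]

end ScalarSeries

/-! ### Locally finite sums and graded operators -/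

section Finsum

lemma finsum_of_injective {ι κ M : Type*} [AddCommMonoid M] (g : ι → κ)
    (hg : Function.Injective g) (f : κ → M) (hf : ∀ k, f k ≠ 0 → k ∈ Set.range g) :
    ∑ᶠ k, f k = ∑ᶠ i, f (g i) := by
  rw [← finsum_mem_range (f := f) hg, ← finsum_mem_univ f]
  refine finsum_mem_inter_support_eq' _ _ _ fun x hx => ?_
  simp only [Set.mem_univ, true_iff]
  exact hf x hx

/-- Summation over the fibres `T k` of a map `g`, all of which are finite. -/
lemma finsum_fiberwise {ι κ M : Type*} [AddCommMonoid M] (g : ι → κ) (T : κ → Finset ι)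
    (hT : ∀ k i, i ∈ T k ↔ g i = k) (f : ι → M) (hf : (Function.support f).Finite) :
    ∑ᶠ i, f i = ∑ᶠ k, ∑ i ∈ T k, f i := by
  classical
  have h2 : Function.support (fun k => ∑ i ∈ T k, f i) ⊆ (hf.toFinset.image g : Finset κ) := by
    intro k hk
    obtain ⟨i, hi, hi0⟩ := Finset.exists_ne_zero_of_sum_ne_zero hk
    simp only [Finset.coe_image, Set.mem_image]
    exact ⟨i, by simpa using hi0, (hT k i).mp hi⟩
  rw [finsum_eq_sum_of_support_subset (s := hf.toFinset) f (by simp),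
    finsum_eq_sum_of_support_subset _ h2,
    ← Finset.sum_fiberwise_of_maps_to (s := hf.toFinset) (t := hf.toFinset.image g) (g := g)
      fun i hi => Finset.mem_image_of_mem g hi]
  refine Finset.sum_congr rfl fun k _ => ?_
  refine Finset.sum_subset (fun i hi => (hT k i).mpr (Finset.mem_filter.mp hi).2) ?_
  intro i hi hni
  by_contra h0
  exact hni (Finset.mem_filter.mpr ⟨by simpa using h0, (hT k i).mp hi⟩)

lemma map_finsum' {ι M N F : Type*} [AddCommMonoid M] [AddCommMonoid N] [FunLike F M N]
    [AddMonoidHomClass F M N] (φ : F) (f : ι → M) (hf : (Function.support f).Finite) :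
    φ (∑ᶠ i, f i) = ∑ᶠ i, φ (f i) :=
  (φ : M →+ N).map_finsum hf

end Finsum

section Graded

variable {V : Type*} [AddCommGroup V] [Module ℂ V]

/-- The operator `A` has degree `n`: `q^d A q^{-d} = q^n A`. -/
def HasDeg (q : ℂ) (qd : Module.End ℂ V) (n : ℤ) (A : Module.End ℂ V) : Prop :=
  ∀ v, qd (A v) = q ^ n • A (qd v)

/-- Every vector is killed by all operators of sufficiently high degree. -/
def Trunc (q : ℂ) (qd : Module.End ℂ V) : Prop :=
  ∀ v, ∃ D : ℤ, ∀ n, D < n → ∀ A, HasDeg q qd n A → A v = 0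

variable {q : ℂ} {qd : Module.End ℂ V}

lemma HasDeg.mul (hq : q ≠ 0) {m n : ℤ} {A B : Module.End ℂ V} (hA : HasDeg q qd m A)
    (hB : HasDeg q qd n B) : HasDeg q qd (m + n) (A * B) := fun v => by
  rw [Module.End.mul_apply, hA, hB, map_smul, smul_smul, zpow_add₀ hq]; rfl

lemma HasDeg.one : HasDeg q qd 0 1 := fun v => by simp

lemma HasDeg.smul {n : ℤ} {A : Module.End ℂ V} (hA : HasDeg q qd n A) (a : ℂ) :
    HasDeg q qd n (a • A) := fun v => by
  rw [LinearMap.smul_apply, LinearMap.smul_apply, map_smul, hA, smul_comm]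

lemma HasDeg.add {n : ℤ} {A B : Module.End ℂ V} (hA : HasDeg q qd n A) (hB : HasDeg q qd n B) :
    HasDeg q qd n (A + B) := fun v => by
  rw [LinearMap.add_apply, LinearMap.add_apply, map_add, hA, hB, smul_add]

lemma HasDeg.zero {n : ℤ} : HasDeg q qd n (0 : Module.End ℂ V) := fun v => by simp

lemma HasDeg.sum {ι : Type*} {n : ℤ} (s : Finset ι) {A : ι → Module.End ℂ V}
    (hA : ∀ i ∈ s, HasDeg q qd n (A i)) : HasDeg q qd n (∑ i ∈ s, A i) := by
  classical
  induction s using Finset.induction_on with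
  | empty => simpa using HasDeg.zero
  | insert i s hi ih =>
    rw [Finset.sum_insert hi]
    exact (hA i (Finset.mem_insert_self i s)).add
      (ih fun j hj => hA j (Finset.mem_insert_of_mem hj))

lemma HasDeg.expCoeff {c : ℕ → Module.End ℂ V} {s : ℤ}
    (h : ∀ m : ℕ, 0 < m → HasDeg q qd (s * m) (c m)) (n : ℕ) :
    HasDeg q qd (s * n) (expCoeff c n) := fun v => by
  rw [expCoeff_intertwine qd (c := c) (c' := fun m => (q ^ s) ^ m • c m) (fun m hm v => ?_) n v,
    expCoeff_scale, LinearMap.smul_apply, zpow_mul, zpow_natCast]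
  rw [h m hm, LinearMap.smul_apply, zpow_mul, zpow_natCast]

/-- A family of operators of which only finitely many act nontrivially on any given vector. -/
def LocFin {ι : Type*} (f : ι → Module.End ℂ V) : Prop :=
  ∀ v, (Function.support fun i => f i v).Finite

open Classical in
/-- The sum of a locally finite family of operators (`0` if the family is not locally finite). -/
def locSum {ι : Type*} (f : ι → Module.End ℂ V) : Module.End ℂ V :=
  if h : LocFin f then
    { toFun := fun v => ∑ᶠ i, f i v
      map_add' := fun v w => by
        simp only [map_add]
        exact finsum_add_distrib (h v) (h w)
      map_smul' := fun a v => by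
        simp only [map_smul, RingHom.id_apply]
        exact (smul_finsum' a (h v)).symm }
  else 0

lemma locSum_apply {ι : Type*} {f : ι → Module.End ℂ V} (h : LocFin f) (v : V) :
    locSum f v = ∑ᶠ i, f i v := by
  rw [locSum, dif_pos h]; rfl

lemma HasDeg.locSum {ι : Type*} {f : ι → Module.End ℂ V} {n : ℤ}
    (h : ∀ i, HasDeg q qd n (f i)) : HasDeg q qd n (locSum f) := fun v => by
  by_cases hf : LocFin f
  · rw [locSum_apply hf, locSum_apply hf, map_finsum' qd _ (hf v), smul_finsum' _ (hf _)]
    exact finsum_congr fun i => h i v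
  · simp [EllToroidal.locSum, dif_neg hf]

/-- The coefficients of `L(z) x(z) R(z)`, where `L(z) = ∑ L_a z^a` and `R(z) = ∑ R_b z^{-b}`. -/
def dress (L : ℕ → Module.End ℂ V) (x : ℤ → Module.End ℂ V) (R : ℕ → Module.End ℂ V) (n : ℤ) :
    Module.End ℂ V :=
  locSum fun ab : ℕ × ℕ => L ab.1 * x (n + ab.1 - ab.2) * R ab.2

section Dress

variable (hq : q ≠ 0) (ht : Trunc q qd) {L L' : ℕ → Module.End ℂ V} {x : ℤ → Module.End ℂ V}
  {R R' : ℕ → Module.End ℂ V} (hx : ∀ n, HasDeg q qd n (x n)) (hR : ∀ b : ℕ, HasDeg q qd b (R b))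
  (hL : ∀ a : ℕ, HasDeg q qd (-a) (L a))

include hq ht hx hR

/-- On a given vector `v` only finitely many terms of `L(z) x(z) R(z)` survive: the degree of
`R_b` bounds `b`, and the degree of `x R_b` bounds `a`. -/
lemma finite_dress (n : ℤ) (v : V) : (Function.support fun ab : ℕ × ℕ =>
    L ab.1 (x (n + ab.1 - ab.2) (R ab.2 v))).Finite := by
  obtain ⟨D, hD⟩ := ht v
  refine ((Set.finite_Iic (D - n).toNat).prod (Set.finite_Iic D.toNat)).subset fun ab hab => ?_
  rw [Function.mem_support] at hab
  constructor
  · by_contra h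
    simp only [Set.mem_Iic, not_le] at h
    refine hab ?_
    have := hD (n + ab.1 - ab.2 + ab.2) (by omega) _
      ((hx (n + ab.1 - ab.2)).mul hq (hR ab.2))
    rw [Module.End.mul_apply] at this
    rw [this, map_zero]
  · by_contra h
    simp only [Set.mem_Iic, not_le] at h
    refine hab ?_
    rw [hD ab.2 (by omega) _ (hR _), map_zero, map_zero]

lemma locFin_dress (n : ℤ) :
    LocFin fun ab : ℕ × ℕ => L ab.1 * x (n + ab.1 - ab.2) * R ab.2 :=
  finite_dress hq ht hx hR n

lemma dress_apply (n : ℤ) (v : V) :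
    dress L x R n v = ∑ᶠ ab : ℕ × ℕ, L ab.1 (x (n + ab.1 - ab.2) (R ab.2 v)) :=
  locSum_apply (locFin_dress hq ht hx hR n) v

include hL in
lemma hasDeg_dress (n : ℤ) : HasDeg q qd n (dress L x R n) := by
  refine HasDeg.locSum fun ab => ?_
  have := ((hL ab.1).mul hq (hx (n + ab.1 - ab.2))).mul hq (hR ab.2)
  convert this using 1
  ring

/-- The commutator of a dressed current with an operator which commutes with the right factor. -/
lemma dress_comm_left {y : Module.End ℂ V} {m : ℕ} {l μ : ℂ}
    (hyL : ∀ a, y * L a = L a * y + l • (if m ≤ a then L (a - m) else 0))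
    (hyx : ∀ N, y * x N = x N * y + μ • x (N + m)) (hyR : ∀ b, y * R b = R b * y) (n : ℤ) :
    y * dress L x R n = dress L x R n * y + (l + μ) • dress L x R (n + m) := by
  ext v
  have hf := fun n => finite_dress hq ht hx hR (L := L) n
  have hF : (Function.support fun ab : ℕ × ℕ =>
      if m ≤ ab.1 then L (ab.1 - m) (x (n + ab.1 - ab.2) (R ab.2 v)) else 0).Finite := by
    refine ((hf (n + m) v).image fun ab => (ab.1 + m, ab.2)).subset fun ab hab => ?_
    rw [Function.mem_support] at hab
    split_ifs at hab with h
    · refine ⟨(ab.1 - m, ab.2), ?_, Prod.ext (by simp; omega) rfl⟩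
      rw [Function.mem_support]
      rwa [show n + m + ((ab.1 - m : ℕ) : ℤ) - ab.2 = n + ab.1 - ab.2 by
        push_cast [Nat.cast_sub h]; ring]
    · simp at hab
  rw [Module.End.mul_apply, LinearMap.add_apply, Module.End.mul_apply, LinearMap.smul_apply,
    dress_apply hq ht hx hR, dress_apply hq ht hx hR, dress_apply hq ht hx hR,
    map_finsum' y _ (hf n v), add_smul, smul_finsum' μ (hf (n + m) v)]
  have h1 : ∑ᶠ ab : ℕ × ℕ, L ab.1 (x (n + m + ab.1 - ab.2) (R ab.2 v)) =
      ∑ᶠ ab : ℕ × ℕ, if m ≤ ab.1 then L (ab.1 - m) (x (n + ab.1 - ab.2) (R ab.2 v)) else 0 := by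
    symm
    rw [finsum_of_injective (fun ab : ℕ × ℕ => (ab.1 + m, ab.2)) (fun a b h => by
      simp only [Prod.mk.injEq, add_left_inj] at h; exact Prod.ext h.1 h.2)]
    · refine finsum_congr fun ab => ?_
      rw [if_pos (by simp)]
      simp only [Nat.add_sub_cancel]
      congr 3; push_cast; ring
    · intro ab hab
      split_ifs at hab with h
      · exact ⟨(ab.1 - m, ab.2), Prod.ext (by simp; omega) rfl⟩
      · simp at hab
  rw [h1, smul_finsum' l hF, ← add_assoc, ← finsum_add_distrib (hf n (y v)) (by
      refine hF.subset fun ab h => ?_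
      rw [Function.mem_support] at h ⊢
      exact fun h0 => h (by rw [h0, smul_zero])), ← finsum_add_distrib]
  · refine finsum_congr fun ab => ?_
    have e1 := LinearMap.congr_fun (hyL ab.1) (x (n + ab.1 - ab.2) (R ab.2 v))
    have e2 := LinearMap.congr_fun (hyx (n + ab.1 - ab.2)) (R ab.2 v)
    have e3 := LinearMap.congr_fun (hyR ab.2) v
    simp only [Module.End.mul_apply, LinearMap.add_apply, LinearMap.smul_apply] at e1 e2 e3
    rw [e1, e2, e3, map_add, map_smul, show n + (ab.1 : ℤ) - ab.2 + m = n + m + ab.1 - ab.2 by ring]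
    have e4 : (if m ≤ ab.1 then L (ab.1 - m) else 0) (x (n + ab.1 - ab.2) (R ab.2 v)) =
        if m ≤ ab.1 then L (ab.1 - m) (x (n + ab.1 - ab.2) (R ab.2 v)) else 0 := by
      split_ifs <;> rfl
    rw [e4]
    abel
  · refine ((hf n (y v)).union hF).subset fun ab h => ?_
    by_contra h0
    simp only [Set.mem_union, Function.mem_support, not_or, not_not] at h0
    rw [Function.mem_support] at h
    refine h ?_
    rw [h0.1, h0.2, smul_zero, add_zero]
  · refine (hf (n + m) v).subset fun ab h => ?_
    rw [Function.mem_support] at h ⊢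
    exact fun h0 => h (by rw [h0, smul_zero])

/-- The commutator of a dressed current with an operator which commutes with the left factor. -/
lemma dress_comm_right {y : Module.End ℂ V} {m : ℕ} {l μ : ℂ}
    (hyL : ∀ a, y * L a = L a * y)
    (hyx : ∀ N, y * x N = x N * y + μ • x (N - m))
    (hyR : ∀ b, y * R b = R b * y + l • (if m ≤ b then R (b - m) else 0)) (n : ℤ) :
    y * dress L x R n = dress L x R n * y + (l + μ) • dress L x R (n - m) := by
  ext v
  have hf := fun n => finite_dress hq ht hx hR (L := L) n
  have hF : (Function.support fun ab : ℕ × ℕ =>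
      if m ≤ ab.2 then L ab.1 (x (n + ab.1 - ab.2) (R (ab.2 - m) v)) else 0).Finite := by
    refine ((hf (n - m) v).image fun ab => (ab.1, ab.2 + m)).subset fun ab hab => ?_
    rw [Function.mem_support] at hab
    split_ifs at hab with h
    · refine ⟨(ab.1, ab.2 - m), ?_, Prod.ext rfl (by simp; omega)⟩
      rw [Function.mem_support]
      rwa [show n - m + (ab.1 : ℤ) - ((ab.2 - m : ℕ) : ℤ) = n + ab.1 - ab.2 by
        push_cast [Nat.cast_sub h]; ring]
    · simp at hab
  rw [Module.End.mul_apply, LinearMap.add_apply, Module.End.mul_apply, LinearMap.smul_apply,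
    dress_apply hq ht hx hR, dress_apply hq ht hx hR, dress_apply hq ht hx hR,
    map_finsum' y _ (hf n v), add_smul, smul_finsum' μ (hf (n - m) v)]
  have h1 : ∑ᶠ ab : ℕ × ℕ, L ab.1 (x (n - m + ab.1 - ab.2) (R ab.2 v)) =
      ∑ᶠ ab : ℕ × ℕ, if m ≤ ab.2 then L ab.1 (x (n + ab.1 - ab.2) (R (ab.2 - m) v)) else 0 := by
    symm
    rw [finsum_of_injective (fun ab : ℕ × ℕ => (ab.1, ab.2 + m)) (fun a b h => by
      simp only [Prod.mk.injEq, add_left_inj] at h; exact Prod.ext h.1 h.2)]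
    · refine finsum_congr fun ab => ?_
      rw [if_pos (by simp)]
      simp only [Nat.add_sub_cancel]
      congr 3; push_cast; ring
    · intro ab hab
      split_ifs at hab with h
      · exact ⟨(ab.1, ab.2 - m), Prod.ext rfl (by simp; omega)⟩
      · simp at hab
  rw [h1, smul_finsum' l hF, ← add_assoc, ← finsum_add_distrib (hf n (y v)) (by
      refine hF.subset fun ab h => ?_
      rw [Function.mem_support] at h ⊢
      exact fun h0 => h (by rw [h0, smul_zero])), ← finsum_add_distrib]
  · refine finsum_congr fun ab => ?_
    have e1 := LinearMap.congr_fun (hyL ab.1) (x (n + ab.1 - ab.2) (R ab.2 v))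
    have e2 := LinearMap.congr_fun (hyx (n + ab.1 - ab.2)) (R ab.2 v)
    have e3 := LinearMap.congr_fun (hyR ab.2) v
    simp only [Module.End.mul_apply, LinearMap.add_apply, LinearMap.smul_apply] at e1 e2 e3
    rw [e1, e2, e3, map_add, map_add, map_add, map_smul, map_smul, map_smul,
      show n + (ab.1 : ℤ) - ab.2 - m = n - m + ab.1 - ab.2 by ring]
    have e4 : L ab.1 (x (n + ab.1 - ab.2) ((if m ≤ ab.2 then R (ab.2 - m) else 0) v)) =
        if m ≤ ab.2 then L ab.1 (x (n + ab.1 - ab.2) (R (ab.2 - m) v)) else 0 := by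
      split_ifs
      · rfl
      · simp
    rw [e4]
  · refine ((hf n (y v)).union hF).subset fun ab h => ?_
    by_contra h0
    simp only [Set.mem_union, Function.mem_support, not_or, not_not] at h0
    rw [Function.mem_support] at h
    refine h ?_
    rw [h0.1, h0.2, smul_zero, add_zero]
  · refine (hf (n - m) v).subset fun ab h => ?_
    rw [Function.mem_support] at h ⊢
    exact fun h0 => h (by rw [h0, smul_zero])

/-- Dressing by inverse series undoes a dressing. -/
lemma dress_dress (hL : ∀ a : ℕ, HasDeg q qd (-a) (L a)) (hR' : ∀ b : ℕ, HasDeg q qd b (R' b))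
    (hLL : PowerSeries.mk L' * PowerSeries.mk L = 1)
    (hRR : PowerSeries.mk R * PowerSeries.mk R' = 1) (n : ℤ) :
    dress L' (dress L x R) R' n = x n := by
  ext v
  have hd : ∀ n, HasDeg q qd n (dress L x R n) := hasDeg_dress hq ht hx hR hL
  -- The fourfold sum over the coefficients of `L'`, `L`, `R`, `R'` is finite on `v`, so that it
  -- may be regrouped by the total degrees in `L' L` and in `R R'`.
  have key : (Function.support fun p : (ℕ × ℕ) × (ℕ × ℕ) => L' p.1.1 (L p.2.1
      (x (n + p.1.1 - p.1.2 + p.2.1 - p.2.2) (R p.2.2 (R' p.1.2 v))))).Finite := by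
    obtain ⟨D, hD⟩ := ht v
    refine (((Set.finite_Iic (D - n).toNat).prod (Set.finite_Iic D.toNat)).prod
      ((Set.finite_Iic (D - n).toNat).prod (Set.finite_Iic D.toNat))).subset fun p hp => ?_
    rw [Function.mem_support] at hp
    have k1 : ((p.1.2 : ℕ) : ℤ) ≤ D := by
      by_contra h
      exact hp (by rw [hD p.1.2 (by omega) _ (hR' _)]; simp)
    have k2 : ((p.2.2 : ℕ) : ℤ) + p.1.2 ≤ D := by
      by_contra h
      refine hp ?_
      have := hD (p.2.2 + p.1.2) (by omega) _ ((hR p.2.2).mul hq (hR' p.1.2))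
      rw [Module.End.mul_apply] at this
      rw [this]; simp
    have k3 : n + p.1.1 + p.2.1 ≤ D := by
      by_contra h
      refine hp ?_
      have := hD (n + p.1.1 - p.1.2 + p.2.1 - p.2.2 + (p.2.2 + p.1.2)) (by omega) _
        ((hx (n + p.1.1 - p.1.2 + p.2.1 - p.2.2)).mul hq ((hR p.2.2).mul hq (hR' p.1.2)))
      rw [Module.End.mul_apply, Module.End.mul_apply] at this
      rw [this]; simp
    simp only [Set.mem_prod, Set.mem_Iic]
    omega
  rw [dress_apply hq ht hd hR']
  have e1 : ∀ ab : ℕ × ℕ, L' ab.1 (dress L x R (n + ab.1 - ab.2) (R' ab.2 v)) =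
      ∑ᶠ cd : ℕ × ℕ, L' ab.1 (L cd.1 (x (n + ab.1 - ab.2 + cd.1 - cd.2) (R cd.2 (R' ab.2 v)))) := by
    intro ab
    rw [dress_apply hq ht hx hR]
    exact map_finsum' (L' ab.1) _ (finite_dress hq ht hx hR (L := L) _ (R' ab.2 v))
  rw [finsum_congr e1, ← finsum_curry (fun p : (ℕ × ℕ) × (ℕ × ℕ) => L' p.1.1 (L p.2.1
      (x (n + p.1.1 - p.1.2 + p.2.1 - p.2.2) (R p.2.2 (R' p.1.2 v))))) key,
    finsum_fiberwise (fun p : (ℕ × ℕ) × (ℕ × ℕ) => (p.1.1 + p.2.1, p.2.2 + p.1.2))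
      (fun k => (Finset.HasAntidiagonal.antidiagonal k.1 ×ˢ
        Finset.HasAntidiagonal.antidiagonal k.2).image fun p => ((p.1.1, p.2.2), (p.1.2, p.2.1)))
      ?_ _ key]
  · have e2 : ∀ k : ℕ × ℕ, (∑ p ∈ (Finset.HasAntidiagonal.antidiagonal k.1 ×ˢ
        Finset.HasAntidiagonal.antidiagonal k.2).image fun p => ((p.1.1, p.2.2), (p.1.2, p.2.1)),
        L' p.1.1 (L p.2.1 (x (n + p.1.1 - p.1.2 + p.2.1 - p.2.2) (R p.2.2 (R' p.1.2 v))))) =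
        (if k.1 = 0 then (1 : Module.End ℂ V) else 0) (x (n + k.1 - k.2)
          ((if k.2 = 0 then (1 : Module.End ℂ V) else 0) v)) := by
      intro k
      rw [Finset.sum_image fun a _ b _ h => by
        simp only [Prod.mk.injEq] at h
        exact Prod.ext (Prod.ext h.1.1 h.2.1) (Prod.ext h.2.2 h.1.2), Finset.sum_product]
      have hL1 := congrArg (PowerSeries.coeff k.1) hLL
      have hR1 := congrArg (PowerSeries.coeff k.2) hRR
      rw [PowerSeries.coeff_mul, PowerSeries.coeff_one] at hL1 hR1
      simp only [PowerSeries.coeff_mk] at hL1 hR1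
      rw [← hL1, ← hR1, LinearMap.sum_apply]
      refine Finset.sum_congr rfl fun a ha => ?_
      rw [LinearMap.sum_apply, map_sum, map_sum]
      refine Finset.sum_congr rfl fun b hb => ?_
      have ha' := Finset.HasAntidiagonal.mem_antidiagonal.mp ha
      have hb' := Finset.HasAntidiagonal.mem_antidiagonal.mp hb
      simp only [Module.End.mul_apply]
      rw [show n + (a.1 : ℤ) - b.2 + a.2 - b.1 = n + k.1 - k.2 by
        rw [← ha', ← hb']; push_cast; ring]
    rw [finsum_congr e2, finsum_eq_single _ ((0, 0) : ℕ × ℕ)]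
    · simp
    · intro k hk
      by_cases h1 : k.1 = 0
      · have h2 : k.2 ≠ 0 := fun h2 => hk (Prod.ext h1 h2)
        simp [h2]
      · simp [h1]
  · intro k p
    simp only [Finset.mem_image, Finset.mem_product, Finset.HasAntidiagonal.mem_antidiagonal]
    constructor
    · rintro ⟨p', ⟨h1, h2⟩, rfl⟩
      exact Prod.ext h1 h2
    · intro h
      exact ⟨((p.1.1, p.2.1), (p.2.2, p.1.2)), ⟨congrArg Prod.fst h, congrArg Prod.snd h⟩, rfl⟩

end Dress

end Graded

/-! ### Products of currents and scalar structure functions -/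

section Shift

/-- The pairs `s < t` of positions in a product of `r` currents. -/
abbrev Pairs (r : ℕ) : Type := {st : Fin r × Fin r // st.1 < st.2}

/-- The exponents of the monomial `∏_{s < t} (z_s / z_t)^{e_{st}}`, read as a change of the mode
numbers `N_t` of `∏ z_t^{-N_t}`. -/
def shift {r : ℕ} (e : Pairs r → ℕ) (t : Fin r) : ℤ :=
  (∑ st, if st.1.2 = t then (e st : ℤ) else 0) - ∑ st, if st.1.1 = t then (e st : ℤ) else 0

lemma shift_add {r : ℕ} (e f : Pairs r → ℕ) : shift (e + f) = shift e + shift f := by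
  funext t
  simp only [shift, Pi.add_apply, Nat.cast_add]
  have h : ∀ (p : Pairs r → Prop) [DecidablePred p],
      (∑ st, if p st then (e st : ℤ) + f st else 0)
        = (∑ st, if p st then (e st : ℤ) else 0) + ∑ st, if p st then (f st : ℤ) else 0 := by
    intro p _
    rw [← Finset.sum_add_distrib]
    exact Finset.sum_congr rfl fun st _ => by split_ifs <;> simp
  rw [h fun st => st.1.2 = t, h fun st => st.1.1 = t]
  ring

/-- `N_u + N_{u+1} + ⋯`. -/
def tailSum {r : ℕ} (u : Fin r) (N : Fin r → ℤ) : ℤ := ∑ t ∈ Finset.univ.filter (u ≤ ·), N t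

lemma tailSum_add {r : ℕ} (u : Fin r) (N M : Fin r → ℤ) :
    tailSum u (N + M) = tailSum u N + tailSum u M := by
  simp [tailSum, Finset.sum_add_distrib]

lemma tailSum_shift {r : ℕ} (u : Fin r) (e : Pairs r → ℕ) :
    tailSum u (shift e) = ∑ st : Pairs r, if st.1.1 < u ∧ u ≤ st.1.2 then (e st : ℤ) else 0 := by
  have h : ∀ p : Pairs r → Fin r, (∑ t ∈ Finset.univ.filter (u ≤ ·),
      ∑ st, if p st = t then (e st : ℤ) else 0) = ∑ st, if u ≤ p st then (e st : ℤ) else 0 := by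
    intro p
    rw [Finset.sum_comm]
    refine Finset.sum_congr rfl fun st _ => ?_
    rw [Finset.sum_ite_eq]
    simp
  simp only [tailSum, shift, Finset.sum_sub_distrib]
  rw [h fun st => st.1.2, h fun st => st.1.1, ← Finset.sum_sub_distrib]
  refine Finset.sum_congr rfl fun st _ => ?_
  have := st.2
  by_cases h1 : u ≤ st.1.1
  · rw [if_pos (h1.trans this.le), if_pos h1, if_neg (fun h => absurd h.1 (not_lt.mpr h1))]
    simp
  · simp [h1, not_le.mp h1]

lemma tailSum_shift_nonneg {r : ℕ} (u : Fin r) (e : Pairs r → ℕ) : 0 ≤ tailSum u (shift e) := by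
  rw [tailSum_shift]
  exact Finset.sum_nonneg fun st _ => by split_ifs <;> simp

/-- Multiplying by `(z_t/z_s)^e` raises the sum of the mode numbers from position `t` on by `e`.
This is what makes products with structure functions finite sums on truncated series. -/
lemma le_tailSum_shift {r : ℕ} (e : Pairs r → ℕ) (st : Pairs r) :
    (e st : ℤ) ≤ tailSum st.1.2 (shift e) := by
  rw [tailSum_shift]
  have := Finset.single_le_sum (f := fun p : Pairs r =>
    if p.1.1 < st.1.2 ∧ st.1.2 ≤ p.1.2 then (e p : ℤ) else 0)
    (fun p _ => by split_ifs <;> simp) (Finset.mem_univ st)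
  simpa [st.2] using this

end Shift

section MulSer

variable {V V' : Type*} [AddCommGroup V] [Module ℂ V] [AddCommGroup V'] [Module ℂ V'] {r : ℕ}

/-- The coefficients of `∏_{s < t} G_{st}(z_t/z_s) A(z)` for a formal series
`A(z) = ∑ A_N ∏ z_t^{-N_t}`. -/
def mulSer (G : Fin r → Fin r → PowerSeries ℂ) (A : (Fin r → ℤ) → V) (N : Fin r → ℤ) : V :=
  ∑ᶠ e : Pairs r → ℕ, (∏ st, PowerSeries.coeff (e st) (G st.1.1 st.1.2)) • A (N + shift e)

/-- `A_N` vanishes as soon as one of the sums `N_u + N_{u+1} + ⋯` exceeds `D`. -/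
def TailBdd (D : ℤ) (A : (Fin r → ℤ) → V) : Prop := ∀ N u, D < tailSum u N → A N = 0

lemma finite_pi_bdd {τ : Type*} [Finite τ] (S : Set (τ → ℕ)) (B : τ → ℕ)
    (h : ∀ e ∈ S, ∀ t, e t ≤ B t) : S.Finite :=
  (Set.Finite.pi' fun t => Set.finite_Iic (B t)).subset fun e he t => h e he t

lemma TailBdd.finite {D : ℤ} {A : (Fin r → ℤ) → V} (hA : TailBdd D A) (c : (Pairs r → ℕ) → ℂ)
    (N : Fin r → ℤ) : (Function.support fun e : Pairs r → ℕ => c e • A (N + shift e)).Finite := by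
  refine finite_pi_bdd _ (fun st => (D - tailSum st.1.2 N).toNat) fun e he st => ?_
  rw [Function.mem_support] at he
  by_contra h
  refine he ?_
  rw [hA _ st.1.2, smul_zero]
  have := le_tailSum_shift e st
  rw [tailSum_add]
  omega

lemma TailBdd.mulSer {D : ℤ} {A : (Fin r → ℤ) → V} (hA : TailBdd D A)
    (G : Fin r → Fin r → PowerSeries ℂ) : TailBdd D (mulSer G A) := by
  intro N u h
  refine finsum_eq_zero_of_forall_eq_zero fun e => ?_
  rw [hA _ u, smul_zero]
  have := tailSum_shift_nonneg u e
  rw [tailSum_add]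
  omega

lemma map_mulSer {D : ℤ} {A : (Fin r → ℤ) → V} (hA : TailBdd D A) (φ : V →ₗ[ℂ] V')
    (G : Fin r → Fin r → PowerSeries ℂ) (N : Fin r → ℤ) :
    φ (mulSer G A N) = mulSer G (fun N => φ (A N)) N := by
  unfold EllToroidal.mulSer
  rw [map_finsum' φ _ (hA.finite _ N)]
  exact finsum_congr fun e => map_smul _ _ _

/-- Multiplication by structure functions is an action of the algebra of power series. -/
lemma mulSer_mulSer {D : ℤ} {A : (Fin r → ℤ) → V} (hA : TailBdd D A)
    (G H : Fin r → Fin r → PowerSeries ℂ) (N : Fin r → ℤ) :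
    mulSer G (mulSer H A) N = mulSer (fun s t => G s t * H s t) A N := by
  classical
  -- The double sum is finite, so that it may be regrouped by the total exponents `e + f`.
  have key : (Function.support fun p : (Pairs r → ℕ) × (Pairs r → ℕ) =>
      (∏ st, PowerSeries.coeff (p.1 st) (G st.1.1 st.1.2)) •
        ((∏ st, PowerSeries.coeff (p.2 st) (H st.1.1 st.1.2)) •
          A (N + shift p.1 + shift p.2))).Finite := by
    have hB : ∀ p : (Pairs r → ℕ) × (Pairs r → ℕ), A (N + shift p.1 + shift p.2) ≠ 0 →
        ∀ st : Pairs r, p.1 st + p.2 st ≤ (D - tailSum st.1.2 N).toNat := by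
      intro p hp st
      by_contra h
      refine hp (hA _ st.1.2 ?_)
      have h1 := le_tailSum_shift p.1 st
      have h2 := le_tailSum_shift p.2 st
      rw [tailSum_add, tailSum_add]
      omega
    refine ((finite_pi_bdd {e : Pairs r → ℕ | ∀ st, e st ≤ (D - tailSum st.1.2 N).toNat} _
      fun e he => he).prod (finite_pi_bdd {e : Pairs r → ℕ | ∀ st, e st ≤
        (D - tailSum st.1.2 N).toNat} _ fun e he => he)).subset fun p hp => ?_
    rw [Function.mem_support] at hp
    have h0 := hB p fun h => hp (by rw [h, smul_zero, smul_zero])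
    exact ⟨fun st => by have := h0 st; omega, fun st => by have := h0 st; omega⟩
  unfold EllToroidal.mulSer
  have e1 : ∀ e : Pairs r → ℕ, (∏ st, PowerSeries.coeff (e st) (G st.1.1 st.1.2)) •
      (∑ᶠ f : Pairs r → ℕ, (∏ st, PowerSeries.coeff (f st) (H st.1.1 st.1.2)) •
        A (N + shift e + shift f)) = ∑ᶠ f : Pairs r → ℕ,
        (∏ st, PowerSeries.coeff (e st) (G st.1.1 st.1.2)) •
        ((∏ st, PowerSeries.coeff (f st) (H st.1.1 st.1.2)) • A (N + shift e + shift f)) :=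
    fun e => smul_finsum' _ (hA.finite _ _)
  rw [finsum_congr e1, ← finsum_curry (fun p : (Pairs r → ℕ) × (Pairs r → ℕ) =>
      (∏ st, PowerSeries.coeff (p.1 st) (G st.1.1 st.1.2)) •
        ((∏ st, PowerSeries.coeff (p.2 st) (H st.1.1 st.1.2)) •
          A (N + shift p.1 + shift p.2))) key,
    finsum_fiberwise (fun p : (Pairs r → ℕ) × (Pairs r → ℕ) => p.1 + p.2)
      (fun k => (Fintype.piFinset fun st => Finset.HasAntidiagonal.antidiagonal (k st)).image
        fun p => (fun st => (p st).1, fun st => (p st).2)) ?_ _ key]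
  · refine finsum_congr fun k => ?_
    rw [Finset.sum_image fun a _ b _ h => by
      simp only [Prod.mk.injEq] at h
      funext st
      exact Prod.ext (congrFun h.1 st) (congrFun h.2 st)]
    simp only [PowerSeries.coeff_mul]
    rw [Finset.prod_univ_sum, Finset.sum_smul]
    refine Finset.sum_congr rfl fun p hp => ?_
    rw [Fintype.mem_piFinset] at hp
    rw [add_assoc, ← shift_add, smul_smul, ← Finset.prod_mul_distrib]
    congr 3
    congr 1
    funext st
    exact Finset.HasAntidiagonal.mem_antidiagonal.mp (hp st)
  · intro k p
    simp only [Finset.mem_image, Fintype.mem_piFinset, Finset.HasAntidiagonal.mem_antidiagonal]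
    constructor
    · rintro ⟨p', h, rfl⟩
      exact funext h
    · intro h
      exact ⟨fun st => (p.1 st, p.2 st), fun st => congrFun h st, rfl⟩

lemma mulSer_zero (G : Fin 0 → Fin 0 → PowerSeries ℂ) (A : (Fin 0 → ℤ) → V) (N : Fin 0 → ℤ) :
    mulSer G A N = A N := by
  have : IsEmpty (Pairs 0) := ⟨fun st => st.1.1.elim0⟩
  unfold mulSer
  rw [finsum_unique]
  simp only [Finset.univ_eq_empty, Finset.prod_empty, one_smul]
  congr 1
  exact Subsingleton.elim _ _

/-- A pair of positions in a product of `r + 1` currents either involves the first position, or is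
a pair of later positions. -/
def pairsSucc (r : ℕ) : Fin r ⊕ Pairs r ≃ Pairs (r + 1) where
  toFun := Sum.elim (fun t => ⟨(0, t.succ), Fin.succ_pos t⟩)
    (fun st => ⟨(st.1.1.succ, st.1.2.succ), Fin.succ_lt_succ_iff.mpr st.2⟩)
  invFun st := if h : st.1.1 = 0 then
      Sum.inl (st.1.2.pred (Fin.ne_zero_of_lt st.2))
    else Sum.inr ⟨(st.1.1.pred h, st.1.2.pred (Fin.ne_zero_of_lt st.2)), by
      simpa using st.2⟩
  left_inv x := by
    rcases x with t | st <;> simp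
  right_inv st := by
    by_cases h : st.1.1 = 0
    · simp only [h, dite_true, Sum.elim_inl, Fin.succ_pred]
      exact Subtype.ext (Prod.ext h.symm rfl)
    · simp only [h, dite_false, Sum.elim_inr, Fin.succ_pred]

lemma sum_pairs_succ {M : Type*} [AddCommMonoid M] (f : Pairs (r + 1) → M) :
    ∑ st, f st = ∑ t, f (pairsSucc r (Sum.inl t)) + ∑ st, f (pairsSucc r (Sum.inr st)) := by
  rw [← (pairsSucc r).sum_comp, Fintype.sum_sum_type]

lemma prod_pairs_succ {M : Type*} [CommMonoid M] (f : Pairs (r + 1) → M) :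
    ∏ st, f st = (∏ t, f (pairsSucc r (Sum.inl t))) * ∏ st, f (pairsSucc r (Sum.inr st)) := by
  rw [← (pairsSucc r).prod_comp, Fintype.prod_sum_type]

lemma shift_succ (e : Pairs (r + 1) → ℕ) (N : Fin (r + 1) → ℤ) :
    N + shift e = Fin.cons (N 0 - ∑ t, (e (pairsSucc r (Sum.inl t)) : ℤ))
      ((fun t => N t.succ + e (pairsSucc r (Sum.inl t)))
        + shift fun st => e (pairsSucc r (Sum.inr st))) := by
  funext u
  refine Fin.cases ?_ (fun u => ?_) u
  · simp only [Pi.add_apply, shift, Fin.cons_zero]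
    rw [sum_pairs_succ, sum_pairs_succ]
    simp [pairsSucc]
    ring
  · simp only [Pi.add_apply, shift, Fin.cons_succ]
    rw [sum_pairs_succ, sum_pairs_succ]
    simp [pairsSucc, Fin.succ_inj, (Fin.succ_ne_zero u).symm]
    ring

/-- Splitting off the first current. -/
lemma mulSer_succ {D : ℤ} {A : (Fin (r + 1) → ℤ) → V} (hA : TailBdd D A)
    (G : Fin (r + 1) → Fin (r + 1) → PowerSeries ℂ) (N : Fin (r + 1) → ℤ) :
    mulSer G A N = ∑ᶠ e : Fin r → ℕ, (∏ t, PowerSeries.coeff (e t) (G 0 t.succ)) •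
      mulSer (fun s t => G s.succ t.succ) (fun N' => A (Fin.cons (N 0 - ∑ t, (e t : ℤ)) N'))
        (fun t => N t.succ + e t) := by
  let E : (Pairs (r + 1) → ℕ) ≃ (Fin r → ℕ) × (Pairs r → ℕ) :=
    ((pairsSucc r).symm.arrowCongr (Equiv.refl ℕ)).trans (Equiv.sumArrowEquivProdArrow _ _ _)
  have hE : ∀ e, E e = (fun t => e (pairsSucc r (Sum.inl t)), fun st =>
      e (pairsSucc r (Sum.inr st))) :=
    fun e => rfl
  let F : (Fin r → ℕ) × (Pairs r → ℕ) → V := fun p =>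
    (∏ t, PowerSeries.coeff (p.1 t) (G 0 t.succ)) •
      ((∏ st, PowerSeries.coeff (p.2 st) (G st.1.1.succ st.1.2.succ)) •
        A (Fin.cons (N 0 - ∑ t, (p.1 t : ℤ)) ((fun t => N t.succ + p.1 t) + shift p.2)))
  have h1 : ∀ e, (∏ st, PowerSeries.coeff (e st) (G st.1.1 st.1.2)) • A (N + shift e) =
      F (E e) := by
    intro e
    simp only [F, hE]
    rw [shift_succ, prod_pairs_succ, smul_smul]
    rfl
  have hfin : (Function.support F).Finite := by
    have := hA.finite (fun e => ∏ st, PowerSeries.coeff (e st) (G st.1.1 st.1.2)) N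
    refine (this.image E).subset fun p hp => ⟨E.symm p, ?_, E.apply_symm_apply p⟩
    rw [Function.mem_support, h1, E.apply_symm_apply]
    exact hp
  have hA' : ∀ n : ℤ, TailBdd D fun N' : Fin r → ℤ => A (Fin.cons n N') := by
    intro n N' u hu
    refine hA _ u.succ ?_
    convert hu using 1
    unfold tailSum
    rw [Finset.sum_filter, Finset.sum_filter, Fin.sum_univ_succ]
    simp
  unfold mulSer
  rw [finsum_congr h1, finsum_comp_equiv E, finsum_curry F hfin]
  refine finsum_congr fun e => ?_
  simp only [F]
  rw [smul_finsum' _ ((hA' _).finite _ _)]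

end MulSer

section Word

variable {V : Type*} [AddCommGroup V] [Module ℂ V] {r : ℕ}

/-- The coefficient `Y_0(N_0) ⋯ Y_{r-1}(N_{r-1})` of a product of currents. -/
def word (Y : Fin r → ℤ → Module.End ℂ V) (N : Fin r → ℤ) : Module.End ℂ V :=
  (List.ofFn fun t => Y t (N t)).prod

lemma word_succ (Y : Fin (r + 1) → ℤ → Module.End ℂ V) (N : Fin (r + 1) → ℤ) :
    word Y N = Y 0 (N 0) * word (fun t => Y t.succ) (fun t => N t.succ) := by
  simp [word, List.ofFn_succ]

lemma foldr_ofFn (f : Fin r → Module.End ℂ V) (v : V) :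
    (List.ofFn fun t => (f t : V → V)).foldr (fun f w => f w) v = (List.ofFn f).prod v := by
  induction r with
  | zero => simp
  | succ r ih => simp [List.ofFn_succ, ih fun t => f t.succ]

lemma multiCoeff_eq (G : Fin r → Fin r → PowerSeries ℂ) (Y : Fin r → ℤ → Module.End ℂ V)
    (N : Fin r → ℤ) (v : V) :
    multiCoeff G (fun t n => Y t n) N v = mulSer G (fun N => word Y N v) N := by
  unfold multiCoeff mulSer word
  refine finsum_congr fun e => ?_
  congr 1
  refine (foldr_ofFn (fun t => Y t _) v).trans ?_
  congr 3
  funext t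
  simp only [Pi.add_apply, shift, add_sub_assoc]

variable {q : ℂ} {qd : Module.End ℂ V} (hq : q ≠ 0)

include hq

lemma hasDeg_word {Y : Fin r → ℤ → Module.End ℂ V} (hY : ∀ t n, HasDeg q qd n (Y t n))
    (N : Fin r → ℤ) : HasDeg q qd (∑ t, N t) (word Y N) := by
  induction r with
  | zero => simpa [word] using HasDeg.one
  | succ r ih =>
    rw [word_succ, Fin.sum_univ_succ]
    exact (hY 0 _).mul hq (ih (fun t n => hY t.succ n) fun t => N t.succ)

/-- The sum of the last mode numbers is the degree of the product of the last operators, which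
vanishes on `v` if that degree is large. -/
lemma tailBdd_word {Y : Fin r → ℤ → Module.End ℂ V} (hY : ∀ t n, HasDeg q qd n (Y t n)) {v : V}
    {D : ℤ} (hD : ∀ n, D < n → ∀ A, HasDeg q qd n A → A v = 0) :
    TailBdd D fun N => word Y N v := by
  intro N u h
  induction r with
  | zero => exact u.elim0
  | succ r ih =>
    revert h
    refine Fin.cases ?_ (fun u => ?_) u
    · intro h
      refine hD _ ?_ _ (hasDeg_word hq hY N)
      simpa [tailSum] using h
    · intro h
      simp only
      have h1 := ih (fun t n => hY t.succ n) (fun t => N t.succ) u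
      simp only at h1
      rw [word_succ, Module.End.mul_apply, h1, map_zero]
      convert h using 1
      unfold tailSum
      rw [Finset.sum_filter, Finset.sum_filter, Fin.sum_univ_succ]
      simp

lemma locFin_mulWord (ht : Trunc q qd) {Y : Fin r → ℤ → Module.End ℂ V}
    (hY : ∀ t n, HasDeg q qd n (Y t n)) (c : (Pairs r → ℕ) → ℂ) (N : Fin r → ℤ) :
    LocFin fun e : Pairs r → ℕ => c e • word Y (N + shift e) := by
  intro v
  obtain ⟨D, hD⟩ := ht v
  exact (tailBdd_word hq hY hD).finite c N

end Word

/-! ### Heisenberg operators, dressed currents and their vacuum matrix elements -/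

/-- Graded operators `α_{i,m}` on `V` satisfying Heisenberg relations with structure constants
`[α_{i,l}, α_{j,-l}] = c_{ij}(l)`; every vector is killed by all operators of high degree. -/
structure HeisBase (I : Type) (V : Type u) [AddCommGroup V] [Module ℂ V] where
  q : ℂ
  hq : q ≠ 0
  qd : Module.End ℂ V
  trunc : Trunc q qd
  al : I → ℤ → Module.End ℂ V
  cc : I → I → ℤ → ℂ
  al_deg : ∀ i m, HasDeg q qd m (al i m)
  al_comm : ∀ i j l m, l ≠ 0 → m ≠ 0 → al i l * al j m =
    al j m * al i l + (if l + m = 0 then cc i j l else 0) • (1 : Module.End ℂ V)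

namespace HeisBase

variable {I : Type} {V : Type u} [AddCommGroup V] [Module ℂ V] (B : HeisBase I V)

/-- The vectors killed by all `α_{i,m}`, `m > 0`. -/
def vac : Submodule ℂ V where
  carrier := {v | ∀ i, ∀ m : ℤ, 0 < m → B.al i m v = 0}
  zero_mem' := fun i m _ => map_zero _
  add_mem' := fun {v w} hv hw i m hm => by rw [map_add, hv i m hm, hw i m hm, add_zero]
  smul_mem' := fun a v hv i m hm => by rw [map_smul, hv i m hm, smul_zero]

/-- The sum of the images of the creation operators `α_{i,-m}`, `m > 0`. -/
def J : Submodule ℂ V :=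
  Submodule.span ℂ {w | ∃ (i : I) (m : ℤ) (v : V), 0 < m ∧ w = B.al i (-m) v}

lemma al_mem_J (i : I) {m : ℤ} (hm : 0 < m) (v : V) : B.al i (-m) v ∈ B.J :=
  Submodule.subset_span ⟨i, m, v, hm, rfl⟩

/-- An operator which commutes with the creation operators preserves `J`. -/
lemma mem_J_of_commute {A : Module.End ℂ V} (h : ∀ i m, 0 < m → A * B.al i (-m) = B.al i (-m) * A)
    {v : V} (hv : v ∈ B.J) : A v ∈ B.J := by
  have : B.J ≤ B.J.comap A := by
    refine Submodule.span_le.mpr ?_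
    rintro _ ⟨i, m, v, hm, rfl⟩
    show A (B.al i (-m) v) ∈ B.J
    rw [← Module.End.mul_apply, h i m hm]
    exact B.al_mem_J i hm _
  exact this hv

/-- The coefficients of `exp(∑_m th_m α_{i,-m} z^m)`. -/
def eL (i : I) (th : ℕ → ℂ) : ℕ → Module.End ℂ V := expCoeff fun m => th m • B.al i (-m)

/-- The coefficients of `exp(∑_m th_m α_{i,m} z^{-m})`. -/
def eR (i : I) (th : ℕ → ℂ) : ℕ → Module.End ℂ V := expCoeff fun m => th m • B.al i m

lemma commute_al (i j : I) {l m : ℤ} (hl : l ≠ 0) (hm : m ≠ 0) (h : l + m ≠ 0) :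
    Commute (B.al i l) (B.al j m) := by
  show _ = _
  rw [B.al_comm i j l m hl hm, if_neg h, zero_smul, add_zero]

lemma pairComm_L (i : I) (th : ℕ → ℂ) : PairComm fun m => th m • B.al i (-m) :=
  fun m n hm hn => ((B.commute_al i i (by omega) (by omega) (by omega)).smul_left _).smul_right _

lemma pairComm_R (i : I) (th : ℕ → ℂ) : PairComm fun m => th m • B.al i m :=
  fun m n hm hn => ((B.commute_al i i (by omega) (by omega) (by omega)).smul_left _).smul_right _

lemma eL_deg (i : I) (th : ℕ → ℂ) (a : ℕ) : HasDeg B.q B.qd (-a) (B.eL i th a) := by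
  have := HasDeg.expCoeff (q := B.q) (qd := B.qd) (s := -1) (c := fun m => th m • B.al i (-m))
    (fun m _ => by rw [neg_one_mul]; exact (B.al_deg i _).smul _) a
  rwa [neg_one_mul] at this

lemma eR_deg (i : I) (th : ℕ → ℂ) (b : ℕ) : HasDeg B.q B.qd b (B.eR i th b) := by
  have := HasDeg.expCoeff (q := B.q) (qd := B.qd) (s := 1) (c := fun m => th m • B.al i m)
    (fun m _ => by rw [one_mul]; exact (B.al_deg i _).smul _) b
  rwa [one_mul] at this

lemma eL_neg (i : I) (th : ℕ → ℂ) : B.eL i (fun m => - th m) =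
    expCoeff fun m => - (th m • B.al i (-m)) := by
  unfold eL; congr 1; funext m; rw [neg_smul]

lemma eR_neg (i : I) (th : ℕ → ℂ) : B.eR i (fun m => - th m) =
    expCoeff fun m => - (th m • B.al i m) := by
  unfold eR; congr 1; funext m; rw [neg_smul]

lemma mk_eL_neg_mul (i : I) (th : ℕ → ℂ) :
    PowerSeries.mk (B.eL i fun m => - th m) * PowerSeries.mk (B.eL i th) = 1 := by
  rw [eL_neg]; exact expSer_neg_mul (B.pairComm_L i th)

lemma mk_eR_mul_neg (i : I) (th : ℕ → ℂ) :
    PowerSeries.mk (B.eR i th) * PowerSeries.mk (B.eR i fun m => - th m) = 1 := by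
  rw [eR_neg]; exact expSer_mul_neg (B.pairComm_R i th)

lemma eL_mem_J (i : I) (th : ℕ → ℂ) {a : ℕ} (ha : 0 < a) (v : V) : B.eL i th a v ∈ B.J := by
  let S : Submodule ℂ (Module.End ℂ V) :=
    { carrier := {A | ∀ v, A v ∈ B.J}
      zero_mem' := fun v => B.J.zero_mem
      add_mem' := fun ha hb v => B.J.add_mem (ha v) (hb v)
      smul_mem' := fun c _ ha v => B.J.smul_mem c (ha v) }
  exact expCoeff_mem_of_left (B.pairComm_L i th) S (fun m A hm v => B.J.smul_mem _
    (B.al_mem_J i (by omega) _)) ha v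

lemma eR_vac (i : I) (th : ℕ → ℂ) {b : ℕ} (hb : 0 < b) {v : V} (hv : v ∈ B.vac) :
    B.eR i th b v = 0 := by
  let S : Submodule ℂ (Module.End ℂ V) :=
    { carrier := {A | A v = 0}
      zero_mem' := rfl
      add_mem' := fun {A A'} ha hb => by
        show A v + A' v = 0
        rw [show A v = 0 from ha, show A' v = 0 from hb, add_zero]
      smul_mem' := fun c A ha => by
        show c • A v = 0
        rw [show A v = 0 from ha, smul_zero] }
  refine expCoeff_mem_of_right (B.pairComm_R i th) S (fun m A hm => ?_) hb
  show A (th m • B.al i m v) = 0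
  rw [hv i m (by omega), smul_zero, map_zero]

section ExpComm

variable {A : Type*} [Ring A] [Algebra ℂ A]

/-- If `y` commutes with all `c_k` except `c_m`, and `[y, c_m] = l`, then
`[y, exp C(u)] = l u^m exp C(u)`. -/
lemma _root_.EllToroidal.mul_expCoeff_of_single {c : ℕ → A} (h : PairComm c) (y : A) (m : ℕ)
    (hm : 0 < m) (l : ℂ)
    (hl : ∀ k, 0 < k → y * c k = c k * y + (if k = m then l else 0) • (1 : A)) (b : ℕ) :
    y * expCoeff c b = expCoeff c b * y + l • (if m ≤ b then expCoeff c (b - m) else 0) := by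
  have := expCoeff_mul_of_comm h y (fun k => if k = m then -l else 0) (fun k hk => by
    rw [hl k hk, Algebra.algebraMap_eq_smul_one]
    split_ifs <;> simp) b
  rw [this, add_assoc]
  have hs : ∑ x ∈ Finset.HasAntidiagonal.antidiagonal b,
      (if x.1 = 0 then (0 : ℂ) else if x.1 = m then -l else 0) • expCoeff c x.2
      = (-l) • (if m ≤ b then expCoeff c (b - m) else 0) := by
    split_ifs with hmb
    · rw [Finset.sum_eq_single (m, b - m)]
      · simp [hm.ne']
      · intro x hx hne
        have hx' := Finset.HasAntidiagonal.mem_antidiagonal.mp hx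
        have : x.1 ≠ m := fun h => hne (Prod.ext h (by simp; omega))
        simp [this]
      · intro hn
        exact absurd (Finset.HasAntidiagonal.mem_antidiagonal.mpr (by simp; omega)) hn
    · rw [smul_zero]
      refine Finset.sum_eq_zero fun x hx => ?_
      have hx' := Finset.HasAntidiagonal.mem_antidiagonal.mp hx
      have : x.1 ≠ m := by omega
      simp [this]
  rw [hs]
  module

end ExpComm

lemma al_mul_eL (i j : I) (th : ℕ → ℂ) (m : ℕ) (hm : 0 < m) (a : ℕ) :
    B.al j m * B.eL i th a = B.eL i th a * B.al j m +
      (th m * B.cc j i m) • (if m ≤ a then B.eL i th (a - m) else 0) := by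
  refine mul_expCoeff_of_single (B.pairComm_L i th) _ m hm _ (fun k hk => ?_) a
  rw [mul_smul_comm, B.al_comm j i m (-k) (by omega) (by omega), smul_add, smul_smul,
    smul_mul_assoc]
  by_cases h : k = m
  · subst h; simp
  · rw [if_neg (by omega), if_neg h]; simp

lemma al_neg_mul_eR (i j : I) (th : ℕ → ℂ) (m : ℕ) (hm : 0 < m) (b : ℕ) :
    B.al j (-m) * B.eR i th b = B.eR i th b * B.al j (-m) +
      (th m * B.cc j i (-m)) • (if m ≤ b then B.eR i th (b - m) else 0) := by
  refine mul_expCoeff_of_single (B.pairComm_R i th) _ m hm _ (fun k hk => ?_) b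
  rw [mul_smul_comm, B.al_comm j i (-m) k (by omega) (by omega), smul_add, smul_smul,
    smul_mul_assoc]
  by_cases h : k = m
  · subst h; simp
  · rw [if_neg (by omega), if_neg h]; simp

lemma al_neg_commute_eL (i j : I) (th : ℕ → ℂ) (m : ℕ) (hm : 0 < m) (a : ℕ) :
    B.al j (-m) * B.eL i th a = B.eL i th a * B.al j (-m) :=
  ((commute_expCoeff (fun k hk => (B.commute_al i j (by omega) (by omega) (by omega)).smul_left _)
    a).eq).symm

lemma al_commute_eR (i j : I) (th : ℕ → ℂ) (m : ℕ) (hm : 0 < m) (b : ℕ) :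
    B.al j m * B.eR i th b = B.eR i th b * B.al j m :=
  ((commute_expCoeff (fun k hk => (B.commute_al i j (by omega) (by omega) (by omega)).smul_left _)
    b).eq).symm

/-- Dressing a current by exponentials of Heisenberg operators changes its commutators with the
Heisenberg operators by scalars. -/
lemma al_mul_dress (i : I) (th th' : ℕ → ℂ) {x : ℤ → Module.End ℂ V}
    (hx : ∀ n, HasDeg B.q B.qd n (x n)) {μ : I → ℤ → ℂ}
    (hμ : ∀ j l n, l ≠ 0 → B.al j l * x n = x n * B.al j l + μ j l • x (n + l))
    {ν : I → ℤ → ℂ} (hν : ∀ j (m : ℕ), 0 < m → th m * B.cc j i m + μ j m = ν j m)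
    (hν' : ∀ j (m : ℕ), 0 < m → th' m * B.cc j i (-m) + μ j (-m) = ν j (-m))
    (j : I) (l n : ℤ) (hl : l ≠ 0) :
    B.al j l * dress (B.eL i th) x (B.eR i th') n =
      dress (B.eL i th) x (B.eR i th') n * B.al j l +
        ν j l • dress (B.eL i th) x (B.eR i th') (n + l) := by
  rcases lt_or_gt_of_ne hl with h | h
  · obtain ⟨m, rfl⟩ : ∃ m : ℕ, l = -m := ⟨l.natAbs, by omega⟩
    rw [← hν' j m (by omega)]
    exact dress_comm_right B.hq B.trunc hx (B.eR_deg i th') (B.al_neg_commute_eL i j th m (by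
      omega))
      (fun N => hμ j _ N hl) (B.al_neg_mul_eR i j th' m (by omega)) n
  · obtain ⟨m, rfl⟩ : ∃ m : ℕ, l = m := ⟨l.natAbs, by omega⟩
    rw [← hν j m (by omega)]
    exact dress_comm_left B.hq B.trunc hx (B.eR_deg i th') (B.al_mul_eL i j th m (by omega))
      (fun N => hμ j _ N hl) (B.al_commute_eR i j th' m (by omega)) n

end HeisBase

/-- Heisenberg operators together with currents `x_c(z)` which are eigenvectors for their adjoint
action, and exponents `thM`, `thP` of vertex operators whose commutators with the Heisenberg
operators cancel those of the `x_c(z)`. -/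
structure HeisSystem (I ι : Type) (V : Type u) [AddCommGroup V] [Module ℂ V]
    extends HeisBase I V where
  x : ι → ℤ → Module.End ℂ V
  idx : ι → I
  μ : I → ι → ℤ → ℂ
  x_deg : ∀ c n, HasDeg q qd n (x c n)
  al_x : ∀ i c l n, l ≠ 0 → al i l * x c n = x c n * al i l + μ i c l • x c (n + l)
  thM : ι → ℕ → ℂ
  thP : ι → ℕ → ℂ
  cancelM : ∀ i c (m : ℕ), 0 < m → thM c m * cc i (idx c) m + μ i c m = 0
  cancelP : ∀ i c (m : ℕ), 0 < m → thP c m * cc i (idx c) (-m) + μ i c (-m) = 0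

namespace HeisSystem

variable {I ι : Type} {V : Type u} [AddCommGroup V] [Module ℂ V] (S : HeisSystem I ι V)

/-- The coefficients of `E^-(z) x_c(z) E^+(z)`. -/
def z (c : ι) (n : ℤ) : Module.End ℂ V :=
  dress (S.eL (S.idx c) (S.thM c)) (S.x c) (S.eR (S.idx c) (S.thP c)) n

lemma z_deg (c : ι) (n : ℤ) : HasDeg S.q S.qd n (S.z c n) :=
  hasDeg_dress S.hq S.trunc (S.x_deg c) (S.eR_deg _ _) (S.eL_deg _ _) n

/-- The dressed currents commute with the Heisenberg operators. -/
lemma al_z (i : I) (c : ι) (l n : ℤ) (hl : l ≠ 0) : S.al i l * S.z c n = S.z c n * S.al i l := by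
  have := S.al_mul_dress (S.idx c) (S.thM c) (S.thP c) (S.x_deg c)
    (μ := fun i l => S.μ i c l) (fun j l n hl => S.al_x j c l n hl) (ν := fun _ _ => 0)
    (fun j m hm => S.cancelM j c m hm) (fun j m hm => S.cancelP j c m hm) i l n hl
  rwa [zero_smul, add_zero] at this

lemma z_vac (c : ι) (n : ℤ) {v : V} (hv : v ∈ S.vac) : S.z c n v ∈ S.vac := fun i m hm => by
  have := LinearMap.congr_fun (S.al_z i c m n hm.ne') v
  rw [Module.End.mul_apply, Module.End.mul_apply, hv i m hm, map_zero] at this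
  exact this

lemma z_J (c : ι) (n : ℤ) {v : V} (hv : v ∈ S.J) : S.z c n v ∈ S.J :=
  S.mem_J_of_commute (fun i m hm => (S.al_z i c (-m) n (by omega)).symm) hv

/-- The currents `x_c(z)` are recovered from the dressed currents by the inverse dressing. -/
lemma x_eq_dress (c : ι) (n : ℤ) : S.x c n = dress (S.eL (S.idx c) fun m => - S.thM c m) (S.z c)
    (S.eR (S.idx c) fun m => - S.thP c m) n :=
  (dress_dress S.hq S.trunc (S.x_deg c) (S.eR_deg _ _) (S.eL_deg _ _) (S.eR_deg _ _)
    (S.mk_eL_neg_mul _ _) (S.mk_eR_mul_neg _ _) n).symm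

/-- The contraction of two currents:
`E^+_c(z)^{-1} x_{c'}(w) = strC(w/z) x_{c'}(w) E^+_c(z)^{-1}`. -/
def strC (c c' : ι) : PowerSeries ℂ :=
  expSeries fun m => - S.thP c m * S.μ (S.idx c) c' m

lemma eR_mul_x (c c' : ι) (b : ℕ) (N : ℤ) :
    S.eR (S.idx c) (fun m => - S.thP c m) b * S.x c' N = ∑ e ∈ Finset.HasAntidiagonal.antidiagonal
      b,
      PowerSeries.coeff e.1 (S.strC c c') •
        (S.x c' (N + e.1) * S.eR (S.idx c) (fun m => - S.thP c m) e.2) := by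
  refine (expCoeff_mul_current (S.pairComm_R (S.idx c) _) (S.x c')
    (fun m => - S.thP c m * S.μ (S.idx c) c' m) (fun m N hm => ?_) b N).trans ?_
  · rw [smul_mul_assoc, mul_smul_comm, S.al_x _ _ _ _ (by omega), smul_add, add_sub_cancel_left,
      smul_smul]
  · refine Finset.sum_congr rfl fun e _ => ?_
    rw [strC, expSeries_eq_expSer, coeff_expSer]
    rfl

/-- Moving an annihilating exponential to the right through a product of currents produces the
contractions; on a vacuum vector the exponential then disappears. -/
lemma eR_word_vac (c : ι) {r : ℕ} (ch : Fin r → ι) (b : ℕ) (N : Fin r → ℤ) {v : V}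
    (hv : v ∈ S.vac) :
    S.eR (S.idx c) (fun m => - S.thP c m) b (word (fun t => S.x (ch t)) N v) =
      ∑ e ∈ Finset.Nat.antidiagonalTuple r b, (∏ t, PowerSeries.coeff (e t) (S.strC c (ch t))) •
        word (fun t => S.x (ch t)) (fun t => N t + e t) v := by
  induction r generalizing b with
  | zero =>
    rcases Nat.eq_zero_or_pos b with rfl | hb
    · simp [word, HeisBase.eR]
    · obtain ⟨b, rfl⟩ : ∃ b', b = b' + 1 := ⟨b - 1, by omega⟩
      simp [word, S.eR_vac _ _ hb hv]
  | succ r ih =>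
    rw [word_succ, Module.End.mul_apply, ← Module.End.mul_apply, S.eR_mul_x, LinearMap.sum_apply]
    have h1 : ∀ p : ℕ × ℕ, (PowerSeries.coeff p.1 (S.strC c (ch 0)) • (S.x (ch 0) (N 0 + p.1) *
        S.eR (S.idx c) (fun m => - S.thP c m) p.2))
          (word (fun t => S.x (ch t.succ)) (fun t => N t.succ) v) =
        ∑ e ∈ Finset.Nat.antidiagonalTuple r p.2,
          (∏ t, PowerSeries.coeff ((Fin.cons p.1 e : Fin (r + 1) → ℕ) t) (S.strC c (ch t))) •
          word (fun t => S.x (ch t)) (fun t => N t + (Fin.cons p.1 e : Fin (r + 1) → ℕ) t) v := by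
      intro p
      rw [LinearMap.smul_apply, Module.End.mul_apply, ih (fun t => ch t.succ), map_sum,
        Finset.smul_sum]
      refine Finset.sum_congr rfl fun e _ => ?_
      rw [map_smul, smul_smul, Fin.prod_univ_succ, word_succ]
      simp
    rw [Finset.sum_congr rfl fun p _ => h1 p, Finset.sum_sigma']
    refine Finset.sum_bij' (fun p _ => (Fin.cons p.1.1 p.2 : Fin (r + 1) → ℕ))
      (fun e _ => ⟨(e 0, ∑ t, e (Fin.succ t)), fun t => e t.succ⟩) ?_ ?_ ?_ ?_ ?_
    · rintro ⟨p, e⟩ h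
      simp only [Finset.mem_sigma, Finset.HasAntidiagonal.mem_antidiagonal,
        Finset.Nat.mem_antidiagonalTuple] at h ⊢
      rw [Fin.sum_univ_succ]
      simp only [Fin.cons_zero, Fin.cons_succ]
      omega
    · intro e h
      simp only [Finset.mem_sigma, Finset.HasAntidiagonal.mem_antidiagonal,
        Finset.Nat.mem_antidiagonalTuple] at h ⊢
      rw [Fin.sum_univ_succ] at h
      exact ⟨h, trivial⟩
    · rintro ⟨⟨p1, p2⟩, e⟩ h
      simp only [Finset.mem_sigma, Finset.HasAntidiagonal.mem_antidiagonal,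
        Finset.Nat.mem_antidiagonalTuple] at h
      obtain ⟨h1, rfl⟩ := h
      simp
    · intro e _
      exact Fin.cons_self_tail e
    · intro _ _; rfl

/-- Modulo `J`, the left exponential of a dressed current disappears. -/
lemma mkQ_x (c : ι) (N : ℤ) (v : V) : S.J.mkQ (S.x c N v) =
    ∑ᶠ b : ℕ, S.J.mkQ (S.z c (N - b) (S.eR (S.idx c) (fun m => - S.thP c m) b v)) := by
  have hf := finite_dress S.hq S.trunc (S.z_deg c) (S.eR_deg (S.idx c) fun m => - S.thP c m)
    (L := S.eL (S.idx c) fun m => - S.thM c m) N v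
  rw [S.x_eq_dress, dress_apply S.hq S.trunc (S.z_deg c) (S.eR_deg _ _), map_finsum' _ _ hf,
    finsum_of_injective (fun b : ℕ => (0, b)) (fun a b h => (Prod.mk.inj h).2)]
  · refine finsum_congr fun b => ?_
    simp [HeisBase.eL]
  · rintro ⟨a, b⟩ h
    rcases Nat.eq_zero_or_pos a with rfl | ha
    · exact ⟨b, rfl⟩
    · exact absurd ((Submodule.Quotient.mk_eq_zero _).mpr (S.eL_mem_J _ _ ha _)) h

/-- The vacuum matrix elements of a product of currents `x_c(z)` are those of the product of the
dressed currents, multiplied by the contractions of all pairs. -/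
theorem mkQ_word {r : ℕ} (ch : Fin r → ι) (N : Fin r → ℤ) {v : V} (hv : v ∈ S.vac) :
    S.J.mkQ (word (fun t => S.x (ch t)) N v) =
      S.J.mkQ (mulSer (fun s t => S.strC (ch s) (ch t)) (fun N => word (fun t =>
        S.z (ch t)) N v) N) := by
  -- Modulo `J` the first current may be replaced by the dressed current followed by an annihilating
  -- exponential. Moving the latter to the vacuum vector gives the contractions with the first
  -- current, and the induction hypothesis applies because the dressed currents preserve `J`.
  induction r with
  | zero => rw [mulSer_zero]; simp [word]
  | succ r ih =>
    obtain ⟨D, hD⟩ := S.trunc v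
    have hz : TailBdd D fun N => word (fun t => S.z (ch t)) N v :=
      tailBdd_word S.hq (fun t n => S.z_deg (ch t) n) hD
    have hz' : TailBdd D fun N => word (fun t => S.z (ch (Fin.succ t))) N v :=
      tailBdd_word S.hq (fun t n => S.z_deg (ch t.succ) n) hD
    have hx' : TailBdd D fun N => word (fun t => S.x (ch (Fin.succ t))) N v :=
      tailBdd_word S.hq (fun t n => S.x_deg (ch t.succ) n) hD
    rw [word_succ, Module.End.mul_apply, S.mkQ_x]
    have h1 : ∀ b : ℕ, S.J.mkQ (S.z (ch 0) (N 0 - b) (S.eR (S.idx (ch 0))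
        (fun m => - S.thP (ch 0) m) b (word (fun t => S.x (ch t.succ)) (fun t => N t.succ) v))) =
        ∑ e ∈ Finset.Nat.antidiagonalTuple r b,
          (∏ t, PowerSeries.coeff (e t) (S.strC (ch 0) (ch t.succ))) • S.J.mkQ
          (S.z (ch 0) (N 0 - ∑ t, (e t : ℤ))
            (word (fun t => S.x (ch t.succ)) (fun t => N t.succ + e t) v)) := by
      intro b
      rw [S.eR_word_vac _ (fun t => ch t.succ) b _ hv, map_sum, map_sum]
      refine Finset.sum_congr rfl fun e he => ?_
      rw [Finset.Nat.mem_antidiagonalTuple] at he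
      rw [map_smul, map_smul, ← he]
      push_cast
      rfl
    rw [finsum_congr h1, ← finsum_fiberwise (fun e : Fin r → ℕ => ∑ t, e t)
      (fun b => Finset.Nat.antidiagonalTuple r b)
      (fun k i => Finset.Nat.mem_antidiagonalTuple)
      (fun e => (∏ t, PowerSeries.coeff (e t) (S.strC (ch 0) (ch t.succ))) • S.J.mkQ
          (S.z (ch 0) (N 0 - ∑ t, (e t : ℤ))
            (word (fun t => S.x (ch t.succ)) (fun t => N t.succ + e t) v)))]
    · rw [mulSer_succ hz, map_finsum']
      · refine finsum_congr fun e => ?_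
        rw [map_smul]
        congr 1
        have h2 := ih (fun t => ch t.succ) (fun t => N t.succ + e t)
        have h3 : ∀ w : V, S.J.mkQ (S.z (ch 0) (N 0 - ∑ t, (e t : ℤ)) w) =
            S.J.mapQ S.J (S.z (ch 0) (N 0 - ∑ t, (e t : ℤ))) (fun w hw => S.z_J _ _ hw)
              (S.J.mkQ w) := fun w => rfl
        rw [h3, h2, ← h3, map_mulSer hz']
        congr 2
        funext N'
        rw [word_succ]
        simp
      · refine finite_pi_bdd _ (fun t => (D - tailSum t (fun t => N t.succ)).toNat) fun e he t => ?_
        rw [Function.mem_support] at he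
        by_contra h
        refine he ?_
        have h4 : ∀ N' : Fin r → ℤ, word (fun t => S.z (ch t)) (Fin.cons (N 0 - ∑ t,
          (e t : ℤ)) N') v
            = S.z (ch 0) (N 0 - ∑ t, (e t : ℤ)) (word (fun t => S.z (ch t.succ)) N' v) := by
          intro N'
          rw [word_succ]; simp
        simp only [h4]
        rw [← map_mulSer hz', hz'.mulSer _ _ t, map_zero, smul_zero]
        have h5 : ((e t : ℕ) : ℤ) ≤ tailSum t fun t => (e t : ℤ) :=
          Finset.single_le_sum (f := fun t => (e t : ℤ)) (fun _ _ => by simp) (by simp)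
        have h6 := tailSum_add t (fun t => N t.succ) (fun t => (e t : ℤ))
        rw [show (fun t => N (Fin.succ t) + (e t : ℤ)) = (fun t => N t.succ) + fun t =>
          (e t : ℤ) from rfl,
          h6]
        omega
    · refine finite_pi_bdd _ (fun t => (D - tailSum t (fun t => N t.succ)).toNat) fun e he t => ?_
      rw [Function.mem_support] at he
      by_contra h
      refine he ?_
      have h0 := hx' (fun t => N t.succ + e t) t ?_
      · simp only at h0
        rw [h0, map_zero, map_zero, smul_zero]
      · have h5 : ((e t : ℕ) : ℤ) ≤ tailSum t fun t => (e t : ℤ) :=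
          Finset.single_le_sum (f := fun t => (e t : ℤ)) (fun _ _ => by simp) (by simp)
        have h6 := tailSum_add t (fun t => N t.succ) (fun t => (e t : ℤ))
        rw [show (fun t => N (Fin.succ t) + (e t : ℤ)) = (fun t => N t.succ) + fun t =>
          (e t : ℤ) from rfl,
          h6]
        omega

end HeisSystem

/-! ### Representations of the Heisenberg algebra are generated by their vacuum spaces -/

section WeylPair

variable {A : Type*} [Ring A] [Algebra ℂ A]

/-- The partial sums of `∑_r (-1)^r x^r p^r / r!`. If `[p, x] = 1`, the full sum is the projection
onto the kernel of `p` along the image of `x`. -/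
def weylProj (x p : A) (R : ℕ) : A :=
  ∑ r ∈ Finset.range R, ((-1) ^ r * (r.factorial : ℂ)⁻¹) • (x ^ r * p ^ r)

variable {x p : A}

lemma mul_pow_of_weyl (h : p * x = x * p + 1) (r : ℕ) :
    p * x ^ (r + 1) = x ^ (r + 1) * p + ((r + 1 : ℕ) : ℂ) • x ^ r := by
  induction r with
  | zero => simpa using h
  | succ r ih =>
    rw [pow_succ x (r + 1), ← mul_assoc, ih, add_mul, mul_assoc, h, mul_add, mul_one, ← mul_assoc,
      smul_mul_assoc, ← pow_succ, ← pow_succ, Nat.cast_succ (r + 1), add_smul, one_smul]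
    abel

lemma pow_mul_of_weyl (h : p * x = x * p + 1) (r : ℕ) :
    p ^ (r + 1) * x = x * p ^ (r + 1) + ((r + 1 : ℕ) : ℂ) • p ^ r := by
  induction r with
  | zero => simpa using h
  | succ r ih =>
    rw [pow_succ' p (r + 1), mul_assoc, ih, mul_add, ← mul_assoc, h, add_mul, one_mul, mul_assoc,
      mul_smul_comm, ← pow_succ', ← pow_succ', Nat.cast_succ (r + 1), add_smul, one_smul]
    abel

lemma factorial_step (r : ℕ) : ((-1 : ℂ) ^ (r + 1) * ((r + 1).factorial : ℂ)⁻¹) * ((r + 1 : ℕ) : ℂ)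
    = - ((-1) ^ r * (r.factorial : ℂ)⁻¹) := by
  have : ((r : ℂ) + 1) ≠ 0 := by exact_mod_cast Nat.succ_ne_zero r
  rw [Nat.factorial_succ]
  push_cast
  field_simp
  ring

/-- The truncated projection is annihilated by `p` up to a multiple of `x^R p^{R+1}`. -/
lemma mul_weylProj (h : p * x = x * p + 1) (R : ℕ) : p * weylProj x p (R + 1) =
    ((-1) ^ R * (R.factorial : ℂ)⁻¹) • (x ^ R * p ^ (R + 1)) := by
  induction R with
  | zero => simp [weylProj]
  | succ R ih =>
    rw [weylProj, Finset.sum_range_succ, mul_add, ← weylProj, ih, mul_smul_comm, ← mul_assoc,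
      mul_pow_of_weyl h, add_mul, smul_add, smul_mul_assoc, smul_smul, factorial_step, mul_assoc,
      ← pow_succ']
    module

/-- The truncated projection annihilates the image of `x` up to `x^{R+1} p^R`. -/
lemma weylProj_mul (h : p * x = x * p + 1) (R : ℕ) : weylProj x p (R + 1) * x =
    ((-1) ^ R * (R.factorial : ℂ)⁻¹) • (x ^ (R + 1) * p ^ R) := by
  induction R with
  | zero => simp [weylProj]
  | succ R ih =>
    rw [weylProj, Finset.sum_range_succ, add_mul, ← weylProj, ih, smul_mul_assoc, mul_assoc,
      pow_mul_of_weyl h, mul_add, smul_add, mul_smul_comm, smul_smul, factorial_step, ← mul_assoc,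
      ← pow_succ]
    module

lemma commute_weylProj {a : A} (hx : Commute a x) (hp : Commute a p) (R : ℕ) :
    Commute a (weylProj x p R) :=
  Commute.sum_right _ _ _ fun r _ => ((hx.pow_right r).mul_right (hp.pow_right r)).smul_right _

end WeylPair

namespace HeisBase

variable {I : Type} [Fintype I] [DecidableEq I] {V : Type u} [AddCommGroup V] [Module ℂ V]
  (B : HeisBase I V)

/-- The matrices `(c_{ij}(n))_{ij}`, `n ≥ 1`, are invertible. -/
def Nondeg : Prop := ∀ n : ℕ, 0 < n → (Matrix.of fun i j => B.cc i j n).det ≠ 0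

/-- The annihilation operators dual to the creation operators `α_{j,-n}`. -/
def ann (j : I) (n : ℕ) : Module.End ℂ V :=
  ∑ i, (Matrix.of fun i j => B.cc i j n)⁻¹ j i • B.al i n

variable {B}

/-- The operators `ann j n` and `α_{k,-m}` satisfy the canonical commutation relations. -/
lemma Nondeg.ann_comm (hB : B.Nondeg) (j k : I) {n m : ℕ} (hn : 0 < n) (hm : 0 < m) :
    B.ann j n * B.al k (-m) = B.al k (-m) * B.ann j n +
      (if j = k ∧ n = m then 1 else 0) := by
  have hu : IsUnit (Matrix.of fun i j => B.cc i j n).det := (hB n hn).isUnit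
  have h1 : ∀ i, (Matrix.of fun i j => B.cc i j n)⁻¹ j i • B.al i n * B.al k (-m) =
      B.al k (-m) * ((Matrix.of fun i j => B.cc i j n)⁻¹ j i • B.al i n) +
      ((Matrix.of fun i j => B.cc i j n)⁻¹ j i * (if n = m then B.cc i k n else 0)) •
        (1 : Module.End ℂ V) := by
    intro i
    rw [smul_mul_assoc, B.al_comm i k n (-m) (by omega) (by omega), smul_add, smul_smul,
      mul_smul_comm]
    congr 3
    refine if_congr ?_ rfl rfl
    omega
  rw [ann, Finset.sum_mul, Finset.mul_sum, Finset.sum_congr rfl fun i _ => h1 i,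
    Finset.sum_add_distrib, ← Finset.sum_smul]
  congr 1
  by_cases h : n = m
  · subst h
    have := congrFun (congrFun (Matrix.nonsing_inv_mul _ hu) j) k
    rw [Matrix.mul_apply] at this
    simp only [Matrix.of_apply] at this
    simp only [if_true, and_true, this, Matrix.one_apply]
    split_ifs <;> simp
  · simp [h]

lemma Nondeg.al_eq (hB : B.Nondeg) (i : I) {n : ℕ} (hn : 0 < n) :
    B.al i n = ∑ j, B.cc i j n • B.ann j n := by
  have hu : IsUnit (Matrix.of fun i j => B.cc i j n).det := (hB n hn).isUnit
  have h1 := Matrix.mul_nonsing_inv _ hu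
  simp only [ann, Finset.smul_sum, smul_smul]
  rw [Finset.sum_comm]
  have h2 : ∀ k, ∑ j, (B.cc i j n * (Matrix.of fun i j => B.cc i j n)⁻¹ j k) • B.al k n =
      (if i = k then (1 : ℂ) else 0) • B.al k n := by
    intro k
    rw [← Finset.sum_smul]
    congr 1
    have := congrFun (congrFun h1 i) k
    rw [Matrix.mul_apply, Matrix.one_apply] at this
    exact this
  rw [Finset.sum_congr rfl fun k _ => h2 k]
  simp

lemma ann_deg (j : I) (n : ℕ) : HasDeg B.q B.qd n (B.ann j n) :=
  HasDeg.sum _ fun i _ => (B.al_deg i n).smul _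

lemma ann_commute (j k : I) {n m : ℕ} (hn : 0 < n) (hm : 0 < m) :
    Commute (B.ann j n) (B.ann k m) :=
  Commute.sum_left _ _ _ fun i _ => Commute.sum_right _ _ _ fun i' _ =>
    ((B.commute_al i i' (by omega) (by omega) (by omega)).smul_left _).smul_right _

lemma hasDeg_pow {A : Module.End ℂ V} {n : ℤ} (hA : HasDeg B.q B.qd n A) (r : ℕ) :
    HasDeg B.q B.qd (n * r) (A ^ r) := by
  induction r with
  | zero => simpa using HasDeg.one
  | succ r ih =>
    rw [pow_succ]
    convert ih.mul B.hq hA using 1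
    push_cast; ring

lemma hasDeg_weylProj (j : I) (n R : ℕ) :
    HasDeg B.q B.qd 0 (weylProj (B.al j (-n)) (B.ann j n) R) := by
  refine HasDeg.sum _ fun r _ => HasDeg.smul ?_ _
  have := (hasDeg_pow (B.al_deg j (-n)) r).mul B.hq (hasDeg_pow (ann_deg j n) r)
  convert this using 1
  ring

/-- A subspace stable under the Heisenberg operators is generated from its vacuum vectors by the
creation operators. -/
theorem Nondeg.le_of_vac_le (hB : B.Nondeg) (S U : Submodule ℂ V)
    (hS : ∀ i m, m ≠ 0 → ∀ v ∈ S, B.al i m v ∈ S)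
    (hU : ∀ i m, 0 < m → ∀ v ∈ U, B.al i (-m) v ∈ U) (h0 : S ⊓ B.vac ≤ U) : S ≤ U := by
  -- Induction on a bound `D` such that all operators of degree greater than `D` kill the vector. By
  -- successive projections, `v` is changed by elements of `U` until it is a vacuum vector.
  have hSann : ∀ j (n : ℕ), 0 < n → ∀ v ∈ S, B.ann j n v ∈ S := by
    intro j n hn v hv
    rw [ann, LinearMap.sum_apply]
    exact S.sum_mem fun i _ => S.smul_mem _ (hS i n (by omega) v hv)
  have hSpow : ∀ j (n : ℕ), 0 < n → ∀ r, ∀ v ∈ S, (B.ann j n ^ r) v ∈ S := by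
    intro j n hn r
    induction r with
    | zero => intro v hv; simpa using hv
    | succ r ih => intro v hv; rw [pow_succ, Module.End.mul_apply]; exact ih _ (hSann j n hn v hv)
  have key : ∀ D : ℕ, ∀ v ∈ S,
      (∀ n : ℤ, D < n → ∀ A, HasDeg B.q B.qd n A → A v = 0) → v ∈ U ⊓ S := by
    intro D
    induction D using Nat.strong_induction_on with
    | _ D ih =>
      intro v hv hD
      -- successive projections onto the kernels of the annihilation operators in a finite set
      have step : ∀ T : Finset (I × ℕ), (∀ a ∈ T, 0 < a.2) → ∃ u ∈ U ⊓ S,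
          (∀ a ∈ T, B.ann a.1 a.2 (v - u) = 0) ∧
          ∀ n : ℤ, D < n → ∀ A, HasDeg B.q B.qd n A → A (v - u) = 0 := by
        intro T
        induction T using Finset.induction_on with
        | empty => exact fun _ => ⟨0, Submodule.zero_mem _, by simp, by simpa using hD⟩
        | insert a T ha ihT =>
          intro hT
          obtain ⟨u, hu, hu1, hu2⟩ := ihT fun b hb => hT b (Finset.mem_insert_of_mem hb)
          have ha0 : 0 < a.2 := hT a (Finset.mem_insert_self a T)
          have hw : B.ann a.1 a.2 * B.al a.1 (-a.2) = B.al a.1 (-a.2) * B.ann a.1 a.2 + 1 := by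
            rw [hB.ann_comm _ _ ha0 ha0]; simp
          set w := v - u with hwdef
          have hwS : w ∈ S := S.sub_mem hv hu.2
          set P := weylProj (B.al a.1 (-a.2)) (B.ann a.1 a.2) (D + 1) with hP
          -- The terms of `w - P w` are creation operators applied to `(ann)^(r+1) w`, for which
          -- the bound is smaller than `D`.
          have hPw : w - P w ∈ U ⊓ S := by
            have : P w = w + ∑ r ∈ Finset.range D, ((-1) ^ (r + 1) * ((r + 1).factorial : ℂ)⁻¹) •
                (B.al a.1 (-a.2) ^ (r + 1)) ((B.ann a.1 a.2 ^ (r + 1)) w) := by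
              rw [hP, weylProj, Finset.sum_range_succ', LinearMap.add_apply, LinearMap.sum_apply,
                add_comm]
              simp
            rw [this, sub_add_cancel_left]
            refine Submodule.neg_mem _ (Submodule.sum_mem _ fun r _ => Submodule.smul_mem _ _ ?_)
            have hp : (B.ann a.1 a.2 ^ (r + 1)) w ∈ U ⊓ S := by
              rcases Nat.lt_or_ge D (a.2 * (r + 1)) with h | h
              · rw [hu2 ((a.2 : ℤ) * (r + 1 : ℕ)) (by exact_mod_cast h) _
                  (hasDeg_pow (ann_deg _ _) _)]
                exact Submodule.zero_mem _
              · have hpos : 0 < a.2 * (r + 1) := Nat.mul_pos ha0 r.succ_pos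
                refine ih (D - a.2 * (r + 1)) (by omega) _ (hSpow _ _ ha0 _ _ hwS) fun n hn A hA =>
                  ?_
                rw [← Module.End.mul_apply]
                refine hu2 (n + (a.2 : ℤ) * (r + 1 : ℕ)) ?_ _
                  (hA.mul B.hq (hasDeg_pow (ann_deg _ _) _))
                push_cast [Nat.cast_sub h] at hn ⊢
                linarith
            have hx : ∀ k, ∀ y ∈ U ⊓ S, (B.al a.1 (-a.2) ^ k) y ∈ U ⊓ S := by
              intro k
              induction k with
              | zero => intro y hy; simpa using hy
              | succ k ihk =>
                intro y hy
                rw [pow_succ, Module.End.mul_apply]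
                exact ihk _ ⟨hU _ _ (by omega) _ hy.1, hS _ _ (by omega) _ hy.2⟩
            exact hx _ _ hp
          refine ⟨u + (w - P w), Submodule.add_mem _ hu hPw, ?_, ?_⟩
          · have hv' : v - (u + (w - P w)) = P w := by rw [hwdef]; abel
            rw [hv']
            intro b hb
            by_cases hba : b = a
            -- `D + 1` terms suffice, since `(ann)^(D+1)` has degree greater than `D`.
            · subst hba
              rw [← Module.End.mul_apply, hP, mul_weylProj hw, LinearMap.smul_apply,
                Module.End.mul_apply, hu2 ((b.2 : ℤ) * (D + 1 : ℕ)) ?_ _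
                  (hasDeg_pow (ann_deg _ _) _), map_zero, smul_zero]
              have : 1 * (D + 1) ≤ b.2 * (D + 1) := Nat.mul_le_mul_right _ ha0
              exact_mod_cast (by omega : D < b.2 * (D + 1))
            · have hbT : b ∈ T := (Finset.mem_insert.mp hb).resolve_left hba
              have hb0 := hT b hb
              -- The projection commutes with the other annihilation operators, which still
              -- kill `P w`.
              have hc : Commute (B.ann b.1 b.2) (B.al a.1 (-a.2)) := by
                show _ = _
                rw [hB.ann_comm _ _ hb0 ha0, if_neg (fun h => hba (Prod.ext h.1 h.2)), add_zero]
              have := commute_weylProj hc (ann_commute b.1 a.1 hb0 ha0) (D + 1)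
              rw [← Module.End.mul_apply, hP, this.eq, Module.End.mul_apply, hu1 b hbT, map_zero]
          · have hv' : v - (u + (w - P w)) = P w := by rw [hwdef]; abel
            rw [hv']
            intro n hn A hA
            rw [← Module.End.mul_apply]
            have := hA.mul B.hq (hasDeg_weylProj (B := B) a.1 a.2 (D + 1))
            rw [add_zero] at this
            exact hu2 n hn _ this
      -- Annihilation operators of degree greater than `D` kill `v - u` anyway.
      obtain ⟨u, hu, hu1, hu2⟩ := step (Finset.univ ×ˢ Finset.Icc 1 D) (fun a ha => by
        simp only [Finset.mem_product, Finset.mem_Icc] at ha; omega)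
      have hvac : v - u ∈ B.vac := by
        intro i m hm
        obtain ⟨n, rfl⟩ : ∃ n : ℕ, m = n := ⟨m.toNat, by omega⟩
        rcases Nat.lt_or_ge D n with h | h
        · exact hu2 n (by exact_mod_cast h) _ (B.al_deg i n)
        · rw [hB.al_eq i (by omega), LinearMap.sum_apply]
          refine Finset.sum_eq_zero fun j _ => ?_
          rw [LinearMap.smul_apply, hu1 (j, n) (by simp; omega), smul_zero]
      have hvS : v - u ∈ S := S.sub_mem hv hu.2
      have := Submodule.add_mem _ (show v - u ∈ U ⊓ S from ⟨h0 ⟨hvS, hvac⟩, hvS⟩) hu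
      rwa [sub_add_cancel] at this
  intro v hv
  obtain ⟨D, hD⟩ := B.trunc v
  exact (key D.toNat v hv fun n hn A hA => hD n (by omega) A hA).1

/-- Vacuum vectors are not in the image of the creation operators. -/
theorem Nondeg.eq_zero_of_mem_J (hB : B.Nondeg) {v : V} (hv : v ∈ B.vac) (hJ : v ∈ B.J) :
    v = 0 := by
  -- Induction on the number of creation operators needed to express `v`.
  have key : ∀ (T : Finset (I × ℕ)), (∀ a ∈ T, 0 < a.2) → ∀ f : I × ℕ → V,
      v = ∑ a ∈ T, B.al a.1 (-a.2) (f a) → v = 0 := by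
    intro T
    induction T using Finset.induction_on with
    | empty => intro _ f h; simpa using h
    | insert a T ha ih =>
      intro hT f h
      have ha0 : 0 < a.2 := hT a (Finset.mem_insert_self a T)
      have hw : B.ann a.1 a.2 * B.al a.1 (-a.2) = B.al a.1 (-a.2) * B.ann a.1 a.2 + 1 := by
        rw [hB.ann_comm _ _ ha0 ha0]; simp
      obtain ⟨D, hD⟩ := B.trunc (f a)
      set R := D.toNat + 1 with hR
      -- this projection fixes `v` and kills the summand of `a`
      set P := weylProj (B.al a.1 (-a.2)) (B.ann a.1 a.2) (R + 1) with hP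
      have hPv : P v = v := by
        have hz : B.ann a.1 a.2 v = 0 := by
          rw [ann, LinearMap.sum_apply]
          refine Finset.sum_eq_zero fun i _ => ?_
          rw [LinearMap.smul_apply, hv i a.2 (by omega), smul_zero]
        rw [hP, weylProj, Finset.sum_range_succ', LinearMap.add_apply, LinearMap.sum_apply,
          Finset.sum_eq_zero]
        · simp
        · intro r _
          rw [LinearMap.smul_apply, Module.End.mul_apply, pow_succ (B.ann a.1 a.2),
            Module.End.mul_apply, hz,
            map_zero, map_zero, smul_zero]
      have hPa : P (B.al a.1 (-a.2) (f a)) = 0 := by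
        rw [← Module.End.mul_apply, hP, weylProj_mul hw, LinearMap.smul_apply, Module.End.mul_apply,
          hD ((a.2 : ℤ) * R) ?_ _ (hasDeg_pow (ann_deg _ _) _), map_zero, smul_zero]
        have h1 : 1 * R ≤ a.2 * R := Nat.mul_le_mul_right _ ha0
        have h2 : (R : ℤ) ≤ (a.2 : ℤ) * R := by exact_mod_cast (by omega : R ≤ a.2 * R)
        omega
      refine ih (fun b hb => hT b (Finset.mem_insert_of_mem hb)) (fun b => P (f b)) ?_
      rw [Finset.sum_insert ha] at h
      have h3 := congrArg P h
      rw [hPv, map_add, hPa, zero_add, map_sum] at h3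
      rw [h3]
      refine Finset.sum_congr rfl fun b hb => ?_
      have hb0 := hT b (Finset.mem_insert_of_mem hb)
      have hba : b ≠ a := fun h => ha (h ▸ hb)
      have hc : Commute (B.al b.1 (-b.2)) (B.ann a.1 a.2) := by
        show _ = _
        rw [hB.ann_comm _ _ ha0 hb0, if_neg (fun h => hba (Prod.ext h.1.symm h.2.symm)), add_zero]
      have := commute_weylProj (B.commute_al b.1 a.1 (l := -b.2) (m := -a.2) (by omega) (by omega)
        (by omega)) hc (R + 1)
      rw [← Module.End.mul_apply, ← Module.End.mul_apply, hP, this.eq]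
  have hJ' : ∃ (T : Finset (I × ℕ)) (f : I × ℕ → V), (∀ a ∈ T, 0 < a.2) ∧
      v = ∑ a ∈ T, B.al a.1 (-a.2) (f a) := by
    refine Submodule.span_induction (p := fun v _ => ∃ (T : Finset (I × ℕ)) (f : I × ℕ → V),
      (∀ a ∈ T, 0 < a.2) ∧ v = ∑ a ∈ T, B.al a.1 (-a.2) (f a)) ?_ ?_ ?_ ?_ hJ
    · rintro _ ⟨i, m, v, hm, rfl⟩
      refine ⟨{(i, m.toNat)}, fun _ => v, by simp; omega, ?_⟩
      simp [hm.le]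
    · exact ⟨∅, 0, by simp, by simp⟩
    · rintro _ _ _ _ ⟨T, f, hT, rfl⟩ ⟨T', f', hT', rfl⟩
      refine ⟨T ∪ T', fun a => (if a ∈ T then f a else 0) + if a ∈ T' then f' a else 0, ?_, ?_⟩
      · intro a ha
        rcases Finset.mem_union.mp ha with h | h
        exacts [hT a h, hT' a h]
      · simp only [map_add, Finset.sum_add_distrib]
        congr 1
        · rw [← Finset.sum_subset (Finset.subset_union_left (s₁ := T) (s₂ := T'))]
          · exact Finset.sum_congr rfl fun a ha => by rw [if_pos ha]
          · intro a _ ha; rw [if_neg ha, map_zero]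
        · rw [← Finset.sum_subset (Finset.subset_union_right (s₁ := T) (s₂ := T'))]
          · exact Finset.sum_congr rfl fun a ha => by rw [if_pos ha]
          · intro a _ ha; rw [if_neg ha, map_zero]
    · rintro c _ _ ⟨T, f, hT, rfl⟩
      exact ⟨T, fun a => c • f a, hT, by simp [Finset.smul_sum]⟩
  obtain ⟨T, f, hT, h⟩ := hJ'
  exact key T hT f h

/-- A graded family of operators whose commutators with the Heisenberg operators lie in the family
vanishes as soon as its vacuum matrix elements do. -/
theorem Nondeg.eq_zero_of_matrix (hB : B.Nondeg) {Γ : Type*} (deg : Γ → ℤ)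
    (R : Γ → Module.End ℂ V) (hdeg : ∀ N, HasDeg B.q B.qd (deg N) (R N))
    (hcomm : ∀ i n, n ≠ 0 → ∀ N v, B.al i n (R N v) - R N (B.al i n v) ∈
      Submodule.span ℂ {w | ∃ N', deg N' = deg N + n ∧ w = R N' v})
    (hvac : ∀ v ∈ B.vac, ∀ N, R N v ∈ B.J) (N : Γ) : R N = 0 := by
  -- On vacuum vectors: descending induction on the degree of `R N`. If all members of higher degree
  -- kill `v`, then `R N v` is a vacuum vector, and it lies in `J` by hypothesis.
  have h1 : ∀ v ∈ B.vac, ∀ N, R N v = 0 := by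
    intro v hv
    obtain ⟨D, hD⟩ := B.trunc v
    have : ∀ k : ℕ, ∀ N, D - deg N < k → R N v = 0 := by
      intro k
      induction k with
      | zero => intro N hN; exact hD (deg N) (by simpa using hN) _ (hdeg N)
      | succ k ih =>
        intro N hN
        refine hB.eq_zero_of_mem_J (fun i n hn => ?_) (hvac v hv N)
        have := hcomm i n hn.ne' N v
        rw [hv i n hn, map_zero, sub_zero] at this
        have hle : Submodule.span ℂ {w | ∃ N', deg N' = deg N + n ∧ w = R N' v} ≤ ⊥ := by
          refine Submodule.span_le.mpr ?_
          rintro _ ⟨N', hN', rfl⟩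
          exact ih N' (by push_cast at hN; omega)
        exact (Submodule.mem_bot ℂ).mp (hle this)
    exact fun N => this (D - deg N + 1).toNat N (by omega)
  -- The common kernel of the family is stable under the creation operators.
  let U : Submodule ℂ V :=
    { carrier := {v | ∀ N, R N v = 0}
      zero_mem' := fun N => map_zero _
      add_mem' := fun {v w} hv hw N => by rw [map_add, hv N, hw N, add_zero]
      smul_mem' := fun c v hv N => by rw [map_smul, hv N, smul_zero] }
  have hU := hB.le_of_vac_le ⊤ U (fun _ _ _ _ _ => trivial) (fun i m hm v hv N => by
    have := hcomm i (-m) (by omega) N v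
    rw [hv N, map_zero, zero_sub] at this
    have hle : Submodule.span ℂ {w | ∃ N', deg N' = deg N + -m ∧ w = R N' v} ≤ ⊥ := by
      refine Submodule.span_le.mpr ?_
      rintro _ ⟨N', _, rfl⟩
      exact hv N'
    exact neg_eq_zero.mp ((Submodule.mem_bot ℂ).mp (hle this))) (fun v hv => h1 v hv.2)
  ext v
  exact hU (Submodule.mem_top (x := v)) N

end HeisBase

/-! ### Transfer of relations between currents and dressed currents -/

section MulWord

variable {V : Type*} [AddCommGroup V] [Module ℂ V] {r : ℕ}

/-- The operator coefficients of `∏_{s < t} G_{st}(z_t/z_s) Y_0(z_0) ⋯ Y_{r-1}(z_{r-1})`. -/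
def mulWord (G : Fin r → Fin r → PowerSeries ℂ) (Y : Fin r → ℤ → Module.End ℂ V)
    (N : Fin r → ℤ) : Module.End ℂ V :=
  locSum fun e : Pairs r → ℕ =>
    (∏ st, PowerSeries.coeff (e st) (G st.1.1 st.1.2)) • word Y (N + shift e)

variable {q : ℂ} {qd : Module.End ℂ V} (hq : q ≠ 0) (ht : Trunc q qd)
  {Y : Fin r → ℤ → Module.End ℂ V} (hY : ∀ t n, HasDeg q qd n (Y t n))

include hq ht hY in
lemma mulWord_apply (G : Fin r → Fin r → PowerSeries ℂ) (N : Fin r → ℤ) (v : V) :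
    mulWord G Y N v = mulSer G (fun N => word Y N v) N :=
  locSum_apply (locFin_mulWord hq ht hY _ N) v

lemma sum_shift (e : Pairs r → ℕ) : ∑ t, shift e t = 0 := by
  simp only [shift, Finset.sum_sub_distrib]
  rw [Finset.sum_comm, Finset.sum_comm (f := fun t (st : Pairs r) => if st.1.1 =
      t then (e st : ℤ) else 0)]
  simp

include hq hY in
lemma hasDeg_mulWord (G : Fin r → Fin r → PowerSeries ℂ) (N : Fin r → ℤ) :
    HasDeg q qd (∑ t, N t) (mulWord G Y N) := by
  refine HasDeg.locSum fun e => HasDeg.smul ?_ _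
  have := hasDeg_word hq hY (N + shift e)
  simpa [Finset.sum_add_distrib, sum_shift] using this

end MulWord

namespace HeisSystem

variable {I ι : Type} {V : Type u} [AddCommGroup V] [Module ℂ V] (S : HeisSystem I ι V)

lemma al_mul_word (i : I) {l : ℤ} (hl : l ≠ 0) {r : ℕ} (ch : Fin r → ι) (N : Fin r → ℤ) :
    S.al i l * word (fun t => S.x (ch t)) N = word (fun t => S.x (ch t)) N * S.al i l +
      ∑ t, S.μ i (ch t) l • word (fun t => S.x (ch t)) (N + Pi.single t l) := by
  induction r with
  | zero => simp [word]
  | succ r ih =>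
    rw [word_succ, ← mul_assoc, S.al_x i _ _ _ hl, add_mul, mul_assoc, ih (fun t => ch t.succ),
      mul_add,
      Finset.mul_sum, Fin.sum_univ_succ, mul_assoc, add_assoc]
    congr 1
    rw [add_comm]
    congr 1
    · rw [word_succ, smul_mul_assoc]
      simp [Fin.succ_ne_zero]
    · refine Finset.sum_congr rfl fun t _ => ?_
      rw [word_succ, mul_smul_comm]
      congr 2
      · simp [(Fin.succ_ne_zero t).symm]
      · congr 1
        funext t'
        simp [Pi.single_apply, Fin.succ_inj]

/-- A product of currents multiplied by scalar structure functions has the same commutators with the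
Heisenberg operators as the product itself. -/
lemma al_mul_mulWord (i : I) {l : ℤ} (hl : l ≠ 0) {r : ℕ} (ch : Fin r → ι)
    (G : Fin r → Fin r → PowerSeries ℂ) (N : Fin r → ℤ) :
    S.al i l * mulWord G (fun t => S.x (ch t)) N = mulWord G (fun t => S.x (ch t)) N * S.al i l +
      ∑ t, S.μ i (ch t) l • mulWord G (fun t => S.x (ch t)) (N + Pi.single t l) := by
  have hY : ∀ t n, HasDeg S.q S.qd n ((fun t => S.x (ch t)) t n) := fun t n => S.x_deg (ch t) n
  have hf := fun c N v => locFin_mulWord S.hq S.trunc hY c N v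
  ext v
  simp only [Module.End.mul_apply, LinearMap.add_apply, LinearMap.sum_apply, LinearMap.smul_apply]
  rw [mulWord, locSum_apply (hf _ N), locSum_apply (hf _ N), map_finsum' _ _ (hf _ N v)]
  have h1 : ∀ t, S.μ i (ch t) l • mulWord G (fun t => S.x (ch t)) (N + Pi.single t l) v =
      ∑ᶠ e : Pairs r → ℕ, S.μ i (ch t) l • ((∏ st, PowerSeries.coeff (e st) (G st.1.1 st.1.2)) •
        word (fun t => S.x (ch t)) (N + Pi.single t l + shift e)) v := by
    intro t
    rw [mulWord, locSum_apply (hf _ _), smul_finsum' _ (hf _ _ v)]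
  have h2 : ∀ t, (Function.support fun e : Pairs r → ℕ => S.μ i (ch t) l •
      ((∏ st, PowerSeries.coeff (e st) (G st.1.1 st.1.2)) •
        word (fun t => S.x (ch t)) (N + Pi.single t l + shift e)) v).Finite := fun t =>
    (hf _ (N + Pi.single t l) v).subset fun e he h0 => he (by simp only at h0 ⊢; rw [h0, smul_zero])
  rw [Finset.sum_congr rfl fun t _ => h1 t, ← finsum_sum_comm _ _ fun t _ => h2 t,
    ← finsum_add_distrib (hf _ N _)]
  · refine finsum_congr fun e => ?_
    have := LinearMap.congr_fun (S.al_mul_word i hl ch (N + shift e)) v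
    simp only [Module.End.mul_apply, LinearMap.add_apply, LinearMap.sum_apply,
      LinearMap.smul_apply] at this ⊢
    rw [map_smul, this, smul_add, Finset.smul_sum]
    congr 1
    refine Finset.sum_congr rfl fun t _ => ?_
    rw [smul_comm, add_right_comm]
  · refine (Set.Finite.biUnion (Set.finite_univ) fun t _ => h2 t).subset fun e he => ?_
    obtain ⟨t, _, ht⟩ := Finset.exists_ne_zero_of_sum_ne_zero he
    exact Set.mem_biUnion (Set.mem_univ t) ht

/-- The vacuum matrix elements of `∏ G_{st}(z_t/z_s) x(z_0) ⋯ x(z_{r-1})`. -/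
lemma mkQ_mulWord {r : ℕ} (ch : Fin r → ι) (G : Fin r → Fin r → PowerSeries ℂ) (N : Fin r → ℤ)
    {v : V} (hv : v ∈ S.vac) :
    S.J.mkQ (mulWord G (fun t => S.x (ch t)) N v) =
      S.J.mkQ (mulWord (fun s t => G s t * S.strC (ch s) (ch t)) (fun t => S.z (ch t)) N v) := by
  obtain ⟨D, hD⟩ := S.trunc v
  have hz := tailBdd_word S.hq (fun t n => S.z_deg (ch t) n) hD
  have hx := tailBdd_word S.hq (fun t n => S.x_deg (ch t) n) hD
  rw [mulWord_apply S.hq S.trunc fun t n => S.x_deg (ch t) n,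
    mulWord_apply S.hq S.trunc fun t n => S.z_deg (ch t) n, map_mulSer hx, ← mulSer_mulSer hz,
    map_mulSer (hz.mulSer _)]
  congr 1
  funext N
  exact S.mkQ_word ch N hv

lemma word_z_vac {r : ℕ} (ch : Fin r → ι) (N : Fin r → ℤ) {v : V} (hv : v ∈ S.vac) :
    word (fun t => S.z (ch t)) N v ∈ S.vac := by
  induction r with
  | zero => simpa [word] using hv
  | succ r ih =>
    rw [word_succ]
    exact S.z_vac _ _ (ih _ _)

lemma mulWord_z_vac {r : ℕ} (ch : Fin r → ι) (G : Fin r → Fin r → PowerSeries ℂ) (N : Fin r → ℤ)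
    {v : V} (hv : v ∈ S.vac) : mulWord G (fun t => S.z (ch t)) N v ∈ S.vac := by
  rw [mulWord_apply S.hq S.trunc fun t n => S.z_deg (ch t) n]
  exact finsum_induction (· ∈ S.vac) (S.vac.zero_mem) (fun _ _ => S.vac.add_mem)
    fun e => S.vac.smul_mem _ (S.word_z_vac ch _ hv)

section Relation

variable {τ : Type} [Fintype τ] [DecidableEq τ] (ch : τ → ι)

/-- The family `R_N` has the same commutators with the Heisenberg operators as products of the
currents `x_{ch t}(z_t)`, `t ∈ τ`. -/
def Covariant (R : (τ → ℤ) → Module.End ℂ V) : Prop := ∀ i (l : ℤ), l ≠ 0 → ∀ N,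
  S.al i l * R N = R N * S.al i l + ∑ t, S.μ i (ch t) l • R (N + Pi.single t l)

variable {S ch}

lemma Covariant.add {R R' : (τ → ℤ) → Module.End ℂ V} (h : S.Covariant ch R)
    (h' : S.Covariant ch R') : S.Covariant ch fun N => R N + R' N := fun i l hl N => by
  simp only [mul_add, add_mul, smul_add, Finset.sum_add_distrib, h i l hl N, h' i l hl N]
  abel

lemma Covariant.smul {R : (τ → ℤ) → Module.End ℂ V} (h : S.Covariant ch R) (a : ℂ) :
    S.Covariant ch fun N => a • R N := fun i l hl N => by
  simp only [mul_smul_comm, smul_mul_assoc, h i l hl N, smul_add, Finset.smul_sum]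
  congr 1
  exact Finset.sum_congr rfl fun t _ => smul_comm _ _ _

lemma Covariant.zero : S.Covariant ch fun _ => 0 := fun i l _ N => by simp

lemma Covariant.sum {K : Type*} (s : Finset K) {R : K → (τ → ℤ) → Module.End ℂ V}
    (h : ∀ k, S.Covariant ch (R k)) : S.Covariant ch fun N => ∑ k ∈ s, R k N := by
  classical
  induction s using Finset.induction_on with
  | empty => simpa using Covariant.zero
  | insert k s hk ih => simpa [Finset.sum_insert hk] using (h k).add ih

variable (S ch)

/-- A product of the currents in any order and with any structure functions is covariant; the shift
`N₀` accounts for a monomial prefactor. -/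
lemma covariant_mulWord {r : ℕ} (π : Fin r ≃ τ) (G : Fin r → Fin r → PowerSeries ℂ) (N₀ : τ → ℤ) :
    S.Covariant ch fun N => mulWord G (fun t => S.x (ch (π t))) fun t => (N + N₀) (π t) := by
  intro i l hl N
  simp only
  rw [S.al_mul_mulWord i hl (fun t => ch (π t)), ← π.sum_comp]
  congr 1
  refine Finset.sum_congr rfl fun t _ => ?_
  congr 2
  funext t'
  simp only [Pi.add_apply, Pi.single_apply, π.apply_eq_iff_eq]
  ring

/-- A linear relation between products of the currents `x_c(z)`, with structure functions `G_k`,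
holds if and only if the relation between the dressed currents with the structure functions
`G_k strC` holds on the vacuum space. Here `π_k` is the order of the variables in the `k`-th
product, and `Φ` collects the terms which are not products of currents. -/
theorem relation_iff [Fintype I] [DecidableEq I] (hB : S.toHeisBase.Nondeg) {K : Type*} [Fintype K]
    {r : ℕ} (π : K → Fin r ≃ τ) (c : K → ℂ) (G : K → Fin r → Fin r → PowerSeries ℂ)
    (N₀ : K → τ → ℤ) (d : ℤ) (hd : ∀ k, ∑ t, N₀ k t = d) (Φ Ψ : (τ → ℤ) → Module.End ℂ V)
    (hΦ : S.Covariant ch Φ) (hΦd : ∀ N, HasDeg S.q S.qd ((∑ t, N t) + d) (Φ N))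
    (hΨ : ∀ N, ∀ v ∈ S.vac, Ψ N v ∈ S.vac)
    (hΦΨ : ∀ N, ∀ v ∈ S.vac, S.J.mkQ (Φ N v) = S.J.mkQ (Ψ N v)) :
    (∀ N v, ∑ k, c k • mulWord (G k) (fun t => S.x (ch (π k t)))
        (fun t => (N + N₀ k) (π k t)) v + Φ N v = 0) ↔
      ∀ N, ∀ v ∈ S.vac, ∑ k, c k • mulWord (fun s t => G k s t * S.strC (ch (π k s)) (ch (π k t)))
        (fun t => S.z (ch (π k t))) (fun t => (N + N₀ k) (π k t)) v + Ψ N v = 0 := by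
  -- Both sides of the equivalence have the same vacuum matrix elements.
  have hQ : ∀ N, ∀ v ∈ S.vac, S.J.mkQ (∑ k, c k • mulWord (G k) (fun t => S.x (ch (π k t)))
        (fun t => (N + N₀ k) (π k t)) v + Φ N v) = S.J.mkQ (∑ k, c k • mulWord
          (fun s t => G k s t * S.strC (ch (π k s)) (ch (π k t)))
        (fun t => S.z (ch (π k t))) (fun t => (N + N₀ k) (π k t)) v + Ψ N v) := by
    intro N v hv
    rw [map_add, map_add, hΦΨ N v hv, map_sum, map_sum]
    congr 1
    refine Finset.sum_congr rfl fun k _ => ?_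
    rw [map_smul, map_smul, S.mkQ_mulWord (fun t => ch (π k t)) _ _ hv]
  constructor
  · intro h N v hv
    -- The relation between dressed currents maps vacuum vectors to vacuum vectors in `J`.
    refine hB.eq_zero_of_mem_J ?_ ?_
    · exact S.vac.add_mem (S.vac.sum_mem fun k _ => S.vac.smul_mem _
        (S.mulWord_z_vac (fun t => ch (π k t)) _ _ hv)) (hΨ N v hv)
    · have := hQ N v hv
      rw [h, map_zero] at this
      exact (Submodule.Quotient.mk_eq_zero _).mp this.symm
  · intro h N v
    have hcov : S.Covariant ch fun N => ∑ k, c k • mulWord (G k) (fun t => S.x (ch (π k t)))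
        (fun t => (N + N₀ k) (π k t)) + Φ N :=
      (Covariant.sum _ fun k => (S.covariant_mulWord ch (π k) (G k) (N₀ k)).smul (c k)).add hΦ
    have := hB.eq_zero_of_matrix (fun N : τ → ℤ => (∑ t, N t) + d)
      (fun N => ∑ k, c k • mulWord (G k) (fun t => S.x (ch (π k t)))
        (fun t => (N + N₀ k) (π k t)) + Φ N) ?_ ?_ ?_ N
    · simpa using LinearMap.congr_fun this v
    · intro N
      refine (HasDeg.sum _ fun k _ => HasDeg.smul ?_ _).add (hΦd N)
      have := hasDeg_mulWord S.hq (fun t n => S.x_deg (ch (π k t)) n) (G k)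
        (fun t => (N + N₀ k) (π k t))
      rwa [(π k).sum_comp (N + N₀ k), show ∑ t, (N + N₀ k) t = (∑ t, N t) + d by
        rw [← hd k, ← Finset.sum_add_distrib]; rfl] at this
    · intro i n hn N v
      have := LinearMap.congr_fun (hcov i n hn N) v
      simp only [Module.End.mul_apply, LinearMap.add_apply (M := V) (σ₁₂ := RingHom.id ℂ)] at this ⊢
      rw [this, add_sub_cancel_left, LinearMap.sum_apply]
      refine Submodule.sum_mem _ fun t _ => Submodule.smul_mem _ _ (Submodule.subset_span
        ⟨N + Pi.single t n, ?_, by simp⟩)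
      simp only [Pi.add_apply, Finset.sum_add_distrib, Finset.sum_pi_single', Finset.mem_univ,
        if_true]
      ring
    · intro v hv N
      have := hQ N v hv
      rw [h N v hv, map_zero] at this
      refine (Submodule.Quotient.mk_eq_zero _).mp ?_
      rw [← Submodule.mkQ_apply, ← this]
      simp

end Relation

end HeisSystem

/-! ### Structure constants and structure functions -/

variable {X : SimpleType}

lemma SimpleType.mMat_swap (X : SimpleType) (i j : X.Idx) : X.mMat j i = - X.mMat i j := by
  match X, i, j with
  | A n hn, i, j =>
    have h : ∀ i j : Fin (n + 1), ((if j = i + 1 then 1 else 0) - (if j + 1 =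
      i then 1 else 0) : ℤ) =
        -((if i = j + 1 then 1 else 0) - (if i + 1 = j then 1 else 0)) := by
      intro i j
      rw [neg_sub, if_congr (eq_comm (a := j)) rfl rfl, if_congr (eq_comm (a := j + 1)) rfl rfl]
    exact h i j
  | B .., i, j | C .., i, j | D .., i, j | E6, i, j | E7, i, j | E8, i, j | F4, i, j
  | G2, i, j => show (0 : ℤ) = -0; simp

namespace Params

variable (T : Params X)

/-- The standing conditions on the parameters: `b` is symmetric, the nome `p`, `p^*` and
`q^{2k}` have modulus less than one, and `q`, `κ` are generic. -/
structure Generic : Prop where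
  d_pos : ∀ i, 0 < T.d i
  symm : ∀ i j, T.b i j = T.b j i
  q_ne : T.q ≠ 0
  q_pow : ∀ n : ℕ, 0 < n → T.q ^ n ≠ 1
  κ_ne : T.κ ≠ 0
  det : ∀ n : ℕ, 0 < n →
    (Matrix.of fun i j => T.br (T.b i j * n) * T.κ ^ (-(n : ℤ) * X.mMat i j)).det ≠ 0
  p_ne : T.p ≠ 0
  p_lt : ‖T.p‖ < 1
  pStar_lt : ‖T.pStar‖ < 1
  s_lt : ‖T.s‖ < 1

/-- `[α_{i,l}, α_{j,-l}] = ([b_{ij} l][kl]/l) (1 - p^l)/(1 - p^{*l}) κ^{-l m_{ij}} q^{-kl}`. -/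
def cc (i j : X.Idx) (l : ℤ) : ℂ :=
  T.br (T.b i j * l) * T.brk l / l * T.pRatio l * T.κm i j ^ l * T.qk ^ (-l)

/-- The coefficients in `[α_{i,l}, x^±_j(z)] = muX z^l x^±_j(z)`. -/
def muX (i : X.Idx) : Sgn × X.Idx → ℤ → ℂ
  | (.pos, j), l => T.br (T.b i j * l) / l * T.pRatio l * T.qk ^ (-l) * T.κm i j ^ l
  | (.neg, j), l => - (T.br (T.b i j * l) / l * T.κm i j ^ l)

/-- The ratio of `α'_{i,l}` and `α_{i,l}` for the sign `-`, and `1` for the sign `+`. -/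
def primeRatio : Sgn → ℤ → ℂ
  | .pos, _ => 1
  | .neg, l => (1 - T.pStar ^ l) / (1 - T.p ^ l) * T.qk ^ l

/-- The exponents of `E^-(α_i, z)` and `E^-(α'_i, z)`. -/
def thM (c : Sgn × X.Idx) (m : ℕ) : ℂ :=
  ((-c.1.val : ℤ) : ℂ) * ((T.q - T.q⁻¹) / (T.qk ^ (m : ℤ) - T.qk ^ (-(m : ℤ)))) *
    T.primeRatio c.1 (-m)

/-- The exponents of `E^+(α_i, z)` and `E^+(α'_i, z)`. -/
def thP (c : Sgn × X.Idx) (m : ℕ) : ℂ :=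
  (c.1.val : ℂ) * ((T.q - T.q⁻¹) / (T.qk ^ (m : ℤ) - T.qk ^ (-(m : ℤ)))) * T.primeRatio c.1 m

variable {T}

lemma κm_swap (i j : X.Idx) : T.κm j i = (T.κm i j)⁻¹ := by
  rw [κm, κm, X.mMat_swap i j, neg_neg, zpow_neg, inv_inv]

section

variable (hT : T.Generic)

include hT

lemma Generic.κm_ne (i j : X.Idx) : T.κm i j ≠ 0 := zpow_ne_zero _ hT.κ_ne

lemma Generic.qk_ne : T.qk ≠ 0 := by
  rw [qk, Complex.cpow_def_of_ne_zero hT.q_ne]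
  exact Complex.exp_ne_zero _

lemma Generic.pStar_ne : T.pStar ≠ 0 := div_ne_zero hT.p_ne (pow_ne_zero _ hT.qk_ne)

lemma Generic.p_eq : T.p = T.pStar * T.qk ^ 2 := by
  rw [pStar, div_mul_cancel₀ _ (pow_ne_zero _ hT.qk_ne)]

lemma one_sub_pow_ne {x : ℂ} (hx : ‖x‖ < 1) {n : ℕ} (hn : 0 < n) : 1 - x ^ n ≠ 0 := by
  intro h
  have h1 : ‖x ^ n‖ = 1 := by rw [← sub_eq_zero.mp h]; simp
  rw [norm_pow] at h1
  exact absurd h1 (pow_lt_one₀ (norm_nonneg _) hx hn.ne').ne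

lemma Generic.q_sub_ne {n : ℕ} (hn : 0 < n) : T.q ^ n - (T.q ^ n)⁻¹ ≠ 0 := by
  intro h
  have h0 : T.q ^ n ≠ 0 := pow_ne_zero _ hT.q_ne
  refine hT.q_pow (n * 2) (by omega) ?_
  rw [pow_mul, sq]
  rw [sub_eq_zero] at h
  nth_rewrite 2 [h]
  exact mul_inv_cancel₀ h0

lemma Generic.q_sub_inv_ne : T.q - T.q⁻¹ ≠ 0 := by simpa using hT.q_sub_ne one_pos

lemma Generic.qi_sub_inv_ne (i : X.Idx) : T.qi i - (T.qi i)⁻¹ ≠ 0 := hT.q_sub_ne (hT.d_pos i)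

lemma Generic.br_d_eq (i : X.Idx) : T.br (T.d i) = (T.qi i - (T.qi i)⁻¹) / (T.q - T.q⁻¹) := by
  rw [br, qi, zpow_neg, zpow_natCast]

lemma Generic.br_d_ne (i : X.Idx) : T.br (T.d i) ≠ 0 := by
  rw [hT.br_d_eq]
  exact div_ne_zero (hT.qi_sub_inv_ne i) hT.q_sub_inv_ne

lemma Generic.br_mul_bri (i j : X.Idx) (l : ℤ) :
    T.br (T.d i) * T.bri i (X.cartan i j * l) = T.br (T.b i j * l) := by
  have h1 := hT.q_sub_inv_ne
  have h2 := hT.qi_sub_inv_ne i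
  rw [hT.br_d_eq, bri, br, b, qi]
  rw [qi] at h2
  rw [← zpow_natCast, ← zpow_mul, ← zpow_mul, mul_neg, ← mul_assoc]
  rw [← zpow_natCast] at h2
  generalize T.q - T.q⁻¹ = w at *
  generalize T.q ^ (T.d i : ℤ) - (T.q ^ (T.d i : ℤ))⁻¹ = w' at *
  field_simp

/-- The Heisenberg relations in terms of `α_{i,l} = [d_i] α^∨_{i,l}`. -/
lemma Generic.cc_eq (i j : X.Idx) (l : ℤ) : T.cc i j l = T.br (T.d i) * T.br (T.d j) *
    (T.bri i (X.cartan i j * l) / l * ((T.qk ^ l - T.qk ^ (-l)) / (T.qi j - (T.qi j)⁻¹)) *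
      T.pRatio l * T.κm i j ^ l * T.qk ^ (-l)) := by
  have h1 := hT.q_sub_inv_ne
  have h2 := hT.qi_sub_inv_ne j
  rw [cc, ← hT.br_mul_bri i j l, brk, hT.br_d_eq j]
  generalize T.q - T.q⁻¹ = w at *
  generalize T.qi j - (T.qi j)⁻¹ = w' at *
  field_simp

lemma Generic.s_pow (m : ℕ) : T.s ^ m = (T.qk ^ m) ^ 2 := by rw [s, ← pow_mul, ← pow_mul, mul_comm]

lemma Generic.p_pow (m : ℕ) : T.p ^ m = T.pStar ^ m * (T.qk ^ m) ^ 2 := by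
  rw [hT.p_eq, mul_pow, ← pow_mul, ← pow_mul, mul_comm 2]

lemma Generic.nonzero {m : ℕ} (hm : 0 < m) : (T.qk ^ m ≠ 0 ∧ 1 - (T.qk ^ m) ^ 2 ≠ 0) ∧
    (T.pStar ^ m ≠ 0 ∧ 1 - T.pStar ^ m ≠ 0) ∧ 1 - T.pStar ^ m * (T.qk ^ m) ^ 2 ≠ 0 := by
  refine ⟨⟨pow_ne_zero _ hT.qk_ne, ?_⟩, ⟨pow_ne_zero _ hT.pStar_ne,
    one_sub_pow_ne hT hT.pStar_lt hm⟩, ?_⟩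
  · rw [← hT.s_pow]; exact one_sub_pow_ne hT hT.s_lt hm
  · rw [← hT.p_pow]; exact one_sub_pow_ne hT hT.p_lt hm

lemma Generic.pRatio_nat (m : ℕ) :
    T.pRatio m = (1 - T.pStar ^ m * (T.qk ^ m) ^ 2) / (1 - T.pStar ^ m) := by
  rw [pRatio, zpow_natCast, zpow_natCast, hT.p_pow]

lemma Generic.pRatio_neg {m : ℕ} (hm : 0 < m) :
    T.pRatio (-m) = ((T.qk ^ m) ^ 2)⁻¹ * T.pRatio m := by
  obtain ⟨⟨h1, h2⟩, ⟨h3, h4⟩, h5⟩ := hT.nonzero hm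
  have h6 : T.pStar ^ m - 1 ≠ 0 := fun h => h4 (by rw [← neg_sub, h, neg_zero])
  rw [hT.pRatio_nat, pRatio, zpow_neg, zpow_neg, zpow_natCast, zpow_natCast, hT.p_pow]
  have h7 : 1 - (T.pStar ^ m)⁻¹ ≠ 0 := by
    rw [show 1 - (T.pStar ^ m)⁻¹ = (T.pStar ^ m - 1) * (T.pStar ^ m)⁻¹ by field_simp]
    exact mul_ne_zero h6 (inv_ne_zero h3)
  generalize T.pStar ^ m = P at *
  generalize T.qk ^ m = Q at *
  field_simp
  ring

lemma Generic.br_neg (n : ℤ) : T.br (-n) = - T.br n := by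
  rw [br, br, neg_neg, ← neg_sub, neg_div]

lemma Generic.muX_neg_index (i j : X.Idx) (m : ℤ) : T.br (T.b i j * -m) = - T.br (T.b i j * m) := by
  rw [mul_neg, hT.br_neg]

lemma Generic.cc_nat (i j : X.Idx) (m : ℕ) : T.cc i j m = T.br (T.b i j * m) / m *
    ((T.qk ^ m - (T.qk ^ m)⁻¹) / (T.q - T.q⁻¹)) * T.pRatio m * T.κm i j ^ m * (T.qk ^ m)⁻¹ := by
  rw [cc, brk, zpow_neg, zpow_natCast, zpow_natCast]
  push_cast
  ring

lemma Generic.cc_neg (i j : X.Idx) {m : ℕ} (hm : 0 < m) : T.cc i j (-m) =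
    - (T.br (T.b i j * m) / m * ((T.qk ^ m - (T.qk ^ m)⁻¹) / (T.q - T.q⁻¹)) * T.pRatio m *
      (T.κm i j ^ m)⁻¹ * (T.qk ^ m)⁻¹) := by
  obtain ⟨⟨h1, h2⟩, -, -⟩ := hT.nonzero hm
  rw [cc, brk, neg_neg, zpow_neg, zpow_neg, zpow_natCast, zpow_natCast, hT.muX_neg_index,
    hT.pRatio_neg hm]
  push_cast
  field_simp
  ring

lemma Generic.muX_pos_neg (i j : X.Idx) {m : ℕ} (hm : 0 < m) : T.muX i (.pos, j) (-m) =
    T.br (T.b i j * m) / m * T.pRatio m * (T.qk ^ m)⁻¹ * (T.κm i j ^ m)⁻¹ := by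
  obtain ⟨⟨h1, h2⟩, -, -⟩ := hT.nonzero hm
  rw [muX, neg_neg, zpow_neg, zpow_natCast, zpow_natCast, hT.muX_neg_index, hT.pRatio_neg hm]
  push_cast
  field_simp

lemma Generic.muX_pos_nat (i j : X.Idx) (m : ℕ) : T.muX i (.pos, j) m =
    T.br (T.b i j * m) / m * T.pRatio m * (T.qk ^ m)⁻¹ * T.κm i j ^ m := by
  rw [muX, zpow_neg, zpow_natCast, zpow_natCast]; push_cast; rfl

lemma Generic.muX_neg_neg (i j : X.Idx) (m : ℕ) : T.muX i (.neg, j) (-m) =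
    - (T.br (T.b i j * m) / m * (T.κm i j ^ m)⁻¹) := by
  rw [muX, zpow_neg, zpow_natCast, hT.muX_neg_index]
  push_cast
  rw [neg_div_neg_eq]

lemma Generic.muX_neg_nat (i j : X.Idx) (m : ℕ) : T.muX i (.neg, j) m =
    - (T.br (T.b i j * m) / m * T.κm i j ^ m) := by
  rw [muX, zpow_natCast]; push_cast; rfl

lemma Generic.primeRatio_nat (m : ℕ) : T.primeRatio .neg m = (T.pRatio m)⁻¹ * T.qk ^ m := by
  rw [primeRatio, pRatio, inv_div, zpow_natCast, zpow_natCast, zpow_natCast]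

lemma Generic.primeRatio_neg {m : ℕ} (hm : 0 < m) :
    T.primeRatio .neg (-m) = (T.pRatio m)⁻¹ * T.qk ^ m := by
  obtain ⟨⟨h1, h2⟩, -, -⟩ := hT.nonzero hm
  have : T.primeRatio .neg (-m) = (T.pRatio (-m))⁻¹ * T.qk ^ (-(m : ℤ)) := by
    rw [primeRatio, pRatio, inv_div]
  rw [this, hT.pRatio_neg hm, zpow_neg, zpow_natCast, mul_inv, inv_inv]
  field_simp

lemma Generic.pRatio_ne {m : ℕ} (hm : 0 < m) : T.pRatio m ≠ 0 := by
  obtain ⟨-, ⟨h3, h4⟩, h5⟩ := hT.nonzero hm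
  rw [hT.pRatio_nat]
  exact div_ne_zero h5 h4

lemma Generic.qk_sub_ne {m : ℕ} (hm : 0 < m) : T.qk ^ m - (T.qk ^ m)⁻¹ ≠ 0 := by
  obtain ⟨⟨h1, h2⟩, -, -⟩ := hT.nonzero hm
  rw [show T.qk ^ m - (T.qk ^ m)⁻¹ = - (1 - (T.qk ^ m) ^ 2) * (T.qk ^ m)⁻¹ by field_simp; ring]
  exact mul_ne_zero (neg_ne_zero.mpr h2) (inv_ne_zero h1)

/-- The vertex operator `E^-` cancels the commutators of `α_{i,m}` with the currents. -/
lemma Generic.cancelM (i : X.Idx) (c : Sgn × X.Idx) (m : ℕ) (hm : 0 < m) :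
    T.thM c m * T.cc i c.2 m + T.muX i c m = 0 := by
  have h1 := hT.qk_sub_ne hm
  have h2 := hT.q_sub_inv_ne
  have h3 := hT.pRatio_ne hm
  have h4 : T.qk ^ m ≠ 0 := pow_ne_zero _ hT.qk_ne
  obtain ⟨ε, j⟩ := c
  cases ε
  · rw [thM, hT.cc_nat, hT.muX_pos_nat, zpow_neg, zpow_natCast]
    simp only [primeRatio, Sgn.val]
    push_cast
    generalize T.qk ^ m - (T.qk ^ m)⁻¹ = D at *
    generalize T.q - T.q⁻¹ = w at *
    field_simp
    ring
  · rw [thM, hT.cc_nat, hT.muX_neg_nat, zpow_neg, zpow_natCast]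
    simp only [hT.primeRatio_neg hm, Sgn.val]
    push_cast
    generalize T.qk ^ m - (T.qk ^ m)⁻¹ = D at *
    generalize T.q - T.q⁻¹ = w at *
    field_simp
    ring

/-- The vertex operator `E^+` cancels the commutators of `α_{i,-m}` with the currents. -/
lemma Generic.cancelP (i : X.Idx) (c : Sgn × X.Idx) (m : ℕ) (hm : 0 < m) :
    T.thP c m * T.cc i c.2 (-m) + T.muX i c (-m) = 0 := by
  have h1 := hT.qk_sub_ne hm
  have h2 := hT.q_sub_inv_ne
  have h3 := hT.pRatio_ne hm
  have h4 : T.qk ^ m ≠ 0 := pow_ne_zero _ hT.qk_ne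
  obtain ⟨ε, j⟩ := c
  cases ε
  · rw [thP, hT.cc_neg _ _ hm, hT.muX_pos_neg _ _ hm, zpow_neg, zpow_natCast]
    simp only [primeRatio, Sgn.val]
    push_cast
    generalize T.qk ^ m - (T.qk ^ m)⁻¹ = D at *
    generalize T.q - T.q⁻¹ = w at *
    field_simp
    ring
  · rw [thP, hT.cc_neg _ _ hm, hT.muX_neg_neg, zpow_neg, zpow_natCast]
    simp only [hT.primeRatio_nat, Sgn.val]
    push_cast
    generalize T.qk ^ m - (T.qk ^ m)⁻¹ = D at *
    generalize T.q - T.q⁻¹ = w at *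
    field_simp
    ring

/-- The Heisenberg pairing is antisymmetric. -/
lemma Generic.cc_swap (i j : X.Idx) {l : ℤ} (hl : l ≠ 0) : T.cc j i (-l) = - T.cc i j l := by
  have key : ∀ m : ℕ, 0 < m → ∀ i j : X.Idx, T.cc j i (-m) = - T.cc i j m := by
    intro m hm i j
    rw [hT.cc_neg _ _ hm, hT.cc_nat, hT.symm i j, κm_swap i j, inv_pow, inv_inv]
  rcases lt_or_gt_of_ne hl with h | h
  · obtain ⟨m, rfl⟩ : ∃ m : ℕ, l = -m := ⟨l.natAbs, by omega⟩
    rw [key m (by omega), neg_neg, neg_neg]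
  · obtain ⟨m, rfl⟩ : ∃ m : ℕ, l = m := ⟨l.natAbs, by omega⟩
    exact key m (by omega) i j

/-- The Heisenberg pairing in degree `n` is a nonzero multiple of the matrix
`[b_{ij} n] κ^{-n m_{ij}}`. -/
lemma Generic.cc_det {n : ℕ} (hn : 0 < n) : (Matrix.of fun i j => T.cc i j n).det ≠ 0 := by
  have h : (Matrix.of fun i j => T.cc i j n) =
      ((T.qk ^ n - (T.qk ^ n)⁻¹) / (T.q - T.q⁻¹) / n * T.pRatio n * (T.qk ^ n)⁻¹) •
      Matrix.of fun i j => T.br (T.b i j * n) * T.κ ^ (-(n : ℤ) * X.mMat i j) := by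
    ext i j
    rw [Matrix.smul_apply, Matrix.of_apply, Matrix.of_apply, hT.cc_nat, κm,
      ← zpow_natCast (T.κ ^ _),
      ← zpow_mul, smul_eq_mul, show -(n : ℤ) * X.mMat i j = -X.mMat i j * n by ring]
    ring
  rw [h, Matrix.det_smul]
  refine mul_ne_zero (pow_ne_zero _ ?_) (hT.det n hn)
  have h1 : (n : ℂ) ≠ 0 := Nat.cast_ne_zero.mpr hn.ne'
  exact mul_ne_zero (mul_ne_zero (div_ne_zero (div_ne_zero (hT.qk_sub_ne hn) hT.q_sub_inv_ne) h1)
    (hT.pRatio_ne hn)) (inv_ne_zero (pow_ne_zero _ hT.qk_ne))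

end

/-! ### Identities between structure functions -/

/-- `1 - x u = exp(-∑ x^m u^m / m)`. -/
lemma expSeries_log (x : ℂ) : expSeries (fun m => - (x ^ m / m)) =
    1 - PowerSeries.C x * PowerSeries.X := by
  rw [expSeries_eq_expSer]
  -- `1 - x u` solves the differential equation which characterizes the exponential.
  refine eq_of_euler_eq (coeff_zero_euler (genSer fun m => - (x ^ m / (m : ℂ))))
    (euler_expSer (pairComm_scalar _)) ?_ (by simp)
  ext n
  rw [mul_sub, mul_one, ← mul_assoc, coeff_euler, map_sub, map_sub, coeff_euler]
  rcases n with _ | n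
  · simp
  · rw [PowerSeries.coeff_succ_mul_X, PowerSeries.coeff_succ_mul_X, PowerSeries.coeff_mul_C,
      coeff_euler, coeff_genSer, coeff_genSer, PowerSeries.coeff_C, PowerSeries.coeff_one]
    have hn : ((n : ℂ) + 1) ≠ 0 := by exact_mod_cast Nat.succ_ne_zero n
    rcases n with _ | n
    · simp
    · have hn' : ((n : ℂ) + 1) ≠ 0 := by exact_mod_cast Nat.succ_ne_zero n
      simp only [Nat.succ_ne_zero, if_false, smul_eq_mul]
      push_cast at hn ⊢
      field_simp
      ring

lemma strRatio_eq (i j : X.Idx) (x y : ℂ) : T.strRatio i j x y = expSeries fun m =>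
    T.κm i j ^ m * (- ((T.q ^ (- T.b i j) * x) ^ m / (m * (1 - T.s ^ m))) +
      (T.q ^ T.b i j * y) ^ m / (m * (1 - T.s ^ m))) := by
  rw [strRatio, qPoch, qPoch, expSeries_inv, expSeries_mul, rescale_expSeries]
  congr 1
  funext m
  rw [neg_neg]

lemma zpow_mul_nat (a : ℂ) (n : ℤ) (m : ℕ) : a ^ (n * m) = (a ^ n) ^ m := by
  rw [zpow_mul, zpow_natCast]

section

variable (hT : T.Generic)

include hT

/-- The structure functions of the quadratic and of the Serre relations of the `Z`-algebra differ by
the factor `1 - q^{±b_{ij}} κ^{-m_{ij}} w/z`. -/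
lemma Generic.one_sub_mul_strSerreZ (ε : Sgn) (i j : X.Idx) :
    (1 - PowerSeries.C (T.q ^ (ε.val * T.b i j) * T.κm i j) * PowerSeries.X) * T.strSerreZ ε i j =
      T.strZ i j := by
  rw [← expSeries_log]
  cases ε
  · simp only [strSerreZ, strZ, strRatio_eq, expSeries_mul, Sgn.val, one_mul]
    refine expSeries_congr fun m hm => ?_
    have h1 := one_sub_pow_ne hT hT.s_lt hm
    have h2 : (m : ℂ) ≠ 0 := Nat.cast_ne_zero.mpr hm.ne'
    simp only [mul_pow, mul_one]
    field_simp
    ring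
  · simp only [strSerreZ, strZ, strRatio_eq, expSeries_mul, Sgn.val, neg_one_mul]
    refine expSeries_congr fun m hm => ?_
    have h1 := one_sub_pow_ne hT hT.s_lt hm
    have h2 : (m : ℂ) ≠ 0 := Nat.cast_ne_zero.mpr hm.ne'
    simp only [mul_pow, mul_one]
    field_simp
    ring

/-- The contraction of the currents `x_c` and `x_{c'}`. -/
def _root_.EllToroidal.Params.contr (T : Params X) (c c' : Sgn × X.Idx) : PowerSeries ℂ :=
  expSeries fun m => - T.thP c m * T.muX c.2 c' m

/-- The elliptic structure function `G^±_{ij}`, multiplied by the contraction, loses its dependence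
on `p` and becomes `F^±_{ij}`. -/
lemma Generic.strU_mul_contr (ε : Sgn) (i j : X.Idx) :
    T.strU ε i j * T.contr (ε, i) (ε, j) = T.strSerreZ ε i j := by
  cases ε
  · simp only [strU, gSeries, contr, strSerreZ, strRatio_eq, rescale_expSeries, expSeries_mul]
    refine expSeries_congr fun m hm => ?_
    obtain ⟨⟨h1, h2⟩, ⟨h3, h4⟩, h5⟩ := hT.nonzero hm
    have h6 : (m : ℂ) ≠ 0 := Nat.cast_ne_zero.mpr hm.ne'
    have h7 := hT.q_sub_inv_ne
    have h9 : (T.q ^ T.b i j) ^ m ≠ 0 := pow_ne_zero _ (zpow_ne_zero _ hT.q_ne)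
    rw [hT.muX_pos_nat, thP, hT.pRatio_nat, hT.s_pow, br]
    simp only [primeRatio, Sgn.val, zpow_neg, zpow_natCast, zpow_mul_nat, mul_one]
    have h8' : T.qk ^ m - (T.qk ^ m)⁻¹ = - (1 - (T.qk ^ m) ^ 2) * (T.qk ^ m)⁻¹ := by
      field_simp; ring
    rw [h8', inv_pow]
    push_cast
    generalize T.pStar ^ m = P at *
    generalize T.qk ^ m = Q at *
    generalize (T.q ^ T.b i j) ^ m = y at *
    generalize T.q - T.q⁻¹ = w at *
    field_simp
    ring
  · simp only [strU, gSeries, contr, strSerreZ, strRatio_eq, rescale_expSeries, expSeries_mul,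
      expSeries_inv]
    refine expSeries_congr fun m hm => ?_
    obtain ⟨⟨h1, h2⟩, ⟨h3, h4⟩, h5⟩ := hT.nonzero hm
    have h6 : (m : ℂ) ≠ 0 := Nat.cast_ne_zero.mpr hm.ne'
    have h7 := hT.q_sub_inv_ne
    have h9 : (T.q ^ T.b i j) ^ m ≠ 0 := pow_ne_zero _ (zpow_ne_zero _ hT.q_ne)
    rw [hT.muX_neg_nat, thP, hT.primeRatio_nat, hT.pRatio_nat, br]
    simp only [Sgn.val, zpow_neg, zpow_natCast, zpow_mul_nat, mul_pow]
    rw [hT.p_pow, hT.s_pow]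
    have h8' : T.qk ^ m - (T.qk ^ m)⁻¹ = - (1 - (T.qk ^ m) ^ 2) * (T.qk ^ m)⁻¹ := by
      field_simp; ring
    rw [h8', inv_pow]
    push_cast
    generalize T.pStar ^ m = P at *
    generalize T.qk ^ m = Q at *
    generalize (T.q ^ T.b i j) ^ m = y at *
    generalize T.q - T.q⁻¹ = w at *
    field_simp
    ring

lemma strMix_eq (i j : X.Idx) : T.strMix i j = expSeries fun m =>
    T.κm i j ^ m * (- ((T.q ^ T.b i j * T.qk) ^ m / (m * (1 - T.s ^ m))) +
      (T.q ^ (- T.b i j) * T.qk) ^ m / (m * (1 - T.s ^ m))) := by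
  rw [strMix, qPoch, qPoch, expSeries_inv, expSeries_mul, rescale_expSeries]
  congr 1
  funext m
  rw [neg_neg]

/-- The contraction of `x^+_i` and `x^-_j` is the structure function of the mixed relations. -/
lemma Generic.contr_mixed (i j : X.Idx) : T.contr (.pos, i) (.neg, j) = T.strMix i j := by
  rw [strMix_eq hT, contr]
  refine expSeries_congr fun m hm => ?_
  obtain ⟨⟨h1, h2⟩, ⟨h3, h4⟩, h5⟩ := hT.nonzero hm
  have h6 : (m : ℂ) ≠ 0 := Nat.cast_ne_zero.mpr hm.ne'
  have h7 := hT.q_sub_inv_ne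
  have h9 : (T.q ^ T.b i j) ^ m ≠ 0 := pow_ne_zero _ (zpow_ne_zero _ hT.q_ne)
  rw [hT.muX_neg_nat, thP, br, hT.s_pow]
  simp only [primeRatio, Sgn.val, zpow_neg, zpow_natCast, zpow_mul_nat, mul_pow]
  have h8' : T.qk ^ m - (T.qk ^ m)⁻¹ = - (1 - (T.qk ^ m) ^ 2) * (T.qk ^ m)⁻¹ := by
    field_simp; ring
  rw [h8', inv_pow]
  push_cast
  generalize T.qk ^ m = Q at *
  generalize (T.q ^ T.b i j) ^ m = y at *
  generalize T.q - T.q⁻¹ = w at *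
  field_simp
  ring

lemma Generic.contr_mixed' (i j : X.Idx) : T.contr (.neg, i) (.pos, j) = T.strMix i j := by
  rw [strMix_eq hT, contr]
  refine expSeries_congr fun m hm => ?_
  obtain ⟨⟨h1, h2⟩, ⟨h3, h4⟩, h5⟩ := hT.nonzero hm
  have h6 : (m : ℂ) ≠ 0 := Nat.cast_ne_zero.mpr hm.ne'
  have h7 := hT.q_sub_inv_ne
  have h8 := hT.pRatio_ne hm
  have h9 : (T.q ^ T.b i j) ^ m ≠ 0 := pow_ne_zero _ (zpow_ne_zero _ hT.q_ne)
  rw [hT.muX_pos_nat, thP, hT.primeRatio_nat, br, hT.s_pow]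
  simp only [Sgn.val, zpow_neg, zpow_natCast, zpow_mul_nat, mul_pow]
  have h8' : T.qk ^ m - (T.qk ^ m)⁻¹ = - (1 - (T.qk ^ m) ^ 2) * (T.qk ^ m)⁻¹ := by
    field_simp; ring
  rw [h8', inv_pow]
  push_cast
  generalize T.pRatio m = P at *
  generalize T.qk ^ m = Q at *
  generalize (T.q ^ T.b i j) ^ m = y at *
  generalize T.q - T.q⁻¹ = w at *
  field_simp
  ring

end

end Params

/-! ### The Heisenberg system of a module -/

variable {X : SimpleType} {T : Params X}

-- Shortcuts for the instance search.
instance : Field (Mero X) := inferInstance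
instance : DivisionRing (Mero X) := inferInstance
instance : Ring (Mero X) := inferInstance
instance : Semiring (Mero X) := inferInstance

/-- The conditions on modules of level `(k,l)` other than the relations among the currents
`x^±_i(z)`. -/
structure URep.IsPreModule (T : Params X) (V : URep.{u} X) : Prop where
  common : IsCommon T V.wt V.x V.K V.qd
  truncated : IsTruncated T V.qd
  avee_zero : ∀ i, V.avee i 0 = 0
  avee_maps : ∀ i m ν, ∀ v ∈ V.wt ν, V.avee i m v ∈ V.wt ν
  avee_K : ∀ i m ε j v, V.K ε j (V.avee i m v) = V.avee i m (V.K ε j v)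
  avee_qd : ∀ i m v, V.qd (V.avee i m v) = T.q ^ m • V.avee i m (V.qd v)
  al_al : ∀ i j (l m : ℤ), l ≠ 0 → m ≠ 0 → ∀ v,
    V.al T i l (V.al T j m v) - V.al T j m (V.al T i l v) =
      (if l + m = 0 then T.cc i j l else 0) • v
  al_x : ∀ i c (l n : ℤ), l ≠ 0 → ∀ v,
    V.al T i l (V.x c.1 c.2 n v) - V.x c.1 c.2 n (V.al T i l v) =
      T.muX i c l • V.x c.1 c.2 (n + l) v

/-- An `𝔽`-linear operator as a `ℂ`-linear operator. -/
def restrictEnd (X : SimpleType) (V : Type u) [AddCommGroup V] [Module ℂ V] [Module (Mero X) V]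
    [IsScalarTower ℂ (Mero X) V] : Module.End (Mero X) V →ₐ[ℂ] Module.End ℂ V where
  toFun A := A.restrictScalars ℂ
  map_one' := rfl
  map_mul' _ _ := rfl
  map_zero' := rfl
  map_add' _ _ := rfl
  commutes' _ := rfl

section Trunc

variable {V : Type u} [AddCommGroup V] [Module ℂ V] [Module (Mero X) V]
  [IsScalarTower ℂ (Mero X) V] {qd : Module.End (Mero X) V}

lemma mem_degSpace {ω : ℂ} {v : V} : v ∈ degSpace T qd ω ↔ qd v = T.q ^ ω • v := by
  rw [degSpace, Module.End.mem_eigenspace_iff, algebraMap_smul]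

/-- An operator of degree `n` maps `V_ω` to `V_{ω+n}`, which vanishes for large `n`. -/
lemma IsTruncated.trunc' (hq : T.q ≠ 0) (h : IsTruncated T qd) :
    Trunc T.q (restrictEnd X V qd) := by
  intro v
  have hv : v ∈ ⨆ ω : ℂ, degSpace T qd ω := by rw [h.diag]; trivial
  induction hv using Submodule.iSup_induction' with
  | mem ω v hv =>
    obtain ⟨n₀, hn⟩ := h.trunc ω
    refine ⟨n₀, fun n hn' A hA => ?_⟩
    lift n to ℕ using (by omega)
    have : A v ∈ degSpace T qd (ω + n) := by
      rw [mem_degSpace] at hv ⊢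
      have h1 : qd (A v) = T.q ^ (n : ℤ) • A (qd v) := hA v
      rw [h1, hv, map_smul, smul_smul, Complex.cpow_add _ _ hq, Complex.cpow_natCast, zpow_natCast,
        mul_comm]
    rw [hn n (by exact_mod_cast hn')] at this
    exact (Submodule.mem_bot _).mp this
  | zero => exact ⟨0, fun n _ A _ => map_zero A⟩
  | add v w _ _ hv hw =>
    obtain ⟨D, hD⟩ := hv
    obtain ⟨D', hD'⟩ := hw
    refine ⟨max D D', fun n hn A hA => ?_⟩
    rw [map_add, hD n (lt_of_le_of_lt (le_max_left _ _) hn) A hA,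
      hD' n (lt_of_le_of_lt (le_max_right _ _) hn) A hA, add_zero]

end Trunc

lemma URep.IsUModule.isPreModule (hT : T.Generic) {V : URep.{u} X} (h : V.IsUModule T) :
    V.IsPreModule T where
  common := h.common
  truncated := h.truncated
  avee_zero := h.avee_zero
  avee_maps := h.avee_maps
  avee_K := h.avee_K
  avee_qd := h.avee_qd
  al_al i j l m hl hm v := by
    simp only [URep.al, LinearMap.smul_apply, LinearMap.map_smul_of_tower]
    rw [smul_comm (T.br (T.d j)), ← smul_sub, ← smul_sub, h.avee_avee i j l m hl hm, smul_smul,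
      smul_smul]
    congr 1
    split_ifs
    · rw [hT.cc_eq]
    · simp
  al_x i c l n hl v := by
    obtain ⟨ε, j⟩ := c
    have hlin := (h.common.Y_weight ε j n).linear.map_smul (T.br (T.d i)) (V.avee i l v)
    simp only [URep.al, LinearMap.smul_apply] at hlin ⊢
    rw [hlin, ← smul_sub]
    cases ε
    · rw [h.avee_xpos i j l n hl v, smul_smul, Params.muX, ← hT.br_mul_bri]
      congr 1; ring
    · rw [h.avee_xneg i j l n hl v, smul_smul, Params.muX, ← hT.br_mul_bri]
      congr 1; ring

/-- The exponents of `E^±(α_i, z)` and `E^±(α'_i, z)` in terms of the `α_{i,m}`. -/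
lemma eOp_eq {A : Type*} [Ring A] [Algebra ℂ A] (ε η : Sgn) (θ : ℤ) (al : X.Idx → ℤ → A)
    (i : X.Idx) : eOp T ε η θ al i = expCoeff fun m =>
      (θ * ((T.q - T.q⁻¹) / (T.qk ^ (m : ℤ) - T.qk ^ (-(m : ℤ)))) *
        T.primeRatio ε (η.val * m)) • al i (η.val * m) := by
  unfold eOp
  congr 1
  funext m
  cases ε
  · simp [heis, Params.primeRatio]
  · simp [heis, Params.primeRatio, smul_smul]

namespace URep.IsPreModule

variable {V : URep.{u} X} (h : V.IsPreModule T) (hT : T.Generic)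

include h in
lemma K_al (ε : Sgn) (i j : X.Idx) (m : ℤ) (v : V) :
    V.K ε i (V.al T j m v) = V.al T j m (V.K ε i v) := by
  simp only [URep.al, LinearMap.smul_apply, LinearMap.map_smul_of_tower, h.avee_K]

include h in
lemma qd_al (i : X.Idx) (m : ℤ) (v : V) :
    V.qd (V.al T i m v) = T.q ^ m • V.al T i m (V.qd v) := by
  simp only [URep.al, LinearMap.smul_apply, LinearMap.map_smul_of_tower, h.avee_qd]
  rw [smul_comm]

include h in
lemma al_maps (i : X.Idx) (m : ℤ) {ν : HStar X} {v : V} (hv : v ∈ V.wt ν) :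
    V.al T i m v ∈ V.wt ν := by
  simp only [URep.al, LinearMap.smul_apply]
  rw [← algebraMap_smul (Mero X)]
  exact (V.wt ν).smul_mem _ (h.avee_maps i m ν v hv)

/-- The operators `α_{i,m}` and `x^±_{i,n}` on `V` as a system of currents over a Heisenberg
algebra. -/
def system : HeisSystem X.Idx (Sgn × X.Idx) V where
  q := T.q
  hq := hT.q_ne
  qd := restrictEnd X V V.qd
  trunc := h.truncated.trunc' hT.q_ne
  al i m := restrictEnd X V (V.al T i m)
  cc := T.cc
  al_deg i m v := h.qd_al i m v
  al_comm i j l m hl hm := by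
    ext v
    have := h.al_al i j l m hl hm v
    rw [sub_eq_iff_eq_add, add_comm] at this
    exact this
  x c n := (h.common.Y_weight c.1 c.2 n).linear.mk'
  idx := Prod.snd
  μ := T.muX
  x_deg c n v := h.common.qd_Y c.1 c.2 n v
  al_x i c l n hl := by
    ext v
    have := h.al_x i c l n hl v
    rw [sub_eq_iff_eq_add, add_comm] at this
    exact this
  thM := T.thM
  thP := T.thP
  cancelM i c m hm := hT.cancelM i c m hm
  cancelP i c m hm := hT.cancelP i c m hm

lemma system_nondeg : (h.system hT).toHeisBase.Nondeg := fun _ hn => hT.cc_det hn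

/-- The dressed currents of the system are the operators `Z^±_i(z)`. -/
lemma system_z (c : Sgn × X.Idx) (n : ℤ) (v : V) :
    (h.system hT).z c n v = V.zOp T c.1 c.2 n v := by
  have := dress_apply (h.system hT).hq (h.system hT).trunc
    (L := (h.system hT).eL c.2 (T.thM c)) ((h.system hT).x_deg c)
    ((h.system hT).eR_deg c.2 (T.thP c)) n v
  refine this.trans (finsum_congr fun ab => ?_)
  have hL : (h.system hT).eL c.2 (T.thM c) ab.1 =
      restrictEnd X V (eOp T c.1 .neg (-c.1.val) (V.al T) c.2 ab.1) := by
    rw [eOp_eq, map_expCoeff]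
    show expCoeff _ _ = _
    congr 1
    funext m
    rw [map_smul, Params.thM]
    simp only [Sgn.val, neg_one_mul]
    rfl
  have hR : (h.system hT).eR c.2 (T.thP c) ab.2 =
      restrictEnd X V (eOp T c.1 .pos c.1.val (V.al T) c.2 ab.2) := by
    rw [eOp_eq, map_expCoeff]
    show expCoeff _ _ = _
    congr 1
    funext m
    rw [map_smul, Params.thP]
    simp only [Sgn.val, one_mul]
    rfl
  rw [hL, hR]
  rfl

lemma strC_eq (c c' : Sgn × X.Idx) : (h.system hT).strC c c' = T.contr c c' := rfl

end URep.IsPreModule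

/-! ### Relations of the currents and relations of the dressed currents -/

section TwoCoeff

variable {V : Type u} [AddCommGroup V] [Module ℂ V]

instance : Unique (Pairs 2) where
  default := ⟨(0, 1), Fin.zero_lt_one⟩
  uniq := by
    rintro ⟨⟨s, t⟩, h⟩
    refine Subtype.ext (Prod.ext ?_ ?_) <;> simp only at h ⊢ <;> apply Fin.ext <;>
      simp only [Fin.lt_def, Fin.val_zero, Fin.val_one] at h ⊢ <;> omega

lemma twoCoeff_eq (G : Fin 2 → Fin 2 → PowerSeries ℂ) (Y : Fin 2 → ℤ → Module.End ℂ V)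
    (N : Fin 2 → ℤ) (v : V) :
    twoCoeff (G 0 1) (fun n => Y 0 n) (fun n => Y 1 n) (N 0) (N 1) v =
      mulSer G (fun N => word Y N v) N := by
  unfold twoCoeff mulSer
  rw [← finsum_comp_equiv (Equiv.funUnique (Pairs 2) ℕ).symm]
  refine finsum_congr fun n => ?_
  have h : (default : Pairs 2) = ⟨(0, 1), Fin.zero_lt_one⟩ := rfl
  rw [Fintype.prod_unique, h]
  congr 1
  beta_reduce
  rw [word_succ, word_succ]
  simp [word, shift, h, sub_eq_add_neg]

lemma twoCoeff_X_mul (G : PowerSeries ℂ) (Y Y' : ℤ → V → V) (a b : ℤ) (v : V) :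
    twoCoeff (PowerSeries.X * G) Y Y' (a + 1) b v = twoCoeff G Y Y' a (b + 1) v := by
  unfold twoCoeff
  rw [finsum_of_injective (fun n : ℕ => n + 1) (add_left_injective 1)]
  · refine finsum_congr fun n => ?_
    rw [PowerSeries.coeff_succ_X_mul]
    congr 2
    · push_cast; ring
    · congr 1; push_cast; ring
  · intro n hn
    rcases n with _ | n
    · simp at hn
    · exact ⟨n, rfl⟩

lemma twoCoeff_C_mul (c : ℂ) (G : PowerSeries ℂ) (Y Y' : ℤ → V → V) (a b : ℤ) (v : V) :
    twoCoeff (PowerSeries.C c * G) Y Y' a b v = c • twoCoeff G Y Y' a b v := by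
  unfold twoCoeff
  rw [smul_finsum]
  exact finsum_congr fun n => by rw [PowerSeries.coeff_C_mul, smul_smul]

variable {q : ℂ} {qd : Module.End ℂ V} (hq : q ≠ 0) (ht : Trunc q qd)
  {Y Y' : ℤ → Module.End ℂ V} (hY : ∀ n, HasDeg q qd n (Y n)) (hY' : ∀ n, HasDeg q qd n (Y' n))

include ht hY' in
lemma finite_twoCoeff (G : PowerSeries ℂ) (a b : ℤ) (v : V) :
    (Function.support fun n : ℕ => PowerSeries.coeff n G • Y (a - n) (Y' (b + n) v)).Finite := by
  obtain ⟨D, hD⟩ := ht v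
  refine (Set.finite_Iic (D - b).toNat).subset fun n hn => ?_
  by_contra h
  rw [Set.mem_Iic, not_le] at h
  refine hn ?_
  simp only
  rw [hD (b + n) (by omega) _ (hY' _), map_zero, smul_zero]

include ht hY' in
lemma twoCoeff_sub (G G' : PowerSeries ℂ) (a b : ℤ) (v : V) :
    twoCoeff (G - G') (fun n => Y n) (fun n => Y' n) a b v =
      twoCoeff G (fun n => Y n) (fun n => Y' n) a b v -
        twoCoeff G' (fun n => Y n) (fun n => Y' n) a b v := by
  unfold twoCoeff
  rw [← finsum_sub_distrib (finite_twoCoeff ht hY' G a b v) (finite_twoCoeff ht hY' G' a b v)]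
  exact finsum_congr fun n => by rw [map_sub, sub_smul]

include ht hY' in
/-- Multiplication of the structure function by `1 - c w/z`. -/
lemma twoCoeff_one_sub_mul (c : ℂ) (G : PowerSeries ℂ) (a b : ℤ) (v : V) :
    twoCoeff ((1 - PowerSeries.C c * PowerSeries.X) * G) (fun n => Y n) (fun n => Y' n)
      (a + 1) b v =
      twoCoeff G (fun n => Y n) (fun n => Y' n) (a + 1) b v -
        c • twoCoeff G (fun n => Y n) (fun n => Y' n) a (b + 1) v := by
  rw [sub_mul, one_mul, twoCoeff_sub ht hY', mul_assoc, twoCoeff_C_mul, twoCoeff_X_mul]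

end TwoCoeff

variable {X : SimpleType} {T : Params X}

/-- The relations of the universal dynamical `Z`-algebra hold on the vector `v`. -/
structure ZRelAt (T : Params X) {V : Type u} [AddCommGroup V] [Module ℂ V]
    (Z : Sgn → X.Idx → ℤ → V → V) (K : Sgn → X.Idx → V → V) (v : V) : Prop where
  Z_Z : ∀ ε i j (a b : ℤ), twoCoeff (T.strZ i j) (Z ε i) (Z ε j) (a + 1) b v =
    - T.κm i j • twoCoeff (T.strZ j i) (Z ε j) (Z ε i) (b + 1) a v
  Zpos_Zneg : ∀ i j (a b : ℤ), twoCoeff (T.strMix i j) (Z .pos i) (Z .neg j) a b v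
      - twoCoeff (T.strMix j i) (Z .neg j) (Z .pos i) b a v =
    if i = j ∧ a + b = 0 then (T.qi i - (T.qi i)⁻¹)⁻¹ •
      (T.qk ^ a • K .pos i v - T.qk ^ (-a) • K .neg i v) else 0
  serre : ∀ ε i j, i ≠ j → ∀ (N : Fin (1 - X.cartan i j).toNat → ℤ) (M : ℤ),
    ∑ σ : Equiv.Perm (Fin (1 - X.cartan i j).toNat), ∑ r : Fin ((1 - X.cartan i j).toNat + 1),
      ((-1) ^ r.val * T.brBinom i (1 - X.cartan i j).toNat r.val) •
        multiCoeff
          (fun s t => T.strSerreZ ε (Fin.insertNth (α := fun _ => X.Idx) r j (fun _ => i) s)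
            (Fin.insertNth (α := fun _ => X.Idx) r j (fun _ => i) t))
          (fun t => Z ε (Fin.insertNth (α := fun _ => X.Idx) r j (fun _ => i) t))
          (Fin.insertNth (α := fun _ => ℤ) r M (fun t => N (σ t))) v = 0

section Transport

variable {V V' : Type u} [AddCommGroup V] [Module ℂ V] [AddCommGroup V'] [Module ℂ V']
  (f : V →ₗ[ℂ] V') (hf : Function.Injective f)

include hf

lemma map_twoCoeff (G : PowerSeries ℂ) {Y Y' : ℤ → V → V} {Y₁ Y₁' : ℤ → V' → V'}
    (h : ∀ n v, f (Y n v) = Y₁ n (f v)) (h' : ∀ n v, f (Y' n v) = Y₁' n (f v)) (a b : ℤ) (v : V) :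
    f (twoCoeff G Y Y' a b v) = twoCoeff G Y₁ Y₁' a b (f v) := by
  unfold twoCoeff
  refine (f.toAddMonoidHom.map_finsum_of_injective hf _).trans (finsum_congr fun n => ?_)
  show f (_ • _) = _
  rw [map_smul, h, h']

lemma map_multiCoeff {r : ℕ} (G : Fin r → Fin r → PowerSeries ℂ) {Y : Fin r → ℤ → V → V}
    {Y' : Fin r → ℤ → V' → V'} (h : ∀ t n v, f (Y t n v) = Y' t n (f v)) (N : Fin r → ℤ) (v : V) :
    f (multiCoeff G Y N v) = multiCoeff G Y' N (f v) := by
  unfold multiCoeff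
  refine (f.toAddMonoidHom.map_finsum_of_injective hf _).trans (finsum_congr fun e => ?_)
  show f (_ • _) = _
  rw [map_smul]
  congr 1
  have key : ∀ (r : ℕ) (g : Fin r → V → V) (g' : Fin r → V' → V') (_ : ∀ t v, f (g t v) =
      g' t (f v)),
      f ((List.ofFn g).foldr (fun f w => f w) v) = (List.ofFn g').foldr (fun f w => f w) (f v) := by
    intro r
    induction r with
    | zero => intro g g' _; simp
    | succ r ih =>
      intro g g' hg
      rw [List.ofFn_succ, List.ofFn_succ, List.foldr_cons, List.foldr_cons, hg,
        ih _ (fun t => g' t.succ) fun t => hg t.succ]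
  exact key r _ _ fun t v => h t _ v

/-- The relations of the `Z`-algebra may be checked after an injective intertwiner. -/
lemma zRelAt_map {Z : Sgn → X.Idx → ℤ → V → V} {K : Sgn → X.Idx → V → V}
    {Z' : Sgn → X.Idx → ℤ → V' → V'} {K' : Sgn → X.Idx → V' → V'}
    (hZ : ∀ ε i n v, f (Z ε i n v) = Z' ε i n (f v)) (hK : ∀ ε i v, f (K ε i v) = K' ε i (f v))
    (v : V) : ZRelAt T Z' K' (f v) ↔ ZRelAt T Z K v := by
  have h2 : ∀ G ε i ε' j a b, f (twoCoeff G (Z ε i) (Z ε' j) a b v) =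
      twoCoeff G (Z' ε i) (Z' ε' j) a b (f v) :=
    fun G ε i ε' j a b => map_twoCoeff f hf G (hZ ε i) (hZ ε' j) a b v
  have hr : ∀ {r : ℕ} (G : Fin r → Fin r → PowerSeries ℂ) ε (i : Fin r → X.Idx) N,
      f (multiCoeff G (fun t => Z ε (i t)) N v) = multiCoeff G (fun t => Z' ε (i t)) N (f v) :=
    fun G ε i N => map_multiCoeff f hf G (fun t => hZ ε (i t)) N v
  constructor
  · intro h
    refine ⟨fun ε i j a b => hf ?_, fun i j a b => hf ?_, fun ε i j hij N M => hf ?_⟩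
    · rw [map_smul, h2, h2, h.Z_Z]
    · rw [map_sub, h2, h2, h.Zpos_Zneg, apply_ite f, map_smul, map_sub, map_smul, map_smul, hK, hK,
        map_zero]
    · rw [map_zero, ← h.serre ε i j hij N M]
      simp only [map_sum, map_smul, hr]
  · intro h
    refine ⟨fun ε i j a b => ?_, fun i j a b => ?_, fun ε i j hij N M => ?_⟩
    · rw [← h2, ← h2, h.Z_Z, map_smul]
    · rw [← h2, ← h2, ← map_sub, h.Zpos_Zneg, apply_ite f, map_smul, map_sub, map_smul, map_smul,
        hK,
        hK, map_zero]
    · simp only [← hr, ← map_smul, ← map_sum]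
      rw [h.serre ε i j hij N M, map_zero]

end Transport

namespace HeisBase

variable {I : Type} {V : Type u} [AddCommGroup V] [Module ℂ V] (B : HeisBase I V)

/-- The coefficients of the constant current `1`. -/
def unitCur (V : Type u) [AddCommGroup V] [Module ℂ V] (n : ℤ) : Module.End ℂ V :=
  if n = 0 then 1 else 0

lemma unitCur_deg (n : ℤ) : HasDeg B.q B.qd n (unitCur V n) := by
  unfold unitCur
  split_ifs with h
  · subst h; exact HasDeg.one
  · exact HasDeg.zero

/-- The coefficients of `exp(∑_m th_m α_{i,-m} z^m) exp(∑_m th'_m α_{i,m} z^{-m})`. -/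
def vertex (i : I) (th th' : ℕ → ℂ) (n : ℤ) : Module.End ℂ V :=
  dress (B.eL i th) (unitCur V) (B.eR i th') n

lemma vertex_deg (i : I) (th th' : ℕ → ℂ) (n : ℤ) : HasDeg B.q B.qd n (B.vertex i th th' n) :=
  hasDeg_dress B.hq B.trunc B.unitCur_deg (B.eR_deg _ _) (B.eL_deg _ _) n

lemma vertex_apply (i : I) (th th' : ℕ → ℂ) (n : ℤ) (v : V) : B.vertex i th th' n v =
    ∑ᶠ ab : ℕ × ℕ, if (ab.2 : ℤ) - ab.1 = n then B.eL i th ab.1 (B.eR i th' ab.2 v) else 0 := by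
  rw [vertex, dress_apply B.hq B.trunc B.unitCur_deg (B.eR_deg _ _)]
  refine finsum_congr fun ab => ?_
  unfold unitCur
  have : (n + ab.1 - ab.2 = 0) ↔ ((ab.2 : ℤ) - ab.1 = n) := by omega
  rw [if_congr this rfl rfl]
  split_ifs <;> simp

lemma al_mul_vertex (i : I) (th th' : ℕ → ℂ) {ν : I → ℤ → ℂ}
    (hν : ∀ j (m : ℕ), 0 < m → th m * B.cc j i m = ν j m)
    (hν' : ∀ j (m : ℕ), 0 < m → th' m * B.cc j i (-m) = ν j (-m)) (j : I) (l n : ℤ) (hl : l ≠ 0) :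
    B.al j l * B.vertex i th th' n =
      B.vertex i th th' n * B.al j l + ν j l • B.vertex i th th' (n + l) := by
  refine B.al_mul_dress i th th' B.unitCur_deg (μ := fun _ _ => 0) (fun j l n _ => ?_)
    (fun j m hm => by rw [add_zero, hν j m hm]) (fun j m hm => by rw [add_zero,
      hν' j m hm]) j l n hl
  unfold unitCur
  split_ifs <;> simp

/-- The vacuum matrix elements of a vertex operator are those of the constant current `1`. -/
lemma mkQ_vertex (i : I) (th th' : ℕ → ℂ) (n : ℤ) {v : V} (hv : v ∈ B.vac) :
    B.J.mkQ (B.vertex i th th' n v) = if n = 0 then B.J.mkQ v else 0 := by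
  have hf := finite_dress B.hq B.trunc (L := B.eL i th) B.unitCur_deg (B.eR_deg i th') n v
  rw [vertex, dress_apply B.hq B.trunc B.unitCur_deg (B.eR_deg _ _), map_finsum' _ _ hf,
    finsum_eq_single _ (0, 0)]
  · have hL : B.eL i th 0 = 1 := expCoeff_zero _
    have hR : B.eR i th' 0 = 1 := expCoeff_zero _
    simp only [hL, hR, Nat.cast_zero, add_zero, sub_zero, Module.End.one_apply, unitCur]
    split_ifs <;> simp
  · rintro ⟨a, b⟩ hab
    rcases Nat.eq_zero_or_pos b with rfl | hb
    · have ha : 0 < a := Nat.pos_of_ne_zero fun h => hab (by rw [h])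
      exact (Submodule.Quotient.mk_eq_zero _).mpr (B.eL_mem_J _ _ ha _)
    · simp only [B.eR_vac _ _ hb hv, map_zero]

end HeisBase

variable {X : SimpleType} {T : Params X}

section MulWord

variable {V : Type u} [AddCommGroup V] [Module ℂ V] {q : ℂ} {qd : Module.End ℂ V} (hq : q ≠ 0)
  (ht : Trunc q qd)

include hq ht

lemma mulWord_two {Y : Fin 2 → ℤ → Module.End ℂ V} (hY : ∀ t n, HasDeg q qd n (Y t n))
    (G : Fin 2 → Fin 2 → PowerSeries ℂ) (N : Fin 2 → ℤ) (v : V) : mulWord G Y N v =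
      twoCoeff (G 0 1) (fun n => Y 0 n) (fun n => Y 1 n) (N 0) (N 1) v := by
  rw [mulWord_apply hq ht hY, twoCoeff_eq]

lemma mulWord_multi {r : ℕ} {Y : Fin r → ℤ → Module.End ℂ V} (hY : ∀ t n, HasDeg q qd n (Y t n))
    (G : Fin r → Fin r → PowerSeries ℂ) (N : Fin r → ℤ) (v : V) :
    mulWord G Y N v = multiCoeff G (fun t n => Y t n) N v := by
  rw [mulWord_apply hq ht hY, multiCoeff_eq]

end MulWord

namespace Params

variable (T)

/-- The exponents of the creation part of `φ^±_i`, in terms of the `α_{i,-m}`. -/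
def phL (ε : Sgn) (m : ℕ) : ℂ :=
  -((T.q - T.q⁻¹) * (match ε with | .pos => T.p ^ m | .neg => 1) / (1 - T.p ^ m))

/-- The exponents of the annihilation part of `φ^±_i`, in terms of the `α_{i,m}`. -/
def phR (ε : Sgn) (m : ℕ) : ℂ :=
  (T.q - T.q⁻¹) * (match ε with | .pos => 1 | .neg => T.p ^ m) / (1 - T.p ^ m)

/-- The coefficients of the commutators of `α_{i,l}` and `x^+_j(z) x^-_j(w)` at `w = q^{∓k} z`. -/
def muPhi (ε : Sgn) (i j : X.Idx) (l : ℤ) : ℂ :=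
  T.muX i (.pos, j) l * T.qk ^ (ε.val * l) + T.muX i (.neg, j) l

variable {T} (hT : T.Generic)

include hT

/-- The creation part of `φ^±_i` has the commutators with `α_{j,m}`, `m > 0`, which the product
`x^+_i(z) x^-_i(w)` has at `w = q^{∓k} z`. -/
lemma Generic.phL_mul_cc (ε : Sgn) (i j : X.Idx) {m : ℕ} (hm : 0 < m) :
    T.phL ε m * T.cc j i m = T.muPhi ε j i m := by
  obtain ⟨⟨h1, h2⟩, ⟨h3, h4⟩, h5⟩ := hT.nonzero hm
  have h6 : (m : ℂ) ≠ 0 := Nat.cast_ne_zero.mpr hm.ne'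
  have h7 := hT.q_sub_inv_ne
  cases ε <;>
  · rw [phL, muPhi, hT.cc_nat, hT.muX_pos_nat, hT.muX_neg_nat, hT.pRatio_nat, hT.p_pow]
    simp only [Sgn.val, one_mul, neg_one_mul, zpow_neg, zpow_natCast]
    generalize T.pStar ^ m = P at *
    generalize T.qk ^ m = Q at *
    generalize T.q - T.q⁻¹ = w at *
    field_simp
    ring

/-- The annihilation part of `φ^±_i` has the commutators with `α_{j,-m}`, `m > 0`, which the product
`x^+_i(z) x^-_i(w)` has at `w = q^{∓k} z`. -/
lemma Generic.phR_mul_cc (ε : Sgn) (i j : X.Idx) {m : ℕ} (hm : 0 < m) :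
    T.phR ε m * T.cc j i (-m) = T.muPhi ε j i (-m) := by
  obtain ⟨⟨h1, h2⟩, ⟨h3, h4⟩, h5⟩ := hT.nonzero hm
  have h6 : (m : ℂ) ≠ 0 := Nat.cast_ne_zero.mpr hm.ne'
  have h7 := hT.q_sub_inv_ne
  cases ε <;>
  · rw [phR, muPhi, hT.cc_neg _ _ hm, hT.muX_pos_neg _ _ hm, hT.muX_neg_neg, hT.pRatio_nat,
      hT.p_pow]
    simp only [Sgn.val, one_mul, neg_one_mul, zpow_neg, zpow_natCast, neg_neg]
    generalize T.pStar ^ m = P at *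
    generalize T.qk ^ m = Q at *
    generalize T.q - T.q⁻¹ = w at *
    field_simp
    ring

end Params

namespace URep.IsPreModule

variable {V : URep.{u} X} (h : V.IsPreModule T) (hT : T.Generic)

include h hT

lemma system_exp (i : X.Idx) (η : Sgn) (u : ℕ → ℂ) (n : ℕ) :
    expCoeff (fun m : ℕ => ((T.q - T.q⁻¹) * u m / (1 - T.p ^ m)) •
      (h.system hT).al i (η.val * m)) n = restrictEnd X V (expCoeff (fun m : ℕ =>
      ((T.qi i - (T.qi i)⁻¹) * u m / (1 - T.p ^ m)) • V.avee i (η.val * m)) n) := by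
  have hc : T.br (T.d i) * (T.q - T.q⁻¹) = T.qi i - (T.qi i)⁻¹ := by
    rw [hT.br_d_eq, div_mul_cancel₀ _ hT.q_sub_inv_ne]
  rw [map_expCoeff]
  congr 1
  funext m
  show _ • restrictEnd X V (V.al T i (η.val * m)) = _
  rw [← map_smul, URep.al, smul_smul, ← hc]
  congr 2
  ring

/-- `φ^±_i` is the product of `K^±_i` and a vertex operator in the `α_{i,m}`. -/
lemma phi_eq (ε : Sgn) (i : X.Idx) (M : ℤ) (v : V) :
    V.phi T ε i M v = V.K ε i ((h.system hT).vertex i (T.phL ε) (T.phR ε) M v) := by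
  rw [HeisBase.vertex_apply]
  have hL : ∀ (u : ℕ → ℂ) a, (h.system hT).eL i (fun m => -((T.q - T.q⁻¹) * u m / (1 - T.p ^ m))) a
      =
      restrictEnd X V (expCoeff (fun m : ℕ =>
      (-((T.qi i - (T.qi i)⁻¹) * u m / (1 - T.p ^ m))) • V.avee i (-m)) a) := by
    intro u a
    have := h.system_exp hT i .neg (fun m => - u m) a
    simp only [Sgn.val, neg_one_mul, mul_neg, neg_div] at this
    exact this
  have hR : ∀ (u : ℕ → ℂ) b, (h.system hT).eR i (fun m => (T.q - T.q⁻¹) * u m / (1 - T.p ^ m)) b =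
      restrictEnd X V (expCoeff (fun m : ℕ =>
      ((T.qi i - (T.qi i)⁻¹) * u m / (1 - T.p ^ m)) • V.avee i m) b) := by
    intro u b
    have := h.system_exp hT i .pos u b
    simp only [Sgn.val, one_mul] at this
    exact this
  cases ε <;>
  · unfold URep.phi Params.phL Params.phR
    simp only [hL, hR]
    rfl

lemma system_z_fun (c : Sgn × X.Idx) :
    (fun n => ((h.system hT).z c n : V → V)) = V.zOp T c.1 c.2 :=
  funext fun n => funext fun v => h.system_z hT c n v

/-- The quadratic relations of the currents `x^±_i(z)` and of the dressed currents. -/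
lemma x_x_iff (ε : Sgn) (i j : X.Idx) :
    (∀ (a b : ℤ) v,
      T.κ ^ X.mMat i j • twoCoeff (T.strU ε i j) (V.x ε i) (V.x ε j) (a + 1) b v
        - T.q ^ (ε.val * T.b i j) • twoCoeff (T.strU ε i j) (V.x ε i) (V.x ε j) a (b + 1) v =
      (T.κ ^ X.mMat i j * T.q ^ (ε.val * T.b i j)) •
          twoCoeff (T.strU ε j i) (V.x ε j) (V.x ε i) b (a + 1) v
        - twoCoeff (T.strU ε j i) (V.x ε j) (V.x ε i) (b + 1) a v) ↔
    ∀ (a b : ℤ), ∀ v ∈ V.vacuum T,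
      twoCoeff (T.strZ i j) (V.zOp T ε i) (V.zOp T ε j) (a + 1) b v =
        - T.κm i j • twoCoeff (T.strZ j i) (V.zOp T ε j) (V.zOp T ε i) (b + 1) a v := by
  let S := h.system hT
  let ch : Fin 2 → Sgn × X.Idx := ![(ε, i), (ε, j)]
  have key := HeisSystem.relation_iff S ch (h.system_nondeg hT) (K := Fin 4)
    ![Equiv.refl _, Equiv.refl _, Equiv.swap 0 1, Equiv.swap 0 1]
    ![T.κ ^ X.mMat i j, - T.q ^ (ε.val * T.b i j), - (T.κ ^ X.mMat i j * T.q ^ (ε.val * T.b i j)),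
      1]
    ![fun _ _ => T.strU ε i j, fun _ _ => T.strU ε i j, fun _ _ => T.strU ε j i,
      fun _ _ => T.strU ε j i]
    ![![1, 0], ![0, 1], ![1, 0], ![0, 1]] 1 (fun k => by fin_cases k <;> simp [Fin.sum_univ_two])
    (fun _ => 0) (fun _ => 0) HeisSystem.Covariant.zero (fun _ => HasDeg.zero)
    (fun _ _ _ => S.vac.zero_mem) (fun _ _ _ => rfl)
  have hx : ∀ (π : Fin 2 ≃ Fin 2) G N v, mulWord G (fun t => S.x (ch (π t))) N v =
      twoCoeff (G 0 1) (V.x (ch (π 0)).1 (ch (π 0)).2) (V.x (ch (π 1)).1 (ch (π 1)).2) (N 0)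
        (N 1) v :=
    fun π G N v => mulWord_two S.hq S.trunc (fun t n => S.x_deg (ch (π t)) n) G N v
  have hz : ∀ (π : Fin 2 ≃ Fin 2) G N v, mulWord G (fun t => S.z (ch (π t))) N v =
      twoCoeff (G 0 1) (V.zOp T (ch (π 0)).1 (ch (π 0)).2) (V.zOp T (ch (π 1)).1 (ch (π 1)).2)
        (N 0) (N 1) v := fun π G N v => by
    rw [mulWord_two S.hq S.trunc (fun t n => S.z_deg (ch (π t)) n) G N v, h.system_z_fun hT,
      h.system_z_fun hT]
  simp only [hx, hz] at key
  simp only [Fin.sum_univ_four, Matrix.cons_val, Equiv.refl_apply, Equiv.swap_apply_left,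
    Equiv.swap_apply_right, Pi.add_apply, ch, add_zero, LinearMap.zero_apply, one_smul, S, strC_eq,
    hT.strU_mul_contr] at key
  -- After the transfer the structure functions are `F^±_{ij}`, together with the linear factors of
  -- the quadratic relation; on the left these give the structure function of the `Z`-algebra.
  have hF : ∀ i j (a b : ℤ) v, twoCoeff (T.strZ i j) (V.zOp T ε i) (V.zOp T ε j) (a + 1) b v =
      twoCoeff (T.strSerreZ ε i j) (V.zOp T ε i) (V.zOp T ε j) (a + 1) b v -
        (T.q ^ (ε.val * T.b i j) * T.κm i j) •
          twoCoeff (T.strSerreZ ε i j) (V.zOp T ε i) (V.zOp T ε j) a (b + 1) v := by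
    intro i j a b v
    rw [← hT.one_sub_mul_strSerreZ ε i j, ← h.system_z_fun hT (ε, i), ← h.system_z_fun hT (ε, j)]
    exact twoCoeff_one_sub_mul S.trunc (fun n => S.z_deg (ε, j) n) _ _ a b v
  have hκ : T.κ ^ X.mMat i j = T.κm j i := by rw [Params.κm, X.mMat_swap i j, neg_neg]
  have hκ' : T.κm j i * T.κm i j = 1 := by
    rw [Params.κm_swap i j, inv_mul_cancel₀ (hT.κm_ne i j)]
  rw [hκ] at key ⊢
  refine Iff.trans ⟨fun hr N v => ?_, fun hr a b v => ?_⟩ (key.trans ⟨fun hr a b v hv => ?_,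
    fun hr N v hv => ?_⟩)
  · have := hr (N 0) (N 1) v
    rw [← sub_eq_zero] at this
    rw [← this]
    module
  · have := hr ![a, b] v
    simp only [Matrix.cons_val_zero, Matrix.cons_val_one] at this
    rw [← sub_eq_zero, ← this]
    module
  · have := hr ![a, b] v hv
    simp only [Matrix.cons_val_zero, Matrix.cons_val_one] at this
    rw [hF i j a b v, hF j i b a v, hT.symm j i, ← sub_eq_zero]
    have h2 := congrArg (fun v => T.κm i j • v) this
    simp only [smul_zero] at h2
    rw [← h2]
    generalize twoCoeff (T.strSerreZ ε i j) (V.zOp T ε i) (V.zOp T ε j) (a + 1) b v = A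
    generalize twoCoeff (T.strSerreZ ε i j) (V.zOp T ε i) (V.zOp T ε j) a (b + 1) v = B
    generalize twoCoeff (T.strSerreZ ε j i) (V.zOp T ε j) (V.zOp T ε i) (b + 1) a v = C
    generalize twoCoeff (T.strSerreZ ε j i) (V.zOp T ε j) (V.zOp T ε i) b (a + 1) v = D
    generalize T.q ^ (ε.val * T.b i j) = y
    match_scalars
    · linear_combination -hκ'
    · ring
    · ring
    · ring
  · have := hr (N 0) (N 1) v hv
    rw [hF i j _ _ v, hF j i _ _ v, hT.symm j i, ← sub_eq_zero] at this
    have h2 := congrArg (fun v => T.κm j i • v) this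
    simp only [smul_zero] at h2
    rw [← h2]
    generalize twoCoeff (T.strSerreZ ε i j) (V.zOp T ε i) (V.zOp T ε j) (N 0 + 1) (N 1) v = A
    generalize twoCoeff (T.strSerreZ ε i j) (V.zOp T ε i) (V.zOp T ε j) (N 0) (N 1 + 1) v = B
    generalize twoCoeff (T.strSerreZ ε j i) (V.zOp T ε j) (V.zOp T ε i) (N 1 + 1) (N 0) v = C
    generalize twoCoeff (T.strSerreZ ε j i) (V.zOp T ε j) (V.zOp T ε i) (N 1) (N 0 + 1) v = D
    generalize T.q ^ (ε.val * T.b i j) = y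
    match_scalars
    · ring
    · linear_combination y * hκ'
    · linear_combination T.κm j i * y * hκ'
    · linear_combination -hκ'

/-- The term `q^{εk a} K^ε_i φ^ε_i` of the mixed relations at `z^{-N_0} w^{-N_1}`, without
`(q_i - q_i⁻¹)⁻¹`. -/
def phiTerm (ε : Sgn) (i : X.Idx) (N : Fin 2 → ℤ) : Module.End ℂ V :=
  T.qk ^ (ε.val * N 0) • (V.K ε i * (h.system hT).vertex i (T.phL ε) (T.phR ε) (N 0 + N 1))

lemma covariant_phiTerm (ε : Sgn) (i : X.Idx) :
    (h.system hT).Covariant ![(.pos, i), (.neg, i)] (h.phiTerm hT ε i) := by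
  intro j l hl N
  have h1 := (h.system hT).al_mul_vertex i (T.phL ε) (T.phR ε) (ν := fun j l => T.muPhi ε j i l)
    (fun j m hm => hT.phL_mul_cc ε i j hm) (fun j m hm => hT.phR_mul_cc ε i j hm) j l (N 0 + N 1) hl
  have hK : (h.system hT).al j l * V.K ε i = V.K ε i * (h.system hT).al j l :=
    LinearMap.ext fun v => (h.K_al ε i j l v).symm
  simp only [phiTerm]
  rw [mul_smul_comm, ← mul_assoc, hK, mul_assoc, h1, mul_add, smul_add, smul_mul_assoc, mul_assoc]
  congr 1
  simp only [Fin.sum_univ_two, Matrix.cons_val_zero, Matrix.cons_val_one, Pi.add_apply,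
    Pi.single_eq_same, ne_eq, one_ne_zero, zero_ne_one, not_false_eq_true, Pi.single_eq_of_ne,
    add_zero]
  rw [show N 0 + l + N 1 = N 0 + N 1 + l by ring, ← add_assoc, mul_smul_comm, mul_add,
    zpow_add₀ hT.qk_ne, Params.muPhi]
  show _ = T.muX j (.pos, i) l • _ + T.muX j (.neg, i) l • _
  module

lemma phiTerm_deg (ε : Sgn) (i : X.Idx) (N : Fin 2 → ℤ) :
    HasDeg (h.system hT).q (h.system hT).qd (N 0 + N 1) (h.phiTerm hT ε i N) := by
  have hK : HasDeg (h.system hT).q (h.system hT).qd 0 (V.K ε i) := fun v => by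
    rw [zpow_zero, one_smul]
    exact (h.common.K_qd ε i v).symm
  have := (hK.mul (h.system hT).hq
    ((h.system hT).vertex_deg i (T.phL ε) (T.phR ε) (N 0 + N 1))).smul (T.qk ^ (ε.val * N 0))
  rwa [zero_add] at this

lemma K_vac (ε : Sgn) (i : X.Idx) {v : V} (hv : v ∈ V.vacuum T) : V.K ε i v ∈ V.vacuum T :=
  fun j m hm => by rw [← h.K_al, hv j m hm, map_zero]

/-- On the vacuum and modulo `J`, the current `φ^±_i` reduces to `K^±_i`. -/
lemma mkQ_phiTerm (ε : Sgn) (i : X.Idx) (N : Fin 2 → ℤ) {v : V} (hv : v ∈ (h.system hT).vac) :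
    (h.system hT).J.mkQ (h.phiTerm hT ε i N v) = (h.system hT).J.mkQ
      (if N 0 + N 1 = 0 then T.qk ^ (ε.val * N 0) • V.K ε i v else 0) := by
  have h1 := (h.system hT).mkQ_vertex i (T.phL ε) (T.phR ε) (N 0 + N 1) hv
  have h2 : (h.system hT).vertex i (T.phL ε) (T.phR ε) (N 0 + N 1) v -
      (if N 0 + N 1 = 0 then v else 0) ∈ (h.system hT).J := by
    rw [← Submodule.Quotient.mk_eq_zero, ← Submodule.mkQ_apply, map_sub, h1, apply_ite
      ((h.system hT).J.mkQ), map_zero, sub_self]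
  have hK : ∀ j m, 0 < m → V.K ε i * (h.system hT).al j (-m) = (h.system hT).al j (-m) * V.K ε i :=
    fun j m _ => LinearMap.ext fun v => h.K_al ε i j (-m) v
  have h3 := (h.system hT).J.smul_mem (T.qk ^ (ε.val * N 0)) ((h.system hT).mem_J_of_commute hK h2)
  rw [← sub_eq_zero, ← map_sub]
  refine (Submodule.Quotient.mk_eq_zero _).mpr ?_
  convert h3 using 1
  rw [map_sub, smul_sub, apply_ite (V.K ε i), map_zero, smul_ite, smul_zero]
  rfl

end URep.IsPreModule

variable {X : SimpleType} {T : Params X}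

namespace URep.IsPreModule

variable {V : URep.{u} X} (h : V.IsPreModule T) (hT : T.Generic)

include h hT

/-- The mixed relations of the currents `x^±_i(z)` and of the dressed currents. -/
lemma xpos_xneg_iff (i j : X.Idx) :
    (∀ (a b : ℤ) v,
      V.x .pos i a (V.x .neg j b v) - V.x .neg j b (V.x .pos i a v) =
        if i = j then (T.qi i - (T.qi i)⁻¹)⁻¹ •
          (T.qk ^ a • V.phi T .pos i (a + b) v - T.qk ^ (-a) • V.phi T .neg i (a + b) v) else 0) ↔
    ∀ (a b : ℤ), ∀ v ∈ V.vacuum T,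
      twoCoeff (T.strMix i j) (V.zOp T .pos i) (V.zOp T .neg j) a b v
          - twoCoeff (T.strMix j i) (V.zOp T .neg j) (V.zOp T .pos i) b a v =
        if i = j ∧ a + b = 0 then (T.qi i - (T.qi i)⁻¹)⁻¹ •
          (T.qk ^ a • V.K .pos i v - T.qk ^ (-a) • V.K .neg i v) else 0 := by
  let S := h.system hT
  let ch : Fin 2 → Sgn × X.Idx := ![(.pos, i), (.neg, j)]
  let w : ℂ := (T.qi i - (T.qi i)⁻¹)⁻¹
  let Φ : (Fin 2 → ℤ) → Module.End ℂ V := fun N => if i = j then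
    (-w) • (h.phiTerm hT .pos i N + (-1 : ℂ) • h.phiTerm hT .neg i N) else 0
  let Ψ : (Fin 2 → ℤ) → Module.End ℂ V := fun N => if i = j ∧ N 0 + N 1 = 0 then
    (-w) • (T.qk ^ (N 0) • V.K .pos i + (-1 : ℂ) • T.qk ^ (-N 0) • V.K .neg i) else 0
  have key := HeisSystem.relation_iff S ch (h.system_nondeg hT) (K := Fin 2)
    ![Equiv.refl _, Equiv.swap 0 1] ![1, -1] (fun _ _ _ => 1) (fun _ => 0) 0 (fun k => by simp)
    Φ Ψ ?_ ?_ ?_ ?_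
  · have hx : ∀ (π : Fin 2 ≃ Fin 2) G N v, mulWord G (fun t => S.x (ch (π t))) N v =
        twoCoeff (G 0 1) (V.x (ch (π 0)).1 (ch (π 0)).2) (V.x (ch (π 1)).1 (ch (π 1)).2)
          (N 0) (N 1) v :=
      fun π G N v => mulWord_two S.hq S.trunc (fun t n => S.x_deg (ch (π t)) n) G N v
    have hz : ∀ (π : Fin 2 ≃ Fin 2) G N v, mulWord G (fun t => S.z (ch (π t))) N v =
        twoCoeff (G 0 1) (V.zOp T (ch (π 0)).1 (ch (π 0)).2) (V.zOp T (ch (π 1)).1 (ch (π 1)).2)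
          (N 0) (N 1) v := fun π G N v => by
      rw [mulWord_two S.hq S.trunc (fun t n => S.z_deg (ch (π t)) n) G N v, h.system_z_fun hT,
        h.system_z_fun hT]
    have h1 : ∀ (Y Y' : ℤ → V → V) a b v, twoCoeff 1 Y Y' a b v = Y a (Y' b v) := by
      intro Y Y' a b v
      unfold twoCoeff
      rw [finsum_eq_single _ 0]
      · simp
      · intro n hn
        simp [PowerSeries.coeff_one, hn]
    have hΦ : ∀ N v, Φ N v = - if i = j then w • (T.qk ^ (N 0) • V.phi T .pos i (N 0 + N 1) v -
        T.qk ^ (-(N 0)) • V.phi T .neg i (N 0 + N 1) v) else 0 := by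
      intro N v
      simp only [Φ]
      split_ifs with hij
      · rw [h.phi_eq hT, h.phi_eq hT, LinearMap.smul_apply, LinearMap.add_apply,
          LinearMap.smul_apply, phiTerm, phiTerm, LinearMap.smul_apply, LinearMap.smul_apply,
          Module.End.mul_apply, Module.End.mul_apply]
        simp only [Sgn.val, one_mul, neg_one_mul]
        module
      · simp
    have hΨ : ∀ N v, Ψ N v = - if i = j ∧ N 0 + N 1 = 0 then w • (T.qk ^ (N 0) • V.K .pos i v -
        T.qk ^ (-(N 0)) • V.K .neg i v) else 0 := by
      intro N v
      simp only [Ψ]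
      split_ifs with hij
      · simp only [LinearMap.smul_apply, LinearMap.add_apply]
        module
      · simp
    simp only [hx, hz, hΦ, hΨ] at key
    simp only [Fin.sum_univ_two, Matrix.cons_val, Equiv.refl_apply, Equiv.swap_apply_left,
      Equiv.swap_apply_right, Pi.add_apply, ch, add_zero, Pi.zero_apply, one_smul, S, strC_eq,
      one_mul, hT.contr_mixed, hT.contr_mixed', h1, neg_smul, ← sub_eq_add_neg, sub_eq_zero] at key
    exact ⟨fun hr a b v hv => key.mp (fun N v => hr (N 0) (N 1) v) ![a, b] v hv,
      fun hr a b v => key.mpr (fun N v hv => hr (N 0) (N 1) v hv) ![a, b] v⟩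
  · by_cases hij : i = j
    · subst hij
      simp only [Φ, if_true]
      exact (((h.covariant_phiTerm hT .pos i)).add ((h.covariant_phiTerm hT .neg i).smul _)).smul _
    · simp only [Φ, if_neg hij]
      exact HeisSystem.Covariant.zero
  · intro N
    simp only [Φ, Fin.sum_univ_two, add_zero]
    split_ifs
    · exact ((h.phiTerm_deg hT .pos i N).add ((h.phiTerm_deg hT .neg i N).smul _)).smul _
    · exact HasDeg.zero
  · intro N v hv
    simp only [Ψ]
    split_ifs
    · exact S.vac.smul_mem _ (S.vac.add_mem (S.vac.smul_mem _ (h.K_vac hT .pos i hv))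
        (S.vac.smul_mem _ (S.vac.smul_mem _ (h.K_vac hT .neg i hv))))
    · exact S.vac.zero_mem
  · intro N v hv
    simp only [Φ, Ψ]
    by_cases hij : i = j
    · simp only [hij, true_and, if_true]
      subst hij
      rw [LinearMap.smul_apply, LinearMap.add_apply, LinearMap.smul_apply, map_smul, map_add,
        map_smul, h.mkQ_phiTerm hT .pos i N hv, h.mkQ_phiTerm hT .neg i N hv]
      simp only [Sgn.val, one_mul, neg_one_mul]
      split_ifs
      · simp only [LinearMap.smul_apply, LinearMap.add_apply, map_smul, map_add]
        rfl
      · simp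
    · simp [hij]

/-- The Serre relations of the currents `x^±_i(z)` and of the dressed currents. -/
lemma serre_iff (ε : Sgn) (i j : X.Idx) (a : ℕ) :
    SerreRel T (T.strU ε) (V.x ε) i j a ↔
    ∀ v ∈ V.vacuum T, ∀ (N : Fin a → ℤ) (M : ℤ),
    ∑ σ : Equiv.Perm (Fin a), ∑ r : Fin (a + 1), ((-1) ^ r.val * T.brBinom i a r.val) •
        multiCoeff
          (fun s t => T.strSerreZ ε (Fin.insertNth (α := fun _ => X.Idx) r j (fun _ => i) s)
            (Fin.insertNth (α := fun _ => X.Idx) r j (fun _ => i) t))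
          (fun t => V.zOp T ε (Fin.insertNth (α := fun _ => X.Idx) r j (fun _ => i) t))
          (Fin.insertNth (α := fun _ => ℤ) r M (fun t => N (σ t))) v = 0 := by
  let S := h.system hT
  -- the variable `w` is `none`, and `z_t` is `some t`
  let ch : Option (Fin a) → Sgn × X.Idx := fun t => (ε, t.elim j fun _ => i)
  let π : Equiv.Perm (Fin a) × Fin (a + 1) → Fin (a + 1) ≃ Option (Fin a) :=
    fun k => (finSuccEquiv' k.2).trans k.1.optionCongr
  have key := HeisSystem.relation_iff S ch (h.system_nondeg hT) π
    (fun k => (-1) ^ k.2.val * T.brBinom i a k.2.val)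
    (fun k s t => T.strU ε (ch (π k s)).2 (ch (π k t)).2)
    (fun _ => 0) 0 (fun k => by simp) (fun _ => 0) (fun _ => 0) HeisSystem.Covariant.zero
    (fun _ => HasDeg.zero) (fun _ _ _ => S.vac.zero_mem) (fun _ _ _ => rfl)
  have hπ : ∀ {α : Type} (f : Option (Fin a) → α) k t, f (π k t) =
      Fin.insertNth (α := fun _ => α) k.2 (f none) (fun t => f (some (k.1 t))) t := by
    intro α f k t
    refine Fin.succAboveCases k.2 ?_ (fun t => ?_) t
    · rw [Fin.insertNth_apply_same]
      simp [π]
    · rw [Fin.insertNth_apply_succAbove]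
      simp [π]
  have hch : ∀ k t, ch (π k t) = (ε, Fin.insertNth (α := fun _ => X.Idx) k.2 j (fun _ => i) t) :=
    fun k t => Prod.ext rfl (hπ (fun t => (ch t).2) k t)
  have hN : ∀ k (N : Option (Fin a) → ℤ), (fun t => (N + 0) (π k t)) =
      Fin.insertNth (α := fun _ => ℤ) k.2 (N none) (fun t => N (some (k.1 t))) := by
    intro k N
    funext t
    rw [add_zero]
    exact hπ N k t
  have hx : ∀ k G N v, mulWord G (fun t => S.x (ch (π k t))) N v =
      multiCoeff G (fun t => V.x ε (Fin.insertNth (α := fun _ => X.Idx) k.2 j (fun _ =>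
        i) t)) N v := by
    intro k G N v
    rw [mulWord_multi S.hq S.trunc (fun t n => S.x_deg (ch (π k t)) n)]
    simp only [hch]
    rfl
  have hz : ∀ k G N v, mulWord G (fun t => S.z (ch (π k t))) N v =
      multiCoeff G (fun t => V.zOp T ε (Fin.insertNth (α := fun _ => X.Idx) k.2 j (fun _ => i) t))
        N v := by
    intro k G N v
    rw [mulWord_multi S.hq S.trunc (fun t n => S.z_deg (ch (π k t)) n)]
    simp only [hch]
    rw [show (fun t n => ((S.z (ε, Fin.insertNth (α := fun _ => X.Idx) k.2 j (fun _ =>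
      i) t) n : V → V)))
      = fun t => V.zOp T ε (Fin.insertNth (α := fun _ => X.Idx) k.2 j (fun _ => i) t) from
      funext fun t => h.system_z_fun hT _]
  simp only [hx, hz, hN] at key
  simp only [hch, Fintype.sum_prod_type, S, strC_eq, hT.strU_mul_contr,
    LinearMap.zero_apply, add_zero] at key
  exact ⟨fun hr v hv N M => key.mp (fun N v => hr (fun t => N (some t)) (N none) v)
      (fun t => t.elim M N) v hv,
    fun hr N M v => key.mpr (fun N v hv => hr v hv (fun t => N (some t)) (N none))
      (fun t => t.elim M N) v⟩

/-- The relations among the currents `x^±_i(z)` hold if and only if the dressed currents satisfy the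
relations of the `Z`-algebra on the vacuum space. -/
theorem isUModule_iff : V.IsUModule T ↔ ∀ v ∈ V.vacuum T, ZRelAt T (V.zOp T) (fun ε i =>
    V.K ε i) v := by
  constructor
  · intro hU v hv
    exact ⟨fun ε i j a b => (h.x_x_iff hT ε i j).mp (hU.x_x ε i j) a b v hv,
      fun i j a b => (h.xpos_xneg_iff hT i j).mp (hU.xpos_xneg i j) a b v hv,
      fun ε i j hij N M => (h.serre_iff hT ε i j _).mp (hU.serre ε i j hij) v hv N M⟩
  · intro hZ
    have hbr : ∀ i, T.br (T.d i) ≠ 0 := hT.br_d_ne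
    have hx : ∀ i c (l n : ℤ), l ≠ 0 → ∀ v,
        V.avee i l (V.x c.1 c.2 n v) - V.x c.1 c.2 n (V.avee i l v) =
          ((T.br (T.d i))⁻¹ * T.muX i c l) • V.x c.1 c.2 (n + l) v := by
      intro i c l n hl v
      rw [mul_smul, ← h.al_x i c l n hl v, smul_sub]
      have hlin := (h.common.Y_weight c.1 c.2 n).linear.map_smul (T.br (T.d i)) (V.avee i l v)
      simp only [URep.al, LinearMap.smul_apply] at hlin ⊢
      rw [hlin, inv_smul_smul₀ (hbr i), inv_smul_smul₀ (hbr i)]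
    exact
      { common := h.common
        truncated := h.truncated
        avee_zero := h.avee_zero
        avee_maps := h.avee_maps
        avee_K := h.avee_K
        avee_qd := h.avee_qd
        avee_avee := fun i j l m hl hm v => by
          have := h.al_al i j l m hl hm v
          simp only [URep.al, LinearMap.smul_apply, LinearMap.map_smul_of_tower] at this
          rw [smul_comm (T.br (T.d j)), ← smul_sub, ← smul_sub, smul_smul] at this
          rw [← inv_smul_smul₀ (mul_ne_zero (hbr i) (hbr j)) (_ - _), this, smul_smul]
          congr 1
          split_ifs
          · rw [hT.cc_eq, inv_mul_cancel_left₀ (mul_ne_zero (hbr i) (hbr j))]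
          · simp
        avee_xpos := fun i j l n hl v => by
          rw [hx i (.pos, j) l n hl v, Params.muX, ← hT.br_mul_bri]
          congr 1
          rw [mul_div_assoc, mul_assoc, mul_assoc, mul_assoc, inv_mul_cancel_left₀ (hbr i)]
          ring
        avee_xneg := fun i j l n hl v => by
          rw [hx i (.neg, j) l n hl v, Params.muX, ← hT.br_mul_bri]
          congr 1
          rw [mul_div_assoc, mul_neg, mul_assoc, inv_mul_cancel_left₀ (hbr i)]
        x_x := fun ε i j => (h.x_x_iff hT ε i j).mpr fun a b v hv => (hZ v hv).Z_Z ε i j a b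
        xpos_xneg := fun i j => (h.xpos_xneg_iff hT i j).mpr
          fun a b v hv => (hZ v hv).Zpos_Zneg i j a b
        serre := fun ε i j hij => (h.serre_iff hT ε i j _).mpr
          fun v hv N M => (hZ v hv).serre ε i j hij N M }

end URep.IsPreModule

/-! ### Graded subspaces -/

section Graded

variable {F : Type*} [Ring F] {ι ι' : Type*} [DecidableEq ι] [DecidableEq ι'] {V V' : Type*}
    [AddCommGroup V] [Module F V]
  [AddCommGroup V'] [Module F V'] {wt : ι → Submodule F V} {wt' : ι' → Submodule F V'}

/-- The projection onto a summand of an internal direct sum. -/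
def wtProj (h : DirectSum.IsInternal wt) (ν : ι) : V →ₗ[F] V :=
  (wt ν).subtype ∘ₗ DirectSum.component F ι (fun ν => wt ν) ν ∘ₗ
    (LinearEquiv.ofBijective (DirectSum.coeLinearMap wt) h).symm.toLinearMap

lemma wtProj_mem (h : DirectSum.IsInternal wt) (ν : ι) (v : V) : wtProj h ν v ∈ wt ν :=
  Subtype.prop _

lemma wtProj_of_mem (h : DirectSum.IsInternal wt) {ν : ι} {v : V} (hv : v ∈ wt ν) (μ : ι) :
    wtProj h μ v = if ν = μ then v else 0 := by
  have h1 : (LinearEquiv.ofBijective (DirectSum.coeLinearMap wt) h).symm v =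
      DirectSum.lof F ι (fun ν => wt ν) ν ⟨v, hv⟩ := by
    rw [LinearEquiv.symm_apply_eq]
    exact (DirectSum.coeLinearMap_lof wt ν ⟨v, hv⟩).symm
  simp only [wtProj, LinearMap.comp_apply, LinearEquiv.coe_coe, h1, DirectSum.component.of]
  split_ifs with h2
  · subst h2; rfl
  · rfl

lemma exists_sum_wtProj (h : DirectSum.IsInternal wt) (v : V) :
    ∃ s : Finset ι, v = ∑ ν ∈ s, wtProj h ν v := by
  suffices ∃ s : Finset ι, ∀ t, s ⊆ t → v = ∑ ν ∈ t, wtProj h ν v by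
    obtain ⟨s, hs⟩ := this
    exact ⟨s, hs s subset_rfl⟩
  have hv : v ∈ ⨆ ν, wt ν := by rw [h.submodule_iSup_eq_top]; trivial
  induction hv using Submodule.iSup_induction' with
  | mem ν v hv =>
    refine ⟨{ν}, fun t ht => ?_⟩
    rw [Finset.sum_congr rfl fun μ _ => wtProj_of_mem h hv μ, Finset.sum_ite_eq,
      if_pos (Finset.singleton_subset_iff.mp ht)]
  | zero => exact ⟨∅, fun t _ => by simp⟩
  | add v w _ _ hv hw =>
    obtain ⟨s, hs⟩ := hv
    obtain ⟨s', hs'⟩ := hw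
    refine ⟨s ∪ s', fun t ht => ?_⟩
    simp only [map_add, Finset.sum_add_distrib]
    rw [← hs t (Finset.union_subset_left ht), ← hs' t (Finset.union_subset_right ht)]

lemma mem_wt_of_wtProj_eq (h : DirectSum.IsInternal wt) {ν : ι} {v : V} (hv : wtProj h ν v = v) :
    v ∈ wt ν := hv ▸ wtProj_mem h ν v

/-- Homogeneous maps commute with the projections. -/
lemma wtProj_map (h : DirectSum.IsInternal wt) (h' : DirectSum.IsInternal wt') {σ : ι → ι'}
    (hσ : Function.Injective σ) (A : V →+ V') (hA : ∀ ν, ∀ v ∈ wt ν, A v ∈ wt' (σ ν)) (ν : ι)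
      (v : V) :
    wtProj h' (σ ν) (A v) = A (wtProj h ν v) := by
  have hv : v ∈ ⨆ ν, wt ν := by rw [h.submodule_iSup_eq_top]; trivial
  induction hv using Submodule.iSup_induction' with
  | mem μ v hv =>
    rw [wtProj_of_mem h' (hA μ v hv), wtProj_of_mem h hv, apply_ite A, map_zero]
    exact if_congr hσ.eq_iff rfl rfl
  | zero => simp
  | add v w _ _ hv hw => simp only [map_add, hv, hw]

/-- A subspace is graded if and only if it is stable under the projections. -/
lemma le_iSup_inf_iff (h : DirectSum.IsInternal wt) (S : Submodule F V) :
    S ≤ ⨆ ν, S ⊓ wt ν ↔ ∀ ν, ∀ v ∈ S, wtProj h ν v ∈ S := by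
  constructor
  · intro hS ν v hv
    have hv' := hS hv
    clear hv
    induction hv' using Submodule.iSup_induction' with
    | mem μ w hw =>
      rw [wtProj_of_mem h hw.2]
      split_ifs
      exacts [hw.1, S.zero_mem]
    | zero => simp
    | add v w _ _ hv hw =>
      rw [map_add]
      exact S.add_mem hv hw
  · intro hS v hv
    obtain ⟨s, hs⟩ := exists_sum_wtProj h v
    rw [hs]
    exact Submodule.sum_mem _ fun ν _ => Submodule.mem_iSup_of_mem ν ⟨hS ν v hv, wtProj_mem h ν v⟩

/-- The kernels of homogeneous maps are graded. -/
lemma wtProj_ker (h : DirectSum.IsInternal wt) (h' : DirectSum.IsInternal wt') {σ : ι → ι'}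
    (hσ : Function.Injective σ) (A : V →+ V') (hA : ∀ ν, ∀ v ∈ wt ν, A v ∈ wt' (σ ν)) (ν : ι)
      {v : V}
    (hv : A v = 0) : A (wtProj h ν v) = 0 := by
  rw [← wtProj_map h h' hσ A hA, hv, map_zero]

lemma iSup_comap_subtype {S : Submodule F V} (hS : S ≤ ⨆ ν, S ⊓ wt ν) :
    ⨆ ν, (wt ν).comap S.subtype = ⊤ := by
  refine Submodule.map_injective_of_injective S.injective_subtype ?_
  rw [Submodule.map_iSup, Submodule.map_top, Submodule.range_subtype]
  simp only [Submodule.map_comap_subtype]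
  exact le_antisymm (iSup_le fun ν => inf_le_left) hS

lemma isInternal_comap_subtype (h : DirectSum.IsInternal wt) {S : Submodule F V}
    (hS : S ≤ ⨆ ν, S ⊓ wt ν) : DirectSum.IsInternal fun ν => (wt ν).comap S.subtype := by
  rw [DirectSum.isInternal_submodule_iff_iSupIndep_and_iSup_eq_top]
  refine ⟨fun ν => ?_, iSup_comap_subtype hS⟩
  rw [Submodule.disjoint_def]
  intro v hv hv'
  have h1 : (v : V) ∈ ⨆ μ, ⨆ (_ : μ ≠ ν), wt μ := by
    have h2 := Submodule.mem_map_of_mem (f := S.subtype) hv'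
    simp only [Submodule.map_iSup] at h2
    exact iSup_mono (fun μ => iSup_mono fun _ => Submodule.map_comap_le _ _) h2
  exact Subtype.ext (Submodule.disjoint_def.mp (h.submodule_iSupIndep ν) v hv h1)

end Graded

/-! ### The vacuum space is a module over the `Z`-algebra -/

variable {X : SimpleType} {T : Params X}

lemma iSupIndep_eigenspace {K V ι : Type*} [Field K] [AddCommGroup V] [Module K V]
    (f : Module.End K V) {c : ι → K} (hc : Function.Injective c) :
    iSupIndep fun i => f.eigenspace (c i) :=
  (Module.End.eigenspaces_iSupIndep f).comp hc

section Trunc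

variable {V : Type u} [AddCommGroup V] [Module ℂ V] [Module (Mero X) V]
  [IsScalarTower ℂ (Mero X) V] {qd : Module.End (Mero X) V}

/-- The eigenvalues `q^ω` of `q^d`. -/
abbrev DegIdx (T : Params X) : Type := Set.range fun ω : ℂ => T.q ^ ω

/-- The eigenspaces of `q^d`, indexed by the eigenvalues. -/
def eigSpace (T : Params X) (qd : Module.End (Mero X) V) (c : DegIdx T) : Submodule (Mero X) V :=
  Module.End.eigenspace qd (algebraMap ℂ (Mero X) c)

lemma mem_eigSpace {c : DegIdx T} {v : V} : v ∈ eigSpace T qd c ↔ qd v = (c : ℂ) • v := by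
  rw [eigSpace, Module.End.mem_eigenspace_iff, algebraMap_smul]

lemma IsTruncated.internal (h : IsTruncated T qd) : DirectSum.IsInternal (eigSpace T qd) := by
  rw [DirectSum.isInternal_submodule_iff_iSupIndep_and_iSup_eq_top]
  refine ⟨?_, ?_⟩
  · exact iSupIndep_eigenspace qd
      ((algebraMap ℂ (Mero X)).injective.comp Subtype.val_injective)
  · rw [eq_top_iff, ← h.diag]
    exact iSup_le fun ω => le_iSup (eigSpace T qd) ⟨T.q ^ ω, ω, rfl⟩

/-- Shift of the eigenvalues by `q^n`. -/
def shiftIdx (hq : T.q ≠ 0) (n : ℤ) (c : DegIdx T) : DegIdx T :=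
  ⟨T.q ^ n * c, by
    obtain ⟨_, ω, rfl⟩ := c
    refine ⟨n + ω, ?_⟩
    simp only
    rw [Complex.cpow_add _ _ hq, Complex.cpow_intCast]⟩

lemma shiftIdx_injective (hq : T.q ≠ 0) (n : ℤ) : Function.Injective (shiftIdx hq n) := by
  intro c c' h
  exact Subtype.ext (mul_left_cancel₀ (zpow_ne_zero n hq) (congrArg Subtype.val h))

/-- A subspace stable under the projections onto the eigenspaces of `q^d` is truncated. -/
lemma IsTruncated.restrict (h : IsTruncated T qd) {S : Submodule (Mero X) V}
    (hqd : ∀ v ∈ S, qd v ∈ S) (hS : ∀ c, ∀ v ∈ S, wtProj h.internal c v ∈ S) :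
    IsTruncated T (qd.restrict hqd) := by
  have hdeg : ∀ ω, degSpace T (qd.restrict hqd) ω = (degSpace T qd ω).comap S.subtype := by
    intro ω
    ext v
    rw [mem_degSpace, Submodule.mem_comap, mem_degSpace]
    exact Subtype.ext_iff
  refine ⟨?_, fun ω => ?_⟩
  · simp only [hdeg]
    refine iSup_comap_subtype (((le_iSup_inf_iff h.internal S).mpr hS).trans (iSup_le fun c => ?_))
    obtain ⟨_, ω, rfl⟩ := c
    exact le_iSup (fun ω => S ⊓ degSpace T qd ω) ω
  · obtain ⟨n₀, hn⟩ := h.trunc ω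
    refine ⟨n₀, fun n hn' => ?_⟩
    rw [hdeg, hn n hn', Submodule.comap_bot, LinearMap.ker_eq_bot]
    exact S.injective_subtype

end Trunc

lemma centralProd_induction {V : Type u} [AddCommGroup V] [Module ℂ V]
    {K : X.Idx → Module.End ℂ V} {P : Module.End ℂ V → Prop} (h1 : P 1)
    (hmul : ∀ A B, P A → P B → P (A * B)) (hK : ∀ i, P (K i)) : P (centralProd T K) := by
  refine List.prod_induction P hmul h1 fun A hA => ?_
  obtain ⟨i, -, rfl⟩ := List.mem_map.mp hA
  induction T.a i with
  | zero => rwa [pow_zero]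
  | succ n ih => rw [pow_succ]; exact hmul _ _ ih (hK i)

namespace URep.IsPreModule

variable {V V' : URep.{u} X} (h : V.IsPreModule T) (h' : V'.IsPreModule T) (hT : T.Generic)

include h hT in
lemma finite_zOp (ε : Sgn) (i : X.Idx) (n : ℤ) (v : V) : (Function.support fun ab : ℕ × ℕ =>
    eOp T ε .neg (-ε.val) (V.al T) i ab.1
      (V.x ε i (n + ab.1 - ab.2) (eOp T ε .pos ε.val (V.al T) i ab.2 v))).Finite := by
  let S := h.system hT
  have hR : ∀ b : ℕ, HasDeg S.q S.qd b
      (restrictEnd X V (eOp T ε .pos ε.val (V.al T) i b)) := by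
    intro b
    rw [eOp_eq, map_expCoeff]
    have := HasDeg.expCoeff (q := S.q) (qd := S.qd) (s := 1) (c := fun m => restrictEnd X V
      ((ε.val * ((T.q - T.q⁻¹) / (T.qk ^ (m : ℤ) - T.qk ^ (-(m : ℤ)))) *
        T.primeRatio ε (Sgn.pos.val * m)) • V.al T i (Sgn.pos.val * m))) (fun m _ => by
        rw [map_smul]; exact (S.al_deg i _).smul _) b
    rwa [one_mul] at this
  exact finite_dress S.hq S.trunc
    (L := fun a => restrictEnd X V (eOp T ε .neg (-ε.val) (V.al T) i a))
    (fun n => S.x_deg (ε, i) n) hR n v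

include h hT in
/-- A linear map which commutes with the `α_{i,m}` and, up to a constant, with the currents
`x^±_i(z)`, commutes with the dressed currents up to the same constant. -/
lemma map_zOp (φ : V →ₗ[ℂ] V') (hal : ∀ i m v, φ (V.al T i m v) = V'.al T i m (φ v)) (ε : Sgn)
    (i : X.Idx) (c : ℂ) (hx : ∀ n v, φ (V.x ε i n v) = c • V'.x ε i n (φ v)) (n : ℤ) (v : V) :
    φ (V.zOp T ε i n v) = c • V'.zOp T ε i n (φ v) := by
  have he : ∀ η θ m v, φ (eOp T ε η θ (V.al T) i m v) = eOp T ε η θ (V'.al T) i m (φ v) := by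
    intro η θ m v
    have h1 := expCoeff_intertwine φ (c := fun m => restrictEnd X V
      ((θ * ((T.q - T.q⁻¹) / (T.qk ^ (m : ℤ) - T.qk ^ (-(m : ℤ)))) *
        T.primeRatio ε (η.val * m)) • V.al T i (η.val * m)))
      (c' := fun m => restrictEnd X V'
      ((θ * ((T.q - T.q⁻¹) / (T.qk ^ (m : ℤ) - T.qk ^ (-(m : ℤ)))) *
        T.primeRatio ε (η.val * m)) • V'.al T i (η.val * m))) (fun m _ v => by
        rw [map_smul, map_smul, LinearMap.smul_apply, LinearMap.smul_apply, map_smul]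
        congr 1
        exact hal i _ v) m v
    rw [← map_expCoeff, ← map_expCoeff] at h1
    rw [eOp_eq, eOp_eq]
    exact h1
  unfold URep.zOp
  rw [map_finsum' φ _ (h.finite_zOp hT ε i n v)]
  rw [smul_finsum]
  refine finsum_congr fun ab => ?_
  rw [he, hx, he, LinearMap.map_smul_of_tower]

include h hT in
/-- The dressed currents have the weights of the currents, since the `α_{i,m}` have weight zero. -/
lemma zOp_weight (ε : Sgn) (i : X.Idx) (n : ℤ) :
    HasWeight V.wt (wtX X ε i) (V.zOp T ε i n) := by
  have hz := h.system_z hT (ε, i) n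
  refine ⟨⟨fun v w => ?_, fun c v => ?_⟩, fun g v => ?_, fun ν v hv => ?_⟩
  · rw [← hz, ← hz, ← hz, map_add]
  · rw [← hz, ← hz, map_smul]
  · unfold URep.zOp
    rw [smul_finsum]
    refine finsum_congr fun ab => ?_
    rw [← map_smul, (h.common.Y_weight ε i _).shift, map_smul]
  · have he : ∀ η θ m ν, ∀ v ∈ V.wt ν, eOp T ε η θ (V.al T) i m v ∈ V.wt ν := by
      intro η θ m ν
      -- The `𝔽`-linear operators preserving `V_ν` form a subalgebra containing the `α_{i,m}`.
      let B : Subalgebra ℂ (Module.End (Mero X) V) :=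
        { carrier := {A | ∀ v ∈ V.wt ν, A v ∈ V.wt ν}
          mul_mem' := fun ha hb v hv => ha _ (hb v hv)
          add_mem' := fun ha hb v hv => (V.wt ν).add_mem (ha v hv) (hb v hv)
          algebraMap_mem' := fun c v hv => by
            rw [Module.algebraMap_end_apply, ← algebraMap_smul (Mero X)]
            exact (V.wt ν).smul_mem _ hv }
      rw [eOp_eq]
      exact expCoeff_mem B (fun m _ => B.smul_mem (fun v hv => h.al_maps i _ hv) _) m
    exact finsum_induction (· ∈ V.wt (ν + wtX X ε i)) (Submodule.zero_mem _)
      (fun _ _ => Submodule.add_mem _) fun ab => he _ _ _ _ _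
        ((h.common.Y_weight ε i _).maps ν _ (he _ _ _ _ _ hv))

include h in
lemma qd_vac (hq : T.q ≠ 0) {v : V} (hv : v ∈ V.vacuum T) : V.qd v ∈ V.vacuum T := fun i m hm => by
  have := h.qd_al i m v
  rw [hv i m hm, map_zero, eq_comm, smul_eq_zero] at this
  exact this.resolve_left (zpow_ne_zero _ hq)

include h hT in
lemma vacuumStable : V.VacuumStable T where
  Z ε i n v hv := by
    rw [← h.system_z hT (ε, i)]
    exact (h.system hT).z_vac (ε, i) n hv
  K ε i v hv := h.K_vac hT ε i hv
  qd v hv := h.qd_vac hT.q_ne hv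

include h in
lemma wtProj_vac (ν : HStar X) {v : V} (hv : v ∈ V.vacuum T) :
    wtProj h.common.internal ν v ∈ V.vacuum T := fun i m hm =>
  wtProj_ker h.common.internal h.common.internal (σ := id) Function.injective_id
    (V.al T i m).toAddMonoidHom (fun _ _ hv => h.al_maps i m hv) ν (hv i m hm)

include h in
/-- The vacuum space is a kernel of operators which shift the eigenvalues of `q^d` injectively,
hence it is the sum of its intersections with the eigenspaces. -/
lemma eigProj_vac (hq : T.q ≠ 0) (c : DegIdx T) {v : V} (hv : v ∈ V.vacuum T) :
    wtProj h.truncated.internal c v ∈ V.vacuum T := fun i m hm =>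
  wtProj_ker h.truncated.internal h.truncated.internal (shiftIdx_injective hq m)
    (V.al T i m).toAddMonoidHom (fun c v hv => by
      rw [mem_eigSpace] at hv ⊢
      show V.qd (V.al T i m v) = (T.q ^ m * c) • V.al T i m v
      rw [h.qd_al, hv, LinearMap.map_smul_of_tower, smul_smul]) c (hv i m hm)

include h hT in
lemma zOp_K (ε : Sgn) (i : X.Idx) (ε' : Sgn) (j : X.Idx) (n : ℤ) (v : V) :
    V.K ε i (V.zOp T ε' j n v) =
      T.q ^ (ε.val * ε'.val * T.b i j) • V.zOp T ε' j n (V.K ε i v) :=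
  h.map_zOp hT (V.K ε i) (h.K_al ε i) ε' j _ (fun n v => h.common.K_Y ε i ε' j n v) n v

include h hT in
lemma zOp_centralProd (ε ε' : Sgn) (j : X.Idx) (n : ℤ) (v : V) :
    centralProd T (V.K ε) (V.zOp T ε' j n v) = V.zOp T ε' j n (centralProd T (V.K ε) v) := by
  have hal : ∀ i m v, centralProd T (V.K ε) (V.al T i m v) = V.al T i m (centralProd T (V.K ε) v) :=
    centralProd_induction (P := fun A => ∀ i m v, A (V.al T i m v) = V.al T i m (A v))
      (fun _ _ _ => rfl) (fun A B hA hB i m v => by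
        rw [Module.End.mul_apply, Module.End.mul_apply, hB, hA]) (fun i j m v => h.K_al ε i j m v)
  rw [h.map_zOp hT (centralProd T (V.K ε)) hal ε' j 1
    (fun n v => by rw [one_smul]; exact h.common.central_Y ε ε' j n v) n v, one_smul]

end URep.IsPreModule

variable {X : SimpleType} {T : Params X}

lemma map_centralProd {V V' : Type u} [AddCommGroup V] [Module ℂ V] [AddCommGroup V'] [Module ℂ V']
    (φ : V →ₗ[ℂ] V') {K : X.Idx → Module.End ℂ V} {K' : X.Idx → Module.End ℂ V'}
    (h : ∀ i v, φ (K i v) = K' i (φ v)) (v : V) :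
    φ (centralProd T K v) = centralProd T K' (φ v) := by
  have hp : ∀ i n v, φ ((K i ^ n) v) = (K' i ^ n) (φ v) := by
    intro i n
    induction n with
    | zero => intro v; simp
    | succ n ih => intro v; rw [pow_succ, pow_succ, Module.End.mul_apply, ih, h]; rfl
  unfold centralProd
  induction List.finRange (X.rank + 1) with
  | nil => simp
  | cons i L ih =>
    rw [List.map_cons, List.prod_cons, List.map_cons, List.prod_cons, Module.End.mul_apply, hp, ih]
    rfl

/-- The conditions on the grading and on `K^±_i`, `q^d` pass to a graded subspace. -/
lemma IsCommon.comap {V W : Type u} [AddCommGroup V] [Module ℂ V] [Module (Mero X) V]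
    [IsScalarTower ℂ (Mero X) V] [AddCommGroup W] [Module ℂ W] [Module (Mero X) W]
    [IsScalarTower ℂ (Mero X) W]
    {wt : HStar X → Submodule (Mero X) V} {wt' : HStar X → Submodule (Mero X) W}
    {Y : Sgn → X.Idx → ℤ → V → V} {Y' : Sgn → X.Idx → ℤ → W → W} {K : Sgn → X.Idx → Module.End ℂ V}
    {K' : Sgn → X.Idx → Module.End ℂ W} {qd : Module.End (Mero X) V} {qd' : Module.End (Mero X) W}
    (φ : V →ₗ[Mero X] W) (hφ : Function.Injective φ) (hwt : ∀ ν v, v ∈ wt ν ↔ φ v ∈ wt' ν)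
    (hK : ∀ ε i v, φ (K ε i v) = K' ε i (φ v))
    (hqd : ∀ v, φ (qd v) = qd' (φ v)) (h : IsCommon T wt' Y' K' qd')
    {Z' : Sgn → X.Idx → ℤ → W → W} (hZ : ∀ ε i n v, φ (Y ε i n v) = Z' ε i n (φ v))
    (internal : DirectSum.IsInternal wt)
    (Z_weight : ∀ ε j n, HasWeight wt' (wtX X ε j) (Z' ε j n))
    (K_Z : ∀ ε i ε' j n v,
      K' ε i (Z' ε' j n v) = T.q ^ (ε.val * ε'.val * T.b i j) • Z' ε' j n (K' ε i v))
    (qd_Z : ∀ ε j n v, qd' (Z' ε j n v) = T.q ^ n • Z' ε j n (qd' v))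
    (central_Z : ∀ ε ε' j n v,
      centralProd T (K' ε) (Z' ε' j n v) = Z' ε' j n (centralProd T (K' ε) v))
    (K_surj : ∀ ε i, Function.Surjective (K ε i)) (qd_surj : Function.Surjective qd) :
    IsCommon T wt Y K qd := by
  have hs : ∀ (c : ℂ) v, φ (c • v) = c • φ v := fun c v => LinearMap.map_smul_of_tower φ c v
  have hC : ∀ ε v, φ (centralProd T (K ε) v) = centralProd T (K' ε) (φ v) := fun ε v =>
    map_centralProd (φ.restrictScalars ℂ) (fun i v => hK ε i v) v
  exact
    { internal := internal
      Y_weight := fun ε j n =>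
        { linear := ⟨fun v w => hφ (by rw [hZ, map_add, map_add, (Z_weight ε j n).linear.map_add,
              hZ, hZ]),
            fun c v => hφ (by rw [hZ, hs, hs, (Z_weight ε j n).linear.map_smul, hZ])⟩
          shift := fun g v => hφ (by
            rw [map_smul, hZ, hZ, map_smul, (Z_weight ε j n).shift])
          maps := fun ν v hv => by
            rw [hwt, hZ]
            exact (Z_weight ε j n).maps ν _ ((hwt ν v).mp hv) }
      K_weight := fun ε j =>
        { linear := (K ε j).isLinear
          shift := fun g v => hφ (by
            rw [map_smul, hK, hK, map_smul, (h.K_weight ε j).shift])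
          maps := fun ν v hv => by
            rw [hwt, hK]
            exact (h.K_weight ε j).maps ν _ ((hwt ν v).mp hv) }
      qd_maps := fun ν v hv => by
        rw [hwt, hqd]
        exact h.qd_maps ν _ ((hwt ν v).mp hv)
      K_bij := fun ε j => ⟨fun v w hvw => hφ ((h.K_bij ε j).1 (by rw [← hK, ← hK, hvw])),
        K_surj ε j⟩
      qd_bij := ⟨fun v w hvw => hφ (h.qd_bij.1 (by rw [← hqd, ← hqd, hvw])), qd_surj⟩
      K_comm := fun ε ε' i j => LinearMap.ext fun v => hφ (by
        rw [Module.End.mul_apply, Module.End.mul_apply, hK, hK, hK, hK]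
        exact LinearMap.congr_fun (h.K_comm ε ε' i j) (φ v))
      K_qd := fun ε i v => hφ (by rw [hK, hqd, hqd, hK, h.K_qd])
      K_Y := fun ε i ε' j n v => hφ (by rw [hK, hZ, hs, hZ, hK, K_Z])
      qd_Y := fun ε j n v => hφ (by rw [hqd, hZ, hs, hZ, hqd, qd_Z])
      central_Y := fun ε ε' j n v => hφ (by rw [hC, hZ, hZ, hC, central_Z])
      central_F := fun ε g v => hφ (by
        rw [hC, map_smul, h.central_F, LinearMap.map_smul, hC])
      level := fun v => hφ (by rw [hC, hs, h.level]) }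

/-- The vacuum spaces are modules over the `Z`-algebra. -/
theorem omegaWellDefined (hT : T.Generic) : OmegaWellDefined.{u} T where
  stable V := (V.isModule.isPreModule hT).vacuumStable hT
  isModule V := by
    have h := V.isModule.isPreModule hT
    have hst := h.vacuumStable hT
    have hrel := (h.isUModule_iff hT).mp V.isModule
    have hZ : ∀ v : V.rep.vacuum T, ZRelAt T (V.rep.vacuumRep T hst).Z
        (fun ε i => (V.rep.vacuumRep T hst).K ε i) v := fun v =>
      (zRelAt_map ((V.rep.vacuum T).subtype.restrictScalars ℂ) (V.rep.vacuum T).injective_subtype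
        (fun _ _ _ _ => rfl) (fun _ _ _ => rfl) v).mp (hrel v v.2)
    refine ⟨?_, ?_, fun ε i j a b v => (hZ v).Z_Z ε i j a b,
      fun i j a b v => (hZ v).Zpos_Zneg i j a b, fun ε i j hij N M v => (hZ v).serre ε i j hij N M⟩
    · refine IsCommon.comap (V.rep.vacuum T).subtype (V.rep.vacuum T).injective_subtype
        (fun _ _ => Iff.rfl) (fun _ _ _ => rfl) (fun _ => rfl) h.common (Z' := V.rep.zOp T)
        (fun _ _ _ _ => rfl) ?_ (h.zOp_weight hT) (h.zOp_K hT) ?_ (h.zOp_centralProd hT) ?_ ?_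
      · exact isInternal_comap_subtype h.common.internal
          ((le_iSup_inf_iff h.common.internal _).mpr fun ν v hv => h.wtProj_vac ν hv)
      · intro ε j n v
        rw [← h.system_z hT (ε, j), ← h.system_z hT (ε, j)]
        exact (h.system hT).z_deg (ε, j) n v
      · intro ε i (w : V.rep.vacuum T)
        obtain ⟨v, hv⟩ := (h.common.K_bij ε i).2 w
        refine ⟨⟨v, fun j m hm => (h.common.K_bij ε i).1 ?_⟩, Subtype.ext hv⟩
        rw [h.K_al, hv, w.2 j m hm, map_zero]
      · intro (w : V.rep.vacuum T)
        obtain ⟨v, hv⟩ := h.common.qd_bij.2 w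
        refine ⟨⟨v, fun j m hm => h.common.qd_bij.1 ?_⟩, Subtype.ext hv⟩
        rw [h.qd_al, hv, w.2 j m hm, map_zero, smul_zero]
    · exact h.truncated.restrict hst.qd fun c v hv => h.eigProj_vac hT.q_ne c hv
  isHom {V V'} φ := by
    have h := V.isModule.isPreModule hT
    have h' := V'.isModule.isPreModule hT
    refine ⟨fun ν (v : V.rep.vacuum T) hv => φ.isHom.wt ν v hv,
      fun ε i n (v : V.rep.vacuum T) => Subtype.ext ?_,
      fun ε i (v : V.rep.vacuum T) => Subtype.ext (φ.isHom.K ε i v),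
      fun (v : V.rep.vacuum T) => Subtype.ext (φ.isHom.qd v)⟩
    have := h.map_zOp (V' := V'.rep) hT (φ.map.restrictScalars ℂ) (fun i m v => ?_) ε i 1
      (fun n v => by rw [one_smul]; exact φ.isHom.x ε i n v) n v
    · rwa [one_smul] at this
    · show φ.map (T.br (T.d i) • V.rep.avee i m v) = T.br (T.d i) • V'.rep.avee i m (φ.map v)
      rw [← φ.isHom.avee, LinearMap.map_smul_of_tower]

/-! ### The Fock space -/

variable {X : SimpleType} {T : Params X}

lemma fockAl_pos (i : X.Idx) (n : ℕ+) : fockAl T i (n : ℕ) =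
    ∑ j : X.Idx, T.cc i j n • (MvPolynomial.pderiv (j, n)).toLinearMap := by
  obtain ⟨n, rfl⟩ : ∃ m : ℕ, n = m.succPNat := ⟨n.natPred, (PNat.succPNat_natPred n).symm⟩
  show fockAl T i (Int.ofNat (n + 1)) = _
  simp only [fockAl, Params.cc, Nat.succPNat_coe, Nat.succ_eq_add_one]
  refine Finset.sum_congr rfl fun j _ => ?_
  congr 1
  push_cast
  norm_cast

lemma fockAl_neg (i : X.Idx) (n : ℕ+) : fockAl T i (-(n : ℕ)) =
    LinearMap.mulLeft ℂ (MvPolynomial.X (i, n)) := by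
  obtain ⟨n, rfl⟩ : ∃ m : ℕ, n = m.succPNat := ⟨n.natPred, (PNat.succPNat_natPred n).symm⟩
  rfl

lemma fockAl_zero (i : X.Idx) : fockAl T i 0 = 0 := rfl

lemma fockAl_pos_apply (i : X.Idx) (n : ℕ+) (f : Fock X) : fockAl T i (n : ℕ) f =
    ∑ j : X.Idx, T.cc i j n • MvPolynomial.pderiv (j, n) f := by
  rw [fockAl_pos, LinearMap.sum_apply]; rfl

lemma fockAl_neg_apply (i : X.Idx) (n : ℕ+) (f : Fock X) : fockAl T i (-(n : ℕ)) f =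
    MvPolynomial.X (i, n) * f := by
  rw [fockAl_neg]; rfl

lemma int_cases {l : ℤ} (hl : l ≠ 0) : (∃ n : ℕ+, l = (n : ℕ)) ∨ ∃ n : ℕ+, l = -(n : ℕ) := by
  rcases lt_or_gt_of_ne hl with h | h
  · exact Or.inr ⟨⟨l.natAbs, by omega⟩, by show l = -(l.natAbs : ℤ); omega⟩
  · exact Or.inl ⟨⟨l.natAbs, by omega⟩, by show l = (l.natAbs : ℤ); omega⟩

lemma pderiv_comm {σ : Type*} (s t : σ) (f : MvPolynomial σ ℂ) :
    MvPolynomial.pderiv s (MvPolynomial.pderiv t f) =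
      MvPolynomial.pderiv t (MvPolynomial.pderiv s f) := by
  classical
  have h : ⁅MvPolynomial.pderiv (R := ℂ) s, MvPolynomial.pderiv (R := ℂ) t⁆ = 0 := by
    refine MvPolynomial.derivation_ext fun i => ?_
    rw [Derivation.commutator_apply, MvPolynomial.pderiv_X, MvPolynomial.pderiv_X]
    have h1 : ∀ j : σ, (Pi.single (M := fun _ => MvPolynomial σ ℂ) j 1 : σ → MvPolynomial σ ℂ) i =
        MvPolynomial.C (if i = j then 1 else 0) := fun j => by
      rw [Pi.single_apply]; split_ifs <;> simp
    rw [h1, h1, MvPolynomial.pderiv_C, MvPolynomial.pderiv_C, sub_zero]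
    rfl
  have := congrArg (fun D => D f) h
  simp only [Derivation.commutator_apply, Derivation.coe_zero, Pi.zero_apply] at this
  exact sub_eq_zero.mp this

/-- The Heisenberg relations on the Fock space. -/
lemma fockAl_comm (hT : T.Generic) (i j : X.Idx) {l m : ℤ} (hl : l ≠ 0) (hm : m ≠ 0) :
    fockAl T i l * fockAl T j m = fockAl T j m * fockAl T i l +
      (if l + m = 0 then T.cc i j l else 0) • (1 : Module.End ℂ (Fock X)) := by
  have key : ∀ i j (n m : ℕ+), fockAl T i (n : ℕ) * fockAl T j (-(m : ℕ)) =
      fockAl T j (-(m : ℕ)) * fockAl T i (n : ℕ) +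
        (if n = m then T.cc i j n else 0) • (1 : Module.End ℂ (Fock X)) := by
    intro i j n m
    refine LinearMap.ext fun f => ?_
    simp only [Module.End.mul_apply, LinearMap.add_apply, LinearMap.smul_apply,
      Module.End.one_apply]
    rw [fockAl_neg_apply, fockAl_pos_apply, fockAl_neg_apply, fockAl_pos_apply, Finset.mul_sum]
    have : ∀ j', T.cc i j' n • MvPolynomial.pderiv (j', n) (MvPolynomial.X (j, m) * f) =
        MvPolynomial.X (j, m) * T.cc i j' n • MvPolynomial.pderiv (j', n) f +
          (if j' = j then (if n = m then T.cc i j n else 0) • f else 0) := by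
      intro j'
      rw [MvPolynomial.pderiv_mul, smul_add, mul_smul_comm, add_comm]
      congr 1
      by_cases h1 : j' = j
      · subst h1
        by_cases h2 : n = m
        · subst h2; simp
        · rw [MvPolynomial.pderiv_X_of_ne (fun h => h2 (congrArg Prod.snd h).symm)]
          simp [h2]
      · rw [MvPolynomial.pderiv_X_of_ne (fun h => h1 (congrArg Prod.fst h).symm)]
        simp [h1]
    rw [Finset.sum_congr rfl fun j' _ => this j', Finset.sum_add_distrib, Finset.sum_ite_eq',
      if_pos (Finset.mem_univ j)]
  rcases int_cases hl with ⟨n, rfl⟩ | ⟨n, rfl⟩ <;> rcases int_cases hm with ⟨m, rfl⟩ | ⟨m, rfl⟩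
  · rw [if_neg (by have := n.pos; omega), zero_smul, add_zero]
    refine LinearMap.ext fun f => ?_
    simp only [Module.End.mul_apply, fockAl_pos_apply, map_sum, Derivation.map_smul]
    rw [Finset.sum_comm]
    refine Finset.sum_congr rfl fun j _ => Finset.sum_congr rfl fun j' _ => ?_
    rw [pderiv_comm, smul_comm]
  · rw [key]
    congr 2
    exact if_congr (by rw [← PNat.coe_inj]; omega) rfl rfl
  · rw [key j i m n, add_assoc, ← add_smul]
    have : (if m = n then T.cc j i m else 0) +
        (if -((n : ℕ) : ℤ) + (m : ℕ) = 0 then T.cc i j (-(n : ℕ)) else 0) = 0 := by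
      by_cases h : m = n
      · subst h
        rw [if_pos rfl, if_pos (by omega), hT.cc_swap j i (by simp)]
        simp
      · rw [if_neg h, if_neg (by rw [← PNat.coe_inj] at h; omega), add_zero]
    rw [this, zero_smul, add_zero]
  · rw [if_neg (by have := n.pos; omega), zero_smul, add_zero]
    refine LinearMap.ext fun f => ?_
    simp only [Module.End.mul_apply, fockAl_neg_apply]
    ring

/-- The degree of a monomial: `α_{i,-n}` has degree `n`. -/
def fockDeg (m : X.Idx × ℕ+ →₀ ℕ) : ℕ := m.sum fun s e => (s.2 : ℕ) * e

lemma fockQd_monomial (m : X.Idx × ℕ+ →₀ ℕ) (a : ℂ) :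
    fockQd T (MvPolynomial.monomial m a) =
      T.q ^ (-(fockDeg m : ℤ)) • MvPolynomial.monomial m a := by
  have h : ∀ s : X.Idx × ℕ+, ∀ e : ℕ, (MvPolynomial.C (T.q ^ (-(s.2 : ℤ))) * MvPolynomial.X s) ^ e =
      MvPolynomial.C (σ := X.Idx × ℕ+) ((T.q⁻¹) ^ ((s.2 : ℕ) * e)) * MvPolynomial.X s ^ e := by
    intro s e
    rw [mul_pow, ← map_pow, zpow_neg, zpow_natCast, pow_mul]
    simp only [inv_pow]
  show MvPolynomial.aeval _ _ = _
  rw [MvPolynomial.aeval_monomial, MvPolynomial.monomial_eq]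
  simp only [h]
  rw [Finsupp.prod_mul, zpow_neg, zpow_natCast, ← inv_pow, MvPolynomial.smul_eq_C_mul,
    MvPolynomial.algebraMap_eq, mul_left_comm, fockDeg, Finsupp.sum, ← Finset.prod_pow_eq_pow_sum,
    map_prod]
  rfl

lemma coeff_fockQd (m : X.Idx × ℕ+ →₀ ℕ) (f : Fock X) :
    (fockQd T f).coeff m = T.q ^ (-(fockDeg m : ℤ)) * f.coeff m := by
  classical
  induction f using MvPolynomial.induction_on' with
  | monomial m' a =>
    rw [fockQd_monomial, MvPolynomial.coeff_smul, MvPolynomial.coeff_monomial]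
    split_ifs with h
    · rw [h]; rfl
    · simp
  | add f g hf hg => rw [map_add, MvPolynomial.coeff_add, hf, hg, MvPolynomial.coeff_add, mul_add]

lemma fockQd_X_mul (s : X.Idx × ℕ+) (f : Fock X) : fockQd T (MvPolynomial.X s * f) =
    T.q ^ (-(s.2 : ℤ)) • (MvPolynomial.X s * fockQd T f) := by
  show MvPolynomial.aeval _ _ = _
  rw [map_mul, MvPolynomial.aeval_X, MvPolynomial.smul_eq_C_mul, ← mul_assoc]
  rfl

lemma fockQd_pderiv (hq : T.q ≠ 0) (s : X.Idx × ℕ+) (f : Fock X) :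
    fockQd T (MvPolynomial.pderiv s f) =
      T.q ^ (s.2 : ℤ) • MvPolynomial.pderiv s (fockQd T f) := by
  classical
  induction f using MvPolynomial.induction_on with
  | C a =>
    rw [MvPolynomial.pderiv_C, map_zero]
    show _ = _ • MvPolynomial.pderiv s (MvPolynomial.aeval _ (MvPolynomial.C a))
    rw [MvPolynomial.aeval_C, MvPolynomial.algebraMap_eq, MvPolynomial.pderiv_C, smul_zero]
  | add f g hf hg => simp only [map_add, hf, hg, smul_add]
  | mul_X f t hf =>
    rw [mul_comm f, MvPolynomial.pderiv_mul, fockQd_X_mul, map_add, fockQd_X_mul, hf,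
      Derivation.map_smul, MvPolynomial.pderiv_mul]
    by_cases h : s = t
    · subst h
      rw [MvPolynomial.pderiv_X_self, one_mul, one_mul, smul_add, smul_add, smul_smul,
        ← zpow_add₀ hq, add_neg_cancel, zpow_zero, one_smul, mul_smul_comm, smul_comm]
    · rw [MvPolynomial.pderiv_X_of_ne (Ne.symm h), zero_mul, zero_mul, map_zero, zero_add, zero_add,
        mul_smul_comm, smul_comm]

lemma fockAl_deg (hq : T.q ≠ 0) (i : X.Idx) (m : ℤ) (f : Fock X) :
    fockQd T (fockAl T i m f) = T.q ^ m • fockAl T i m (fockQd T f) := by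
  by_cases hm : m = 0
  · subst hm; simp [fockAl_zero]
  rcases int_cases hm with ⟨n, rfl⟩ | ⟨n, rfl⟩
  · rw [fockAl_pos_apply, fockAl_pos_apply, map_sum, Finset.smul_sum]
    refine Finset.sum_congr rfl fun j _ => ?_
    rw [map_smul, fockQd_pderiv hq, smul_comm]
  · rw [fockAl_neg_apply, fockAl_neg_apply, fockQd_X_mul]

lemma fockQd_bijective (hq : T.q ≠ 0) : Function.Bijective (fockQd T) := by
  let R : Fock X →ₗ[ℂ] Fock X := (MvPolynomial.aeval fun in' : X.Idx × ℕ+ =>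
    MvPolynomial.C (T.q ^ (in'.2 : ℤ)) * MvPolynomial.X in' : Fock X →ₐ[ℂ] Fock X).toLinearMap
  have h1 : ∀ f, R (fockQd T f) = f := by
    intro f
    have : ((MvPolynomial.aeval fun in' : X.Idx × ℕ+ =>
        MvPolynomial.C (T.q ^ (in'.2 : ℤ)) * MvPolynomial.X in' : Fock X →ₐ[ℂ] Fock X).comp
      (MvPolynomial.aeval fun in' : X.Idx × ℕ+ =>
        MvPolynomial.C (T.q ^ (-(in'.2 : ℤ))) * MvPolynomial.X in' : Fock X →ₐ[ℂ] Fock X)) =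
        AlgHom.id ℂ _ := by
      refine MvPolynomial.algHom_ext fun s => ?_
      simp only [AlgHom.comp_apply, MvPolynomial.aeval_X, map_mul, MvPolynomial.algHom_C,
        MvPolynomial.algebraMap_eq, AlgHom.id_apply]
      rw [← mul_assoc, ← map_mul, ← zpow_add₀ hq, neg_add_cancel, zpow_zero, map_one, one_mul]
    exact AlgHom.congr_fun this f
  have h2 : ∀ f, fockQd T (R f) = f := by
    intro f
    have : ((MvPolynomial.aeval fun in' : X.Idx × ℕ+ =>
        MvPolynomial.C (T.q ^ (-(in'.2 : ℤ))) * MvPolynomial.X in' : Fock X →ₐ[ℂ] Fock X).comp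
      (MvPolynomial.aeval fun in' : X.Idx × ℕ+ =>
        MvPolynomial.C (T.q ^ (in'.2 : ℤ)) * MvPolynomial.X in' : Fock X →ₐ[ℂ] Fock X)) =
        AlgHom.id ℂ _ := by
      refine MvPolynomial.algHom_ext fun s => ?_
      simp only [AlgHom.comp_apply, MvPolynomial.aeval_X, map_mul, MvPolynomial.algHom_C,
        MvPolynomial.algebraMap_eq, AlgHom.id_apply]
      rw [← mul_assoc, ← map_mul, ← zpow_add₀ hq, add_neg_cancel, zpow_zero, map_one, one_mul]
    exact AlgHom.congr_fun this f
  exact ⟨Function.LeftInverse.injective h1, Function.RightInverse.surjective h2⟩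

/-! ### Tensor products with the Fock space -/

section Graded

variable {F : Type*} [Ring F] {ι : Type*} [DecidableEq ι] {V : Type*} [AddCommGroup V] [Module F V]

/-- A spanning family of subspaces with compatible projections is an internal direct sum. -/
lemma isInternal_of_proj {wt : ι → Submodule F V} (P : ι → V →ₗ[F] V)
    (hP : ∀ ν, ∀ v ∈ wt ν, P ν v = v) (hP' : ∀ ν μ, μ ≠ ν → ∀ v ∈ wt μ, P ν v = 0)
    (htop : ⨆ ν, wt ν = ⊤) : DirectSum.IsInternal wt := by
  rw [DirectSum.isInternal_submodule_iff_iSupIndep_and_iSup_eq_top]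
  refine ⟨fun ν => ?_, htop⟩
  rw [Submodule.disjoint_def]
  intro v hv hv'
  have : ⨆ μ, ⨆ (_ : μ ≠ ν), wt μ ≤ LinearMap.ker (P ν) :=
    iSup_le fun μ => iSup_le fun hμ v hv => LinearMap.mem_ker.mpr (hP' ν μ hμ v hv)
  rw [← hP ν v hv]
  exact this hv'

end Graded

section Tensor

variable {W : Type u} [AddCommGroup W] [Module ℂ W] [Module (Mero X) W]
  [IsScalarTower ℂ (Mero X) W]

instance : IsScalarTower ℂ (Mero X) (W ⊗[ℂ] Fock X) := TensorProduct.isScalarTower_left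

variable {wt : HStar X → Submodule (Mero X) W}

/-- The grading of `W ⊗ F` by the weights of `W`. -/
def tensorWt (wt : HStar X → Submodule (Mero X) W) (ν : HStar X) :
    Submodule (Mero X) (W ⊗[ℂ] Fock X) :=
  Submodule.span (Mero X) {t | ∃ w ∈ wt ν, ∃ f : Fock X, t = w ⊗ₜ[ℂ] f}

lemma tmul_mem_tensorWt {ν : HStar X} {w : W} (hw : w ∈ wt ν) (f : Fock X) :
    w ⊗ₜ[ℂ] f ∈ tensorWt wt ν := Submodule.subset_span ⟨w, hw, f, rfl⟩

lemma iSup_eq_top_of_tmul {κ : Type*} {A : κ → Submodule (Mero X) W} (hA : ⨆ k, A k = ⊤)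
    (D : Submodule (Mero X) (W ⊗[ℂ] Fock X)) (hD : ∀ k, ∀ w ∈ A k, ∀ f : Fock X, w ⊗ₜ[ℂ] f ∈ D) :
    D = ⊤ := by
  rw [eq_top_iff]
  rintro t -
  induction t using TensorProduct.induction_on with
  | zero => exact D.zero_mem
  | add t t' ht ht' => exact D.add_mem ht ht'
  | tmul w f =>
    have hw : w ∈ ⨆ k, A k := by rw [hA]; trivial
    induction hw using Submodule.iSup_induction' with
    | mem k w hw => exact hD k w hw f
    | zero => rw [TensorProduct.zero_tmul]; exact D.zero_mem
    | add w w' _ _ hw hw' => rw [TensorProduct.add_tmul]; exact D.add_mem hw hw'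

/-- The projections onto the weight spaces of `W ⊗ F`. -/
def tensorProj (h : DirectSum.IsInternal wt) (ν : HStar X) :
    W ⊗[ℂ] Fock X →ₗ[Mero X] W ⊗[ℂ] Fock X :=
  TensorProduct.AlgebraTensorModule.map (wtProj h ν) LinearMap.id

lemma tensorProj_tmul (h : DirectSum.IsInternal wt) (ν : HStar X) (w : W) (f : Fock X) :
    tensorProj h ν (w ⊗ₜ[ℂ] f) = wtProj h ν w ⊗ₜ[ℂ] f := rfl

lemma tensorWt_internal (h : DirectSum.IsInternal wt) : DirectSum.IsInternal (tensorWt wt) := by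
  refine isInternal_of_proj (tensorProj h) (fun ν v hv => ?_) (fun ν μ hμ v hv => ?_) ?_
  · have : tensorWt wt ν ≤ LinearMap.eqLocus (tensorProj h ν) LinearMap.id := by
      refine Submodule.span_le.mpr ?_
      rintro _ ⟨w, hw, f, rfl⟩
      show tensorProj h ν (w ⊗ₜ[ℂ] f) = w ⊗ₜ[ℂ] f
      rw [tensorProj_tmul, wtProj_of_mem h hw, if_pos rfl]
    exact this hv
  · have : tensorWt wt μ ≤ LinearMap.ker (tensorProj h ν) := by
      refine Submodule.span_le.mpr ?_
      rintro _ ⟨w, hw, f, rfl⟩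
      show tensorProj h ν (w ⊗ₜ[ℂ] f) = 0
      rw [tensorProj_tmul, wtProj_of_mem h hw, if_neg hμ, TensorProduct.zero_tmul]
    exact this hv
  · exact iSup_eq_top_of_tmul h.submodule_iSup_eq_top _ fun ν w hw f =>
      Submodule.mem_iSup_of_mem ν (tmul_mem_tensorWt hw f)

lemma tensor_smul_tmul (g : Mero X) (w : W) (f : Fock X) :
    g • (w ⊗ₜ[ℂ] f) = (g • w) ⊗ₜ[ℂ] f := rfl

/-- If `A` has weight `χ`, then so does `A ⊗ E`. -/
lemma HasWeight.tensor {χ : HStar X} {A : Module.End ℂ W} (hA : HasWeight wt χ A)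
    (E : Module.End ℂ (Fock X)) : HasWeight (tensorWt wt) χ (TensorProduct.map A E) := by
  have hs : ∀ (g : Mero X) (t : W ⊗[ℂ] Fock X),
      g • TensorProduct.map A E t = TensorProduct.map A E (trans χ g • t) := by
    intro g t
    induction t using TensorProduct.induction_on with
    | zero => simp
    | add t t' ht ht' => rw [map_add, smul_add, ht, ht', smul_add, map_add]
    | tmul w f =>
      rw [TensorProduct.map_tmul, tensor_smul_tmul, hA.shift, tensor_smul_tmul,
        TensorProduct.map_tmul]
  refine ⟨(TensorProduct.map A E).isLinear, hs, fun ν t ht => ?_⟩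
  induction ht using Submodule.span_induction with
  | mem t ht =>
    obtain ⟨w, hw, f, rfl⟩ := ht
    exact tmul_mem_tensorWt (hA.maps ν w hw) _
  | zero => rw [map_zero]; exact Submodule.zero_mem _
  | add t t' _ _ ht ht' => rw [map_add]; exact Submodule.add_mem _ ht ht'
  | smul g t _ ht =>
    -- The translate of a suitable scalar is `g`.
    have := hs ((trans χ).symm g) t
    rw [RingEquiv.apply_symm_apply] at this
    rw [← this]
    exact Submodule.smul_mem _ _ ht

variable {qd : Module.End (Mero X) W}

/-- The Fock space has only nonpositive degrees, so that the degrees of `W ⊗ F` are bounded above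
along each coset of `ℤ` if those of `W` are. -/
lemma IsTruncated.tensor (hq : T.q ≠ 0) (h : IsTruncated T qd) :
    IsTruncated T (TensorProduct.AlgebraTensorModule.map qd (fockQd T)) := by
  refine ⟨iSup_eq_top_of_tmul h.diag _ fun ω w hw f => ?_, fun ω => ?_⟩
  · rw [mem_degSpace] at hw
    induction f using MvPolynomial.induction_on' with
    | monomial m a =>
      refine Submodule.mem_iSup_of_mem (ω - fockDeg m) ?_
      rw [mem_degSpace, TensorProduct.AlgebraTensorModule.map_tmul, hw, fockQd_monomial,
        TensorProduct.tmul_smul, TensorProduct.smul_tmul', smul_smul, TensorProduct.smul_tmul',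
        Complex.cpow_sub _ _ hq, Complex.cpow_natCast, zpow_neg, zpow_natCast, div_eq_mul_inv,
          mul_comm]
    | add f g hf hg => rw [TensorProduct.tmul_add]; exact Submodule.add_mem _ hf hg
  · obtain ⟨n₀, hn⟩ := h.trunc ω
    refine ⟨n₀, fun n hn' => ?_⟩
    rw [eq_bot_iff]
    intro t ht
    rw [mem_degSpace] at ht
    -- The coefficient at a monomial of degree `d` of a vector of degree `ω + n` has degree
    -- `ω + n + d`.
    let e := TensorProduct.equivFinsuppOfBasisRight (R := ℂ) (M := W)
      (MvPolynomial.basisMonomials (X.Idx × ℕ+) ℂ)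
    have he : ∀ w (f : Fock X) m, e (w ⊗ₜ[ℂ] f) m = f.coeff m • w := fun w f m =>
      TensorProduct.equivFinsuppOfBasisRight_apply_tmul_apply _ w f m
    have hqd : ∀ t m, e (TensorProduct.AlgebraTensorModule.map qd (fockQd T) t) m =
        T.q ^ (-(fockDeg m : ℤ)) • qd (e t m) := by
      intro t m
      induction t using TensorProduct.induction_on with
      | zero => simp
      | add t t' ht ht' =>
        rw [map_add, map_add, Finsupp.add_apply, ht, ht', map_add, Finsupp.add_apply, map_add,
          smul_add]
      | tmul w f =>
        rw [TensorProduct.AlgebraTensorModule.map_tmul, he, he, coeff_fockQd,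
          LinearMap.map_smul_of_tower, smul_smul]
    refine (Submodule.mem_bot _).mpr (e.injective ?_)
    rw [map_zero]
    refine Finsupp.ext fun m => ?_
    have h1 : e t m ∈ degSpace T qd (ω + ((n + fockDeg m : ℕ) : ℂ)) := by
      have := hqd t m
      rw [ht, map_smul, Finsupp.smul_apply, zpow_neg, zpow_natCast,
        eq_inv_smul_iff₀ (pow_ne_zero _ hq), smul_smul] at this
      rw [mem_degSpace, ← this, Nat.cast_add, ← add_assoc, Complex.cpow_add (ω + n) _ hq,
        Complex.cpow_natCast, mul_comm]
    rw [hn _ (by omega)] at h1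
    exact (Submodule.mem_bot _).mp h1

end Tensor

/-! ### Induced modules -/

variable {X : SimpleType} {T : Params X}

namespace HeisBase

variable {I : Type} {V V' : Type u} [AddCommGroup V] [Module ℂ V] [AddCommGroup V'] [Module ℂ V']
  (B : HeisBase I V) (B' : HeisBase I V')

/-- A linear map which commutes with the Heisenberg operators and, up to a constant, with the
currents, commutes up to the same constant with the dressed currents. -/
lemma map_dress (φ : V →ₗ[ℂ] V') (hal : ∀ i m v, φ (B.al i m v) = B'.al i m (φ v)) (i : I)
    (th th' : ℕ → ℂ) {x : ℤ → Module.End ℂ V} {x' : ℤ → Module.End ℂ V'} (c : ℂ)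
    (hx : ∀ n, HasDeg B.q B.qd n (x n)) (hx' : ∀ n, HasDeg B'.q B'.qd n (x' n))
    (h : ∀ n v, φ (x n v) = c • x' n (φ v)) (n : ℤ) (v : V) :
    φ (dress (B.eL i th) x (B.eR i th') n v) =
      c • dress (B'.eL i th) x' (B'.eR i th') n (φ v) := by
  have hL : ∀ m v, φ (B.eL i th m v) = B'.eL i th m (φ v) := expCoeff_intertwine φ
    fun m _ v => by rw [LinearMap.smul_apply, LinearMap.smul_apply, map_smul, hal]
  have hR : ∀ m v, φ (B.eR i th' m v) = B'.eR i th' m (φ v) := expCoeff_intertwine φ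
    fun m _ v => by rw [LinearMap.smul_apply, LinearMap.smul_apply, map_smul, hal]
  rw [dress_apply B.hq B.trunc hx (B.eR_deg i th'), dress_apply B'.hq B'.trunc hx' (B'.eR_deg i
      th'),
    map_finsum' φ _ (finite_dress B.hq B.trunc hx (B.eR_deg i th') n v),
    smul_finsum' c (finite_dress B'.hq B'.trunc hx' (B'.eR_deg i th') n (φ v))]
  refine finsum_congr fun ab => ?_
  rw [hL, h, hR, map_smul]

end HeisBase

namespace CatD

variable (W : CatD.{u} T) (hT : T.Generic)

/-- The Heisenberg operators `1 ⊗ α_{i,m}` on `W ⊗ F`. -/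
def indBase : HeisBase X.Idx (W.rep ⊗[ℂ] Fock X) where
  q := T.q
  hq := hT.q_ne
  qd := restrictEnd X _ (TensorProduct.AlgebraTensorModule.map W.rep.qd (fockQd T))
  trunc := (W.isModule.truncated.tensor hT.q_ne).trunc' hT.q_ne
  al i m := Module.End.lTensorAlgHom ℂ (Fock X) W.rep (fockAl T i m)
  cc := T.cc
  al_deg i m t := by
    induction t using TensorProduct.induction_on with
    | zero => simp
    | add t t' ht ht' => simp only [map_add, smul_add, ht, ht']
    | tmul w f =>
      show W.rep.qd w ⊗ₜ[ℂ] fockQd T (fockAl T i m f) =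
        T.q ^ m • (W.rep.qd w ⊗ₜ[ℂ] fockAl T i m (fockQd T f))
      rw [fockAl_deg hT.q_ne, TensorProduct.tmul_smul]
  al_comm i j l m hl hm := by
    rw [← map_mul, fockAl_comm hT i j hl hm, map_add, map_mul, map_smul, map_one]

lemma indBase_nondeg : (W.indBase hT).Nondeg := fun _ hn => hT.cc_det hn

lemma indBase_al (i : X.Idx) (m : ℤ) (w : W.rep) (f : Fock X) :
    (W.indBase hT).al i m (w ⊗ₜ[ℂ] f) = w ⊗ₜ[ℂ] fockAl T i m f := rfl

lemma indRep_al (i : X.Idx) (m : ℤ) (t : W.rep ⊗[ℂ] Fock X) :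
    W.indRep.al T i m t = (W.indBase hT).al i m t := by
  show T.br (T.d i) • (T.br (T.d i))⁻¹ • (W.indBase hT).al i m t = _
  rw [smul_inv_smul₀ (hT.br_d_ne i)]

/-- The operators `Z^±_{i,n} ⊗ 1` on `W ⊗ F`. -/
def indZ (c : Sgn × X.Idx) (n : ℤ) : Module.End ℂ (W.rep ⊗[ℂ] Fock X) :=
  TensorProduct.map (W.zLin c.1 c.2 n) LinearMap.id

lemma indZ_tmul (c : Sgn × X.Idx) (n : ℤ) (w : W.rep) (f : Fock X) :
    W.indZ c n (w ⊗ₜ[ℂ] f) = W.rep.Z c.1 c.2 n w ⊗ₜ[ℂ] f := rfl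

lemma indZ_deg (c : Sgn × X.Idx) (n : ℤ) :
    HasDeg (W.indBase hT).q (W.indBase hT).qd n (W.indZ c n) := fun t => by
  induction t using TensorProduct.induction_on with
  | zero => simp
  | add t t' ht ht' => simp only [map_add, smul_add, ht, ht']
  | tmul w f =>
    show W.rep.qd (W.rep.Z c.1 c.2 n w) ⊗ₜ[ℂ] fockQd T f =
      T.q ^ n • (W.rep.Z c.1 c.2 n (W.rep.qd w) ⊗ₜ[ℂ] fockQd T f)
    rw [W.isModule.common.qd_Y, TensorProduct.smul_tmul']

lemma al_indZ (i : X.Idx) (m : ℤ) (c : Sgn × X.Idx) (n : ℤ) :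
    (W.indBase hT).al i m * W.indZ c n = W.indZ c n * (W.indBase hT).al i m :=
  TensorProduct.ext' fun _ _ => rfl

/-- The operators `x^±_{i,n}` on `W ⊗ F` are obtained by dressing the operators `Z^±_{i,n} ⊗ 1`. -/
def indX (c : Sgn × X.Idx) (n : ℤ) : Module.End ℂ (W.rep ⊗[ℂ] Fock X) :=
  dress ((W.indBase hT).eL c.2 fun m => - T.thM c m) (W.indZ c)
    ((W.indBase hT).eR c.2 fun m => - T.thP c m) n

/-- The summands in the definition of `Ind W`, in terms of Heisenberg operators on `W ⊗ F`. -/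
lemma indX_term (c : Sgn × X.Idx) (n : ℤ) (ab : ℕ × ℕ) (t : W.rep ⊗[ℂ] Fock X) :
    TensorProduct.map (W.zLin c.1 c.2 n) (eOp T c.1 .neg c.1.val (fockAl T) c.2 ab.1 *
        eOp T c.1 .pos (-c.1.val) (fockAl T) c.2 ab.2) t =
      (W.indBase hT).eL c.2 (fun m => - T.thM c m) ab.1 (W.indZ c n
        ((W.indBase hT).eR c.2 (fun m => - T.thP c m) ab.2 t)) := by
  have hL : (W.indBase hT).eL c.2 (fun m => - T.thM c m) ab.1 =
      Module.End.lTensorAlgHom ℂ (Fock X) W.rep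
        (eOp T c.1 .neg c.1.val (fockAl T) c.2 ab.1) := by
    rw [eOp_eq, map_expCoeff]
    show expCoeff _ _ = _
    congr 1
    funext m
    rw [map_smul]
    simp only [Params.thM, Sgn.val, one_mul, Int.cast_neg, neg_mul, neg_neg]
    rfl
  have hR : (W.indBase hT).eR c.2 (fun m => - T.thP c m) ab.2 =
      Module.End.lTensorAlgHom ℂ (Fock X) W.rep
        (eOp T c.1 .pos (-c.1.val) (fockAl T) c.2 ab.2) := by
    rw [eOp_eq, map_expCoeff]
    show expCoeff _ _ = _
    congr 1
    funext m
    rw [map_smul]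
    simp only [Params.thP, Sgn.val, one_mul, Int.cast_neg, neg_mul]
    rfl
  rw [hL, hR]
  induction t using TensorProduct.induction_on with
  | zero => simp
  | add t t' ht ht' => simp only [map_add, ht, ht']
  | tmul w f => rfl

include hT in
lemma finite_indX (c : Sgn × X.Idx) (n : ℤ) (t : W.rep ⊗[ℂ] Fock X) :
    (Function.support fun ab : ℕ × ℕ =>
      TensorProduct.map (W.zLin c.1 c.2 (n + ab.1 - ab.2))
        (eOp T c.1 .neg c.1.val (fockAl T) c.2 ab.1 *
          eOp T c.1 .pos (-c.1.val) (fockAl T) c.2 ab.2) t).Finite := by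
  simp only [W.indX_term hT]
  exact finite_dress (W.indBase hT).hq (W.indBase hT).trunc (W.indZ_deg hT c)
    ((W.indBase hT).eR_deg _ _) n t

lemma indX_apply (c : Sgn × X.Idx) (n : ℤ) (t : W.rep ⊗[ℂ] Fock X) : W.indX hT c n t =
    ∑ᶠ ab : ℕ × ℕ, TensorProduct.map (W.zLin c.1 c.2 (n + ab.1 - ab.2))
      (eOp T c.1 .neg c.1.val (fockAl T) c.2 ab.1 *
        eOp T c.1 .pos (-c.1.val) (fockAl T) c.2 ab.2) t := by
  simp only [W.indX_term hT]
  exact dress_apply (W.indBase hT).hq (W.indBase hT).trunc (W.indZ_deg hT c)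
    ((W.indBase hT).eR_deg _ _) n t

lemma indRep_x (ε : Sgn) (i : X.Idx) (n : ℤ) (t : W.rep ⊗[ℂ] Fock X) :
    W.indRep.x ε i n t = W.indX hT (ε, i) n t := (W.indX_apply hT (ε, i) n t).symm

lemma indX_deg (c : Sgn × X.Idx) (n : ℤ) :
    HasDeg (W.indBase hT).q (W.indBase hT).qd n (W.indX hT c n) :=
  hasDeg_dress (W.indBase hT).hq (W.indBase hT).trunc (W.indZ_deg hT c)
    ((W.indBase hT).eR_deg _ _) ((W.indBase hT).eL_deg _ _) n

lemma indX_weight (c : Sgn × X.Idx) (n : ℤ) :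
    HasWeight (tensorWt W.rep.wt) (wtX X c.1 c.2) (W.indX hT c n) := by
  have hw := fun (ab : ℕ × ℕ) =>
    (show HasWeight W.rep.wt (wtX X c.1 c.2) (W.zLin c.1 c.2 (n + ab.1 - ab.2)) from
      W.isModule.common.Y_weight c.1 c.2 _).tensor
      (eOp T c.1 .neg c.1.val (fockAl T) c.2 ab.1 *
        eOp T c.1 .pos (-c.1.val) (fockAl T) c.2 ab.2)
  refine ⟨(W.indX hT c n).isLinear, fun g t => ?_, fun ν t ht => ?_⟩
  · rw [indX_apply, indX_apply]
    refine (map_finsum' (DistribSMul.toAddMonoidHom (W.rep ⊗[ℂ] Fock X) g) _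
      (W.finite_indX hT c n t)).trans (finsum_congr fun ab => (hw ab).shift g t)
  · rw [indX_apply]
    exact finsum_induction (· ∈ tensorWt W.rep.wt (ν + wtX X c.1 c.2)) (Submodule.zero_mem _)
      (fun _ _ => Submodule.add_mem _) fun ab => (hw ab).maps ν t ht

/-- The currents on `W ⊗ F` have the commutators with the `α_{i,m}` required of `x^±_j(z)`: they
come from the vertex operators alone, since `Z^±_j(z) ⊗ 1` commutes with `1 ⊗ α_{i,m}`. -/
lemma al_indX (i : X.Idx) (c : Sgn × X.Idx) (l n : ℤ) (hl : l ≠ 0) :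
    (W.indBase hT).al i l * W.indX hT c n = W.indX hT c n * (W.indBase hT).al i l +
      T.muX i c l • W.indX hT c (n + l) :=
  (W.indBase hT).al_mul_dress c.2 _ _ (W.indZ_deg hT c) (μ := fun _ _ => 0)
    (fun j l n _ => by rw [W.al_indZ, zero_smul, add_zero])
    (ν := fun i l => T.muX i c l)
    (fun j m hm => by
      have := hT.cancelM j c m hm
      show -T.thM c m * T.cc j c.2 m + 0 = _
      linear_combination -this)
    (fun j m hm => by
      have := hT.cancelP j c m hm
      show -T.thP c m * T.cc j c.2 (-m) + 0 = _
      linear_combination -this) i l n hl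

/-- An operator on `W` which commutes with the `Z^±_{i,n}` up to a constant commutes with the
induced operators `x^±_{i,n}` up to the same constant. -/
lemma map_indX {W W' : CatD.{u} T} (hT : T.Generic) (φ : W.rep →ₗ[ℂ] W'.rep) (c : Sgn × X.Idx)
    (a : ℂ)
    (h : ∀ n w, φ (W.rep.Z c.1 c.2 n w) = a • W'.rep.Z c.1 c.2 n (φ w)) (n : ℤ)
    (t : W.rep ⊗[ℂ] Fock X) :
    TensorProduct.map φ LinearMap.id (W.indX hT c n t) =
      a • W'.indX hT c n (TensorProduct.map φ LinearMap.id t) := by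
  refine (W.indBase hT).map_dress (W'.indBase hT) _ (fun i m t => ?_) c.2 _ _ a (W.indZ_deg hT c)
    (W'.indZ_deg hT c) (fun n t => ?_) n t
  · induction t using TensorProduct.induction_on with
    | zero => simp
    | add t t' ht ht' => simp only [map_add, ht, ht']
    | tmul w f => rfl
  · induction t using TensorProduct.induction_on with
    | zero => simp
    | add t t' ht ht' => simp only [map_add, ht, ht', smul_add]
    | tmul w f =>
      rw [indZ_tmul, TensorProduct.map_tmul, TensorProduct.map_tmul, indZ_tmul, h,
        TensorProduct.smul_tmul']

lemma indK_centralProd (ε : Sgn) : centralProd T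
      (fun i => (TensorProduct.map (W.rep.K ε i) LinearMap.id : Module.End ℂ (W.rep ⊗[ℂ] Fock X))) =
    TensorProduct.map (centralProd T (W.rep.K ε)) LinearMap.id :=
  TensorProduct.ext' fun w f =>
    (map_centralProd ((TensorProduct.mk ℂ W.rep (Fock X)).flip f) (K := W.rep.K ε)
      (K' := fun i => TensorProduct.map (W.rep.K ε i) LinearMap.id) (fun _ _ => rfl) w).symm

lemma indK_al (ε : Sgn) (i j : X.Idx) (m : ℤ) (t : W.rep ⊗[ℂ] Fock X) :
    TensorProduct.map (W.rep.K ε i) LinearMap.id ((W.indBase hT).al j m t) =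
      (W.indBase hT).al j m (TensorProduct.map (W.rep.K ε i) LinearMap.id t) := by
  induction t using TensorProduct.induction_on with
  | zero => simp
  | add t t' ht ht' => simp only [map_add, ht, ht']
  | tmul w f => rfl

/-- The conditions on the grading and on `K^±_i`, `q^d` hold for `W ⊗ F`. -/
lemma ind_isCommon : IsCommon T (tensorWt W.rep.wt) (fun ε i n t => W.indX hT (ε, i) n t)
    (fun ε i => TensorProduct.map (W.rep.K ε i) LinearMap.id)
    (TensorProduct.AlgebraTensorModule.map W.rep.qd (fockQd T)) where
  internal := tensorWt_internal W.isModule.common.internal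
  Y_weight ε i n := W.indX_weight hT (ε, i) n
  K_weight ε i := (W.isModule.common.K_weight ε i).tensor _
  qd_maps ν t ht := by
    have : tensorWt W.rep.wt ν ≤ (tensorWt W.rep.wt ν).comap
        (TensorProduct.AlgebraTensorModule.map W.rep.qd (fockQd T)) := by
      refine Submodule.span_le.mpr ?_
      rintro _ ⟨w, hw, f, rfl⟩
      exact tmul_mem_tensorWt (W.isModule.common.qd_maps ν w hw) _
    exact this ht
  K_bij ε i := (TensorProduct.congr
    (LinearEquiv.ofBijective _ (W.isModule.common.K_bij ε i))
      (LinearEquiv.refl ℂ (Fock X))).bijective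
  qd_bij := (TensorProduct.AlgebraTensorModule.congr
    (LinearEquiv.ofBijective _ W.isModule.common.qd_bij)
    (LinearEquiv.ofBijective _ (fockQd_bijective hT.q_ne))).bijective
  K_comm ε ε' i j := TensorProduct.ext' fun w f => by
    show W.rep.K ε i (W.rep.K ε' j w) ⊗ₜ[ℂ] f = W.rep.K ε' j (W.rep.K ε i w) ⊗ₜ[ℂ] f
    rw [← Module.End.mul_apply, W.isModule.common.K_comm ε ε' i j, Module.End.mul_apply]
  K_qd ε i t := by
    induction t using TensorProduct.induction_on with
    | zero => simp
    | add t t' ht ht' => simp only [map_add, ht, ht']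
    | tmul w f =>
      show W.rep.K ε i (W.rep.qd w) ⊗ₜ[ℂ] fockQd T f = W.rep.qd (W.rep.K ε i w) ⊗ₜ[ℂ] fockQd T f
      rw [W.isModule.common.K_qd]
  K_Y ε i ε' j n t := map_indX hT (W.rep.K ε i) (ε', j) _
    (fun n w => W.isModule.common.K_Y ε i ε' j n w) n t
  qd_Y ε i n t := W.indX_deg hT (ε, i) n t
  central_Y ε ε' j n t := by
    rw [indK_centralProd, map_indX hT (centralProd T (W.rep.K ε)) (ε', j) 1
      (fun n w => by rw [one_smul]; exact W.isModule.common.central_Y ε ε' j n w), one_smul]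
  central_F ε g t := by
    rw [indK_centralProd]
    induction t using TensorProduct.induction_on with
    | zero => simp
    | add t t' ht ht' => simp only [map_add, ht, ht', smul_add]
    | tmul w f =>
      rw [tensor_smul_tmul, TensorProduct.map_tmul, W.isModule.common.central_F]
      rfl
  level t := by
    rw [indK_centralProd]
    induction t using TensorProduct.induction_on with
    | zero => simp
    | add t t' ht ht' => simp only [map_add, ht, ht', smul_add]
    | tmul w f => rw [TensorProduct.map_tmul, W.isModule.common.level]; rfl

include hT in
lemma indRep_isPreModule : W.indRep.IsPreModule T where
  common := by
    have h : W.indRep.x = fun ε i n t => W.indX hT (ε, i) n t := by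
      funext ε i n t; exact W.indRep_x hT ε i n t
    rw [h]
    exact W.ind_isCommon hT
  truncated := W.isModule.truncated.tensor hT.q_ne
  avee_zero i := LinearMap.ext fun (t : W.rep ⊗[ℂ] Fock X) => by
    have h0 : Module.End.lTensorAlgHom ℂ (Fock X) W.rep (fockAl T i 0) = 0 := by
      rw [fockAl_zero, map_zero]
    show (T.br (T.d i))⁻¹ • Module.End.lTensorAlgHom ℂ (Fock X) W.rep (fockAl T i 0) t = _
    rw [h0, LinearMap.zero_apply, smul_zero]
    rfl
  avee_maps i m ν t ht := by
    have : tensorWt W.rep.wt ν ≤ (tensorWt W.rep.wt ν).comap (W.indRep.avee i m) := by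
      refine Submodule.span_le.mpr ?_
      rintro _ ⟨w, hw, f, rfl⟩
      show (T.br (T.d i))⁻¹ • (w ⊗ₜ[ℂ] fockAl T i m f) ∈ tensorWt W.rep.wt ν
      rw [← TensorProduct.tmul_smul]
      exact tmul_mem_tensorWt hw _
    exact this ht
  avee_K := fun i m ε j (t : W.rep ⊗[ℂ] Fock X) => by
    show TensorProduct.map (W.rep.K ε j) LinearMap.id ((T.br (T.d i))⁻¹ • (W.indBase hT).al i m t) =
      (T.br (T.d i))⁻¹ • (W.indBase hT).al i m (TensorProduct.map (W.rep.K ε j) LinearMap.id t)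
    rw [map_smul, indK_al]
  avee_qd := fun i m (t : W.rep ⊗[ℂ] Fock X) => by
    show (W.indBase hT).qd ((T.br (T.d i))⁻¹ • (W.indBase hT).al i m t) =
      T.q ^ m • (T.br (T.d i))⁻¹ • (W.indBase hT).al i m ((W.indBase hT).qd t)
    rw [map_smul, (W.indBase hT).al_deg, smul_comm]
    rfl
  al_al := fun i j l m hl hm (t : W.rep ⊗[ℂ] Fock X) => by
    have := LinearMap.congr_fun ((W.indBase hT).al_comm i j l m hl hm) t
    show W.indRep.al T i l (W.indRep.al T j m t) - W.indRep.al T j m (W.indRep.al T i l t) = _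
    rw [W.indRep_al hT, W.indRep_al hT, W.indRep_al hT, W.indRep_al hT]
    exact sub_eq_iff_eq_add'.mpr this
  al_x := fun i c l n hl (t : W.rep ⊗[ℂ] Fock X) => by
    have := LinearMap.congr_fun (W.al_indX hT i c l n hl) t
    show W.indRep.al T i l (W.indRep.x c.1 c.2 n t) - W.indRep.x c.1 c.2 n (W.indRep.al T i l t) = _
    rw [W.indRep_x hT, W.indRep_al hT, W.indRep_al hT, W.indRep_x hT, W.indRep_x hT]
    exact sub_eq_iff_eq_add'.mpr this

include hT in
/-- Dressing the currents of `Ind W` gives back the operators `Z^±_{i,n} ⊗ 1`. -/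
lemma indRep_z (c : Sgn × X.Idx) (n : ℤ) (t : W.rep ⊗[ℂ] Fock X) :
    W.indRep.zOp T c.1 c.2 n t = W.indZ c n t := by
  have h := W.indRep_isPreModule hT
  let S := h.system hT
  let φ : W.rep ⊗[ℂ] Fock X →ₗ[ℂ] W.indRep := LinearMap.id
  have hdeg : ∀ n, HasDeg S.q S.qd n (W.indZ c n) := W.indZ_deg hT c
  have hx : S.x c = dress (S.eL c.2 fun m => - T.thM c m) (W.indZ c)
      (S.eR c.2 fun m => - T.thP c m) := by
    funext n
    refine LinearMap.ext fun (t : W.rep ⊗[ℂ] Fock X) => ?_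
    have := (W.indBase hT).map_dress S.toHeisBase φ
      (fun i m t => (W.indRep_al hT i m t).symm) c.2 (fun m => - T.thM c m) (fun m => - T.thP c m)
      1 (W.indZ_deg hT c) hdeg (fun n t => (one_smul ℂ _).symm) n t
    rw [one_smul] at this
    exact (W.indRep_x hT c.1 c.2 n t).trans this
  have h1 := S.mk_eL_neg_mul c.2 fun m => - T.thM c m
  have h2 := S.mk_eR_mul_neg c.2 fun m => - T.thP c m
  simp only [neg_neg] at h1 h2
  rw [← h.system_z hT c n t]
  show dress (S.eL c.2 (T.thM c)) (S.x c) (S.eR c.2 (T.thP c)) n t = _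
  rw [hx, dress_dress S.hq S.trunc hdeg (S.eR_deg _ _) (S.eL_deg _ _) (S.eR_deg _ _) h1 h2]
  rfl

/-- The evaluation `W ⊗ F → W` at the origin of the Fock space. -/
def indEval : W.rep ⊗[ℂ] Fock X →ₗ[Mero X] W.rep :=
  (TensorProduct.AlgebraTensorModule.rid ℂ (Mero X) W.rep).toLinearMap ∘ₗ
    TensorProduct.AlgebraTensorModule.map LinearMap.id (MvPolynomial.lcoeff ℂ 0)

lemma indEval_tmul (w : W.rep) (f : Fock X) :
    W.indEval (w ⊗ₜ[ℂ] f) = MvPolynomial.coeff 0 f • w := rfl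

/-- The embedding `w ↦ w ⊗ 1` of `W` into `W ⊗ F`. -/
def indVac : W.rep →ₗ[Mero X] W.rep ⊗[ℂ] Fock X where
  toFun w := w ⊗ₜ[ℂ] 1
  map_add' w w' := TensorProduct.add_tmul w w' 1
  map_smul' _ _ := rfl

lemma indEval_indVac (w : W.rep) : W.indEval (W.indVac w) = w := by
  show W.indEval (w ⊗ₜ[ℂ] 1) = w
  rw [indEval_tmul, MvPolynomial.coeff_zero_one, one_smul]

lemma indVac_mem_vac (w : W.rep) : W.indVac w ∈ (W.indBase hT).vac := fun i m hm => by
  rcases int_cases hm.ne' with ⟨n, rfl⟩ | ⟨n, rfl⟩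
  · show w ⊗ₜ[ℂ] fockAl T i (n : ℕ) 1 = 0
    rw [fockAl_pos_apply, Finset.sum_eq_zero fun j _ => by rw [Derivation.map_one_eq_zero,
      smul_zero],
      TensorProduct.tmul_zero]
  · exact absurd hm (by omega)

/-- `W ⊗ F` is the sum of `W ⊗ 1` and the image of the creation operators. -/
lemma sub_indEval_mem_J (t : W.rep ⊗[ℂ] Fock X) :
    t - W.indVac (W.indEval t) ∈ (W.indBase hT).J := by
  induction t using TensorProduct.induction_on with
  | zero => simp
  | add t t' ht ht' =>
    rw [map_add, map_add, add_sub_add_comm]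
    exact Submodule.add_mem _ ht ht'
  | tmul w f =>
    induction f using MvPolynomial.induction_on with
    | C a =>
      have : w ⊗ₜ[ℂ] (MvPolynomial.C a : Fock X) - W.indVac (W.indEval (w ⊗ₜ[ℂ] MvPolynomial.C a)) =
          0 := by
        rw [indEval_tmul, MvPolynomial.coeff_zero_C, sub_eq_zero]
        show _ = (a • w) ⊗ₜ[ℂ] (1 : Fock X)
        rw [TensorProduct.smul_tmul, ← MvPolynomial.algebraMap_eq, Algebra.algebraMap_eq_smul_one]
      rw [this]
      exact Submodule.zero_mem _
    | add f g hf hg =>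
      rw [TensorProduct.tmul_add, map_add, map_add, add_sub_add_comm]
      exact Submodule.add_mem _ hf hg
    | mul_X f s _ =>
      have h0 : MvPolynomial.coeff 0 (f * MvPolynomial.X s) = 0 := by
        rw [← MvPolynomial.constantCoeff_eq, map_mul, MvPolynomial.constantCoeff_X, mul_zero]
      rw [indEval_tmul, h0, zero_smul, map_zero, sub_zero]
      have := (W.indBase hT).al_mem_J s.1 (m := (s.2 : ℕ)) (by have := s.2.pos; omega)
        (w ⊗ₜ[ℂ] f)
      rwa [indBase_al, fockAl_neg_apply, mul_comm] at this

/-- The vacuum space of `W ⊗ F` is `W ⊗ 1`. -/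
lemma indVac_indEval {t : W.rep ⊗[ℂ] Fock X} (ht : t ∈ (W.indBase hT).vac) :
    W.indVac (W.indEval t) = t :=
  (sub_eq_zero.mp ((W.indBase_nondeg hT).eq_zero_of_mem_J
    ((W.indBase hT).vac.sub_mem ht (W.indVac_mem_vac hT _)) (W.sub_indEval_mem_J hT t))).symm

lemma mem_indRep_vacuum {t : W.rep ⊗[ℂ] Fock X} :
    t ∈ W.indRep.vacuum T ↔ t ∈ (W.indBase hT).vac := by
  refine forall_congr' fun i => forall_congr' fun m => forall_congr' fun _ => ?_
  rw [← W.indRep_al hT]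
  exact Iff.rfl

end CatD

/-- The induced spaces are modules of level `(k,l)`. -/
theorem lambdaWellDefined (hT : T.Generic) : LambdaWellDefined.{u} T where
  isModule W := by
    -- It suffices to check the relations of the `Z`-algebra on the vacuum space `W ⊗ 1`, where the
    -- dressed currents act as on `W`.
    refine ((W.indRep_isPreModule hT).isUModule_iff hT).mpr fun (t : W.rep ⊗[ℂ] Fock X) ht => ?_
    rw [← W.indVac_indEval hT ((W.mem_indRep_vacuum hT).mp ht)]
    refine (zRelAt_map (W.indVac.restrictScalars ℂ) (Function.LeftInverse.injective
      W.indEval_indVac)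
      (Z := W.rep.Z) (K := fun ε i => W.rep.K ε i) (fun ε i n w => ?_) (fun ε i w => rfl)
      (W.indEval t)).mpr ?_
    · exact (W.indRep_z hT (ε, i) n (W.indVac w)).symm
    · exact ⟨fun ε i j a b => W.isModule.Z_Z ε i j a b _, fun i j a b =>
        W.isModule.Zpos_Zneg i j a b _,
        fun ε i j hij N M => W.isModule.serre ε i j hij N M _⟩
  isHom {W W'} φ := by
    refine ⟨fun ν t ht => ?_, fun i m (t : W.rep ⊗[ℂ] Fock X) => ?_,
      fun ε i n (t : W.rep ⊗[ℂ] Fock X) => ?_, fun ε i (t : W.rep ⊗[ℂ] Fock X) => ?_,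
      fun (t : W.rep ⊗[ℂ] Fock X) => ?_⟩
    · have : tensorWt W.rep.wt ν ≤ (tensorWt W'.rep.wt ν).comap (CatD.indMap φ) := by
        refine Submodule.span_le.mpr ?_
        rintro _ ⟨w, hw, f, rfl⟩
        exact tmul_mem_tensorWt (φ.isHom.wt ν w hw) f
      exact this ht
    · show TensorProduct.map (φ.map.restrictScalars ℂ) LinearMap.id
          ((T.br (T.d i))⁻¹ • (W.indBase hT).al i m t) =
        (T.br (T.d i))⁻¹ • (W'.indBase hT).al i m
          (TensorProduct.map (φ.map.restrictScalars ℂ) LinearMap.id t)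
      rw [map_smul]
      congr 1
      induction t using TensorProduct.induction_on with
      | zero => simp
      | add t t' ht ht' => simp only [map_add, ht, ht']
      | tmul w f => rfl
    · rw [W.indRep_x hT]
      refine Eq.trans ?_ (W'.indRep_x hT ε i n _).symm
      have := CatD.map_indX hT (φ.map.restrictScalars ℂ) (ε, i) 1
        (fun n w => by rw [one_smul]; exact φ.isHom.Z ε i n w) n t
      rw [one_smul] at this
      exact this
    · have : TensorProduct.map (φ.map.restrictScalars ℂ) LinearMap.id ∘ₗ
          TensorProduct.map (W.rep.K ε i) LinearMap.id =
          TensorProduct.map (W'.rep.K ε i) (LinearMap.id : Module.End ℂ (Fock X)) ∘ₗ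
            TensorProduct.map (φ.map.restrictScalars ℂ) LinearMap.id :=
        TensorProduct.ext' fun w f => congrArg (· ⊗ₜ[ℂ] f) (φ.isHom.K ε i w)
      exact LinearMap.congr_fun this t
    · have : TensorProduct.map (φ.map.restrictScalars ℂ) LinearMap.id ∘ₗ
          TensorProduct.map (W.rep.qd.restrictScalars ℂ) (fockQd T) =
          TensorProduct.map (W'.rep.qd.restrictScalars ℂ) (fockQd T) ∘ₗ
            TensorProduct.map (φ.map.restrictScalars ℂ) LinearMap.id :=
        TensorProduct.ext' fun w f => congrArg (· ⊗ₜ[ℂ] fockQd T f) (φ.isHom.qd w)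
      exact LinearMap.congr_fun this t

/-! ### The universal property of induced modules -/

variable {X : SimpleType} {T : Params X}

namespace URep.IsPreModule

variable {V : URep.{u} X} (h : V.IsPreModule T)

include h in
lemma commute_al_neg (i j : X.Idx) (m n : ℕ+) :
    V.al T i (-(m : ℕ)) * V.al T j (-(n : ℕ)) = V.al T j (-(n : ℕ)) * V.al T i (-(m : ℕ)) := by
  have hm := m.pos
  have hn := n.pos
  refine LinearMap.ext fun v => ?_
  have := h.al_al i j (-(m : ℕ)) (-(n : ℕ)) (by omega) (by omega) v
  rwa [if_neg (by omega), zero_smul, sub_eq_zero] at this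

open scoped IsMulCommutative in
/-- The action of the Fock space, as the commutative algebra generated by the creation operators. -/
def fockAct : Fock X →ₐ[ℂ] Module.End (Mero X) V :=
  let s : Set (Module.End (Mero X) V) := Set.range fun a : X.Idx × ℕ+ => V.al T a.1 (-(a.2 : ℕ))
  haveI : IsMulCommutative (Algebra.adjoin ℂ s) := Algebra.isMulCommutative_adjoin ℂ (by
    rintro _ ⟨a, rfl⟩ _ ⟨b, rfl⟩
    exact h.commute_al_neg a.1 b.1 a.2 b.2)
  letI : CommRing (Algebra.adjoin ℂ s) :=
    inferInstance
  (Algebra.adjoin ℂ s).val.comp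
    (MvPolynomial.aeval fun a => ⟨V.al T a.1 (-(a.2 : ℕ)), Algebra.subset_adjoin ⟨a, rfl⟩⟩)

lemma fockAct_X (a : X.Idx × ℕ+) :
    h.fockAct (MvPolynomial.X a) = V.al T a.1 (-(a.2 : ℕ)) := by
  simp [fockAct]

end URep.IsPreModule

/-- A linear map on `W ⊗ F` is determined by its restriction to `W ⊗ 1` and by its behaviour under
the creation operators. -/
lemma tensorFock_ext {W V : Type u} [AddCommGroup W] [Module ℂ W] [AddCommGroup V] [Module ℂ V]
    {Φ Φ' : W ⊗[ℂ] Fock X →ₗ[ℂ] V} (D : X.Idx → ℕ+ → W ⊗[ℂ] Fock X → V → V)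
    (h0 : ∀ w, Φ (w ⊗ₜ 1) = Φ' (w ⊗ₜ 1))
    (h : ∀ i n w f, Φ (w ⊗ₜ (MvPolynomial.X (i, n) * f)) = D i n (w ⊗ₜ f) (Φ (w ⊗ₜ f)))
    (h' : ∀ i n w f, Φ' (w ⊗ₜ (MvPolynomial.X (i, n) * f)) = D i n (w ⊗ₜ f) (Φ' (w ⊗ₜ f))) :
    Φ = Φ' := by
  refine TensorProduct.ext' fun w f => ?_
  induction f using MvPolynomial.induction_on with
  | C a =>
    rw [← mul_one (MvPolynomial.C a), ← MvPolynomial.smul_eq_C_mul, ← TensorProduct.smul_tmul]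
    exact h0 _
  | add f g hf hg => rw [TensorProduct.tmul_add, map_add, map_add, hf, hg]
  | mul_X f a hf => rw [mul_comm, h, h', hf]

/-- A homogeneous linear map from a module over the `Z`-algebra to the vacuum space of `V` which
commutes with all operators. -/
structure IsVacHom (W : CatD.{u} T) (V : URep.{u} X) (φ : W.rep →ₗ[Mero X] V) : Prop where
  vac : ∀ w, φ w ∈ V.vacuum T
  wt : ∀ ν, ∀ w ∈ W.rep.wt ν, φ w ∈ V.wt ν
  Z : ∀ ε i n w, φ (W.rep.Z ε i n w) = V.zOp T ε i n (φ w)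
  K : ∀ ε i w, φ (W.rep.K ε i w) = V.K ε i (φ w)
  qd : ∀ w, φ (W.rep.qd w) = V.qd (φ w)

section IndLift

variable {W : CatD.{u} T} {V : URep.{u} X} (h : V.IsPreModule T)

/-- The extension `w ⊗ f ↦ f φ(w)` of a map `φ` from `W` to the vacuum space of `V`. -/
def indLift (φ : W.rep →ₗ[Mero X] V) : W.rep ⊗[ℂ] Fock X →ₗ[Mero X] V :=
  TensorProduct.AlgebraTensorModule.lift
    { toFun := fun w =>
        { toFun := fun f => h.fockAct f (φ w)
          map_add' := fun f g => by rw [map_add]; rfl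
          map_smul' := fun a f => by rw [map_smul]; rfl }
      map_add' := fun w w' => LinearMap.ext fun f => by
        show h.fockAct f (φ (w + w')) = h.fockAct f (φ w) + h.fockAct f (φ w')
        rw [map_add, map_add]
      map_smul' := fun g w => LinearMap.ext fun f => by
        show h.fockAct f (φ (g • w)) = g • h.fockAct f (φ w)
        rw [map_smul, map_smul] }

variable (φ : W.rep →ₗ[Mero X] V)

lemma indLift_tmul (w : W.rep) (f : Fock X) : indLift h φ (w ⊗ₜ f) = h.fockAct f (φ w) := rfl

lemma indLift_one (w : W.rep) : indLift h φ (w ⊗ₜ 1) = φ w := by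
  rw [indLift_tmul, map_one]; rfl

lemma indLift_X_mul (i : X.Idx) (n : ℕ+) (w : W.rep) (f : Fock X) :
    indLift h φ (w ⊗ₜ (MvPolynomial.X (i, n) * f)) =
      V.al T i (-(n : ℕ)) (indLift h φ (w ⊗ₜ f)) := by
  rw [indLift_tmul, map_mul, h.fockAct_X]; rfl

variable {φ} (hφ : IsVacHom W V φ) (hT : T.Generic)

include hφ in
/-- The extension commutes with all `α_{i,m}`: by construction with the creation operators, and with
the annihilation operators because these kill `W ⊗ 1` and its image, and the commutation relations
agree. -/
lemma indLift_al (i : X.Idx) (m : ℤ) (t : W.rep ⊗[ℂ] Fock X) :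
    indLift h φ ((W.indBase hT).al i m t) = V.al T i m (indLift h φ t) := by
  by_cases hm : m = 0
  · subst hm
    have h0 : V.al T i 0 = 0 := by rw [URep.al, h.avee_zero, smul_zero]
    have h1 : (W.indBase hT).al i 0 = 0 := map_zero (Module.End.lTensorAlgHom ℂ (Fock X) W.rep)
    rw [h0, h1]
    simp
  rcases int_cases hm with ⟨n, rfl⟩ | ⟨n, rfl⟩
  · refine LinearMap.congr_fun (f := (indLift h φ).restrictScalars ℂ ∘ₗ (W.indBase hT).al i (n : ℕ))
      (g := (V.al T i (n : ℕ)).restrictScalars ℂ ∘ₗ (indLift h φ).restrictScalars ℂ)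
      (tensorFock_ext (fun j k t v => V.al T j (-(k : ℕ)) v +
        (if ((n : ℕ) : ℤ) + -(k : ℕ) = 0 then T.cc i j (n : ℕ) else 0) • indLift h φ t)
        (fun w => ?_) (fun j k w f => ?_) (fun j k w f => ?_)) t
    · have h1 := W.indVac_mem_vac hT w i (n : ℕ) (by have := n.pos; omega)
      have h2 := hφ.vac w i (n : ℕ) (by have := n.pos; omega)
      show indLift h φ ((W.indBase hT).al i (n : ℕ) (W.indVac w)) =
        V.al T i (n : ℕ) (indLift h φ (w ⊗ₜ 1))
      rw [h1, indLift_one, h2, map_zero]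
    · have := LinearMap.congr_fun (fockAl_comm hT i j (l := (n : ℕ)) (m := -(k : ℕ)) (by simp)
        (by simp)) f
      simp only [Module.End.mul_apply, LinearMap.add_apply, LinearMap.smul_apply,
        Module.End.one_apply, fockAl_neg_apply] at this
      show indLift h φ (w ⊗ₜ fockAl T i (n : ℕ) (MvPolynomial.X (j, k) * f)) =
        V.al T j (-(k : ℕ)) (indLift h φ (w ⊗ₜ fockAl T i (n : ℕ) f)) + _
      rw [this, TensorProduct.tmul_add, map_add, indLift_X_mul, TensorProduct.tmul_smul,
        LinearMap.map_smul_of_tower]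
    · show V.al T i (n : ℕ) (indLift h φ (w ⊗ₜ (MvPolynomial.X (j, k) * f))) =
        V.al T j (-(k : ℕ)) (V.al T i (n : ℕ) (indLift h φ (w ⊗ₜ f))) + _
      rw [indLift_X_mul, ← sub_eq_iff_eq_add']
      exact h.al_al i j _ _ (by simp) (by simp) _
  · induction t using TensorProduct.induction_on with
    | zero => simp
    | add t t' ht ht' => simp only [map_add, ht, ht']
    | tmul w f => rw [CatD.indBase_al, fockAl_neg_apply, indLift_X_mul]

include hφ in
lemma indLift_K (ε : Sgn) (i : X.Idx) (t : W.rep ⊗[ℂ] Fock X) :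
    indLift h φ (TensorProduct.map (W.rep.K ε i) LinearMap.id t) = V.K ε i (indLift h φ t) := by
  refine LinearMap.congr_fun (f := (indLift h φ).restrictScalars ℂ ∘ₗ
    TensorProduct.map (W.rep.K ε i) LinearMap.id) (g := V.K ε i ∘ₗ (indLift h φ).restrictScalars ℂ)
    (tensorFock_ext (fun j k _ v => V.al T j (-(k : ℕ)) v) (fun w => ?_) (fun j k w f => ?_)
      (fun j k w f => ?_)) t
  · show indLift h φ (W.rep.K ε i w ⊗ₜ 1) = V.K ε i (indLift h φ (w ⊗ₜ 1))
    rw [indLift_one, indLift_one, hφ.K]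
  · exact indLift_X_mul h φ j k (W.rep.K ε i w) f
  · show V.K ε i (indLift h φ (w ⊗ₜ (MvPolynomial.X (j, k) * f))) =
      V.al T j (-(k : ℕ)) (V.K ε i (indLift h φ (w ⊗ₜ f)))
    rw [indLift_X_mul, h.K_al]

include hφ in
lemma indLift_qd (t : W.rep ⊗[ℂ] Fock X) :
    indLift h φ (TensorProduct.AlgebraTensorModule.map W.rep.qd (fockQd T) t) =
      V.qd (indLift h φ t) := by
  refine LinearMap.congr_fun (f := (indLift h φ).restrictScalars ℂ ∘ₗ
    (TensorProduct.AlgebraTensorModule.map W.rep.qd (fockQd T)).restrictScalars ℂ)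
    (g := V.qd.restrictScalars ℂ ∘ₗ (indLift h φ).restrictScalars ℂ)
    (tensorFock_ext (fun j k _ v => T.q ^ (-(k : ℤ)) • V.al T j (-(k : ℕ)) v) (fun w => ?_)
      (fun j k w f => ?_) (fun j k w f => ?_)) t
  · show indLift h φ (W.rep.qd w ⊗ₜ fockQd T 1) = V.qd (indLift h φ (w ⊗ₜ 1))
    have : fockQd T 1 = 1 := map_one (MvPolynomial.aeval _)
    rw [this, indLift_one, indLift_one, hφ.qd]
  · show indLift h φ (W.rep.qd w ⊗ₜ fockQd T (MvPolynomial.X (j, k) * f)) =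
      T.q ^ (-(k : ℤ)) • V.al T j (-(k : ℕ)) (indLift h φ (W.rep.qd w ⊗ₜ fockQd T f))
    rw [fockQd_X_mul, TensorProduct.tmul_smul, LinearMap.map_smul_of_tower, indLift_X_mul]
  · show V.qd (indLift h φ (w ⊗ₜ (MvPolynomial.X (j, k) * f))) =
      T.q ^ (-(k : ℤ)) • V.al T j (-(k : ℕ)) (V.qd (indLift h φ (w ⊗ₜ f)))
    rw [indLift_X_mul, h.qd_al]

include hφ in
lemma indLift_indZ (c : Sgn × X.Idx) (n : ℤ) (t : W.rep ⊗[ℂ] Fock X) :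
    indLift h φ (W.indZ c n t) = (h.system hT).z c n (indLift h φ t) := by
  refine LinearMap.congr_fun (f := (indLift h φ).restrictScalars ℂ ∘ₗ W.indZ c n)
    (g := (h.system hT).z c n ∘ₗ (indLift h φ).restrictScalars ℂ)
    (tensorFock_ext (fun j k _ v => V.al T j (-(k : ℕ)) v) (fun w => ?_) (fun j k w f => ?_)
      (fun j k w f => ?_)) t
  · show indLift h φ (W.rep.Z c.1 c.2 n w ⊗ₜ 1) = (h.system hT).z c n (indLift h φ (w ⊗ₜ 1))
    rw [indLift_one, indLift_one, hφ.Z, h.system_z hT]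
  · exact indLift_X_mul h φ j k (W.rep.Z c.1 c.2 n w) f
  · show (h.system hT).z c n (indLift h φ (w ⊗ₜ (MvPolynomial.X (j, k) * f))) =
      V.al T j (-(k : ℕ)) ((h.system hT).z c n (indLift h φ (w ⊗ₜ f)))
    rw [indLift_X_mul]
    exact (LinearMap.congr_fun ((h.system hT).al_z j c (-(k : ℕ)) n (by simp)) _).symm

include hφ hT in
/-- Both currents are obtained by dressing operators which commute with the extension. -/
lemma indLift_x (ε : Sgn) (i : X.Idx) (n : ℤ) (t : W.rep ⊗[ℂ] Fock X) :
    indLift h φ (W.indRep.x ε i n t) = V.x ε i n (indLift h φ t) := by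
  rw [W.indRep_x hT]
  refine ((W.indBase hT).map_dress (h.system hT).toHeisBase ((indLift h φ).restrictScalars ℂ)
    (fun i m t => indLift_al h hφ hT i m t) i (fun m => - T.thM (ε, i) m)
    (fun m => - T.thP (ε, i) m) 1 (W.indZ_deg hT (ε, i)) ((h.system hT).z_deg (ε, i))
    (fun n t => ?_) n t).trans ?_
  · rw [one_smul]
    exact indLift_indZ h hφ hT (ε, i) n t
  · rw [one_smul]
    exact (LinearMap.congr_fun ((h.system hT).x_eq_dress (ε, i) n) _).symm

include hφ hT in
/-- The universal property of the induced module. -/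
lemma indLift_isHom : CatC.IsHom W.indRep V (indLift h φ) where
  wt ν t ht := by
    have : tensorWt W.rep.wt ν ≤ (V.wt ν).comap (indLift h φ) := by
      refine Submodule.span_le.mpr ?_
      rintro _ ⟨w, hw, f, rfl⟩
      show indLift h φ (w ⊗ₜ f) ∈ V.wt ν
      induction f using MvPolynomial.induction_on with
      | C a =>
        rw [← mul_one (MvPolynomial.C a), ← MvPolynomial.smul_eq_C_mul, TensorProduct.tmul_smul,
          LinearMap.map_smul_of_tower, indLift_one, ← algebraMap_smul (Mero X)]
        exact (V.wt ν).smul_mem _ (hφ.wt ν w hw)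
      | add f g hf hg =>
        rw [TensorProduct.tmul_add, map_add]
        exact (V.wt ν).add_mem hf hg
      | mul_X f a hf =>
        rw [mul_comm, indLift_X_mul]
        exact h.al_maps _ _ hf
    exact this ht
  avee := fun i m (t : W.rep ⊗[ℂ] Fock X) => by
    refine (LinearMap.map_smul_of_tower (indLift h φ) (T.br (T.d i))⁻¹
      ((W.indBase hT).al i m t)).trans ?_
    rw [indLift_al h hφ hT, URep.al, LinearMap.smul_apply, inv_smul_smul₀ (hT.br_d_ne i)]
    rfl
  x := indLift_x h hφ hT
  K := indLift_K h hφ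
  qd := indLift_qd h hφ

include hφ hT in
/-- The kernel is stable under the Heisenberg operators and meets the vacuum space `W ⊗ 1`
trivially. -/
lemma indLift_injective (hi : Function.Injective φ) : Function.Injective (indLift h φ) := by
  rw [← LinearMap.ker_eq_bot, eq_bot_iff]
  have := (W.indBase_nondeg hT).le_of_vac_le ((LinearMap.ker (indLift h φ)).restrictScalars ℂ) ⊥
    (fun i m _ t ht => ?_) (fun i m _ t ht => ?_) ?_
  · exact fun t ht => (Submodule.mem_bot _).mpr ((Submodule.mem_bot ℂ).mp (this ht))
  · show indLift h φ _ = 0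
    rw [indLift_al h hφ hT, show indLift h φ t = 0 from ht, map_zero]
  · rw [(Submodule.mem_bot ℂ).mp ht, map_zero]
    exact Submodule.zero_mem _
  · rintro t ⟨ht, htv⟩
    have h1 : indLift h φ t = 0 := ht
    have h2 := W.indVac_indEval hT htv
    rw [← h2] at h1
    have h3 : φ (W.indEval t) = 0 := (indLift_one h φ _).symm.trans h1
    rw [Submodule.mem_bot, ← h2, hi (h3.trans (map_zero φ).symm), map_zero]

include hφ hT in
/-- The image is stable under the creation operators and contains the vacuum space. -/
lemma indLift_surjective (hs : ∀ v ∈ V.vacuum T, ∃ w, φ w = v) :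
    Function.Surjective (indLift h φ) := by
  have := (h.system_nondeg hT).le_of_vac_le ⊤ ((LinearMap.range (indLift h φ)).restrictScalars ℂ)
    (fun _ _ _ _ _ => trivial) (fun i m _ => ?_) ?_
  · exact fun v => this (Submodule.mem_top (x := v))
  · rintro _ ⟨t, rfl⟩
    exact ⟨_, indLift_al h hφ hT i (-m) t⟩
  · rintro v ⟨-, hv⟩
    obtain ⟨w, rfl⟩ := hs v hv
    exact ⟨_, indLift_one h φ w⟩

end IndLift

/-! ### The equivalence of categories -/

variable {X : SimpleType} {T : Params X}

/-- A bijective homogeneous map reflects the grading. -/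
lemma mem_wt_of_bijective {F ι V V' : Type*} [Ring F] [DecidableEq ι] [AddCommGroup V] [Module F V]
    [AddCommGroup V'] [Module F V'] {wt : ι → Submodule F V} {wt' : ι → Submodule F V'}
    (h : DirectSum.IsInternal wt) (h' : DirectSum.IsInternal wt') (φ : V →ₗ[F] V')
    (hφ : Function.Injective φ) (hwt : ∀ ν, ∀ v ∈ wt ν, φ v ∈ wt' ν) {ν : ι} {v : V}
    (hv : φ v ∈ wt' ν) : v ∈ wt ν := by
  have := wtProj_map h h' (σ := id) Function.injective_id φ.toAddMonoidHom hwt ν v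
  refine mem_wt_of_wtProj_eq h (hφ ?_)
  refine Eq.trans this.symm ?_
  rw [id, wtProj_of_mem h' (v := φ.toAddMonoidHom v) hv, if_pos rfl]
  rfl

lemma CatC.isIso_of_bijective {V V' : CatC.{u} T} (φ : V ⟶ V') (hφ : Function.Bijective φ.map) :
    IsIso φ := by
  let e := LinearEquiv.ofBijective φ.map hφ
  have he : ∀ v, φ.map (e.symm v) = v := e.apply_symm_apply
  refine ⟨⟨e.symm.toLinearMap, ⟨fun ν v hv => ?_, fun i m v => hφ.1 ?_, fun ε i n v => hφ.1 ?_,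
    fun ε i v => hφ.1 ?_, fun v => hφ.1 ?_⟩⟩, ?_, ?_⟩
  · exact mem_wt_of_bijective V.isModule.common.internal V'.isModule.common.internal φ.map hφ.1
      φ.isHom.wt (by rw [LinearEquiv.coe_coe, he]; exact hv)
  · rw [φ.isHom.avee, LinearEquiv.coe_coe, he, he]
  · rw [φ.isHom.x, LinearEquiv.coe_coe, he, he]
  · rw [φ.isHom.K, LinearEquiv.coe_coe, he, he]
  · rw [φ.isHom.qd, LinearEquiv.coe_coe, he, he]
  · exact CatC.Hom.ext (LinearMap.ext e.symm_apply_apply)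
  · exact CatC.Hom.ext (LinearMap.ext e.apply_symm_apply)

lemma CatD.isIso_of_bijective {W W' : CatD.{u} T} (φ : W ⟶ W') (hφ : Function.Bijective φ.map) :
    IsIso φ := by
  let e := LinearEquiv.ofBijective φ.map hφ
  have he : ∀ v, φ.map (e.symm v) = v := e.apply_symm_apply
  refine ⟨⟨e.symm.toLinearMap, ⟨fun ν v hv => ?_, fun ε i n v => hφ.1 ?_,
    fun ε i v => hφ.1 ?_, fun v => hφ.1 ?_⟩⟩, ?_, ?_⟩
  · exact mem_wt_of_bijective W.isModule.common.internal W'.isModule.common.internal φ.map hφ.1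
      φ.isHom.wt (by rw [LinearEquiv.coe_coe, he]; exact hv)
  · rw [φ.isHom.Z, LinearEquiv.coe_coe, he, he]
  · rw [φ.isHom.K, LinearEquiv.coe_coe, he, he]
  · rw [φ.isHom.qd, LinearEquiv.coe_coe, he, he]
  · exact CatD.Hom.ext (LinearMap.ext e.symm_apply_apply)
  · exact CatD.Hom.ext (LinearMap.ext e.apply_symm_apply)

section Equivalence

variable (hΩ : OmegaWellDefined.{u} T) (hΛ : LambdaWellDefined.{u} T) (hT : T.Generic)

/-- The inclusion of the vacuum space. -/
def vacIncl (V : CatC.{u} T) : ((Omega hΩ).obj V).rep →ₗ[Mero X] V.rep :=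
  (V.rep.vacuum T).subtype

lemma isVacHom_vacIncl (V : CatC.{u} T) : IsVacHom ((Omega hΩ).obj V) V.rep (vacIncl hΩ V) where
  vac w := w.2
  wt _ _ hw := hw
  Z _ _ _ _ := rfl
  K _ _ _ := rfl
  qd _ := rfl

/-- The map `Ind Ω_V → V`. -/
def counitMap (V : CatC.{u} T) : (Omega hΩ ⋙ Lambda hΛ).obj V ⟶ V where
  map := indLift (V.isModule.isPreModule hT) (vacIncl hΩ V)
  isHom := indLift_isHom (V.isModule.isPreModule hT) (isVacHom_vacIncl hΩ V) hT

lemma isIso_counitMap (V : CatC.{u} T) : IsIso (counitMap hΩ hΛ hT V) :=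
  CatC.isIso_of_bijective _
    ⟨indLift_injective _ (isVacHom_vacIncl hΩ V) hT (V.rep.vacuum T).injective_subtype,
      indLift_surjective _ (isVacHom_vacIncl hΩ V) hT fun v hv => ⟨⟨v, hv⟩, rfl⟩⟩

/-- Every `V` is induced from its vacuum space. -/
def inducedIso : Omega hΩ ⋙ Lambda hΛ ≅ 𝟭 (CatC.{u} T) :=
  NatIso.ofComponents (fun V => @asIso _ _ _ _ _ (isIso_counitMap hΩ hΛ hT V)) fun {V V'} φ => by
    have h := V.isModule.isPreModule hT
    have h' := V'.isModule.isPreModule hT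
    have key := tensorFock_ext
      (Φ := (indLift h' (vacIncl hΩ V')).restrictScalars ℂ ∘ₗ
        TensorProduct.map (((Omega hΩ).map φ).map.restrictScalars ℂ) LinearMap.id)
      (Φ' := φ.map.restrictScalars ℂ ∘ₗ (indLift h (vacIncl hΩ V)).restrictScalars ℂ)
      (fun j k _ v => V'.rep.al T j (-(k : ℕ)) v) (fun w => ?_) (fun j k w f => ?_)
      (fun j k w f => ?_)
    · exact CatC.Hom.ext (LinearMap.ext fun t => LinearMap.congr_fun key t)
    · exact (indLift_one h' _ _).trans (congrArg φ.map (indLift_one h (vacIncl hΩ V) w)).symm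
    · exact indLift_X_mul h' _ j k (((Omega hΩ).map φ).map w) f
    · refine (congrArg φ.map (indLift_X_mul h (vacIncl hΩ V) j k w f)).trans ?_
      show φ.map (T.br (T.d j) • V.rep.avee j _ _) = T.br (T.d j) • V'.rep.avee j _ (φ.map _)
      rw [← φ.isHom.avee, LinearMap.map_smul_of_tower]
      rfl

/-- The map `w ↦ w ⊗ 1` from `W` to the vacuum space of `Ind W`. -/
def unitMap (W : CatD.{u} T) : W ⟶ (Lambda hΛ ⋙ Omega hΩ).obj W where
  map := W.indVac.codRestrict (W.indRep.vacuum T) fun w =>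
    (W.mem_indRep_vacuum hT).mpr (W.indVac_mem_vac hT w)
  isHom :=
    { wt := fun _ _ hw => tmul_mem_tensorWt hw 1
      Z := fun ε i n w => Subtype.ext (W.indRep_z hT (ε, i) n (W.indVac w)).symm
      K := fun _ _ _ => rfl
      qd := fun w => Subtype.ext (by
        have : fockQd T 1 = 1 := map_one (MvPolynomial.aeval _)
        show W.rep.qd w ⊗ₜ[ℂ] (1 : Fock X) = W.rep.qd w ⊗ₜ[ℂ] fockQd T 1
        rw [this]) }

lemma isIso_unitMap (W : CatD.{u} T) : IsIso (unitMap hΩ hΛ hT W) :=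
  CatD.isIso_of_bijective _
    ⟨fun _ _ h => Function.LeftInverse.injective W.indEval_indVac (congrArg Subtype.val h),
      fun v => ⟨W.indEval v.1,
        Subtype.ext (W.indVac_indEval hT ((W.mem_indRep_vacuum hT).mp v.2))⟩⟩

/-- Every `W` is the vacuum space of the module induced from it. -/
def vacuumIso : 𝟭 (CatD.{u} T) ≅ Lambda hΛ ⋙ Omega hΩ :=
  NatIso.ofComponents (fun W => @asIso _ _ _ _ _ (isIso_unitMap hΩ hΛ hT W)) fun _ => rfl

/-- The functors `Ω` and `Λ` are mutually quasi-inverse. -/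
def omegaLambdaEquivalence : CatC.{u} T ≌ CatD.{u} T :=
  CategoryTheory.Equivalence.mk (Omega hΩ) (Lambda hΛ) (inducedIso hΩ hΛ hT).symm
    (vacuumIso hΩ hΛ hT).symm

end Equivalence

/-! ### Irreducibility -/

section TensorSub

variable {W : Type u} [AddCommGroup W] [Module ℂ W] [Module (Mero X) W]
  [IsScalarTower ℂ (Mero X) W]

/-- The subspace `S ⊗ F` of `W ⊗ F`. -/
def tensorSub (S : Submodule (Mero X) W) : Submodule (Mero X) (W ⊗[ℂ] Fock X) :=
  Submodule.span (Mero X) {t | ∃ w ∈ S, ∃ f : Fock X, t = w ⊗ₜ[ℂ] f}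

variable {S : Submodule (Mero X) W}

lemma tmul_mem_tensorSub {w : W} (hw : w ∈ S) (f : Fock X) : w ⊗ₜ[ℂ] f ∈ tensorSub S :=
  Submodule.subset_span ⟨w, hw, f, rfl⟩

/-- Since `S` is a subspace over `𝔽`, every element of `S ⊗ F` is a sum of pure tensors. -/
lemma tensorSub_induction {P : W ⊗[ℂ] Fock X → Prop} (h0 : P 0)
    (hadd : ∀ t t', P t → P t' → P (t + t')) (h : ∀ w ∈ S, ∀ f : Fock X, P (w ⊗ₜ[ℂ] f))
    {t : W ⊗[ℂ] Fock X} (ht : t ∈ tensorSub S) : P t := by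
  induction ht using Submodule.closure_induction with
  | zero => exact h0
  | add t t' _ _ ht ht' => exact hadd t t' ht ht'
  | smul_mem g t ht =>
    obtain ⟨w, hw, f, rfl⟩ := ht
    exact h _ (S.smul_mem g hw) f

lemma tensorSub_graded {wt : HStar X → Submodule (Mero X) W} (hS : S ≤ ⨆ ν, S ⊓ wt ν) :
    tensorSub S ≤ ⨆ ν, tensorSub S ⊓ tensorWt wt ν := by
  refine Submodule.span_le.mpr ?_
  rintro _ ⟨w, hw, f, rfl⟩
  have hw' := hS hw
  clear hw
  show w ⊗ₜ[ℂ] f ∈ ⨆ ν, tensorSub S ⊓ tensorWt wt ν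
  induction hw' using Submodule.iSup_induction' with
  | mem ν w hw => exact Submodule.mem_iSup_of_mem ν ⟨tmul_mem_tensorSub hw.1 f,
      tmul_mem_tensorWt hw.2 f⟩
  | zero => rw [TensorProduct.zero_tmul]; exact Submodule.zero_mem _
  | add w w' _ _ hw hw' => rw [TensorProduct.add_tmul]; exact Submodule.add_mem _ hw hw'

/-- If `A` is injective and restricts to a bijection of `S`, and `E` is surjective, then
`(A ⊗ E)(t) ∈ S ⊗ F` only if `t ∈ S ⊗ F`. -/
lemma map_mem_tensorSub_iff {A : Module.End ℂ W} {E : Module.End ℂ (Fock X)}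
    (hinj : Function.Injective (TensorProduct.map A E)) (hA : Function.Surjective A)
    (hE : Function.Surjective E) (hS : ∀ w, A w ∈ S ↔ w ∈ S) (t : W ⊗[ℂ] Fock X) :
    TensorProduct.map A E t ∈ tensorSub S ↔ t ∈ tensorSub S := by
  constructor
  · intro ht
    obtain ⟨t', ht', h⟩ : ∃ t' ∈ tensorSub S, TensorProduct.map A E t' =
        TensorProduct.map A E t := by
      refine tensorSub_induction (P := fun u => ∃ t' ∈ tensorSub S, TensorProduct.map A E t' = u)
        ⟨0, Submodule.zero_mem _, map_zero _⟩ ?_ ?_ ht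
      · rintro _ _ ⟨t, ht, rfl⟩ ⟨t', ht', rfl⟩
        exact ⟨t + t', Submodule.add_mem _ ht ht', map_add _ _ _⟩
      · intro w hw f
        obtain ⟨w, rfl⟩ := hA w
        obtain ⟨f, rfl⟩ := hE f
        exact ⟨w ⊗ₜ f, tmul_mem_tensorSub ((hS w).mp hw) f, rfl⟩
    rwa [← hinj h]
  · intro ht
    refine tensorSub_induction (P := fun t => TensorProduct.map A E t ∈ tensorSub S)
      ?_ (fun t t' ht ht' => ?_) (fun w hw f => tmul_mem_tensorSub ((hS w).mpr hw) _) ht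
    · rw [map_zero]; exact Submodule.zero_mem _
    · rw [map_add]; exact Submodule.add_mem _ ht ht'

end TensorSub

/-- A subspace stable under the `α_{i,m}` and the `x^±_{i,n}` is stable under the dressed
currents.
    -/
lemma zOp_mem {V : URep.{u} X} {S : Submodule (Mero X) V}
    (hal : ∀ i m, ∀ v ∈ S, V.al T i m v ∈ S) (hx : ∀ ε i n, ∀ v ∈ S, V.x ε i n v ∈ S) (ε : Sgn)
    (i : X.Idx) (n : ℤ) {v : V} (hv : v ∈ S) : V.zOp T ε i n v ∈ S := by
  have he : ∀ η θ m, ∀ v ∈ S, eOp T ε η θ (V.al T) i m v ∈ S := by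
    intro η θ m
    let B : Subalgebra ℂ (Module.End (Mero X) V) :=
      { carrier := {A | ∀ v ∈ S, A v ∈ S}
        mul_mem' := fun ha hb v hv => ha _ (hb v hv)
        add_mem' := fun ha hb v hv => S.add_mem (ha v hv) (hb v hv)
        algebraMap_mem' := fun c v hv => by
          rw [Module.algebraMap_end_apply, ← algebraMap_smul (Mero X)]
          exact S.smul_mem _ hv }
    rw [eOp_eq]
    exact expCoeff_mem B (fun m _ => B.smul_mem (fun v hv => hal i _ v hv) _) m
  exact finsum_induction (· ∈ S) S.zero_mem (fun _ _ => S.add_mem) fun ab =>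
    he _ _ _ _ (hx _ _ _ _ (he _ _ _ _ hv))

namespace CatD

variable (W : CatD.{u} T) (hT : T.Generic)

lemma indVac_wtProj (ν : HStar X) (w : W.rep) :
    W.indVac (wtProj W.isModule.common.internal ν w) =
      wtProj (tensorWt_internal W.isModule.common.internal) ν (W.indVac w) :=
  (wtProj_map W.isModule.common.internal (tensorWt_internal W.isModule.common.internal) (σ := id)
    Function.injective_id W.indVac.toAddMonoidHom (fun _ _ hw => tmul_mem_tensorWt hw 1) ν w).symm

include hT in
/-- A graded stable subspace `S` of `Ind W` is generated by its vacuum vectors, that is, by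
`{w | w ⊗ 1 ∈ S}`, which is a graded stable subspace of `W`. -/
lemma indRep_isIrreducible (hΛ : LambdaWellDefined.{u} T) (hW : W.IsIrreducible) :
    ((Lambda hΛ).obj W).IsIrreducible := by
  obtain ⟨hne, hirr⟩ := hW
  refine ⟨(Function.LeftInverse.injective W.indEval_indVac).nontrivial, ?_⟩
  intro (S : Submodule (Mero X) (W.rep ⊗[ℂ] Fock X)) hgr havee hx hK hqd
  have hal : ∀ i m, ∀ t ∈ S, (W.indBase hT).al i m t ∈ S := fun i m t ht => by
    rw [← W.indRep_al hT]
    show (T.br (T.d i)) • W.indRep.avee i m t ∈ S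
    rw [← algebraMap_smul (Mero X)]
    exact S.smul_mem _ (havee i m t ht)
  have hgr' := (le_iSup_inf_iff (tensorWt_internal W.isModule.common.internal) S).mp hgr
  have key : S.comap W.indVac = ⊥ ∨ S.comap W.indVac = ⊤ := by
    refine hirr (S.comap W.indVac) ?_ (fun ε i n w hw => ?_) (fun ε i w => hK ε i (W.indVac w))
      (fun w => ?_)
    · refine (le_iSup_inf_iff W.isModule.common.internal _).mpr fun ν w hw => ?_
      rw [Submodule.mem_comap, indVac_wtProj]
      exact hgr' ν _ hw
    · show W.indZ (ε, i) n (W.indVac w) ∈ S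
      rw [← W.indRep_z hT]
      refine zOp_mem (V := W.indRep) (fun i m t ht => ?_) hx ε i n hw
      exact (W.indRep_al hT i m t).symm ▸ hal i m t ht
    · refine Iff.trans ?_ (hqd (W.indVac w))
      have h1 : fockQd T 1 = 1 := map_one (MvPolynomial.aeval _)
      have h2 : W.indVac (W.rep.qd w) = W.indRep.qd (W.indVac w) := by
        show W.rep.qd w ⊗ₜ[ℂ] (1 : Fock X) = W.rep.qd w ⊗ₜ[ℂ] fockQd T 1
        rw [h1]
      rw [Submodule.mem_comap, h2]
      exact Iff.rfl
  rcases key with h | h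
  · left
    have := (W.indBase_nondeg hT).le_of_vac_le (S.restrictScalars ℂ) ⊥
      (fun i m _ t ht => hal i m t ht) (fun i m _ t ht => ?_) ?_
    · exact eq_bot_iff.mpr fun t ht => (Submodule.mem_bot _).mpr ((Submodule.mem_bot ℂ).mp (this
        ht))
    · rw [(Submodule.mem_bot ℂ).mp ht, map_zero]
      exact Submodule.zero_mem _
    · rintro t ⟨ht, htv⟩
      have h2 := W.indVac_indEval hT htv
      have h3 : W.indEval t ∈ S.comap W.indVac := by
        rw [Submodule.mem_comap, h2]; exact ht
      rw [h, Submodule.mem_bot] at h3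
      rw [Submodule.mem_bot, ← h2, h3, map_zero]
  · right
    have := (W.indBase_nondeg hT).le_of_vac_le ⊤ (S.restrictScalars ℂ)
      (fun _ _ _ _ _ => trivial) (fun i m _ t ht => hal i (-m) t ht) ?_
    · exact eq_top_iff.mpr fun t _ => this (Submodule.mem_top (x := t))
    · rintro t ⟨-, htv⟩
      rw [← W.indVac_indEval hT htv]
      exact (h ▸ Submodule.mem_top : W.indEval t ∈ S.comap W.indVac)

include hT in
/-- A graded stable subspace `S` of `W` gives the graded stable subspace `S ⊗ F` of `Ind W`, and
`S` is recovered from it by evaluation at the origin. -/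
lemma isIrreducible_of_indRep (hΛ : LambdaWellDefined.{u} T)
    (hV : ((Lambda hΛ).obj W).IsIrreducible) : W.IsIrreducible := by
  obtain ⟨hne, hirr⟩ := hV
  constructor
  · by_contra hsub
    rw [not_nontrivial_iff_subsingleton] at hsub
    have h0 : ∀ t : W.rep ⊗[ℂ] Fock X, t = 0 := fun t => by
      induction t using TensorProduct.induction_on with
      | zero => rfl
      | add t t' ht ht' => rw [ht, ht', add_zero]
      | tmul w f => rw [Subsingleton.elim w 0, TensorProduct.zero_tmul]
    obtain ⟨t, t', htt'⟩ := hne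
    exact htt' ((h0 t).trans (h0 t').symm)
  intro S hgr hZ hK hqd
  have heval : ∀ t ∈ tensorSub S, W.indEval t ∈ S := fun t ht => by
    refine tensorSub_induction (P := fun t => W.indEval t ∈ S) ?_ (fun t t' ht ht' => ?_)
      (fun w hw f => ?_) ht
    · rw [map_zero]; exact S.zero_mem
    · rw [map_add]; exact S.add_mem ht ht'
    · rw [indEval_tmul, ← algebraMap_smul (Mero X)]
      exact S.smul_mem _ hw
  have hterm : ∀ (A : Module.End ℂ W.rep) (E : Module.End ℂ (Fock X)), (∀ w ∈ S, A w ∈ S) →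
      ∀ t ∈ tensorSub S, TensorProduct.map A E t ∈ tensorSub S := fun A E hA t ht => by
    refine tensorSub_induction (P := fun t => TensorProduct.map A E t ∈ tensorSub S) ?_
      (fun t t' ht ht' => ?_) (fun w hw f => tmul_mem_tensorSub (hA w hw) _) ht
    · rw [map_zero]; exact Submodule.zero_mem _
    · rw [map_add]; exact Submodule.add_mem _ ht ht'
  have hc := W.ind_isCommon hT
  have key : tensorSub S = ⊥ ∨ tensorSub S = ⊤ := by
    refine hirr (tensorSub S) (tensorSub_graded hgr) (fun i m t ht => ?_)
      (fun ε i n (t : W.rep ⊗[ℂ] Fock X) ht => ?_) (fun ε i t => ?_) (fun t => ?_)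
    · show (T.br (T.d i))⁻¹ • TensorProduct.map LinearMap.id (fockAl T i m) t ∈ tensorSub S
      rw [← algebraMap_smul (Mero X)]
      exact Submodule.smul_mem _ _ (hterm _ _ (fun w hw => hw) t ht)
    · refine (congrArg (· ∈ tensorSub S) (W.indRep_x hT ε i n t)).mpr ?_
      rw [indX_apply]
      exact finsum_induction (· ∈ tensorSub S) (Submodule.zero_mem _) (fun _ _ =>
        Submodule.add_mem _)
        fun ab => hterm _ _ (fun w hw => hZ ε i _ w hw) t ht
    · exact map_mem_tensorSub_iff (hc.K_bij ε i).1 (W.isModule.common.K_bij ε i).2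
        Function.surjective_id (hK ε i) t
    · exact map_mem_tensorSub_iff (A := W.rep.qd.restrictScalars ℂ) (E := fockQd T) hc.qd_bij.1
        W.isModule.common.qd_bij.2 (fockQd_bijective hT.q_ne).2 hqd t
  rcases key with h | h
  · left
    refine eq_bot_iff.mpr fun w hw => ?_
    have h1 : W.indVac w ∈ tensorSub S := tmul_mem_tensorSub hw 1
    rw [h] at h1
    have h2 : W.indVac w = 0 := (Submodule.mem_bot _).mp h1
    rw [Submodule.mem_bot, ← W.indEval_indVac w, h2, map_zero]
  · right
    refine eq_top_iff.mpr fun w _ => ?_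
    rw [← W.indEval_indVac w]
    exact heval _ ((SetLike.ext_iff.mp h (W.indVac w)).mpr trivial)

end CatD

end EllToroidal

end

theorem mainTheorem2 (X : EllToroidal.SimpleType) (T : EllToroidal.Params X)
    (hd : ∀ i, 0 < T.d i) (hsymm : ∀ i j, T.b i j = T.b j i)
    (ha : ∀ i, 0 < T.a i) (hgcd : Finset.univ.gcd T.a = 1) (hnull : ∀ j, ∑ i, (T.a i : ℤ) * T.b i j = 0)
    (hq0 : T.q ≠ 0) (hq : ∀ n : ℕ, 0 < n → T.q ^ n ≠ 1) (hκ : T.κ ≠ 0)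
    (hgen : ∀ n : ℕ, 0 < n →
      (Matrix.of fun i j => T.br (T.b i j * n) * T.κ ^ (-(n : ℤ) * X.mMat i j)).det ≠ 0)
    (hp0 : T.p ≠ 0) (hp : ‖T.p‖ < 1) (hpStar : ‖T.p * T.q ^ (-2 * T.k)‖ < 1)
    (hk : T.k ≠ 0) (hqk : ‖T.q ^ (2 * T.k)‖ < 1) :
    ∃ (hΩ : EllToroidal.OmegaWellDefined.{u} T) (hΛ : EllToroidal.LambdaWellDefined.{u} T),
      (∃ e : EllToroidal.CatC.{u} T ≌ EllToroidal.CatD.{u} T,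
        e.functor = EllToroidal.Omega hΩ ∧ e.inverse = EllToroidal.Lambda hΛ) ∧
      ∀ W : EllToroidal.CatD.{u} T,
        ((EllToroidal.Lambda hΛ).obj W).IsIrreducible ↔ W.IsIrreducible := by
  have hqk : T.qk ^ 2 = T.q ^ (2 * T.k) := by
    rw [EllToroidal.Params.qk, ← Complex.cpow_nat_mul]
    norm_num
  have hstar : T.pStar = T.p * T.q ^ (-2 * T.k) := by
    rw [EllToroidal.Params.pStar, hqk, neg_mul, Complex.cpow_neg, div_eq_mul_inv]
  have hT : T.Generic :=
    { d_pos := hd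
      symm := hsymm
      q_ne := hq0
      q_pow := hq
      κ_ne := hκ
      det := hgen
      p_ne := hp0
      p_lt := hp
      pStar_lt := by rwa [hstar]
      s_lt := by rwa [EllToroidal.Params.s, hqk] }
  have hΩ := EllToroidal.omegaWellDefined.{u} hT
  have hΛ := EllToroidal.lambdaWellDefined.{u} hT
  exact ⟨hΩ, hΛ, ⟨EllToroidal.omegaLambdaEquivalence hΩ hΛ hT, rfl, rfl⟩, fun W =>
    ⟨W.isIrreducible_of_indRep hT hΛ, W.indRep_isIrreducible hT hΛ⟩⟩
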